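/- Let $N$ be a compact (Hausdorff) smooth manifold with boundary, of dimension $n\ge 1$, and let $M=\mathbb R\times N$. All metrics, forms, functions and diffeomorphisms are smooth up to the boundary. **Definitions.** A *magnetic system* $(N,h,\omega)$ consists of a Riemannian metric $h$ and a one-form $\omega$ on $N$. Let $Y:TN\to TN$ be given by $(Yu,v)_h=d\omega(u,v)$. The *unit speed magnetic geodesics* are the curves $\gamma$ in $N$ with $D_s\dot\gamma=Y\dot\gamma$, $|\dot\gamma|_h=1$; the *magnetic exponential map* is $\exp_x(s\xi)=\gamma_{x,\xi}(s)$ for $s\ge0$, $\xi\in T_xN$, $|\xi|_h=1$, where $\gamma_{x,\xi}$ is the unit speed magnetic geodesic in $N$ with initial velocity $\xi$, as long as it exists. The system is *simple* if $\partial N$ is strictly convex with respect to the magnetic flow, i.e. $\Lambda(\xi,\xi)>(Y\xi,\nu)_h$ for all unit $\xi\in T\partial N$, where $\nu$ is the inward unit normal and $\Lambda$ the second fundamental form, and if for every $x\in N$ the map $\exp_x$ is a diffeomorphism from its domain in $T_xN$ onto $N$ ($C^1$, and $C^\infty$ away from the origin). Then for $x,y\in N$ there is a unique unit speed magnetic geodesic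 $\gamma_{[x,y]}$ from $x$ to $y$ (constant if $x=y$); let $\ell_{x,y}$ be its length and put $$\mathbb A(x,y)=\ell_{x,y}-\int_{\gamma_{[x,y]}}\omega .$$ The restriction of $\mathbb A$ to $\partial N\times\partial N$ is the *boundary action function*. The systems $(h,\omega)$ and $(\hat h,\hat\omega)$ on $N$ are *magnetically gauge equivalent* if $\hat h=\psi^*h$ and $\hat\omega=\psi^*\omega+d\phi$ for a diffeomorphism $\psi:N\to N$ fixing $\partial N$ pointwise and a function $\phi$ vanishing on $\partial N$. A simple system $(N,h,\omega)$ is *boundary rigid* if it is magnetically gauge equivalent to every simple system $(\hat h,\hat\omega)$ on $N$ with the same boundary action function. A *stationary metric* on $M$ is a Lorentzian metric $$g=g_{\lambda,\omega,h}=\lambda(x)\left(-(dt+\omega_j(x)\,dx^j)^2+h_{ij}(x)\,dx^i\,dx^j\right),$$ with $\lambda>0$ a function, $\omega$ a one-form and $h$ a Riemannian metric on $N$; it is *simple* if $(N,h,\omega)$ is simple. Its *scattering relation* $\mathcal S$ on $\partial M=\mathbb R\times\partial N$ relates $(p,v')$ to $(q,w')$ whenever a future pointing lightlike geodesic of $g$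 enters $M$ at $p\in\partial M$ and leaves it at the next point $q\in\partial M$, and $v'$, $w'$ are the $g$-orthogonal projections to $T_p\partial M$, $T_q\partial M$ of its directions there; since lightlike geodesics have no natural parametrization, these directions are taken up to positive factors, at $p$ and at $q$. The metrics $g_{\lambda,\omega,h}$ and $g_{\hat\lambda,\hat\omega,\hat h}$ are *gauge equivalent* if $\hat\omega=\psi^*(\omega+d\phi)$ and $\hat h=\psi^*h$ for a diffeomorphism $\psi:N\to N$ fixing $\partial N$ pointwise and a function $\phi$ vanishing on $\partial N$. A simple stationary $(M,g)$ is *boundary rigid* if $g$ is gauge equivalent to every simple stationary metric $\hat g$ on $M$ with $\mathcal S=\hat{\mathcal S}$. **Theorem.** (1) Let $g=g_{\lambda,\omega,h}$ and $\hat g=g_{\hat\lambda,\hat\omega,\hat h}$ be simple stationary metrics on $M$. Then the implication "$\mathcal S=\hat{\mathcal S}$ implies that $g$ and $\hat g$ are gauge equivalent" holds if and only if the implication "$\mathbb A=\hat{\mathbb A}$ on $\partial N\times\partial N$ implies that $(h,\omega)$ and $(\hat h,\hat\omega)$ are magnetically gauge equivalent" holds. (2) For every simple stationary metric $g_{\lambda,\omega,h}$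 on $M$, the simple magnetic system $(N,h,\omega)$ is boundary rigid if and only if the stationary Lorentzian manifold $(M,g_{\lambda,\omega,h})$ is boundary rigid. -/

import Mathlib

open scoped Manifold ContDiff Topology

noncomputable section

namespace StationaryRigidity

/-! ### Covariant tensor fields in charts and the geodesic equation -/

section Charts

variable {E : Type*} [NormedAddCommGroup E] [NormedSpace ℝ E] {H : Type*} [TopologicalSpace H]
  (I : ModelWithCorners ℝ E H) {M : Type*} [TopologicalSpace M] [ChartedSpace H M]

/-- The differential at `u` of the inverse of the chart `c`. -/
def chartFrame (c : M) (u : E) : E →L[ℝ] TangentSpace I ((extChartAt I c).symm u) :=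
  mfderivWithin 𝓘(ℝ, E) I (extChartAt I c).symm (Set.range I) u

/-- The bilinear form field `g` in the chart `c`, i.e. `g_{ij}(u)`. -/
def chartMetric (g : ∀ p : M, TangentSpace I p →L[ℝ] TangentSpace I p →L[ℝ] ℝ)
    (c : M) (u : E) : E →L[ℝ] E →L[ℝ] ℝ :=
  ContinuousLinearMap.bilinearComp (E := E) (F := E) (G := ℝ) (g ((extChartAt I c).symm u))
    (chartFrame I c u) (chartFrame I c u)

/-- The one-form `om` in the chart `c`, i.e. `ω_j(u)`. -/
def chartForm (om : ∀ p : M, TangentSpace I p →L[ℝ] ℝ) (c : M) (u : E) : E →L[ℝ] ℝ :=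
  (om ((extChartAt I c).symm u)).comp (chartFrame I c u)

/-- The Christoffel symbol of the first kind in the chart `c`:
`½ (∂_a g(b,e) + ∂_b g(a,e) - ∂_e g(a,b))`, which is `(∇_a b, e)_g` for the Levi-Civita
connection of `g` and vector fields with constant components in the chart. -/
def christoffel (g : ∀ p : M, TangentSpace I p →L[ℝ] TangentSpace I p →L[ℝ] ℝ)
    (c : M) (u : E) (a b e : E) : ℝ :=
  (1 / 2 : ℝ) *
    (fderivWithin ℝ (chartMetric I g c) (Set.range I) u a b e
      + fderivWithin ℝ (chartMetric I g c) (Set.range I) u b a e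
      - fderivWithin ℝ (chartMetric I g c) (Set.range I) u e a b)

/-- The exterior derivative in the chart `c`:
`dω(a,b) = ∂_a ω(b) - ∂_b ω(a)`. -/
def chartExtDeriv (om : ∀ p : M, TangentSpace I p →L[ℝ] ℝ) (c : M) (u : E) (a b : E) : ℝ :=
  fderivWithin ℝ (chartForm I om c) (Set.range I) u a b
    - fderivWithin ℝ (chartForm I om c) (Set.range I) u b a

/-- The curve `γ` in the chart `c`. -/
def chartCurve (c : M) (γ : ℝ → M) (s : ℝ) : E := extChartAt I c (γ s)

/-- The velocity in the chart `c` of the curve `γ`, defined on the interval `[0, T]`. -/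
def chartVelocity (c : M) (γ : ℝ → M) (T : ℝ) (s : ℝ) : E :=
  derivWithin (chartCurve I c γ) (Set.Icc 0 T) s

/-- `(D_s γ̇, e)_g` computed in the chart `c`, where `D_s` is the covariant derivative along the
curve `γ : [0, T] → M` for the Levi-Civita connection of `g`. -/
def covariantAcceleration (g : ∀ p : M, TangentSpace I p →L[ℝ] TangentSpace I p →L[ℝ] ℝ)
    (c : M) (γ : ℝ → M) (T : ℝ) (s : ℝ) (e : E) : ℝ :=
  chartMetric I g c (chartCurve I c γ s)
      (derivWithin (chartVelocity I c γ T) (Set.Icc 0 T) s) e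
    + christoffel I g c (chartCurve I c γ s) (chartVelocity I c γ T s) (chartVelocity I c γ T s) e

/-- `γ : [0, T] → M` is a smooth curve solving `D_s γ̇ = 0`. -/
def IsGeodesic (g : ∀ p : M, TangentSpace I p →L[ℝ] TangentSpace I p →L[ℝ] ℝ)
    (T : ℝ) (γ : ℝ → M) : Prop :=
  ContMDiffOn 𝓘(ℝ, ℝ) I ∞ γ (Set.Icc 0 T) ∧
    ∀ c : M, ∀ s ∈ Set.Icc (0 : ℝ) T, γ s ∈ (chartAt H c).source → ∀ e : E,
      covariantAcceleration I g c γ T s e = 0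

/-- The velocity `γ̇(s)` of `γ : [0, T] → M`, as a tangent vector of `M`. -/
def velocity (γ : ℝ → M) (T : ℝ) (s : ℝ) : TangentSpace I (γ s) :=
  mfderivWithin 𝓘(ℝ, ℝ) I γ (Set.Icc 0 T) s (1 : ℝ)

end Charts

/-! ### Magnetic systems on a manifold with boundary -/

variable (n : ℕ) [NeZero n] (N : Type*) [TopologicalSpace N]
  [ChartedSpace (EuclideanHalfSpace n) N] [IsManifold (𝓡∂ n) ∞ N]

/-- A magnetic system `(N, h, ω)`: a smooth Riemannian metric `h` and a smooth one-form `ω`,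
denoted `om`. -/
structure MagneticSystem where
  h : Bundle.ContMDiffRiemannianMetric (𝓡∂ n) ∞ (EuclideanSpace ℝ (Fin n))
    (fun x : N => TangentSpace (𝓡∂ n) x)
  om : ∀ x : N, TangentSpace (𝓡∂ n) x →L[ℝ] ℝ
  smooth_om : ContMDiff (𝓡∂ n) ((𝓡∂ n).prod 𝓘(ℝ, EuclideanSpace ℝ (Fin n) →L[ℝ] ℝ)) ∞
    (fun x : N => Bundle.TotalSpace.mk' (EuclideanSpace ℝ (Fin n) →L[ℝ] ℝ)
      (E := fun x : N => TangentSpace (𝓡∂ n) x →L[ℝ] Bundle.Trivial N ℝ x) x (om x))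

/-- A stationary metric
`g_{λ,ω,h} = λ(x) (-(dt + ω_j(x) dx^j)² + h_{ij}(x) dx^i dx^j)` on `M = ℝ × N`. -/
structure StationaryMetric extends MagneticSystem n N where
  lam : N → ℝ
  lam_pos : ∀ x, 0 < lam x
  smooth_lam : ContMDiff (𝓡∂ n) 𝓘(ℝ, ℝ) ∞ lam

variable {n N}

/-- `v ∈ T_x ∂N`, for a boundary point `x`: tangent vectors at `x` are represented by their
components in the chart at `x`, which takes values in the half space `{u | 0 ≤ u 0}`. -/
def IsTangentToBoundary {x : N} (v : TangentSpace (𝓡∂ n) x) : Prop :=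
  (EuclideanSpace.proj 0 : EuclideanSpace ℝ (Fin n) →L[ℝ] ℝ) v = 0

/-- The tangent vector `v` at a boundary point points strictly into `N`. -/
def PointsInward {x : N} (v : TangentSpace (𝓡∂ n) x) : Prop :=
  0 < (EuclideanSpace.proj 0 : EuclideanSpace ℝ (Fin n) →L[ℝ] ℝ) v

/-- The differential `dφ` of a function `φ : N → ℝ`. -/
def differential (φ : N → ℝ) (x : N) : TangentSpace (𝓡∂ n) x →L[ℝ] ℝ :=
  mfderiv (𝓡∂ n) 𝓘(ℝ, ℝ) φ x

namespace MagneticSystem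

variable (m : MagneticSystem n N)

/-- `γ : [0, ℓ] → N`, `ℓ > 0`, is a unit speed magnetic geodesic: `|γ̇|_h = 1` and
`D_s γ̇ = Y γ̇`, where `(Yu, v)_h = dω(u, v)`. -/
structure IsMagneticGeodesic (ℓ : ℝ) (γ : ℝ → N) : Prop where
  pos : 0 < ℓ
  smooth : ContMDiffOn 𝓘(ℝ, ℝ) (𝓡∂ n) ∞ γ (Set.Icc 0 ℓ)
  unit_speed : ∀ s ∈ Set.Icc (0 : ℝ) ℓ,
    m.h.inner (γ s) (velocity (𝓡∂ n) γ ℓ s) (velocity (𝓡∂ n) γ ℓ s) = 1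
  newton : ∀ c : N, ∀ s ∈ Set.Icc (0 : ℝ) ℓ, γ s ∈ (chartAt (EuclideanHalfSpace n) c).source →
    ∀ e : EuclideanSpace ℝ (Fin n),
      covariantAcceleration (𝓡∂ n) m.h.inner c γ ℓ s e
        = chartExtDeriv (𝓡∂ n) m.om c (chartCurve (𝓡∂ n) c γ s) (chartVelocity (𝓡∂ n) c γ ℓ s) e

/-- `exp_x v = y` for the magnetic exponential map: `exp_x 0 = x`, and
`exp_x (ℓ ξ) = γ(ℓ)` for `ℓ > 0` and a unit vector `ξ ∈ T_x N`, where `γ` is the magnetic geodesic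
in `N` with initial velocity `ξ`, if it exists up to time `ℓ`. -/
def MagneticExp (x : N) (v : TangentSpace (𝓡∂ n) x) (y : N) : Prop :=
  (v = 0 ∧ y = x) ∨
    ∃ (ℓ : ℝ) (γ : ℝ → N), m.IsMagneticGeodesic ℓ γ ∧
      (⟨x, v⟩ : TangentBundle (𝓡∂ n) N) = ⟨γ 0, ℓ • velocity (𝓡∂ n) γ ℓ 0⟩ ∧ y = γ ℓ

/-- `∂N` is strictly convex with respect to the magnetic flow: `Λ(ξ, ξ) > (Yξ, ν)_h` for all unit
vectors `ξ` tangent to `∂N` (hence in both directions `±ξ`), where `ν` is the inward unit normal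
and `Λ(ξ, ξ) = (∇_ξ ξ, ν)_h` is the second fundamental form. -/
def IsStrictlyConvex : Prop :=
  ∀ x ∈ (𝓡∂ n).boundary N, ∀ ξ ν : TangentSpace (𝓡∂ n) x,
    IsTangentToBoundary ξ → m.h.inner x ξ ξ = 1 →
    PointsInward ν → m.h.inner x ν ν = 1 →
    (∀ η : TangentSpace (𝓡∂ n) x, IsTangentToBoundary η → m.h.inner x ν η = 0) →
    chartExtDeriv (𝓡∂ n) m.om x (extChartAt (𝓡∂ n) x x) ξ ν
      < christoffel (𝓡∂ n) m.h.inner x (extChartAt (𝓡∂ n) x x) ξ ξ ν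

/-- Simplicity: `∂N` is strictly convex with respect to the magnetic flow and, for every `x`, the
magnetic exponential map `exp_x` is a diffeomorphism from its domain in `T_x N` onto `N`. The
latter is expressed by the inverse map `L : N → T_x N`, which has to be a `C¹` map with invertible
differential, smooth away from `x` (at the origin, magnetic exponential maps are only `C¹` in
general). -/
def IsSimple : Prop :=
  m.IsStrictlyConvex ∧
    ∀ x : N, ∃ L : N → EuclideanSpace ℝ (Fin n),
      (∀ (v : TangentSpace (𝓡∂ n) x) (y : N), m.MagneticExp x v y ↔ v = L y) ∧
      ContMDiff (𝓡∂ n) 𝓘(ℝ, EuclideanSpace ℝ (Fin n)) 1 L ∧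
      ContMDiffOn (𝓡∂ n) 𝓘(ℝ, EuclideanSpace ℝ (Fin n)) ∞ L {x}ᶜ ∧
      ∀ y : N, Function.Bijective (mfderiv (𝓡∂ n) 𝓘(ℝ, EuclideanSpace ℝ (Fin n)) L y)

/-- `a = ℓ - ∫_γ ω` for a unit speed magnetic geodesic `γ : [0, ℓ] → N` from `x` to `y`
(the constant curve with `ℓ = 0` if `x = y`). -/
def IsAction (x y : N) (a : ℝ) : Prop :=
  (x = y ∧ a = 0) ∨
    ∃ (ℓ : ℝ) (γ : ℝ → N), m.IsMagneticGeodesic ℓ γ ∧ γ 0 = x ∧ γ ℓ = y ∧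
      a = ℓ - ∫ s in (0 : ℝ)..ℓ, m.om (γ s) (velocity (𝓡∂ n) γ ℓ s)

/-- The action `𝔸(x, y) = ℓ_{x,y} - ∫_{γ_{[x,y]}} ω`; for simple systems the magnetic geodesic
`γ_{[x,y]}` from `x` to `y` exists and is unique. -/
def action (x y : N) : ℝ := Classical.epsilon (m.IsAction x y)

/-- The boundary action function, `𝔸` restricted to `∂N × ∂N`. -/
def boundaryAction (x y : (𝓡∂ n).boundary N) : ℝ := m.action x y

/-- Magnetic gauge equivalence: `ĥ = ψ^* h` and `ω̂ = ψ^* ω + dφ` with a diffeomorphism `ψ` fixing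
`∂N` pointwise and a smooth function `φ` vanishing on `∂N`. -/
def IsMagneticallyGaugeEquivalent (m' : MagneticSystem n N) : Prop :=
  ∃ (ψ : N ≃ₘ^∞⟮𝓡∂ n, 𝓡∂ n⟯ N) (φ : N → ℝ),
    ContMDiff (𝓡∂ n) 𝓘(ℝ, ℝ) ∞ φ ∧
    (∀ x ∈ (𝓡∂ n).boundary N, ψ x = x) ∧ (∀ x ∈ (𝓡∂ n).boundary N, φ x = 0) ∧
    (∀ (x : N) (u v : TangentSpace (𝓡∂ n) x), m'.h.inner x u v
      = m.h.inner (ψ x) (mfderiv (𝓡∂ n) (𝓡∂ n) ψ x u) (mfderiv (𝓡∂ n) (𝓡∂ n) ψ x v)) ∧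
    (∀ (x : N) (u : TangentSpace (𝓡∂ n) x), m'.om x u
      = m.om (ψ x) (mfderiv (𝓡∂ n) (𝓡∂ n) ψ x u) + differential φ x u)

/-- Boundary rigidity: every simple magnetic system on `N` with the same boundary action function is
magnetically gauge equivalent to `m`. -/
def IsMagneticallyBoundaryRigid : Prop :=
  ∀ m' : MagneticSystem n N, m'.IsSimple →
    m.boundaryAction = m'.boundaryAction → m.IsMagneticallyGaugeEquivalent m'

end MagneticSystem

namespace StationaryMetric

variable (g : StationaryMetric n N)

/-- The model of `M = ℝ × N`. -/
abbrev cylinderModel (n : ℕ) [NeZero n] :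
    ModelWithCorners ℝ (ℝ × EuclideanSpace ℝ (Fin n)) (ModelProd ℝ (EuclideanHalfSpace n)) :=
  𝓘(ℝ, ℝ).prod (𝓡∂ n)

/-- The time component `v_t` of `v = (v_t, v_x) ∈ T_{(t,x)} (ℝ × N)`. -/
def timePart (p : ℝ × N) : TangentSpace (cylinderModel n) p →L[ℝ] ℝ :=
  ContinuousLinearMap.fst ℝ ℝ (EuclideanSpace ℝ (Fin n))

/-- The spatial component `v_x` of `v = (v_t, v_x) ∈ T_{(t,x)} (ℝ × N)`. -/
def spacePart (p : ℝ × N) : TangentSpace (cylinderModel n) p →L[ℝ] TangentSpace (𝓡∂ n) p.2 :=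
  ContinuousLinearMap.snd ℝ ℝ (EuclideanSpace ℝ (Fin n))

/-- The vector field `∂/∂t` on `ℝ × N`. -/
def timeVector (p : ℝ × N) : TangentSpace (cylinderModel n) p :=
  ((1, 0) : ℝ × EuclideanSpace ℝ (Fin n))

/-- The one-form `dt + ω` on `ℝ × N`. -/
def timeForm (p : ℝ × N) : TangentSpace (cylinderModel n) p →L[ℝ] ℝ :=
  timePart p + (g.om p.2).comp (spacePart p)

/-- The pullback of `h` to `ℝ × N`, i.e. `(v, w) ↦ (v_x, w_x)_h`. -/
def spaceForm (p : ℝ × N) :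
    TangentSpace (cylinderModel n) p →L[ℝ] TangentSpace (cylinderModel n) p →L[ℝ] ℝ :=
  ContinuousLinearMap.bilinearComp (E := EuclideanSpace ℝ (Fin n))
    (F := EuclideanSpace ℝ (Fin n)) (G := ℝ) (E' := ℝ × EuclideanSpace ℝ (Fin n))
    (F' := ℝ × EuclideanSpace ℝ (Fin n)) (g.h.inner p.2) (spacePart p) (spacePart p)

/-- The metric tensor `λ (-(dt + ω)² + h)` on `ℝ × N`. -/
def metric (p : ℝ × N) :
    TangentSpace (cylinderModel n) p →L[ℝ] TangentSpace (cylinderModel n) p →L[ℝ] ℝ :=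
  g.lam p.2 • (g.spaceForm p - (g.timeForm p).smulRight (g.timeForm p))

theorem metric_apply (p : ℝ × N) (v w : TangentSpace (cylinderModel n) p) :
    g.metric p v w = g.lam p.2 *
      (-((timePart p v + g.om p.2 (spacePart p v)) * (timePart p w + g.om p.2 (spacePart p w)))
        + g.h.inner p.2 (spacePart p v) (spacePart p w)) := by
  have h : g.metric p v w = g.lam p.2 * (g.h.inner p.2 (spacePart p v) (spacePart p w)
      - (timePart p v + g.om p.2 (spacePart p v)) *
        (timePart p w + g.om p.2 (spacePart p w))) := rfl
  rw [h]
  ring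

/-- `γ : [0, T] → ℝ × N`, `T > 0`, is a future pointing lightlike geodesic: `(γ̇, γ̇)_g = 0` and
`(γ̇, ∂/∂t)_g < 0`. -/
structure IsLightRay (T : ℝ) (γ : ℝ → ℝ × N) : Prop where
  pos : 0 < T
  geodesic : IsGeodesic (cylinderModel n) g.metric T γ
  lightlike : ∀ s ∈ Set.Icc (0 : ℝ) T,
    g.metric (γ s) (velocity (cylinderModel n) γ T s) (velocity (cylinderModel n) γ T s) = 0
  future : ∀ s ∈ Set.Icc (0 : ℝ) T,
    g.metric (γ s) (velocity (cylinderModel n) γ T s) (timeVector (γ s)) < 0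

/-- `v'` is the `g`-orthogonal projection of `v` to the tangent space of `∂M = ℝ × ∂N`. -/
def IsBoundaryProjection {p : ℝ × N} (v v' : TangentSpace (cylinderModel n) p) : Prop :=
  IsTangentToBoundary (spacePart p v') ∧
    ∀ u : TangentSpace (cylinderModel n) p, IsTangentToBoundary (spacePart p u) →
      g.metric p (v - v') u = 0

/-- The scattering relation `𝓢` (as the set of all pairs `((x, v'), 𝓢(x, v'))`): a future pointing
light ray enters `M = ℝ × N` at a point of `∂M = ℝ × ∂N` and leaves it at the next point of `∂M`;
`v'` and `w'` are the orthogonal projections to `T∂M` of its directions there. Since light rays have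
no natural parametrization, directions are taken up to positive factors, at both ends. -/
def scatteringRelation :
    Set (TangentBundle (cylinderModel n) (ℝ × N) × TangentBundle (cylinderModel n) (ℝ × N)) :=
  {P | ∃ (T : ℝ) (γ : ℝ → ℝ × N), g.IsLightRay T γ ∧
    (γ 0).2 ∈ (𝓡∂ n).boundary N ∧ (γ T).2 ∈ (𝓡∂ n).boundary N ∧
    (∀ s ∈ Set.Ioo (0 : ℝ) T, (γ s).2 ∈ (𝓡∂ n).interior N) ∧
    ∃ (a b : ℝ) (v' : TangentSpace (cylinderModel n) (γ 0))
      (w' : TangentSpace (cylinderModel n) (γ T)), 0 < a ∧ 0 < b ∧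
      g.IsBoundaryProjection (a • velocity (cylinderModel n) γ T 0) v' ∧
      g.IsBoundaryProjection (b • velocity (cylinderModel n) γ T T) w' ∧
      P = (⟨γ 0, v'⟩, ⟨γ T, w'⟩)}

/-- Gauge equivalence of stationary metrics: `ω̂ = ψ^* (ω + dφ)` and `ĥ = ψ^* h` with a
diffeomorphism `ψ` fixing `∂N` pointwise and a smooth function `φ` vanishing on `∂N`. -/
def GaugeEquivalent (g' : StationaryMetric n N) : Prop :=
  ∃ (ψ : N ≃ₘ^∞⟮𝓡∂ n, 𝓡∂ n⟯ N) (φ : N → ℝ),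
    ContMDiff (𝓡∂ n) 𝓘(ℝ, ℝ) ∞ φ ∧
    (∀ x ∈ (𝓡∂ n).boundary N, ψ x = x) ∧ (∀ x ∈ (𝓡∂ n).boundary N, φ x = 0) ∧
    (∀ (x : N) (u : TangentSpace (𝓡∂ n) x), g'.om x u
      = g.om (ψ x) (mfderiv (𝓡∂ n) (𝓡∂ n) ψ x u)
        + differential φ (ψ x) (mfderiv (𝓡∂ n) (𝓡∂ n) ψ x u)) ∧
    (∀ (x : N) (u v : TangentSpace (𝓡∂ n) x), g'.h.inner x u v
      = g.h.inner (ψ x) (mfderiv (𝓡∂ n) (𝓡∂ n) ψ x u) (mfderiv (𝓡∂ n) (𝓡∂ n) ψ x v))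

/-- A stationary metric is simple if its magnetic system `(N, h, ω)` is simple. -/
def IsSimple : Prop := g.toMagneticSystem.IsSimple

/-- Boundary rigidity of `(ℝ × N, g)`: every simple stationary metric on `ℝ × N` with the same
scattering relation is gauge equivalent to `g`. -/
def IsBoundaryRigid : Prop :=
  ∀ g' : StationaryMetric n N, g'.IsSimple →
    g.scatteringRelation = g'.scatteringRelation → g.GaugeEquivalent g'

end StationaryMetric

end StationaryRigidity

end

/-! The theorem reduces to one equivalence for simple stationary metrics: equal scattering relations
if and only if equal boundary actions (`scatteringRelation_eq_iff`).

From light rays to magnetic geodesics. Up to parametrization light rays do not see the conformal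
factor `λ`, and the Killing field `∂/∂t` provides a conserved energy. Parametrized by `h`-arclength,
the projection of a light ray to `N` is therefore a magnetic geodesic `γ`, and every magnetic
geodesic lifts. Along a lift `dt = (1 - ω(γ̇)) ds`, so the time elapsed between the ends is the
action of `γ`. Strict convexity keeps the open part of a magnetic geodesic off `∂N`, so magnetic
geodesics between boundary points account for all of the scattering relation
(`mem_scatteringRelation_iff`): it records the end points, the time delay `𝔸(x, y)`, and the end
directions projected to the boundary. In particular it determines `𝔸` on `∂N × ∂N`.

From the action back to the scattering relation. The boundary action has three one-sided derivatives
in boundary directions `u`. On the diagonal it is `|u| - ω(u)` (`tendsto_diag`), whose even and odd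
parts give the tangential parts of `h` and `ω`. In the final point it is `(V, u) - ω(u)` with `V`
the arrival velocity (`tendsto_end`). In the initial point it is `-(ξ, u) + ω(u)` with `ξ` the
initial velocity (`tendsto_start`). Hence `𝔸` determines the tangential parts of the velocities at
both ends, which is all that the scattering relation contains besides the time delay.

The final point is handled by the first variation formula, an application of the divergence theorem
to the rectangle of magnetic geodesics from `x` to the points of a curve. The initial point is
harder: simplicity concerns `exp_x` for each fixed `x`, with no regularity in `x` assumed, and
reversed magnetic geodesics belong to `-ω`. The argument is variational. The first variation formula
and Cauchy–Schwarz bound the growth of `𝔸(x, ·)` along a curve by the action of the curve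
(`action_sub_le`); this gives the triangle inequality and the continuity of `𝔸`, and the equality
case forces a point onto the geodesic (`exists_eq_of_action_add`). Compactness then shows that the
initial velocity depends continuously on the initial point, and comparing two broken routes with
short first legs pinches the difference quotient.

What remains is formal: the two gauge equivalences agree after replacing `φ` by `φ ∘ ψ`, and every
magnetic system is the one of a stationary metric, for instance with `λ = 1`. -/

open Set Filter

noncomputable section

namespace StationaryRigidity

/-! ### Tensors and derivatives read in charts. -/

section Coordinates

variable {E : Type*} [NormedAddCommGroup E] [NormedSpace ℝ E] {H : Type*} [TopologicalSpace H]
  {I : ModelWithCorners ℝ E H} {M : Type*} [TopologicalSpace M] [ChartedSpace H M]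
  {F : Type*} [NormedAddCommGroup F] [NormedSpace ℝ F]

/-- The bilinear form field `g`, read in the model space. -/
def metricAt (g : ∀ p : M, TangentSpace I p →L[ℝ] TangentSpace I p →L[ℝ] ℝ) (p : M) :
    E →L[ℝ] E →L[ℝ] ℝ := g p

/-- The one-form `om`, read in the model space. -/
def formAt (om : ∀ p : M, TangentSpace I p →L[ℝ] ℝ) (p : M) : E →L[ℝ] ℝ := om p

variable (I) in
/-- The differential of the inverse of a chart, read in the model space. -/
def frameAt (c : M) (u : E) : E →L[ℝ] E := chartFrame I c u

variable (I) in
/-- The differential of a chart, read in the model space. -/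
def coframeAt (c p : M) : E →L[ℝ] E := mfderiv I 𝓘(ℝ, E) (extChartAt I c) p

variable (I) in
/-- The differential of a map into `M` within a set, read in the model space. -/
def derivAt (Γ : F → M) (R : Set F) (q : F) : F →L[ℝ] E := mfderivWithin 𝓘(ℝ, F) I Γ R q

theorem chartMetric_eq (g : ∀ p : M, TangentSpace I p →L[ℝ] TangentSpace I p →L[ℝ] ℝ) (c : M)
    (u a b : E) : chartMetric I g c u a b
      = metricAt g ((extChartAt I c).symm u) (frameAt I c u a) (frameAt I c u b) := rfl

theorem chartForm_eq (om : ∀ p : M, TangentSpace I p →L[ℝ] ℝ) (c : M) (u a : E) :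
    chartForm I om c u a = formAt om ((extChartAt I c).symm u) (frameAt I c u a) := rfl

theorem chartMetric_apply_of_mem
    (g : ∀ p : M, TangentSpace I p →L[ℝ] TangentSpace I p →L[ℝ] ℝ) {c p : M}
    (hp : p ∈ (chartAt H c).source) (a b : E) :
    chartMetric I g c (extChartAt I c p) a b
      = metricAt g p (frameAt I c (extChartAt I c p) a) (frameAt I c (extChartAt I c p) b) := by
  rw [chartMetric_eq, (extChartAt I c).left_inv (by rwa [extChartAt_source])]

theorem chartForm_apply_of_mem (om : ∀ p : M, TangentSpace I p →L[ℝ] ℝ) {c p : M}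
    (hp : p ∈ (chartAt H c).source) (a : E) :
    chartForm I om c (extChartAt I c p) a = formAt om p (frameAt I c (extChartAt I c p) a) := by
  rw [chartForm_eq, (extChartAt I c).left_inv (by rwa [extChartAt_source])]

theorem mdiffAt_of_contMDiffOn {γ : ℝ → M} {J : Set ℝ} {s : ℝ}
    (hγ : ContMDiffOn 𝓘(ℝ, ℝ) I ∞ γ J) (hs : s ∈ J) :
    MDifferentiableWithinAt 𝓘(ℝ, ℝ) I γ J s := (hγ s hs).mdifferentiableWithinAt (by simp)

theorem uniqueDiffWithinAt_Icc {T s : ℝ} (hT : 0 < T) (hs : s ∈ Icc (0 : ℝ) T) :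
    UniqueDiffWithinAt ℝ (Icc (0 : ℝ) T) s := uniqueDiffOn_Icc hT s hs

variable [IsManifold I 1 M]

/-- Tangent vectors at `x` are represented by their components in the preferred chart at `x`, so
that chart has identity differential there. Pointwise identities can thus be checked in the chart of
the point itself. -/
theorem frameAt_self (x : M) : frameAt I x (extChartAt I x x) = ContinuousLinearMap.id ℝ E :=
  mfderivWithin_range_extChartAt_symm (I := I) (x := x)

theorem coframeAt_self (x : M) : coframeAt I x x = ContinuousLinearMap.id ℝ E :=
  mfderiv_extChartAt_self (I := I) (x := x)

theorem chartMetric_self (g : ∀ p : M, TangentSpace I p →L[ℝ] TangentSpace I p →L[ℝ] ℝ) (x : M) :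
    chartMetric I g x (extChartAt I x x) = metricAt g x := by
  ext a b
  rw [chartMetric_apply_of_mem g (mem_chart_source H x), frameAt_self]
  rfl

theorem chartForm_self (om : ∀ p : M, TangentSpace I p →L[ℝ] ℝ) (x : M) :
    chartForm I om x (extChartAt I x x) = formAt om x := by
  ext a
  rw [chartForm_apply_of_mem om (mem_chart_source H x), frameAt_self]
  rfl

theorem hasFDerivWithinAt_extChartAt_comp {Γ : F → M} {R : Set F} {q : F} {c : M}
    (hΓ : MDifferentiableWithinAt 𝓘(ℝ, F) I Γ R q) (hc : Γ q ∈ (chartAt H c).source) :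
    HasFDerivWithinAt (fun r => extChartAt I c (Γ r)) (coframeAt I c (Γ q) ∘L derivAt I Γ R q) R q :=
  ((mdifferentiableAt_extChartAt (I := I) hc).hasMFDerivAt.comp_hasMFDerivWithinAt q
    hΓ.hasMFDerivWithinAt).hasFDerivWithinAt

theorem frameAt_coframeAt {c p : M} (hp : p ∈ (chartAt H c).source) (v : E) :
    frameAt I c (extChartAt I c p) (coframeAt I c p v) = v :=
  congrArg (fun A : E →L[ℝ] E => A v)
    (mfderivWithin_extChartAt_symm_comp_mfderiv_extChartAt' (I := I) (x := c) (y := p)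
      (by rwa [extChartAt_source]))

theorem coframeAt_frameAt {c p : M} (hp : p ∈ (chartAt H c).source) (v : E) :
    coframeAt I c p (frameAt I c (extChartAt I c p) v) = v :=
  congrArg (fun A : E →L[ℝ] E => A v)
    (mfderiv_extChartAt_comp_mfderivWithin_extChartAt_symm' (I := I) (x := c) (y := p)
      (by rwa [extChartAt_source]))

/-- Frame and coframe are inverse to each other, so the chart derivative and the intrinsic
derivative represent the same vector. Values of the metric and of the form on velocities can
therefore be computed in any chart. -/
theorem frameAt_fderivWithin {Γ : F → M} {R : Set F} {q : F} {c : M}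
    (hΓ : MDifferentiableWithinAt 𝓘(ℝ, F) I Γ R q) (hR : UniqueDiffWithinAt ℝ R q)
    (hc : Γ q ∈ (chartAt H c).source) (v : F) :
    frameAt I c (extChartAt I c (Γ q)) (fderivWithin ℝ (fun r => extChartAt I c (Γ r)) R q v)
      = derivAt I Γ R q v := by
  rw [(hasFDerivWithinAt_extChartAt_comp hΓ hc).fderivWithin hR]
  exact frameAt_coframeAt hc _

theorem chartMetric_fderivWithin
    (g : ∀ p : M, TangentSpace I p →L[ℝ] TangentSpace I p →L[ℝ] ℝ)
    {Γ : F → M} {R : Set F} {q : F} {c : M}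
    (hΓ : MDifferentiableWithinAt 𝓘(ℝ, F) I Γ R q) (hR : UniqueDiffWithinAt ℝ R q)
    (hc : Γ q ∈ (chartAt H c).source) (v w : F) :
    chartMetric I g c (extChartAt I c (Γ q))
        (fderivWithin ℝ (fun r => extChartAt I c (Γ r)) R q v)
        (fderivWithin ℝ (fun r => extChartAt I c (Γ r)) R q w)
      = metricAt g (Γ q) (derivAt I Γ R q v) (derivAt I Γ R q w) := by
  rw [chartMetric_apply_of_mem g hc, frameAt_fderivWithin hΓ hR hc, frameAt_fderivWithin hΓ hR hc]

theorem chartForm_fderivWithin (om : ∀ p : M, TangentSpace I p →L[ℝ] ℝ)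
    {Γ : F → M} {R : Set F} {q : F} {c : M}
    (hΓ : MDifferentiableWithinAt 𝓘(ℝ, F) I Γ R q) (hR : UniqueDiffWithinAt ℝ R q)
    (hc : Γ q ∈ (chartAt H c).source) (v : F) :
    chartForm I om c (extChartAt I c (Γ q))
        (fderivWithin ℝ (fun r => extChartAt I c (Γ r)) R q v)
      = formAt om (Γ q) (derivAt I Γ R q v) := by
  rw [chartForm_apply_of_mem om hc, frameAt_fderivWithin hΓ hR hc]

/-! ### Curves on a compact interval -/

theorem hasDerivWithinAt_chartCurve {γ : ℝ → M} {T s : ℝ} {c : M}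
    (hγ : MDifferentiableWithinAt 𝓘(ℝ, ℝ) I γ (Icc 0 T) s)
    (hc : γ s ∈ (chartAt H c).source) :
    HasDerivWithinAt (chartCurve I c γ) (chartVelocity I c γ T s) (Icc 0 T) s :=
  (hasFDerivWithinAt_extChartAt_comp hγ hc).differentiableWithinAt.hasDerivWithinAt

variable (I) in
/-- The velocity of a curve, read in the model space. -/
def velocityAt (γ : ℝ → M) (T s : ℝ) : E := velocity I γ T s

theorem frameAt_chartVelocity {γ : ℝ → M} {T s : ℝ} {c : M} (hT : 0 < T)
    (hs : s ∈ Icc (0 : ℝ) T) (hγ : MDifferentiableWithinAt 𝓘(ℝ, ℝ) I γ (Icc 0 T) s)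
    (hc : γ s ∈ (chartAt H c).source) :
    frameAt I c (chartCurve I c γ s) (chartVelocity I c γ T s) = velocityAt I γ T s :=
  frameAt_fderivWithin hγ (uniqueDiffWithinAt_Icc hT hs) hc (1 : ℝ)

theorem coframeAt_velocityAt {γ : ℝ → M} {T s : ℝ} {c : M} (hT : 0 < T)
    (hs : s ∈ Icc (0 : ℝ) T) (hγ : MDifferentiableWithinAt 𝓘(ℝ, ℝ) I γ (Icc 0 T) s)
    (hc : γ s ∈ (chartAt H c).source) :
    coframeAt I c (γ s) (velocityAt I γ T s) = chartVelocity I c γ T s := by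
  rw [← frameAt_chartVelocity hT hs hγ hc]
  exact coframeAt_frameAt hc _

theorem chartVelocity_self {γ : ℝ → M} {T s : ℝ} (hT : 0 < T) (hs : s ∈ Icc (0 : ℝ) T)
    (hγ : MDifferentiableWithinAt 𝓘(ℝ, ℝ) I γ (Icc 0 T) s) :
    chartVelocity I (γ s) γ T s = velocityAt I γ T s := by
  rw [← coframeAt_velocityAt hT hs hγ (mem_chart_source H _), coframeAt_self]
  rfl

theorem chartMetric_chartVelocity
    (g : ∀ p : M, TangentSpace I p →L[ℝ] TangentSpace I p →L[ℝ] ℝ) {γ : ℝ → M} {T s : ℝ} {c : M}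
    (hT : 0 < T) (hs : s ∈ Icc (0 : ℝ) T) (hγ : MDifferentiableWithinAt 𝓘(ℝ, ℝ) I γ (Icc 0 T) s)
    (hc : γ s ∈ (chartAt H c).source) :
    chartMetric I g c (chartCurve I c γ s) (chartVelocity I c γ T s) (chartVelocity I c γ T s)
      = metricAt g (γ s) (velocityAt I γ T s) (velocityAt I γ T s) :=
  chartMetric_fderivWithin g hγ (uniqueDiffWithinAt_Icc hT hs) hc (1 : ℝ) (1 : ℝ)

theorem chartForm_chartVelocity (om : ∀ p : M, TangentSpace I p →L[ℝ] ℝ) {γ : ℝ → M} {T s : ℝ}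
    {c : M} (hT : 0 < T) (hs : s ∈ Icc (0 : ℝ) T)
    (hγ : MDifferentiableWithinAt 𝓘(ℝ, ℝ) I γ (Icc 0 T) s) (hc : γ s ∈ (chartAt H c).source) :
    chartForm I om c (chartCurve I c γ s) (chartVelocity I c γ T s)
      = formAt om (γ s) (velocityAt I γ T s) :=
  chartForm_fderivWithin om hγ (uniqueDiffWithinAt_Icc hT hs) hc (1 : ℝ)

end Coordinates

/-! ### Smoothness of chart components. -/

section Smoothness

variable {E : Type*} [NormedAddCommGroup E] [NormedSpace ℝ E] {H : Type*} [TopologicalSpace H]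
  {I : ModelWithCorners ℝ E H} {M : Type*} [TopologicalSpace M] [ChartedSpace H M]
  [IsManifold I ∞ M]

theorem contDiffWithinAt_chartCurve {γ : ℝ → M} {T s : ℝ} {c : M}
    (hγ : ContMDiffWithinAt 𝓘(ℝ, ℝ) I ∞ γ (Icc 0 T) s) (hc : γ s ∈ (chartAt H c).source) :
    ContDiffWithinAt ℝ ∞ (chartCurve I c γ) (Icc 0 T) s :=
  contMDiffWithinAt_iff_contDiffWithinAt.1
    ((contMDiffAt_extChartAt' hc).comp_contMDiffWithinAt s hγ)

theorem contDiffWithinAt_chartVelocity {γ : ℝ → M} {T s : ℝ} {c : M} (hT : 0 < T)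
    (hs : s ∈ Icc (0 : ℝ) T)
    (hγ : ContMDiffWithinAt 𝓘(ℝ, ℝ) I ∞ γ (Icc 0 T) s) (hc : γ s ∈ (chartAt H c).source) :
    ContDiffWithinAt ℝ ∞ (chartVelocity I c γ T) (Icc 0 T) s :=
  ((contDiffWithinAt_chartCurve hγ hc).fderivWithin_right (uniqueDiffOn_Icc hT)
    (m := ∞) (by simp) hs).clm_apply contDiffWithinAt_const

/-- The constant fields of a chart are smooth sections of the tangent bundle. Inserting them into a
smooth tensor field turns smoothness of the bundle section into smoothness of its components. -/
theorem contMDiffAt_frame {c p : M} (hp : p ∈ (chartAt H c).source) (a : E) :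
    ContMDiffAt I (I.prod 𝓘(ℝ, E)) ∞ (fun m => Bundle.TotalSpace.mk' E
      (E := fun x : M => TangentSpace I x) m
      ((trivializationAt E (TangentSpace I) c).symmL ℝ m a)) p := by
  apply ContMDiffAt.clm_bundle_apply (F₁ := E) (F₂ := E) (E₁ := Bundle.Trivial M E)
    (E₂ := fun x : M => TangentSpace I x) (b := fun m => m)
  · exact (trivializationAt E (TangentSpace I) c).contMDiffAt_symmL (by simpa using hp)
  · rw [Bundle.contMDiffAt_section]
    exact contMDiffAt_const


theorem contDiffOn_of_frame {c : M} {f : M → ℝ}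
    (h : ∀ p ∈ (chartAt H c).source, ContMDiffAt I 𝓘(ℝ, ℝ) ∞ f p) :
    ContDiffOn ℝ ∞ (fun u => f ((extChartAt I c).symm u)) (extChartAt I c).target := by
  rw [← contMDiffOn_iff_contDiffOn]
  intro u hu
  have hp : (extChartAt I c).symm u ∈ (chartAt H c).source := by
    rw [← extChartAt_source I]; exact (extChartAt I c).map_target hu
  exact (h _ hp).comp_contMDiffWithinAt u (contMDiffOn_extChartAt_symm c u hu)

theorem chartFrame_eq_symmL {c : M} {u : E} (hu : u ∈ (extChartAt I c).target) :
    chartFrame I c u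
      = (trivializationAt E (TangentSpace I) c).symmL ℝ ((extChartAt I c).symm u) := by
  have hp : (extChartAt I c).symm u ∈ (chartAt H c).source := by
    rw [← extChartAt_source I]; exact (extChartAt I c).map_target hu
  rw [TangentBundle.symmL_trivializationAt hp, (extChartAt I c).right_inv hu]
  rfl

variable [FiniteDimensional ℝ E]

theorem contDiffOn_chartForm {om : ∀ p : M, TangentSpace I p →L[ℝ] ℝ}
    (h : ContMDiff I (I.prod 𝓘(ℝ, E →L[ℝ] ℝ)) ∞ (fun x : M => Bundle.TotalSpace.mk' (E →L[ℝ] ℝ)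
      (E := fun x : M => TangentSpace I x →L[ℝ] Bundle.Trivial M ℝ x) x (om x))) (c : M) :
    ContDiffOn ℝ ∞ (chartForm I om c) (extChartAt I c).target := by
  rw [contDiffOn_clm_apply]
  intro a
  have key := contDiffOn_of_frame (I := I) (c := c)
    (f := fun m => om m ((trivializationAt E (TangentSpace I) c).symmL ℝ m a)) (fun p hp => by
      have := ContMDiffAt.clm_bundle_apply (F₁ := E) (F₂ := ℝ) (E₁ := fun x : M => TangentSpace I x)
        (E₂ := Bundle.Trivial M ℝ) (b := fun m => m) (h p) (contMDiffAt_frame hp a)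
      rwa [Bundle.contMDiffAt_section] at this)
  refine key.congr fun u hu => ?_
  rw [← chartFrame_eq_symmL hu]
  rfl

theorem contDiffOn_chartMetric {g : ∀ p : M, TangentSpace I p →L[ℝ] TangentSpace I p →L[ℝ] ℝ}
    (h : ContMDiff I (I.prod 𝓘(ℝ, E →L[ℝ] E →L[ℝ] ℝ)) ∞
      (fun x : M => Bundle.TotalSpace.mk' (E →L[ℝ] E →L[ℝ] ℝ)
        (E := fun x : M => TangentSpace I x →L[ℝ] TangentSpace I x →L[ℝ] ℝ) x (g x))) (c : M) :
    ContDiffOn ℝ ∞ (chartMetric I g c) (extChartAt I c).target := by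
  rw [contDiffOn_clm_apply]
  intro a
  rw [contDiffOn_clm_apply]
  intro b
  have key := contDiffOn_of_frame (I := I) (c := c)
    (f := fun m => g m ((trivializationAt E (TangentSpace I) c).symmL ℝ m a)
      ((trivializationAt E (TangentSpace I) c).symmL ℝ m b)) (fun p hp => by
      have := ContMDiffAt.clm_bundle_apply₂ (F₁ := E) (F₂ := E) (F₃ := ℝ)
        (E₁ := fun x : M => TangentSpace I x) (E₂ := fun x : M => TangentSpace I x)
        (E₃ := Bundle.Trivial M ℝ) (b := fun m => m) (h p) (contMDiffAt_frame hp a)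
        (contMDiffAt_frame hp b)
      rwa [Bundle.contMDiffAt_section] at this)
  refine key.congr fun u hu => ?_
  rw [← chartFrame_eq_symmL hu]
  rfl

end Smoothness

/-! ### The geodesic equation in momentum form, and reparametrization. -/

section Momentum

variable {E : Type*} [NormedAddCommGroup E] [NormedSpace ℝ E] {H : Type*} [TopologicalSpace H]
  {I : ModelWithCorners ℝ E H} {M : Type*} [TopologicalSpace M] [ChartedSpace H M]

theorem extChartAt_mem_range (c p : M) : extChartAt I c p ∈ range I := by
  rw [extChartAt_coe]; exact mem_range_self _

theorem hasFDerivWithinAt_of_contDiffOn_target {V : Type*} [NormedAddCommGroup V]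
    [NormedSpace ℝ V] {c p : M} {f : E → V} (hf : ContDiffOn ℝ ∞ f (extChartAt I c).target)
    (hp : p ∈ (chartAt H c).source) :
    HasFDerivWithinAt f (fderivWithin ℝ f (range I) (extChartAt I c p)) (range I)
      (extChartAt I c p) := by
  have hu : extChartAt I c p ∈ (extChartAt I c).target :=
    (extChartAt I c).map_source (by rwa [extChartAt_source])
  exact (((hf _ hu).differentiableWithinAt (by simp)).mono_of_mem_nhdsWithin
    (extChartAt_target_mem_nhdsWithin_of_mem hu)).hasFDerivWithinAt

variable [IsManifold I ∞ M]

theorem hasDerivWithinAt_comp_chartCurve {V : Type*} [NormedAddCommGroup V]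
    [NormedSpace ℝ V] {c : M} {f : E → V} (hf : ContDiffOn ℝ ∞ f (extChartAt I c).target)
    {γ : ℝ → M} {T s : ℝ} (hs : s ∈ Icc (0 : ℝ) T)
    (hγ : ContMDiffOn 𝓘(ℝ, ℝ) I ∞ γ (Icc 0 T)) (hc : γ s ∈ (chartAt H c).source) :
    HasDerivWithinAt (fun r => f (chartCurve I c γ r))
      (fderivWithin ℝ f (range I) (chartCurve I c γ s) (chartVelocity I c γ T s)) (Icc 0 T) s :=
  (hasFDerivWithinAt_of_contDiffOn_target hf hc).comp_hasDerivWithinAt s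
    (hasDerivWithinAt_chartCurve (I := I) (c := c) (mdiffAt_of_contMDiffOn hγ hs) hc)
    (fun r _ => extChartAt_mem_range c (γ r))

/-- The momentum form of the geodesic equation. -/
theorem hasDerivWithinAt_momentum {g : ∀ p : M, TangentSpace I p →L[ℝ] TangentSpace I p →L[ℝ] ℝ}
    {c : M} (hg : ContDiffOn ℝ ∞ (chartMetric I g c) (extChartAt I c).target)
    {γ : ℝ → M} {T s : ℝ} (hT : 0 < T) (hs : s ∈ Icc (0 : ℝ) T)
    (hγ : ContMDiffOn 𝓘(ℝ, ℝ) I ∞ γ (Icc 0 T)) (hc : γ s ∈ (chartAt H c).source) (e : E) :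
    HasDerivWithinAt
      (fun r => chartMetric I g c (chartCurve I c γ r) (chartVelocity I c γ T r) e)
      (covariantAcceleration I g c γ T s e
        + 1 / 2 * fderivWithin ℝ (chartMetric I g c) (range I) (chartCurve I c γ s) e
          (chartVelocity I c γ T s) (chartVelocity I c γ T s)) (Icc 0 T) s := by
  have hv : HasDerivWithinAt (chartVelocity I c γ T)
      (derivWithin (chartVelocity I c γ T) (Icc 0 T) s) (Icc 0 T) s :=
    ((contDiffWithinAt_chartVelocity hT hs (hγ s hs) hc).differentiableWithinAt
      (by simp)).hasDerivWithinAt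
  have hG := hasDerivWithinAt_comp_chartCurve hg hs hγ hc
  -- The product rule gives `∂_v g(v, e) + g(v̇, e)`, while the Christoffel term on `(v, v, e)` is
  -- `∂_v g(v, e) - ½ ∂_e g(v, v)`; the difference is the extra term of the claim.
  have := (hG.clm_apply hv).clm_apply (hasDerivWithinAt_const s (Icc 0 T) e)
  refine this.congr_deriv ?_
  simp only [covariantAcceleration, christoffel, map_zero, add_zero, add_apply]
  ring

theorem hasDerivWithinAt_chartForm {om : ∀ p : M, TangentSpace I p →L[ℝ] ℝ} {c : M}
    (hom : ContDiffOn ℝ ∞ (chartForm I om c) (extChartAt I c).target)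
    {γ : ℝ → M} {T s : ℝ} (hs : s ∈ Icc (0 : ℝ) T)
    (hγ : ContMDiffOn 𝓘(ℝ, ℝ) I ∞ γ (Icc 0 T)) (hc : γ s ∈ (chartAt H c).source) (e : E) :
    HasDerivWithinAt (fun r => chartForm I om c (chartCurve I c γ r) e)
      (fderivWithin ℝ (chartForm I om c) (range I) (chartCurve I c γ s)
        (chartVelocity I c γ T s) e) (Icc 0 T) s := by
  have hG := hasDerivWithinAt_comp_chartCurve hom hs hγ hc
  refine (hG.clm_apply (hasDerivWithinAt_const s (Icc 0 T) e)).congr_deriv ?_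
  simp

theorem chartVelocity_comp {γ : ℝ → M} {G : ℝ → ℝ} {T T' s G' : ℝ} {c : M} (hT' : 0 < T')
    (hs : s ∈ Icc (0 : ℝ) T') (hG : HasDerivWithinAt G G' (Icc 0 T') s)
    (hmaps : MapsTo G (Icc 0 T') (Icc 0 T))
    (hγ : MDifferentiableWithinAt 𝓘(ℝ, ℝ) I γ (Icc 0 T) (G s))
    (hc : γ (G s) ∈ (chartAt H c).source) :
    chartVelocity I c (γ ∘ G) T' s = G' • chartVelocity I c γ T (G s) :=
  ((hasDerivWithinAt_chartCurve (I := I) hγ hc).scomp s hG hmaps).derivWithin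
    (uniqueDiffWithinAt_Icc hT' hs)

theorem velocityAt_comp {γ : ℝ → M} {G : ℝ → ℝ} {T T' s G' : ℝ} (hT : 0 < T) (hT' : 0 < T')
    (hs : s ∈ Icc (0 : ℝ) T') (hG : HasDerivWithinAt G G' (Icc 0 T') s)
    (hmaps : MapsTo G (Icc 0 T') (Icc 0 T))
    (hγ : MDifferentiableWithinAt 𝓘(ℝ, ℝ) I γ (Icc 0 T) (G s)) :
    velocityAt I (γ ∘ G) T' s = G' • velocityAt I γ T (G s) := by
  have hγG : MDifferentiableWithinAt 𝓘(ℝ, ℝ) I (γ ∘ G) (Icc 0 T') s :=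
    hγ.comp s hG.differentiableWithinAt.mdifferentiableWithinAt hmaps
  have h := chartVelocity_comp (I := I) (c := γ (G s)) hT' hs hG hmaps hγ (mem_chart_source H _)
  rw [chartVelocity_self hT (hmaps hs) hγ] at h
  rw [← h]
  exact (chartVelocity_self (I := I) hT' hs hγG).symm

omit [IsManifold I ∞ M] in
theorem velocityAt_congr {γ γ' : ℝ → M} {T s : ℝ} (h : EqOn γ γ' (Icc 0 T))
    (hs : s ∈ Icc (0 : ℝ) T) : velocityAt I γ T s = velocityAt I γ' T s :=
  congrArg (fun A : ℝ →L[ℝ] E => A 1) (mfderivWithin_congr h (h hs))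

end Momentum

/-! ### Magnetic geodesics and their segments. -/

/-- The model vector space of an `n`-dimensional manifold with boundary. -/
abbrev Space (n : ℕ) : Type := EuclideanSpace ℝ (Fin n)

section

variable {n : ℕ} [NeZero n] {N : Type*} [TopologicalSpace N]
  [ChartedSpace (EuclideanHalfSpace n) N]

/-- The velocity of a curve in `N`, read in the model space. -/
abbrev vel (γ : ℝ → N) (T s : ℝ) : Space n := velocityAt (𝓡∂ n) γ T s

variable [IsManifold (𝓡∂ n) ∞ N]

namespace MagneticSystem

variable (m : MagneticSystem n N)

/-- The inner product on the tangent space at `x`, read in the model space. -/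
abbrev ip (x : N) : Space n →L[ℝ] Space n →L[ℝ] ℝ := metricAt m.h.inner x

/-- The one-form at `x`, read in the model space. -/
abbrev pot (x : N) : Space n →L[ℝ] ℝ := formAt m.om x

/-- The metric in the chart `c`. -/
abbrev gram (c : N) (u : Space n) : Space n →L[ℝ] Space n →L[ℝ] ℝ :=
  chartMetric (𝓡∂ n) m.h.inner c u

/-- The one-form in the chart `c`. -/
abbrev cpot (c : N) (u : Space n) : Space n →L[ℝ] ℝ := chartForm (𝓡∂ n) m.om c u

theorem ip_symm (x : N) (v w : Space n) : m.ip x v w = m.ip x w v := m.h.symm x v w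

theorem ip_pos (x : N) {v : Space n} (hv : v ≠ 0) : 0 < m.ip x v v := m.h.pos x v hv

theorem contDiffOn_gram (c : N) :
    ContDiffOn ℝ ∞ (chartMetric (𝓡∂ n) m.h.inner c) (extChartAt (𝓡∂ n) c).target :=
  contDiffOn_chartMetric m.h.contMDiff c

theorem contDiffOn_cpot (c : N) :
    ContDiffOn ℝ ∞ (chartForm (𝓡∂ n) m.om c) (extChartAt (𝓡∂ n) c).target :=
  contDiffOn_chartForm m.smooth_om c

namespace IsMagneticGeodesic

variable {m} {ℓ : ℝ} {γ : ℝ → N}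

theorem mdiff (hγ : m.IsMagneticGeodesic ℓ γ) {s : ℝ} (hs : s ∈ Icc (0 : ℝ) ℓ) :
    MDifferentiableWithinAt 𝓘(ℝ, ℝ) (𝓡∂ n) γ (Icc 0 ℓ) s :=
  mdiffAt_of_contMDiffOn hγ.smooth hs

theorem ip_vel (hγ : m.IsMagneticGeodesic ℓ γ) {s : ℝ} (hs : s ∈ Icc (0 : ℝ) ℓ) :
    m.ip (γ s) (vel γ ℓ s) (vel γ ℓ s) = 1 := hγ.unit_speed s hs

theorem hasDerivWithinAt_momentum (hγ : m.IsMagneticGeodesic ℓ γ) {s : ℝ}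
    (hs : s ∈ Icc (0 : ℝ) ℓ) {c : N} (hc : γ s ∈ (chartAt (EuclideanHalfSpace n) c).source)
    (e : Space n) :
    HasDerivWithinAt (fun r => m.gram c (chartCurve (𝓡∂ n) c γ r) (chartVelocity (𝓡∂ n) c γ ℓ r) e)
      (chartExtDeriv (𝓡∂ n) m.om c (chartCurve (𝓡∂ n) c γ s) (chartVelocity (𝓡∂ n) c γ ℓ s) e
        + 1 / 2 * fderivWithin ℝ (chartMetric (𝓡∂ n) m.h.inner c) (range (𝓡∂ n))
          (chartCurve (𝓡∂ n) c γ s) e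
          (chartVelocity (𝓡∂ n) c γ ℓ s) (chartVelocity (𝓡∂ n) c γ ℓ s)) (Icc 0 ℓ) s := by
  have := StationaryRigidity.hasDerivWithinAt_momentum (m.contDiffOn_gram c) hγ.pos hs hγ.smooth hc e
  rwa [hγ.newton c s hs hc e] at this

/-- Converse of the momentum equation, by uniqueness of derivatives. It allows segments and
projected light rays to be recognised as magnetic geodesics without computing accelerations. -/
theorem of_hasDerivWithinAt (hℓ : 0 < ℓ) (hsm : ContMDiffOn 𝓘(ℝ, ℝ) (𝓡∂ n) ∞ γ (Icc 0 ℓ))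
    (hunit : ∀ s ∈ Icc (0 : ℝ) ℓ, m.ip (γ s) (vel γ ℓ s) (vel γ ℓ s) = 1)
    (h : ∀ c : N, ∀ s ∈ Icc (0 : ℝ) ℓ, γ s ∈ (chartAt (EuclideanHalfSpace n) c).source →
      ∀ e : Space n, HasDerivWithinAt
        (fun r => m.gram c (chartCurve (𝓡∂ n) c γ r) (chartVelocity (𝓡∂ n) c γ ℓ r) e)
        (chartExtDeriv (𝓡∂ n) m.om c (chartCurve (𝓡∂ n) c γ s) (chartVelocity (𝓡∂ n) c γ ℓ s) e
          + 1 / 2 * fderivWithin ℝ (chartMetric (𝓡∂ n) m.h.inner c) (range (𝓡∂ n))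
            (chartCurve (𝓡∂ n) c γ s) e
            (chartVelocity (𝓡∂ n) c γ ℓ s) (chartVelocity (𝓡∂ n) c γ ℓ s)) (Icc 0 ℓ) s) :
    m.IsMagneticGeodesic ℓ γ where
  pos := hℓ
  smooth := hsm
  unit_speed := hunit
  newton c s hs hc e := by
    have h1 := StationaryRigidity.hasDerivWithinAt_momentum (m.contDiffOn_gram c) hℓ hs hsm hc e
    exact add_right_cancel ((uniqueDiffWithinAt_Icc hℓ hs).eq_deriv _ h1 (h c s hs hc e))

omit [IsManifold (𝓡∂ n) ∞ N] in
theorem source_eventually (hsm : ContMDiffOn 𝓘(ℝ, ℝ) (𝓡∂ n) ∞ γ (Icc 0 ℓ)) {s : ℝ} 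
    (hs : s ∈ Icc (0 : ℝ) ℓ) {c : N} (hc : γ s ∈ (chartAt (EuclideanHalfSpace n) c).source) :
    ∀ᶠ r in 𝓝[Icc 0 ℓ] s, γ r ∈ (chartAt (EuclideanHalfSpace n) c).source :=
  (hsm s hs).continuousWithinAt ((chartAt (EuclideanHalfSpace n) c).open_source.mem_nhds hc)

/-- A piece of a magnetic geodesic is a magnetic geodesic. -/
theorem segment (hγ : m.IsMagneticGeodesic ℓ γ) {a b : ℝ} (ha : 0 ≤ a) (hab : a < b) (hb : b ≤ ℓ) :
    m.IsMagneticGeodesic (b - a) (γ ∘ fun s => a + s) := by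
  have hpos : 0 < b - a := sub_pos.2 hab
  have hmaps : MapsTo (fun s => a + s) (Icc 0 (b - a)) (Icc 0 ℓ) := fun s hs =>
    ⟨by linarith [hs.1], by linarith [hs.2]⟩
  have hd : ∀ s, HasDerivWithinAt (fun s => a + s) 1 (Icc 0 (b - a)) s := fun s =>
    ((hasDerivAt_id s).const_add a).hasDerivWithinAt
  have hsm : ContMDiffOn 𝓘(ℝ, ℝ) (𝓡∂ n) ∞ (γ ∘ fun s => a + s) (Icc 0 (b - a)) :=
    hγ.smooth.comp (contDiff_const.add contDiff_id).contMDiff.contMDiffOn hmaps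
  refine of_hasDerivWithinAt hpos hsm (fun s hs => ?_) fun c s hs hc e => ?_
  · rw [vel, velocityAt_comp hγ.pos hpos hs (hd s) hmaps (hγ.mdiff (hmaps hs)), one_smul]
    exact hγ.ip_vel (hmaps hs)
  · have hv : ∀ r ∈ Icc 0 (b - a), γ (a + r) ∈ (chartAt (EuclideanHalfSpace n) c).source →
        chartVelocity (𝓡∂ n) c (γ ∘ fun s => a + s) (b - a) r
          = chartVelocity (𝓡∂ n) c γ ℓ (a + r) := fun r hr hcr => by
      rw [chartVelocity_comp hpos hr (hd r) hmaps (hγ.mdiff (hmaps hr)) hcr, one_smul]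
    have key := (hγ.hasDerivWithinAt_momentum (hmaps hs) hc e).scomp s (hd s) hmaps
    rw [one_smul] at key
    rw [hv s hs hc]
    refine key.congr_of_eventuallyEq ?_ ?_
    · filter_upwards [source_eventually hsm hs hc, self_mem_nhdsWithin] with r hr hr'
      rw [hv r hr' hr]
      rfl
    · rw [hv s hs hc]
      rfl

theorem vel_segment (hγ : m.IsMagneticGeodesic ℓ γ) {a b s : ℝ} (ha : 0 ≤ a) (hab : a < b)
    (hb : b ≤ ℓ) (hs : s ∈ Icc 0 (b - a)) :
    vel (n := n) (γ ∘ fun s => a + s) (b - a) s = vel γ ℓ (a + s) := by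
  have hmaps : MapsTo (fun s => a + s) (Icc 0 (b - a)) (Icc 0 ℓ) := fun s hs =>
    ⟨by linarith [hs.1], by linarith [hs.2]⟩
  have hd : HasDerivWithinAt (fun s => a + s) 1 (Icc 0 (b - a)) s :=
    ((hasDerivAt_id s).const_add a).hasDerivWithinAt
  rw [vel, velocityAt_comp hγ.pos (sub_pos.2 hab) hs hd hmaps (hγ.mdiff (hmaps hs)), one_smul]

end IsMagneticGeodesic

end MagneticSystem
end

/-! ### Local injectivity and the inverse of the magnetic exponential map. -/

/-- A `C¹` map on a convex set is injective near a point where its derivative is injective. -/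
theorem exists_injOn_of_contDiffWithinAt {E F : Type*} [NormedAddCommGroup E] [NormedSpace ℝ E]
    [FiniteDimensional ℝ E] [NormedAddCommGroup F] [NormedSpace ℝ F] {f : E → F} {S : Set E} {a : E}
    (hS : Convex ℝ S) (hSu : UniqueDiffOn ℝ S) (ha : a ∈ S) (hf : ContDiffWithinAt ℝ 1 f S a)
    (hinj : Function.Injective (fderivWithin ℝ f S a)) :
    ∃ r > 0, InjOn f (Metric.ball a r ∩ S) := by
  obtain ⟨K, hK, hanti⟩ := (fderivWithin ℝ f S a).toLinearMap.injective_iff_antilipschitz.1 hinj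
  have hcont : ContinuousWithinAt (fderivWithin ℝ f S) S a :=
    (hf.fderivWithin_right hSu (m := 0) (by simp) ha).continuousWithinAt
  have hK2 : (0 : ℝ) < (2 * (K : ℝ))⁻¹ := by positivity
  have h1 := hcont (Metric.ball_mem_nhds _ hK2)
  have h2 : ∀ᶠ y in 𝓝[S] a, ContDiffWithinAt ℝ 1 f S y := by
    have := hf.eventually (by simp)
    rwa [insert_eq_of_mem ha] at this
  obtain ⟨r, hr, hball⟩ := Metric.mem_nhdsWithin_iff.1 (inter_mem h1 h2)
  refine ⟨r, hr, fun x hx y hy hxy => ?_⟩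
  have hconv : Convex ℝ (Metric.ball a r ∩ S) := (convex_ball a r).inter hS
  -- On this ball `f` minus its linearization at `a` is Lipschitz with constant `1 / (2K)`, too
  -- small to cancel the linear part, which expands distances by at least `1 / K`.
  have hle := hconv.norm_image_sub_le_of_norm_hasFDerivWithin_le' (f := f)
    (f' := fderivWithin ℝ f S) (φ := fderivWithin ℝ f S a) (C := (2 * (K : ℝ))⁻¹)
    (fun z hz => (((show ContDiffWithinAt ℝ 1 f S z from (hball hz).2).differentiableWithinAt
      (by simp)).hasFDerivWithinAt).mono inter_subset_right)
    (fun z hz => by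
      have := (hball hz).1
      rw [mem_preimage, Metric.mem_ball, dist_eq_norm] at this
      exact this.le) hx hy
  rw [hxy, sub_self, zero_sub, norm_neg] at hle
  have h3 := hanti.le_mul_dist y x
  have h4 : dist (fderivWithin ℝ f S a y) (fderivWithin ℝ f S a x)
      = ‖fderivWithin ℝ f S a (y - x)‖ := by rw [dist_eq_norm, map_sub]
  have hK' : (0 : ℝ) < K := hK
  have h5 : ‖y - x‖ ≤ K * ‖fderivWithin ℝ f S a (y - x)‖ := by
    rw [← h4, ← dist_eq_norm]; exact h3
  have h6 : K * ‖fderivWithin ℝ f S a (y - x)‖ ≤ K * ((2 * (K : ℝ))⁻¹ * ‖y - x‖) := by gcongr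
  have h7 : (K : ℝ) * ((2 * (K : ℝ))⁻¹ * ‖y - x‖) = ‖y - x‖ / 2 := by field_simp
  have : ‖y - x‖ = 0 := by linarith [norm_nonneg (y - x)]
  exact (sub_eq_zero.1 (norm_eq_zero.1 this)).symm

section

variable {n : ℕ} [NeZero n] {N : Type*} [TopologicalSpace N]
  [ChartedSpace (EuclideanHalfSpace n) N] [IsManifold (𝓡∂ n) ∞ N]

theorem convex_range_halfSpace : Convex ℝ (range (𝓡∂ n)) := by
  rw [range_modelWithCornersEuclideanHalfSpace]
  exact convex_halfSpace_ge (f := fun y : EuclideanSpace ℝ (Fin n) => y 0)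
    ⟨fun _ _ => rfl, fun _ _ => rfl⟩ 0

/-- The differential of a map `N → ℝⁿ`, read in the model space. -/
def dmap (L : N → Space n) (y : N) : Space n →L[ℝ] Space n :=
  mfderiv (𝓡∂ n) 𝓘(ℝ, Space n) L y

theorem contDiffWithinAt_comp_extChartAt_symm {L : N → Space n} {k : WithTop ℕ∞} {c p : N}
    (hk : k ≤ ∞)
    (hL : ContMDiffAt (𝓡∂ n) 𝓘(ℝ, Space n) k L p)
    (hp : p ∈ (chartAt (EuclideanHalfSpace n) c).source) :
    ContDiffWithinAt ℝ k (fun u => L ((extChartAt (𝓡∂ n) c).symm u)) (range (𝓡∂ n))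
      (extChartAt (𝓡∂ n) c p) := by
  have hp' : p ∈ (extChartAt (𝓡∂ n) c).source := by rwa [extChartAt_source]
  have hu := (extChartAt (𝓡∂ n) c).map_source hp'
  have h1 : ContMDiffWithinAt 𝓘(ℝ, Space n) (𝓡∂ n) k (extChartAt (𝓡∂ n) c).symm (range (𝓡∂ n))
      (extChartAt (𝓡∂ n) c p) :=
    (((contMDiffOn_extChartAt_symm (I := 𝓡∂ n) (n := ∞) c _ hu).of_le hk).mono_of_mem_nhdsWithin
      (extChartAt_target_mem_nhdsWithin_of_mem hu))
  rw [← contMDiffWithinAt_iff_contDiffWithinAt]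
  refine ContMDiffAt.comp_contMDiffWithinAt _ ?_ h1
  rwa [(extChartAt (𝓡∂ n) c).left_inv hp']

theorem hasFDerivWithinAt_comp_extChartAt_symm {L : N → Space n} {c p : N}
    (hL : MDifferentiableAt (𝓡∂ n) 𝓘(ℝ, Space n) L p)
    (hp : p ∈ (chartAt (EuclideanHalfSpace n) c).source) :
    HasFDerivWithinAt (fun u => L ((extChartAt (𝓡∂ n) c).symm u))
      (dmap L p ∘L frameAt (𝓡∂ n) c (extChartAt (𝓡∂ n) c p)) (range (𝓡∂ n))
      (extChartAt (𝓡∂ n) c p) := by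
  have hp' : p ∈ (extChartAt (𝓡∂ n) c).source := by rwa [extChartAt_source]
  have hu := (extChartAt (𝓡∂ n) c).map_source hp'
  have h1 : MDifferentiableWithinAt 𝓘(ℝ, Space n) (𝓡∂ n) (extChartAt (𝓡∂ n) c).symm (range (𝓡∂ n))
      (extChartAt (𝓡∂ n) c p) := mdifferentiableWithinAt_extChartAt_symm hu
  have hq : (extChartAt (𝓡∂ n) c).symm (extChartAt (𝓡∂ n) c p) = p :=
    (extChartAt (𝓡∂ n) c).left_inv hp'
  have key : ∀ q, q = p → MDifferentiableAt (𝓡∂ n) 𝓘(ℝ, Space n) L q ∧ dmap L q = dmap L p := by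
    rintro q rfl; exact ⟨hL, rfl⟩
  have h2 := ((key _ hq).1.hasMFDerivAt.comp_hasMFDerivWithinAt _
    h1.hasMFDerivWithinAt).hasFDerivWithinAt
  rw [← (key _ hq).2]
  exact h2

theorem frameAt_injective {c p : N} (hp : p ∈ (chartAt (EuclideanHalfSpace n) c).source) :
    Function.Injective (frameAt (𝓡∂ n) c (extChartAt (𝓡∂ n) c p)) :=
  Function.LeftInverse.injective (coframeAt_frameAt hp)

theorem exists_nhds_injOn {L : N → Space n} {p : N}
    (hL : ContMDiffAt (𝓡∂ n) 𝓘(ℝ, Space n) 1 L p) (hinj : Function.Injective (dmap L p)) :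
    ∃ U ∈ 𝓝 p, InjOn L U := by
  have hd := hasFDerivWithinAt_comp_extChartAt_symm (c := p) (hL.mdifferentiableAt (by simp))
    (mem_chart_source _ p)
  have hmem : extChartAt (𝓡∂ n) p p ∈ range (𝓡∂ n) := extChartAt_mem_range p p
  obtain ⟨r, hr, hr'⟩ := exists_injOn_of_contDiffWithinAt convex_range_halfSpace
    (𝓡∂ n).uniqueDiffOn hmem
    (contDiffWithinAt_comp_extChartAt_symm (by simp) hL (mem_chart_source _ p))
    (by
      rw [hd.fderivWithin ((𝓡∂ n).uniqueDiffOn _ hmem)]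
      exact hinj.comp (frameAt_injective (mem_chart_source _ p)))
  refine ⟨(extChartAt (𝓡∂ n) p).source ∩ extChartAt (𝓡∂ n) p ⁻¹' Metric.ball (extChartAt (𝓡∂ n) p p) r,
    inter_mem (extChartAt_source_mem_nhds p)
      ((continuousAt_extChartAt p) (Metric.ball_mem_nhds _ hr)), ?_⟩
  intro x hx y hy hxy
  refine (extChartAt (𝓡∂ n) p).injOn hx.1 hy.1 (hr' ⟨hx.2, extChartAt_mem_range p x⟩
    ⟨hy.2, extChartAt_mem_range p y⟩ ?_)
  simp only [(extChartAt (𝓡∂ n) p).left_inv hx.1, (extChartAt (𝓡∂ n) p).left_inv hy.1, hxy]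

namespace MagneticSystem

variable (m : MagneticSystem n N)

/-- `L` is the inverse of the magnetic exponential map at `x`. -/
structure IsLogMap (x : N) (L : N → Space n) : Prop where
  exp_iff : ∀ (v : Space n) (y : N), m.MagneticExp x v y ↔ v = L y
  contMDiff : ContMDiff (𝓡∂ n) 𝓘(ℝ, Space n) 1 L
  smooth : ContMDiffOn (𝓡∂ n) 𝓘(ℝ, Space n) ∞ L {x}ᶜ
  bijective : ∀ y : N, Function.Bijective (dmap L y)

/-- The norm on the tangent space at `x`. -/
def nrm (x : N) (v : Space n) : ℝ := √(m.ip x v v)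

variable {m}

theorem IsSimple.exists_isLogMap (hm : m.IsSimple) (x : N) : ∃ L, m.IsLogMap x L := by
  obtain ⟨L, h1, h2, h3, h4⟩ := hm.2 x
  exact ⟨L, h1, h2, h3, h4⟩

theorem nrm_smul (x : N) {a : ℝ} (ha : 0 ≤ a) (v : Space n) : m.nrm x (a • v) = a * m.nrm x v := by
  rw [nrm, nrm, map_smul, map_smul, smul_apply, smul_eq_mul, smul_eq_mul,
    ← mul_assoc, Real.sqrt_mul (mul_self_nonneg a), Real.sqrt_mul_self ha]

theorem IsMagneticGeodesic.nrm_vel {ℓ : ℝ} {γ : ℝ → N} (hγ : m.IsMagneticGeodesic ℓ γ) {s : ℝ}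
    (hs : s ∈ Icc (0 : ℝ) ℓ) : m.nrm (γ s) (vel γ ℓ s) = 1 := by
  rw [nrm, hγ.ip_vel hs, Real.sqrt_one]

theorem IsMagneticGeodesic.zero_mem {ℓ : ℝ} {γ : ℝ → N} (hγ : m.IsMagneticGeodesic ℓ γ) :
    (0 : ℝ) ∈ Icc (0 : ℝ) ℓ := ⟨le_rfl, hγ.pos.le⟩

theorem IsMagneticGeodesic.right_mem {ℓ : ℝ} {γ : ℝ → N} (hγ : m.IsMagneticGeodesic ℓ γ) :
    ℓ ∈ Icc (0 : ℝ) ℓ := ⟨hγ.pos.le, le_rfl⟩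

theorem magneticExp_iff {x y : N} {v : Space n} : m.MagneticExp x v y ↔ (v = 0 ∧ y = x) ∨
    ∃ (ℓ : ℝ) (γ : ℝ → N), m.IsMagneticGeodesic ℓ γ ∧ γ 0 = x ∧ γ ℓ = y ∧ v = ℓ • vel γ ℓ 0 := by
  refine or_congr Iff.rfl (exists_congr fun ℓ => exists_congr fun γ => and_congr_right fun _ => ?_)
  constructor
  · rintro ⟨h, rfl⟩
    refine ⟨(congrArg (fun p : TangentBundle (𝓡∂ n) N => p.1) h).symm, rfl, ?_⟩
    exact congrArg (fun p : TangentBundle (𝓡∂ n) N => (p.2 : Space n)) h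
  · rintro ⟨rfl, rfl, rfl⟩
    exact ⟨rfl, rfl⟩

namespace IsLogMap

variable {x : N} {L : N → Space n}

theorem apply_self (h : m.IsLogMap x L) : L x = 0 :=
  ((h.exp_iff 0 x).1 (magneticExp_iff.2 (Or.inl ⟨rfl, rfl⟩))).symm

/-- Initial segments of a geodesic are geodesics with the same initial velocity, so the logarithm
straightens the geodesics from `x` into rays. -/
theorem apply_geodesic (h : m.IsLogMap x L) {ℓ : ℝ} {γ : ℝ → N} (hγ : m.IsMagneticGeodesic ℓ γ)
    (h0 : γ 0 = x) {s : ℝ} (hs : s ∈ Icc (0 : ℝ) ℓ) : L (γ s) = s • vel γ ℓ 0 := by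
  rcases hs.1.eq_or_lt with rfl | hpos
  · rw [h0, h.apply_self, zero_smul]
  · refine ((h.exp_iff _ _).1 (magneticExp_iff.2 (Or.inr ⟨s - 0, _, hγ.segment le_rfl hpos hs.2, ?_,
      ?_, ?_⟩))).symm
    · simpa using h0
    · simp
    · rw [IsMagneticGeodesic.vel_segment hγ le_rfl hpos hs.2 (by simpa using hpos.le)]
      simp

theorem exists_geodesic (h : m.IsLogMap x L) {y : N} (hy : y ≠ x) :
    ∃ (ℓ : ℝ) (γ : ℝ → N), m.IsMagneticGeodesic ℓ γ ∧ γ 0 = x ∧ γ ℓ = y := by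
  rcases magneticExp_iff.1 ((h.exp_iff (L y) y).2 rfl) with h1 | ⟨ℓ, γ, h1, h2, h3, -⟩
  · exact absurd h1.2 hy
  · exact ⟨ℓ, γ, h1, h2, h3⟩

theorem nrm_geodesic (h : m.IsLogMap x L) {ℓ : ℝ} {γ : ℝ → N} (hγ : m.IsMagneticGeodesic ℓ γ)
    (h0 : γ 0 = x) {s : ℝ} (hs : s ∈ Icc (0 : ℝ) ℓ) : m.nrm x (L (γ s)) = s := by
  rw [h.apply_geodesic hγ h0 hs, nrm_smul _ hs.1, ← h0, hγ.nrm_vel hγ.zero_mem, mul_one]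

theorem apply_eq_zero (h : m.IsLogMap x L) {y : N} : L y = 0 ↔ y = x := by
  refine ⟨fun hy => ?_, fun hy => hy ▸ h.apply_self⟩
  by_contra hne
  obtain ⟨ℓ, γ, hγ, h0, h1⟩ := h.exists_geodesic hne
  have := h.nrm_geodesic hγ h0 hγ.right_mem
  rw [h1, hy, nrm] at this
  simp at this
  exact hγ.pos.ne this

theorem continuous (h : m.IsLogMap x L) : Continuous L := h.contMDiff.continuous

variable [T2Space N]

/-- Both curves have the same image under `L`. At this stage `L` is only known to be locally
injective, so the closed set of times where the curves agree is propagated to the right along the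
interval; no uniqueness theorem for differential equations enters. -/
theorem eqOn_geodesic (h : m.IsLogMap x L) {ℓ : ℝ} {γ γ' : ℝ → N} (hγ : m.IsMagneticGeodesic ℓ γ)
    (hγ' : m.IsMagneticGeodesic ℓ γ') (h0 : γ 0 = x) (h0' : γ' 0 = x)
    (hv : vel (n := n) γ ℓ 0 = vel γ' ℓ 0) : EqOn γ γ' (Icc 0 ℓ) := by
  have hc := hγ.smooth.continuousOn
  have hc' := hγ'.smooth.continuousOn
  have hclosed : IsClosed ({s | γ s = γ' s} ∩ Icc (0 : ℝ) ℓ) := by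
    have := (hc.prodMk hc').preimage_isClosed_of_isClosed isClosed_Icc (t := diagonal N)
      isClosed_diagonal
    rw [inter_comm]
    exact this
  refine hclosed.Icc_subset_of_forall_mem_nhdsWithin (by simp [h0, h0']) fun s hs => ?_
  obtain ⟨U, hU, hUinj⟩ := exists_nhds_injOn (L := L) (h.contMDiff (γ s)) (h.bijective _).1
  have hsI : s ∈ Icc (0 : ℝ) ℓ := ⟨hs.2.1, hs.2.2.le⟩
  have hs1 : γ s = γ' s := hs.1
  have hle : 𝓝[>] s ≤ 𝓝[Icc 0 ℓ] s :=
    nhdsWithin_le_of_mem (mem_of_superset (Ioo_mem_nhdsGT hs.2.2)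
      fun r hr => ⟨hs.2.1.trans hr.1.le, hr.2.le⟩)
  have e1 := (hc s hsI).mono_left hle hU
  have e2 := (hc' s hsI).mono_left hle (hs1 ▸ hU)
  have e3 := hle self_mem_nhdsWithin
  filter_upwards [e1, e2, e3] with r h1 h2 h3
  exact hUinj h1 h2 (by rw [h.apply_geodesic hγ h0 h3, h.apply_geodesic hγ' h0' h3, hv])

/-- This says that `exp_x` is single valued, which `exp_iff` alone does not. Equal logarithms force
equal lengths and equal initial velocities, and then the geodesics coincide. -/
theorem injective (h : m.IsLogMap x L) : Function.Injective L := by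
  intro y y' hyy
  by_cases hy : y = x
  · rw [hy, h.apply_self] at hyy
    rw [hy, h.apply_eq_zero.1 hyy.symm]
  by_cases hy' : y' = x
  · rw [hy', h.apply_self] at hyy
    exact absurd (h.apply_eq_zero.1 hyy) hy
  obtain ⟨ℓ, γ, hγ, h0, h1⟩ := h.exists_geodesic hy
  obtain ⟨ℓ', γ', hγ', h0', h1'⟩ := h.exists_geodesic hy'
  have e1 := h.nrm_geodesic hγ h0 hγ.right_mem
  have e2 := h.nrm_geodesic hγ' h0' hγ'.right_mem
  have e3 := h.apply_geodesic hγ h0 hγ.right_mem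
  have e4 := h.apply_geodesic hγ' h0' hγ'.right_mem
  rw [h1] at e1 e3
  rw [h1'] at e2 e4
  obtain rfl : ℓ = ℓ' := by rw [← e1, ← e2, hyy]
  have hv : vel γ ℓ 0 = vel γ' ℓ 0 := smul_right_injective _ hγ.pos.ne' (by
    exact e3.symm.trans (hyy.trans e4))
  rw [← h1, ← h1', h.eqOn_geodesic hγ hγ' h0 h0' hv hγ.right_mem]

end IsLogMap

section Uniqueness

theorem IsSimple.length_eq (hm : m.IsSimple) {ℓ ℓ' : ℝ} {γ γ' : ℝ → N}
    (hγ : m.IsMagneticGeodesic ℓ γ) (hγ' : m.IsMagneticGeodesic ℓ' γ') (h0 : γ 0 = γ' 0)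
    (h1 : γ ℓ = γ' ℓ') : ℓ = ℓ' := by
  obtain ⟨L, h⟩ := hm.exists_isLogMap (γ 0)
  rw [← h.nrm_geodesic hγ rfl hγ.right_mem, ← h.nrm_geodesic hγ' h0.symm hγ'.right_mem, h1]

theorem IsSimple.eqOn [T2Space N] (hm : m.IsSimple) {ℓ : ℝ} {γ γ' : ℝ → N}
    (hγ : m.IsMagneticGeodesic ℓ γ) (hγ' : m.IsMagneticGeodesic ℓ γ') (h0 : γ 0 = γ' 0)
    (h1 : γ ℓ = γ' ℓ) : EqOn γ γ' (Icc 0 ℓ) := by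
  obtain ⟨L, h⟩ := hm.exists_isLogMap (γ 0)
  refine h.eqOn_geodesic hγ hγ' rfl h0.symm (smul_right_injective _ hγ.pos.ne' ?_)
  exact (h.apply_geodesic hγ rfl hγ.right_mem).symm.trans
    ((congrArg L h1).trans (h.apply_geodesic hγ' h0.symm hγ'.right_mem))

/-- A loop would be a geodesic of positive length from a point to itself, whereas the logarithm of
the base point is zero. -/
theorem IsSimple.ne (hm : m.IsSimple) {ℓ : ℝ} {γ : ℝ → N} (hγ : m.IsMagneticGeodesic ℓ γ)
    {s t : ℝ} (hs : 0 ≤ s) (hst : s < t) (ht : t ≤ ℓ) : γ s ≠ γ t := by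
  intro h
  obtain ⟨L, hL⟩ := hm.exists_isLogMap (γ s)
  have h1 := hγ.segment hs hst ht
  have := hL.nrm_geodesic h1 (by simp) h1.right_mem
  simp only [Function.comp_apply, add_sub_cancel, ← h, hL.apply_self, nrm] at this
  simp at this
  linarith


end Uniqueness

end MagneticSystem
end

/-! ### The action of curves and of pairs of points. -/

section

variable {n : ℕ} [NeZero n] {N : Type*} [TopologicalSpace N]
  [ChartedSpace (EuclideanHalfSpace n) N] [IsManifold (𝓡∂ n) ∞ N]
  {F : Type*} [NormedAddCommGroup F] [NormedSpace ℝ F]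

theorem contDiffWithinAt_extChartAt_comp {Γ : F → N} {R : Set F} {q : F} {c : N} {k : WithTop ℕ∞}
    (hk : k ≤ ∞) (hΓ : ContMDiffWithinAt 𝓘(ℝ, F) (𝓡∂ n) k Γ R q)
    (hc : Γ q ∈ (chartAt (EuclideanHalfSpace n) c).source) :
    ContDiffWithinAt ℝ k (fun r => extChartAt (𝓡∂ n) c (Γ r)) R q :=
  contMDiffWithinAt_iff_contDiffWithinAt.1
    (((contMDiffAt_extChartAt' (n := ∞) hc).of_le hk).comp_contMDiffWithinAt q hΓ)

omit [IsManifold (𝓡∂ n) ∞ N] in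
theorem eventually_mem_source {F : Type*} [TopologicalSpace F] {Γ : F → N} {R : Set F} {q : F} {c : N}
    (hΓ : ContinuousWithinAt Γ R q) (hc : Γ q ∈ (chartAt (EuclideanHalfSpace n) c).source) :
    ∀ᶠ r in 𝓝[R] q, Γ r ∈ (chartAt (EuclideanHalfSpace n) c).source :=
  hΓ ((chartAt (EuclideanHalfSpace n) c).open_source.mem_nhds hc)

omit [IsManifold (𝓡∂ n) ∞ N] in
theorem continuousWithinAt_comp_extChartAt {F V : Type*} [TopologicalSpace F] [TopologicalSpace V]
    {Γ : F → N} {R : Set F} {q : F} {c : N} {f : Space n → V}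
    (hf : ContinuousOn f (extChartAt (𝓡∂ n) c).target)
    (hΓ : ContinuousWithinAt Γ R q) (hc : Γ q ∈ (chartAt (EuclideanHalfSpace n) c).source) :
    ContinuousWithinAt (fun r => f (extChartAt (𝓡∂ n) c (Γ r))) R q := by
  have hu : extChartAt (𝓡∂ n) c (Γ q) ∈ (extChartAt (𝓡∂ n) c).target :=
    (extChartAt (𝓡∂ n) c).map_source (by rwa [extChartAt_source])
  refine ContinuousWithinAt.comp_of_mem_nhdsWithin_image (hf _ hu)
    (((continuousAt_extChartAt' (by rwa [extChartAt_source])).comp_continuousWithinAt hΓ)) ?_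
  have hsub : (fun r => extChartAt (𝓡∂ n) c (Γ r)) '' R ⊆ range (𝓡∂ n) :=
    image_subset_iff.2 fun r _ => extChartAt_mem_range c (Γ r)
  exact nhdsWithin_mono _ hsub (extChartAt_target_mem_nhdsWithin_of_mem hu)

namespace MagneticSystem

variable (m : MagneticSystem n N)

theorem continuousOn_ip_derivAt {Γ : F → N} {R : Set F}
    (hΓ : ContMDiffOn 𝓘(ℝ, F) (𝓡∂ n) 1 Γ R) (hR : UniqueDiffOn ℝ R) (v w : F) :
    ContinuousOn (fun q => m.ip (Γ q) (derivAt (𝓡∂ n) Γ R q v) (derivAt (𝓡∂ n) Γ R q w)) R := by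
  intro q hq
  have hc := mem_chart_source (EuclideanHalfSpace n) (Γ q)
  have h1 : ContinuousWithinAt (fun r => chartMetric (𝓡∂ n) m.h.inner (Γ q)
      (extChartAt (𝓡∂ n) (Γ q) (Γ r))) R q :=
    continuousWithinAt_comp_extChartAt (m.contDiffOn_gram (Γ q)).continuousOn
      (hΓ q hq).continuousWithinAt hc
  have h2 := ((contDiffWithinAt_extChartAt_comp (by simp) (hΓ q hq) hc).fderivWithin_right hR
    (m := 0) (by simp) hq).continuousWithinAt
  have hv := h2.clm_apply (continuousWithinAt_const (b := v))
  have hw := h2.clm_apply (continuousWithinAt_const (b := w))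
  refine ((h1.clm_apply hv).clm_apply hw).congr_of_eventuallyEq ?_ ?_
  · filter_upwards [eventually_mem_source (hΓ q hq).continuousWithinAt hc, self_mem_nhdsWithin]
      with r hr hr'
    exact (chartMetric_fderivWithin _ ((hΓ r hr').mdifferentiableWithinAt (by simp)) (hR r hr')
      hr v w).symm
  · exact (chartMetric_fderivWithin _ ((hΓ q hq).mdifferentiableWithinAt (by simp)) (hR q hq)
      hc v w).symm

theorem continuousOn_pot_derivAt {Γ : F → N} {R : Set F}
    (hΓ : ContMDiffOn 𝓘(ℝ, F) (𝓡∂ n) 1 Γ R) (hR : UniqueDiffOn ℝ R) (v : F) :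
    ContinuousOn (fun q => m.pot (Γ q) (derivAt (𝓡∂ n) Γ R q v)) R := by
  intro q hq
  have hc := mem_chart_source (EuclideanHalfSpace n) (Γ q)
  have h1 : ContinuousWithinAt (fun r => chartForm (𝓡∂ n) m.om (Γ q)
      (extChartAt (𝓡∂ n) (Γ q) (Γ r))) R q :=
    continuousWithinAt_comp_extChartAt (m.contDiffOn_cpot (Γ q)).continuousOn
      (hΓ q hq).continuousWithinAt hc
  have h2 := ((contDiffWithinAt_extChartAt_comp (by simp) (hΓ q hq) hc).fderivWithin_right hR
    (m := 0) (by simp) hq).continuousWithinAt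
  have hv := h2.clm_apply (continuousWithinAt_const (b := v))
  refine (h1.clm_apply hv).congr_of_eventuallyEq ?_ ?_
  · filter_upwards [eventually_mem_source (hΓ q hq).continuousWithinAt hc, self_mem_nhdsWithin]
      with r hr hr'
    exact (chartForm_fderivWithin _ ((hΓ r hr').mdifferentiableWithinAt (by simp)) (hR r hr')
      hr v).symm
  · exact (chartForm_fderivWithin _ ((hΓ q hq).mdifferentiableWithinAt (by simp)) (hR q hq)
      hc v).symm

/-- The action `∫ (|ċ| - ω(ċ))` of a curve `c : [0, T] → N`. -/
def curveAction (T : ℝ) (c : ℝ → N) : ℝ :=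
  ∫ s in (0 : ℝ)..T, (m.nrm (c s) (vel c T s) - m.pot (c s) (vel c T s))

theorem continuousOn_nrm_vel {T : ℝ} {c : ℝ → N} (hT : 0 < T)
    (hc : ContMDiffOn 𝓘(ℝ, ℝ) (𝓡∂ n) ∞ c (Icc 0 T)) :
    ContinuousOn (fun s => m.nrm (c s) (vel c T s)) (Icc 0 T) :=
  (m.continuousOn_ip_derivAt (hc.of_le (by simp)) (uniqueDiffOn_Icc hT) (1 : ℝ) (1 : ℝ)).sqrt

theorem continuousOn_pot_vel {T : ℝ} {c : ℝ → N} (hT : 0 < T)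
    (hc : ContMDiffOn 𝓘(ℝ, ℝ) (𝓡∂ n) ∞ c (Icc 0 T)) :
    ContinuousOn (fun s => m.pot (c s) (vel c T s)) (Icc 0 T) :=
  m.continuousOn_pot_derivAt (hc.of_le (by simp)) (uniqueDiffOn_Icc hT) (1 : ℝ)

variable {m}

namespace IsMagneticGeodesic

variable {ℓ : ℝ} {γ : ℝ → N}

theorem curveAction_eq (hγ : m.IsMagneticGeodesic ℓ γ) :
    m.curveAction ℓ γ = ∫ s in (0 : ℝ)..ℓ, (1 - m.pot (γ s) (vel γ ℓ s)) := by
  refine intervalIntegral.integral_congr fun s hs => ?_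
  rw [uIcc_of_le hγ.pos.le] at hs
  simp only [hγ.nrm_vel hs]

theorem curveAction_eq_sub (hγ : m.IsMagneticGeodesic ℓ γ) :
    m.curveAction ℓ γ = ℓ - ∫ s in (0 : ℝ)..ℓ, m.pot (γ s) (vel γ ℓ s) := by
  rw [hγ.curveAction_eq, intervalIntegral.integral_sub]
  · simp
  · simp
  · apply ContinuousOn.intervalIntegrable
    rw [uIcc_of_le hγ.pos.le]
    exact m.continuousOn_pot_vel hγ.pos hγ.smooth

theorem curveAction_segment (hγ : m.IsMagneticGeodesic ℓ γ) {a b : ℝ} (ha : 0 ≤ a) (hab : a < b)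
    (hb : b ≤ ℓ) : m.curveAction (b - a) (γ ∘ fun s => a + s)
      = ∫ s in a..b, (1 - m.pot (γ s) (vel γ ℓ s)) := by
  rw [(hγ.segment ha hab hb).curveAction_eq]
  have h := intervalIntegral.integral_comp_add_left (a := 0) (b := b - a)
    (fun s => 1 - m.pot (γ s) (vel γ ℓ s)) a
  simp only [add_zero, add_sub_cancel] at h
  rw [← h]
  refine intervalIntegral.integral_congr fun s hs => ?_
  rw [uIcc_of_le (sub_pos.2 hab).le] at hs
  simp only [hγ.vel_segment ha hab hb hs, Function.comp_apply]

theorem intervalIntegrable (hγ : m.IsMagneticGeodesic ℓ γ) {a b : ℝ} (ha : a ∈ Icc 0 ℓ)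
    (hb : b ∈ Icc 0 ℓ) :
    IntervalIntegrable (fun s => 1 - m.pot (γ s) (vel γ ℓ s)) MeasureTheory.volume a b :=
  ((continuousOn_const.sub (m.continuousOn_pot_vel hγ.pos hγ.smooth)).mono
    (uIcc_subset_Icc ha hb)).intervalIntegrable

end IsMagneticGeodesic

theorem isAction_iff {x y : N} {a : ℝ} : m.IsAction x y a ↔ (x = y ∧ a = 0) ∨
    ∃ (ℓ : ℝ) (γ : ℝ → N), m.IsMagneticGeodesic ℓ γ ∧ γ 0 = x ∧ γ ℓ = y ∧ a = m.curveAction ℓ γ := by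
  refine or_congr Iff.rfl (exists_congr fun ℓ => exists_congr fun γ => and_congr_right fun hγ =>
    and_congr_right fun _ => and_congr_right fun _ => ?_)
  rw [hγ.curveAction_eq_sub]
  exact Iff.rfl

namespace IsSimple

theorem exists_geodesic (hm : m.IsSimple) {x y : N} (h : x ≠ y) :
    ∃ (ℓ : ℝ) (γ : ℝ → N), m.IsMagneticGeodesic ℓ γ ∧ γ 0 = x ∧ γ ℓ = y :=
  (hm.exists_isLogMap x).elim fun _ hL => hL.exists_geodesic h.symm

theorem isAction_action (hm : m.IsSimple) (x y : N) : m.IsAction x y (m.action x y) := by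
  refine Classical.epsilon_spec (p := m.IsAction x y) ?_
  by_cases h : x = y
  · exact ⟨0, Or.inl ⟨h, rfl⟩⟩
  · obtain ⟨ℓ, γ, h1, h2, h3⟩ := hm.exists_geodesic h
    exact ⟨_, isAction_iff.2 (Or.inr ⟨ℓ, γ, h1, h2, h3, rfl⟩)⟩

theorem action_self (hm : m.IsSimple) (x : N) : m.action x x = 0 := by
  rcases isAction_iff.1 (hm.isAction_action x x) with h | ⟨ℓ, γ, hγ, h0, h1, -⟩
  · exact h.2
  · exact absurd (h0.trans h1.symm) (hm.ne hγ le_rfl hγ.pos le_rfl)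

variable [T2Space N]

theorem vel_eq (hm : m.IsSimple) {ℓ : ℝ} {γ γ' : ℝ → N} (hγ : m.IsMagneticGeodesic ℓ γ)
    (hγ' : m.IsMagneticGeodesic ℓ γ') (h0 : γ 0 = γ' 0) (h1 : γ ℓ = γ' ℓ) {s : ℝ}
    (hs : s ∈ Icc 0 ℓ) : vel (n := n) γ ℓ s = vel γ' ℓ s :=
  velocityAt_congr (hm.eqOn hγ hγ' h0 h1) hs

theorem action_eq (hm : m.IsSimple) {ℓ : ℝ} {γ : ℝ → N} (hγ : m.IsMagneticGeodesic ℓ γ) :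
    m.action (γ 0) (γ ℓ) = m.curveAction ℓ γ := by
  rcases isAction_iff.1 (hm.isAction_action (γ 0) (γ ℓ)) with h | ⟨ℓ', γ', hγ', h0, h1, h⟩
  · exact absurd h.1 (hm.ne hγ le_rfl hγ.pos le_rfl)
  · obtain rfl := hm.length_eq hγ hγ' h0.symm h1.symm
    rw [h, hγ.curveAction_eq, hγ'.curveAction_eq]
    refine intervalIntegral.integral_congr fun s hs => ?_
    rw [uIcc_of_le hγ.pos.le] at hs
    simp only [hm.vel_eq hγ hγ' h0.symm h1.symm hs, hm.eqOn hγ hγ' h0.symm h1.symm hs]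

theorem action_eq_integral (hm : m.IsSimple) {ℓ : ℝ} {γ : ℝ → N} (hγ : m.IsMagneticGeodesic ℓ γ)
    {a b : ℝ} (ha : 0 ≤ a) (hab : a ≤ b) (hb : b ≤ ℓ) :
    m.action (γ a) (γ b) = ∫ s in a..b, (1 - m.pot (γ s) (vel γ ℓ s)) := by
  rcases hab.eq_or_lt with rfl | hab
  · rw [hm.action_self, intervalIntegral.integral_same]
  · have := hm.action_eq (hγ.segment ha hab hb)
    rw [hγ.curveAction_segment ha hab hb] at this
    simpa using this

theorem action_add (hm : m.IsSimple) {ℓ : ℝ} {γ : ℝ → N} (hγ : m.IsMagneticGeodesic ℓ γ)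
    {a b c : ℝ} (ha : 0 ≤ a) (hab : a ≤ b) (hbc : b ≤ c) (hc : c ≤ ℓ) :
    m.action (γ a) (γ b) + m.action (γ b) (γ c) = m.action (γ a) (γ c) := by
  rw [hm.action_eq_integral hγ ha hab (hbc.trans hc), hm.action_eq_integral hγ (ha.trans hab) hbc hc,
    hm.action_eq_integral hγ ha (hab.trans hbc) hc]
  exact intervalIntegral.integral_add_adjacent_intervals
    (hγ.intervalIntegrable ⟨ha, hab.trans (hbc.trans hc)⟩ ⟨ha.trans hab, hbc.trans hc⟩)
    (hγ.intervalIntegrable ⟨ha.trans hab, hbc.trans hc⟩ ⟨ha.trans (hab.trans hbc), hc⟩)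

end IsSimple

end MagneticSystem
end

/-! ### Analytic tools for the first variation. -/

/-- If `f ∘ g` is `C^k` and `f` is `C^k` with invertible differential, then a continuous `g` is
`C^k`. -/
theorem contDiffOn_of_comp_left {E G : Type*} [NormedAddCommGroup E] [NormedSpace ℝ E]
    [CompleteSpace E] [NormedAddCommGroup G] [NormedSpace ℝ G] {f : E → E} {S : Set E} {g : G → E}
    {R : Set G} (hS : UniqueDiffOn ℝ S) (hbij : ∀ a ∈ S, Function.Bijective (fderivWithin ℝ f S a))
    (hR : UniqueDiffOn ℝ R) (hg : ContinuousOn g R) (hmaps : MapsTo g R S) (k : ℕ)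
    (hf : ContDiffOn ℝ k f S) (hfg : ContDiffOn ℝ k (f ∘ g) R) : ContDiffOn ℝ k g R := by
  induction k with
  | zero => simpa using hg
  | succ k ih =>
    have hk : (1 : WithTop ℕ∞) ≤ ((k + 1 : ℕ) : WithTop ℕ∞) := by norm_cast; omega
    have hk' : ((k : ℕ) : WithTop ℕ∞) ≤ ((k + 1 : ℕ) : WithTop ℕ∞) := by norm_cast; omega
    have hgk := ih (hf.of_le hk') (hfg.of_le hk')
    have hinv : ∀ a ∈ S, ∃ e : E ≃L[ℝ] E, (e : E →L[ℝ] E) = fderivWithin ℝ f S a := fun a ha =>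
      ⟨ContinuousLinearEquiv.ofBijective (fderivWithin ℝ f S a)
        (LinearMap.ker_eq_bot.2 (hbij a ha).1) (LinearMap.range_eq_top.2 (hbij a ha).2),
        ContinuousLinearEquiv.coe_ofBijective _ _ _⟩
    -- The chain rule solved for `Dg`. Its right side is as regular as `g` is by the induction
    -- hypothesis, so `g` gains one derivative.
    have hd : ∀ q ∈ R, HasFDerivWithinAt g
        ((fderivWithin ℝ f S (g q)).inverse ∘L fderivWithin ℝ (f ∘ g) R q) R q := fun q hq => by
      obtain ⟨e, he⟩ := hinv _ (hmaps hq)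
      have h1 := ((hf.differentiableOn (by positivity)) _ (hmaps hq)).hasFDerivWithinAt
      have h2 := ((hfg.differentiableOn (by positivity)) q hq).hasFDerivWithinAt
      refine HasFDerivWithinAt.of_comp_of_leftInverse (f := f) (t := S) (h := f ∘ g)
        (tendsto_nhdsWithin_of_tendsto_nhds_of_eventually_within _ (hg q hq)
          (eventually_nhdsWithin_of_forall hmaps)) h1 h2 EventuallyEq.rfl ?_ hq
      rw [← he, ContinuousLinearMap.inverse_equiv]
      exact e.symm_apply_apply
    rw [Nat.cast_succ, contDiffOn_succ_iff_fderivWithin hR]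
    refine ⟨fun q hq => (hd q hq).differentiableWithinAt, by simp, ?_⟩
    have h1 : ContDiffOn ℝ k (fderivWithin ℝ f S) S :=
      hf.fderivWithin hS (by norm_cast)
    have h2 : ContDiffOn ℝ k (fderivWithin ℝ (f ∘ g) R) R :=
      hfg.fderivWithin hR (by norm_cast)
    have h3 : ContDiffOn ℝ k (fun q => (fderivWithin ℝ f S (g q)).inverse) R := fun q hq => by
      obtain ⟨e, he⟩ := hinv _ (hmaps hq)
      have h4 : ContDiffAt ℝ k ContinuousLinearMap.inverse (fderivWithin ℝ f S (g q)) := by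
        rw [← he]; exact contDiffAt_map_inverse e
      exact h4.comp_contDiffWithinAt q ((h1.comp hgk hmaps) q hq)
    exact (h3.clm_comp h2).congr fun q hq => (hd q hq).fderivWithin (hR q hq)

theorem HasFDerivWithinAt.comp_of_forall_mem {E V F : Type*} [NormedAddCommGroup E]
    [NormedSpace ℝ E] [NormedAddCommGroup V] [NormedSpace ℝ V] [NormedAddCommGroup F]
    [NormedSpace ℝ F] {f : E → V} {f' : E →L[ℝ] V} {S : Set E} {U : F → E} {U' : F →L[ℝ] E} {q : F}
    (hf : HasFDerivWithinAt f f' S (U q)) (hU : HasFDerivAt U U' q) (hS : ∀ r, U r ∈ S) :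
    HasFDerivAt (fun r => f (U r)) (f' ∘L U') q := by
  rw [← hasFDerivWithinAt_univ] at hU ⊢
  exact hf.comp q hU fun r _ => hS r

/-- The first variation identity for a two-parameter family `U(τ, s)` such that the curves
`U(τ, ·)` have constant speed `ℓ(τ)` and satisfy the magnetic geodesic equation. -/
theorem variation_identity {E : Type*} [NormedAddCommGroup E] [NormedSpace ℝ E]
    {G : E → E →L[ℝ] E →L[ℝ] ℝ} {G' : E →L[ℝ] E →L[ℝ] E →L[ℝ] ℝ} {W : E → E →L[ℝ] ℝ}
    {W' : E →L[ℝ] E →L[ℝ] ℝ} {S : Set E} {U : ℝ × ℝ → E} {q : ℝ × ℝ} {ℓ : ℝ → ℝ} {ℓ' : ℝ}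
    (hU : ContDiffAt ℝ 2 U q) (hUS : ∀ r, U r ∈ S) (hG : HasFDerivWithinAt G G' S (U q))
    (hW : HasFDerivWithinAt W W' S (U q)) (hsymm : ∀ v w, G (U q) v w = G (U q) w v)
    (hℓ : HasDerivAt ℓ ℓ' q.1) (hℓ0 : ℓ q.1 ≠ 0)
    (hspeed : ∀ᶠ r in 𝓝 q, G (U r) (fderiv ℝ U r (0, 1)) (fderiv ℝ U r (0, 1)) = ℓ r.1 * ℓ r.1)
    (hEL : ∀ e, HasDerivAt (fun s => G (U (q.1, s)) (fderiv ℝ U (q.1, s) (0, 1)) e)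
      (1 / 2 * G' e (fderiv ℝ U q (0, 1)) (fderiv ℝ U q (0, 1))
        + ℓ q.1 * (W' (fderiv ℝ U q (0, 1)) e - W' e (fderiv ℝ U q (0, 1)))) q.2) :
    ∃ P f : ℝ × ℝ →L[ℝ] ℝ,
      HasFDerivAt (fun r => (ℓ r.1)⁻¹ * G (U r) (fderiv ℝ U r (0, 1)) (fderiv ℝ U r (1, 0))
        - W (U r) (fderiv ℝ U r (1, 0))) P q ∧
      HasFDerivAt (fun r => ℓ r.1 - W (U r) (fderiv ℝ U r (0, 1))) f q ∧
      P (0, 1) = f (1, 0) := by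
  have hU1 : HasFDerivAt U (fderiv ℝ U q) q := (hU.differentiableAt (by simp)).hasFDerivAt
  have hU2 : HasFDerivAt (fderiv ℝ U) (fderiv ℝ (fderiv ℝ U) q) q :=
    ((hU.fderiv_right (m := 1) (by norm_num)).differentiableAt (by simp)).hasFDerivAt
  have hsym : IsSymmSndFDerivAt ℝ U q := hU.isSymmSndFDerivAt (by simp)
  have hGU := HasFDerivWithinAt.comp_of_forall_mem (V := E →L[ℝ] E →L[ℝ] ℝ) hG hU1 hUS
  have hWU := HasFDerivWithinAt.comp_of_forall_mem hW hU1 hUS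
  have hUs := hU2.clm_apply (hasFDerivAt_const ((0, 1) : ℝ × ℝ) q)
  have hUt := hU2.clm_apply (hasFDerivAt_const ((1, 0) : ℝ × ℝ) q)
  have hl : HasFDerivAt (fun r : ℝ × ℝ => ℓ r.1) (ℓ' • ContinuousLinearMap.fst ℝ ℝ ℝ) q :=
    hℓ.comp_hasFDerivAt q hasFDerivAt_fst
  have hli : HasFDerivAt (fun r : ℝ × ℝ => (ℓ r.1)⁻¹)
      ((-ℓ' / (ℓ q.1) ^ 2) • ContinuousLinearMap.fst ℝ ℝ ℝ) q :=
    (hℓ.fun_inv hℓ0).comp_hasFDerivAt q hasFDerivAt_fst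
  refine ⟨_, _, (hli.mul ((hGU.clm_apply hUs).clm_apply hUt)).sub (hWU.clm_apply hUt),
    hl.sub (hWU.clm_apply hUs), ?_⟩
  -- The `τ`-derivative of the speed relation expresses `G(U_τs, U_s)` through `ℓ ℓ'` and the
  -- derivative of `G`.
  have e1 : HasFDerivAt (fun r : ℝ × ℝ => ℓ r.1 * ℓ r.1) _ q :=
    ((hGU.clm_apply hUs).clm_apply hUs).congr_of_eventuallyEq (hspeed.mono fun r hr => hr.symm)
  have e2 := congrArg (fun A : ℝ × ℝ →L[ℝ] ℝ => A (1, 0)) (e1.unique (hl.mul hl))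
  have hline : HasDerivAt (fun s : ℝ => ((q.1, s) : ℝ × ℝ)) (0, 1) q.2 :=
    (hasDerivAt_const _ _).prodMk (hasDerivAt_id _)
  have e3 := fun e : E => (hEL e).unique (((hGU.clm_apply hUs).clm_apply
    (hasFDerivAt_const e q)).comp_hasDerivAt_of_eq q.2 hline rfl)
  -- The Euler–Lagrange equation is tested with the variation field `U_τ`; symmetry of the second
  -- derivative of `U` then identifies the remaining mixed terms.
  have e4 := e3 (fderiv ℝ U q (1, 0))
  have e5 : fderiv ℝ (fderiv ℝ U) q (0, 1) (1, 0) = fderiv ℝ (fderiv ℝ U) q (1, 0) (0, 1) := hsym _ _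
  simp at e2 e4 ⊢
  rw [hsymm (fderiv ℝ (fderiv ℝ U) q (1, 0) (0, 1))] at e2
  rw [e5]
  have hli : (ℓ q.1)⁻¹ * ℓ q.1 = 1 := inv_mul_cancel₀ hℓ0
  linear_combination (ℓ q.1)⁻¹ * (e2 / 2) - (ℓ q.1)⁻¹ * e4
    + (ℓ' + W' (fderiv ℝ U q (0, 1)) (fderiv ℝ U q (1, 0))
      - W' (fderiv ℝ U q (1, 0)) (fderiv ℝ U q (0, 1))) * hli

section

variable {n : ℕ} [NeZero n] {N : Type*} [TopologicalSpace N]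
  [ChartedSpace (EuclideanHalfSpace n) N] [IsManifold (𝓡∂ n) ∞ N]
  {F : Type*} [NormedAddCommGroup F] [NormedSpace ℝ F]

/-- In charts this is `contDiffOn_of_comp_left`. It transfers regularity from the logarithm of a
family of points to the family itself, also at boundary points of `N`. -/
theorem contMDiffOn_of_comp_left {L : N → Space n} {O : Set N} {k : ℕ} (hO : IsOpen O)
    (hk : 1 ≤ k) (hL : ∀ p ∈ O, ContMDiffAt (𝓡∂ n) 𝓘(ℝ, Space n) k L p)
    (hbij : ∀ p ∈ O, Function.Bijective (dmap L p)) {Γ : F → N} {R : Set F}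
    (hR : UniqueDiffOn ℝ R) (hΓ : ContinuousOn Γ R) (hmaps : MapsTo Γ R O)
    (hLΓ : ContDiffOn ℝ k (L ∘ Γ) R) : ContMDiffOn 𝓘(ℝ, F) (𝓡∂ n) k Γ R := by
  intro q hq
  set φ := extChartAt (𝓡∂ n) (Γ q) with hφ
  obtain ⟨A, hA, hA'⟩ := continuousOn_iff'.1 hΓ φ.source (isOpen_extChartAt_source (Γ q))
  obtain ⟨B, hB, hB'⟩ := continuousOn_iff'.1 (continuousOn_extChartAt_symm (I := 𝓡∂ n) (Γ q)) O hO
  have hS : UniqueDiffOn ℝ (φ.target ∩ B) := (uniqueDiffOn_extChartAt_target (Γ q)).inter hB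
  have hsub : φ.target ∩ B ⊆ range (𝓡∂ n) :=
    inter_subset_left.trans (extChartAt_target_subset_range (Γ q))
  have hp : ∀ u ∈ φ.target ∩ B, φ.symm u ∈ O ∧
      φ.symm u ∈ (chartAt (EuclideanHalfSpace n) (Γ q)).source ∧ φ (φ.symm u) = u :=
    fun u hu => ⟨(hB'.symm.subset ⟨hu.2, hu.1⟩).1, by
      rw [← extChartAt_source (𝓡∂ n)]; exact φ.map_target hu.1, φ.right_inv hu.1⟩
  have hqA : q ∈ R ∩ A := by
    have : q ∈ A ∩ R := hA' ▸ ⟨mem_extChartAt_source (Γ q), hq⟩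
    exact this.symm
  have hsource : ∀ r ∈ R ∩ A, Γ r ∈ φ.source := fun r hr => (hA'.symm.subset hr.symm).1
  have key : ContDiffOn ℝ k (φ ∘ Γ) (R ∩ A) := by
    refine contDiffOn_of_comp_left (f := L ∘ φ.symm) hS (fun u hu => ?_) (hR.inter hA) ?_ ?_ k ?_ ?_
    · obtain ⟨h1, h2, h3⟩ := hp u hu
      have hd := hasFDerivWithinAt_comp_extChartAt_symm
        ((hL _ h1).mdifferentiableAt (by norm_cast; omega)) h2
      rw [← hφ, h3] at hd
      have hd' : fderivWithin ℝ (L ∘ φ.symm) (φ.target ∩ B) u = _ :=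
        (hd.mono hsub).fderivWithin (hS u hu)
      rw [hd', ContinuousLinearMap.coe_comp]
      refine (hbij _ h1).comp ⟨?_, ?_⟩
      · have := frameAt_injective h2
        rwa [← hφ, h3] at this
      · intro v
        have := frameAt_coframeAt (I := 𝓡∂ n) h2 v
        rw [← hφ, h3] at this
        exact ⟨_, this⟩
    · exact fun r hr => ((continuousAt_extChartAt' (hsource r hr)).comp_continuousWithinAt
        ((hΓ r hr.1).mono inter_subset_left))
    · intro r hr
      refine ⟨φ.map_source (hsource r hr), ?_⟩
      have h1 : φ.symm (φ (Γ r)) ∈ O := by rw [φ.left_inv (hsource r hr)]; exact hmaps hr.1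
      exact (hB'.subset ⟨h1, φ.map_source (hsource r hr)⟩).1
    · intro u hu
      obtain ⟨h1, h2, h3⟩ := hp u hu
      have := contDiffWithinAt_comp_extChartAt_symm (by exact_mod_cast le_top) (hL _ h1) h2
      rw [← hφ, h3] at this
      exact this.mono hsub
    · refine (hLΓ.mono inter_subset_left).congr fun r hr => ?_
      simp only [Function.comp_apply, φ.left_inv (hsource r hr)]
  rw [contMDiffWithinAt_iff_target]
  refine ⟨hΓ q hq, ?_⟩
  rw [contMDiffWithinAt_iff_contDiffWithinAt]
  exact (key q hqA).mono_of_mem_nhdsWithin (inter_mem_nhdsWithin R (hA.mem_nhds hqA.2))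

end

/-! ### The fan of magnetic geodesics from a point to a curve. -/

section

variable {n : ℕ} [NeZero n] {N : Type*} [TopologicalSpace N]
  [ChartedSpace (EuclideanHalfSpace n) N] [IsManifold (𝓡∂ n) ∞ N]
  {F : Type*} [NormedAddCommGroup F] [NormedSpace ℝ F]

omit [IsManifold (𝓡∂ n) ∞ N] in
theorem derivAt_comp {F' : Type*} [NormedAddCommGroup F'] [NormedSpace ℝ F'] {Γ : F → N} {R : Set F}
    {j : F' → F} {j' : F' →L[ℝ] F} {J : Set F'} {s : F'}
    (hΓ : MDifferentiableWithinAt 𝓘(ℝ, F) (𝓡∂ n) Γ R (j s)) (hj : HasFDerivWithinAt j j' J s)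
    (hmaps : MapsTo j J R) (hJ : UniqueDiffWithinAt ℝ J s) :
    derivAt (𝓡∂ n) (Γ ∘ j) J s = derivAt (𝓡∂ n) Γ R (j s) ∘L j' :=
  (hΓ.hasMFDerivWithinAt.comp s hj.hasMFDerivWithinAt hmaps).mfderivWithin hJ.uniqueMDiffWithinAt

namespace MagneticSystem

variable {m : MagneticSystem n N}

/-- `v` is the velocity at `y` of a magnetic geodesic from `x` to `y`. -/
def IsArrival (m : MagneticSystem n N) (x y : N) (v : Space n) : Prop :=
  ∃ (ℓ : ℝ) (γ : ℝ → N), m.IsMagneticGeodesic ℓ γ ∧ γ 0 = x ∧ γ ℓ = y ∧ vel γ ℓ ℓ = v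

namespace IsLogMap

variable {x : N} {L : N → Space n}

/-- The image of the logarithm is star-shaped about the origin, because geodesics contain their
initial segments. -/
theorem exists_eq_smul (h : m.IsLogMap x L) (y : N) {s : ℝ} (hs : s ∈ Icc (0 : ℝ) 1) :
    ∃ z, L z = s • L y := by
  by_cases hy : y = x
  · exact ⟨x, by rw [hy, h.apply_self, smul_zero]⟩
  · obtain ⟨ℓ, γ, hγ, h0, h1⟩ := h.exists_geodesic hy
    refine ⟨γ (s * ℓ), ?_⟩
    rw [h.apply_geodesic hγ h0 ⟨mul_nonneg hs.1 hγ.pos.le, mul_le_of_le_one_left hγ.pos.le hs.2⟩,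
      ← h1, h.apply_geodesic hγ h0 hγ.right_mem, smul_smul]

/-- The point dividing the magnetic geodesic from `x` to `y` in the ratio `s : 1 - s`. -/
def divide (_h : m.IsLogMap x L) (y : N) (s : ℝ) : N :=
  haveI : Nonempty N := ⟨x⟩
  Function.invFun L (s • L y)

theorem apply_divide (h : m.IsLogMap x L) (y : N) {s : ℝ} (hs : s ∈ Icc (0 : ℝ) 1) :
    L (h.divide y s) = s • L y :=
  haveI : Nonempty N := ⟨x⟩
  Function.invFun_eq (h.exists_eq_smul y hs)

theorem length_eq (h : m.IsLogMap x L) {ℓ : ℝ} {γ : ℝ → N} (hγ : m.IsMagneticGeodesic ℓ γ)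
    (h0 : γ 0 = x) : m.nrm x (L (γ ℓ)) = ℓ := h.nrm_geodesic hγ h0 hγ.right_mem

variable [T2Space N]

theorem divide_geodesic (h : m.IsLogMap x L) {ℓ : ℝ} {γ : ℝ → N} (hγ : m.IsMagneticGeodesic ℓ γ)
    (h0 : γ 0 = x) {s : ℝ} (hs : s ∈ Icc (0 : ℝ) 1) : h.divide (γ ℓ) s = γ (s * ℓ) := by
  apply h.injective
  rw [h.apply_divide _ hs, h.apply_geodesic hγ h0 hγ.right_mem, smul_smul,
    h.apply_geodesic hγ h0 ⟨mul_nonneg hs.1 hγ.pos.le, mul_le_of_le_one_left hγ.pos.le hs.2⟩]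

omit [T2Space N] in
theorem divide_zero (h : m.IsLogMap x L) (y : N) : h.divide y 0 = x := by
  rw [← h.apply_eq_zero, h.apply_divide _ ⟨le_rfl, zero_le_one⟩, zero_smul]

theorem divide_one (h : m.IsLogMap x L) (y : N) : h.divide y 1 = y := by
  apply h.injective
  rw [h.apply_divide _ ⟨zero_le_one, le_rfl⟩, one_smul]

/-- The magnetic geodesics from `x` to the points of the curve `c`, parametrized by `[0, 1]`. -/
def fan (h : m.IsLogMap x L) (c : ℝ → N) (q : ℝ × ℝ) : N := h.divide (c q.1) q.2

variable [CompactSpace N] {T : ℝ} {c : ℝ → N}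

/-- Since `N` is compact, the injective continuous `L` is a closed embedding, so continuity may be
tested after applying `L`, where the fan is `s • L (c τ)`. -/
theorem continuousOn_fan (h : m.IsLogMap x L) (hc : ContinuousOn c (Icc 0 T)) :
    ContinuousOn (h.fan c) (Icc 0 T ×ˢ Icc (0 : ℝ) 1) := by
  rw [(h.continuous.isClosedEmbedding h.injective).isInducing.continuousOn_iff]
  have : ContinuousOn (fun q : ℝ × ℝ => q.2 • L (c q.1)) (Icc 0 T ×ˢ Icc (0 : ℝ) 1) :=
    continuousOn_snd.smul (h.continuous.comp_continuousOn
      (hc.comp continuousOn_fst fun q hq => hq.1))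
  exact this.congr fun q hq => h.apply_divide _ hq.2

theorem uniqueDiffOn_rect (hT : 0 < T) : UniqueDiffOn ℝ (Icc 0 T ×ˢ Icc (0 : ℝ) 1) :=
  (uniqueDiffOn_Icc hT).prod uniqueDiffOn_Icc_zero_one

/-- On the closed rectangle one derivative is all that is available: the fan meets `x` at `s = 0`,
where the logarithm is only `C¹`. -/
theorem contMDiffOn_fan (h : m.IsLogMap x L) (hT : 0 < T)
    (hc : ContMDiffOn 𝓘(ℝ, ℝ) (𝓡∂ n) ∞ c (Icc 0 T)) :
    ContMDiffOn 𝓘(ℝ, ℝ × ℝ) (𝓡∂ n) 1 (h.fan c) (Icc 0 T ×ˢ Icc (0 : ℝ) 1) := by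
  refine contMDiffOn_of_comp_left (k := 1) isOpen_univ le_rfl (fun p _ => h.contMDiff p)
    (fun p _ => h.bijective p) (uniqueDiffOn_rect hT) (h.continuousOn_fan hc.continuousOn)
    (mapsTo_univ _ _) ?_
  have h1 : ContDiffOn ℝ 1 (L ∘ c) (Icc 0 T) :=
    contMDiffOn_iff_contDiffOn.1 (h.contMDiff.comp_contMDiffOn (hc.of_le (by simp)))
  have h2 : ContDiffOn ℝ 1 (fun q : ℝ × ℝ => q.2 • (L ∘ c) q.1) (Icc 0 T ×ˢ Icc (0 : ℝ) 1) :=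
    contDiffOn_snd.smul (h1.comp contDiffOn_fst fun q hq => hq.1)
  exact h2.congr fun q hq => h.apply_divide _ hq.2

omit [CompactSpace N] in
theorem contMDiffAt_of_ne (h : m.IsLogMap x L) {y : N} (hy : y ≠ x) :
    ContMDiffAt (𝓡∂ n) 𝓘(ℝ, Space n) ∞ L y :=
  (h.smooth y hy).contMDiffAt (isOpen_compl_singleton.mem_nhds hy)

omit [T2Space N] [CompactSpace N] in
theorem contDiffOn_comp_curve (h : m.IsLogMap x L) {J : Set ℝ}
    (hc : ContMDiffOn 𝓘(ℝ, ℝ) (𝓡∂ n) ∞ c J) (hx : ∀ τ ∈ J, c τ ≠ x) : ContDiffOn ℝ ∞ (L ∘ c) J :=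
  contMDiffOn_iff_contDiffOn.1 (h.smooth.comp hc hx)

/-- For `s > 0` the fan avoids `x`, where the logarithm is smooth. Two derivatives are what
`variation_identity` requires. -/
theorem contMDiffOn_fan_interior (h : m.IsLogMap x L)
    (hc : ContMDiffOn 𝓘(ℝ, ℝ) (𝓡∂ n) ∞ c (Icc 0 T)) (hx : ∀ τ ∈ Icc 0 T, c τ ≠ x) :
    ContMDiffOn 𝓘(ℝ, ℝ × ℝ) (𝓡∂ n) 2 (h.fan c) (Ioo 0 T ×ˢ Ioo (0 : ℝ) 1) := by
  have hsub : Ioo 0 T ×ˢ Ioo (0 : ℝ) 1 ⊆ Icc 0 T ×ˢ Icc (0 : ℝ) 1 :=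
    prod_mono Ioo_subset_Icc_self Ioo_subset_Icc_self
  refine contMDiffOn_of_comp_left (k := 2) isOpen_compl_singleton (by norm_num)
    (fun p hp => (h.contMDiffAt_of_ne hp).of_le (by exact WithTop.coe_le_coe.2 le_top))
    (fun p _ => h.bijective p) (isOpen_Ioo.prod isOpen_Ioo).uniqueDiffOn
    ((h.continuousOn_fan hc.continuousOn).mono hsub) (fun q hq => ?_) ?_
  · rw [mem_compl_iff, mem_singleton_iff, ← h.apply_eq_zero, fan, h.apply_divide _ (hsub hq).2,
      smul_eq_zero, h.apply_eq_zero]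
    exact not_or.2 ⟨hq.2.1.ne', hx _ (hsub hq).1⟩
  · have h2 : ContDiffOn ℝ ((2 : ℕ) : WithTop ℕ∞) (fun q : ℝ × ℝ => q.2 • (L ∘ c) q.1)
        (Icc 0 T ×ˢ Icc (0 : ℝ) 1) :=
      contDiffOn_snd.smul (((h.contDiffOn_comp_curve hc hx).of_le (by exact WithTop.coe_le_coe.2 le_top)).comp
        contDiffOn_fst fun q hq => hq.1)
    exact (h2.mono hsub).congr fun q hq => h.apply_divide _ (hsub hq).2

theorem hasFDerivWithinAt_smul_length {ℓ s : ℝ} {J : Set ℝ} :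
    HasFDerivWithinAt (fun s => s * ℓ) (ℓ • ContinuousLinearMap.id ℝ ℝ) J s := by
  simpa using (hasFDerivAt_id s).mul_const ℓ |>.hasFDerivWithinAt

theorem derivAt_fan_snd (h : m.IsLogMap x L) (hT : 0 < T)
    (hc : ContMDiffOn 𝓘(ℝ, ℝ) (𝓡∂ n) ∞ c (Icc 0 T)) {ℓ : ℝ} {γ : ℝ → N}
    (hγ : m.IsMagneticGeodesic ℓ γ) (h0 : γ 0 = x) {τ s : ℝ} (hτ : τ ∈ Icc 0 T) (h1 : γ ℓ = c τ)
    (hs : s ∈ Icc (0 : ℝ) 1) :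
    derivAt (𝓡∂ n) (h.fan c) (Icc 0 T ×ˢ Icc (0 : ℝ) 1) (τ, s) (0, 1) = ℓ • vel γ ℓ (s * ℓ) := by
  have hu := uniqueDiffOn_Icc_zero_one s hs
  have hmaps : MapsTo (fun s : ℝ => s * ℓ) (Icc (0 : ℝ) 1) (Icc 0 ℓ) := fun s hs =>
    ⟨mul_nonneg hs.1 hγ.pos.le, mul_le_of_le_one_left hγ.pos.le hs.2⟩
  have e1 := derivAt_comp (Γ := h.fan c) (R := Icc 0 T ×ˢ Icc (0 : ℝ) 1) (j := fun s : ℝ => (τ, s))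
    (J := Icc (0 : ℝ) 1) (s := s)
    ((h.contMDiffOn_fan hT hc (τ, s) ⟨hτ, hs⟩).mdifferentiableWithinAt (by simp))
    ((hasFDerivAt_const τ s).prodMk (hasFDerivAt_id s)).hasFDerivWithinAt
    (fun s hs => ⟨hτ, hs⟩) hu
  have e2 := derivAt_comp (Γ := γ) (R := Icc 0 ℓ) (j := fun s : ℝ => s * ℓ)
    (J := Icc (0 : ℝ) 1) (s := s) (hγ.mdiff (hmaps hs)) hasFDerivWithinAt_smul_length hmaps hu
  have e3 : derivAt (𝓡∂ n) (h.fan c ∘ fun s : ℝ => (τ, s)) (Icc (0 : ℝ) 1) s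
      = derivAt (𝓡∂ n) (γ ∘ fun s : ℝ => s * ℓ) (Icc (0 : ℝ) 1) s := by
    have : EqOn (h.fan c ∘ fun s : ℝ => (τ, s)) (γ ∘ fun s : ℝ => s * ℓ) (Icc (0 : ℝ) 1) :=
      fun r hr => by
        simp only [Function.comp_apply, fan, ← h1]
        exact h.divide_geodesic hγ h0 hr
    exact mfderivWithin_congr this (this hs)
  have e4 := congrArg (fun A : ℝ →L[ℝ] Space n => A 1) (e1.symm.trans (e3.trans e2))
  simp only [ContinuousLinearMap.comp_apply, ContinuousLinearMap.prod_apply, zero_apply,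
    ContinuousLinearMap.id_apply, smul_apply, smul_eq_mul, mul_one] at e4
  rw [e4, ← mul_one ℓ, ← smul_eq_mul, map_smul, smul_eq_mul, mul_one]
  rfl

theorem derivAt_fan_fst_one (h : m.IsLogMap x L) (hT : 0 < T)
    (hc : ContMDiffOn 𝓘(ℝ, ℝ) (𝓡∂ n) ∞ c (Icc 0 T)) {τ : ℝ} (hτ : τ ∈ Icc 0 T) :
    derivAt (𝓡∂ n) (h.fan c) (Icc 0 T ×ˢ Icc (0 : ℝ) 1) (τ, 1) (1, 0) = vel c T τ := by
  have e1 := derivAt_comp (Γ := h.fan c) (R := Icc 0 T ×ˢ Icc (0 : ℝ) 1)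
    (j := fun s : ℝ => (s, (1 : ℝ))) (J := Icc (0 : ℝ) T) (s := τ)
    ((h.contMDiffOn_fan hT hc (τ, 1) ⟨hτ, zero_le_one, le_rfl⟩).mdifferentiableWithinAt (by simp))
    ((hasFDerivAt_id τ).prodMk (hasFDerivAt_const 1 τ)).hasFDerivWithinAt
    (fun s hs => ⟨hs, zero_le_one, le_rfl⟩) (uniqueDiffWithinAt_Icc hT hτ)
  have e2 : h.fan c ∘ (fun s : ℝ => (s, (1 : ℝ))) = c := funext fun s => h.divide_one _
  rw [e2] at e1
  exact (congrArg (fun A : ℝ →L[ℝ] Space n => A 1) e1).symm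

theorem derivAt_fan_fst_zero (h : m.IsLogMap x L) (hT : 0 < T)
    (hc : ContMDiffOn 𝓘(ℝ, ℝ) (𝓡∂ n) ∞ c (Icc 0 T)) {τ : ℝ} (hτ : τ ∈ Icc 0 T) :
    derivAt (𝓡∂ n) (h.fan c) (Icc 0 T ×ˢ Icc (0 : ℝ) 1) (τ, 0) (1, 0) = 0 := by
  have e1 := derivAt_comp (Γ := h.fan c) (R := Icc 0 T ×ˢ Icc (0 : ℝ) 1)
    (j := fun s : ℝ => (s, (0 : ℝ))) (J := Icc (0 : ℝ) T) (s := τ)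
    ((h.contMDiffOn_fan hT hc (τ, 0) ⟨hτ, le_rfl, zero_le_one⟩).mdifferentiableWithinAt (by simp))
    ((hasFDerivAt_id τ).prodMk (hasFDerivAt_const 0 τ)).hasFDerivWithinAt
    (fun s hs => ⟨hs, le_rfl, zero_le_one⟩) (uniqueDiffWithinAt_Icc hT hτ)
  have e2 : h.fan c ∘ (fun s : ℝ => (s, (0 : ℝ))) = fun _ => x := funext fun s => h.divide_zero _
  rw [e2] at e1
  refine (congrArg (fun A : ℝ →L[ℝ] Space n => A 1) e1).symm.trans ?_
  exact congrArg (fun A : ℝ →L[ℝ] Space n => A 1)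
    (mfderivWithin_const (I := 𝓘(ℝ, ℝ)) (I' := 𝓡∂ n) (s := Icc 0 T) (x := τ) (c := x))

end IsLogMap

end MagneticSystem
end

/-! ### The first variation formula. -/

section

variable {n : ℕ} [NeZero n] {N : Type*} [TopologicalSpace N]
  [ChartedSpace (EuclideanHalfSpace n) N] [IsManifold (𝓡∂ n) ∞ N]

namespace MagneticSystem

variable {m : MagneticSystem n N}

namespace IsLogMap

variable {x : N} {L : N → Space n} {T : ℝ} {c : ℝ → N}

theorem continuousOn_length (h : m.IsLogMap x L) (hc : ContinuousOn c (Icc 0 T)) :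
    ContinuousOn (fun τ => m.nrm x (L (c τ))) (Icc 0 T) := by
  have h1 := h.continuous.comp_continuousOn hc
  exact (((m.ip x).continuous.comp_continuousOn h1).clm_apply h1).sqrt

variable [T2Space N] [CompactSpace N]

omit [T2Space N] [CompactSpace N] in
theorem hasDerivAt_length (h : m.IsLogMap x L) (hc : ContMDiffOn 𝓘(ℝ, ℝ) (𝓡∂ n) ∞ c (Icc 0 T))
    (hx : ∀ τ ∈ Icc 0 T, c τ ≠ x) {τ : ℝ} (hτ : τ ∈ Ioo 0 T) :
    ∃ ℓ', HasDerivAt (fun τ => m.nrm x (L (c τ))) ℓ' τ := by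
  have hτ' := Ioo_subset_Icc_self hτ
  have h1 : DifferentiableAt ℝ (L ∘ c) τ :=
    ((h.contDiffOn_comp_curve hc hx).contDiffAt (Icc_mem_nhds hτ.1 hτ.2)).differentiableAt (by simp)
  have h2 : DifferentiableAt ℝ (fun τ => m.ip x (L (c τ)) (L (c τ))) τ :=
    ((m.ip x).differentiableAt.comp τ h1).clm_apply h1
  exact ⟨_, (h2.sqrt (m.ip_pos x (fun h0 => hx τ hτ' (h.apply_eq_zero.1 h0))).ne').hasDerivAt⟩

/-- The momentum of the fan in the direction of the parameter of the curve. -/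
def fanMomentum (h : m.IsLogMap x L) (c : ℝ → N) (T : ℝ) (q : ℝ × ℝ) : ℝ :=
  (m.nrm x (L (c q.1)))⁻¹ * m.ip (h.fan c q)
      (derivAt (𝓡∂ n) (h.fan c) (Icc 0 T ×ˢ Icc (0 : ℝ) 1) q (0, 1))
      (derivAt (𝓡∂ n) (h.fan c) (Icc 0 T ×ˢ Icc (0 : ℝ) 1) q (1, 0))
    - m.pot (h.fan c q) (derivAt (𝓡∂ n) (h.fan c) (Icc 0 T ×ˢ Icc (0 : ℝ) 1) q (1, 0))

/-- The density of the action of the geodesics of the fan. -/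
def fanDensity (h : m.IsLogMap x L) (c : ℝ → N) (T : ℝ) (q : ℝ × ℝ) : ℝ :=
  m.nrm x (L (c q.1))
    - m.pot (h.fan c q) (derivAt (𝓡∂ n) (h.fan c) (Icc 0 T ×ˢ Icc (0 : ℝ) 1) q (0, 1))

omit [T2Space N] [CompactSpace N] in
theorem exists_geodesic_length (h : m.IsLogMap x L) {y : N} (hy : y ≠ x) :
    ∃ γ, m.IsMagneticGeodesic (m.nrm x (L y)) γ ∧ γ 0 = x ∧ γ (m.nrm x (L y)) = y := by
  obtain ⟨ℓ, γ, hγ, h0, h1⟩ := h.exists_geodesic hy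
  have := h.length_eq hγ h0
  rw [h1] at this
  rw [this]
  exact ⟨γ, hγ, h0, h1⟩

theorem fanDensity_eq (h : m.IsLogMap x L) (hT : 0 < T)
    (hc : ContMDiffOn 𝓘(ℝ, ℝ) (𝓡∂ n) ∞ c (Icc 0 T)) {ℓ : ℝ} {γ : ℝ → N}
    (hγ : m.IsMagneticGeodesic ℓ γ) (h0 : γ 0 = x) {τ s : ℝ} (hτ : τ ∈ Icc 0 T) (h1 : γ ℓ = c τ)
    (hs : s ∈ Icc (0 : ℝ) 1) :
    h.fanDensity c T (τ, s) = ℓ * (1 - m.pot (γ (s * ℓ)) (vel γ ℓ (s * ℓ))) := by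
  rw [fanDensity, h.derivAt_fan_snd hT hc hγ h0 hτ h1 hs, map_smul, smul_eq_mul, fan, ← h1,
    h.divide_geodesic hγ h0 hs, h.length_eq hγ h0]
  ring

theorem integral_fanDensity (hm : m.IsSimple) (h : m.IsLogMap x L) (hT : 0 < T)
    (hc : ContMDiffOn 𝓘(ℝ, ℝ) (𝓡∂ n) ∞ c (Icc 0 T)) {τ : ℝ} (hτ : τ ∈ Icc 0 T) (hx : c τ ≠ x) :
    ∫ s in (0 : ℝ)..1, h.fanDensity c T (τ, s) = m.action x (c τ) := by
  obtain ⟨ℓ, γ, hγ, h0, h1⟩ := h.exists_geodesic hx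
  have e1 : ∫ s in (0 : ℝ)..1, h.fanDensity c T (τ, s)
      = ∫ s in (0 : ℝ)..1, ℓ * (1 - m.pot (γ (s * ℓ)) (vel γ ℓ (s * ℓ))) := by
    refine intervalIntegral.integral_congr fun s hs => ?_
    rw [uIcc_of_le zero_le_one] at hs
    exact h.fanDensity_eq hT hc hγ h0 hτ h1 hs
  have e2 := intervalIntegral.mul_integral_comp_mul_right (a := 0) (b := 1)
    (f := fun s => 1 - m.pot (γ s) (vel γ ℓ s)) ℓ
  rw [e1, intervalIntegral.integral_const_mul, e2, zero_mul, one_mul, ← hγ.curveAction_eq,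
    ← hm.action_eq hγ, h0, h1]

/-- All geodesics of the fan start at `x`, so the variation field vanishes there and the side `s =
0` does not contribute to the first variation. -/
theorem fanMomentum_zero (h : m.IsLogMap x L) (hT : 0 < T)
    (hc : ContMDiffOn 𝓘(ℝ, ℝ) (𝓡∂ n) ∞ c (Icc 0 T)) {τ : ℝ} (hτ : τ ∈ Icc 0 T) :
    h.fanMomentum c T (τ, 0) = 0 := by
  simp only [fanMomentum, h.derivAt_fan_fst_zero hT hc hτ, map_zero, mul_zero, sub_zero]

theorem fanMomentum_one (h : m.IsLogMap x L) (hT : 0 < T)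
    (hc : ContMDiffOn 𝓘(ℝ, ℝ) (𝓡∂ n) ∞ c (Icc 0 T)) {τ : ℝ} (hτ : τ ∈ Icc 0 T) {ℓ : ℝ} {γ : ℝ → N}
    (hγ : m.IsMagneticGeodesic ℓ γ) (h0 : γ 0 = x) (h1 : γ ℓ = c τ) :
    h.fanMomentum c T (τ, 1)
      = m.ip (c τ) (vel γ ℓ ℓ) (vel c T τ) - m.pot (c τ) (vel c T τ) := by
  have hl := hγ.pos.ne'
  have h1' : h.fan c (τ, 1) = c τ := h.divide_one _
  simp only [fanMomentum, h.derivAt_fan_fst_one hT hc hτ,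
    h.derivAt_fan_snd hT hc hγ h0 hτ h1 ⟨zero_le_one, le_rfl⟩, h1', one_mul, map_smul, smul_apply,
    smul_eq_mul, ← h1, h.length_eq hγ h0]
  field_simp

theorem continuousOn_fanDensity (h : m.IsLogMap x L) (hT : 0 < T)
    (hc : ContMDiffOn 𝓘(ℝ, ℝ) (𝓡∂ n) ∞ c (Icc 0 T)) :
    ContinuousOn (h.fanDensity c T) (Icc 0 T ×ˢ Icc (0 : ℝ) 1) :=
  ((h.continuousOn_length hc.continuousOn).comp continuousOn_fst fun _ hq => hq.1).sub
    (m.continuousOn_pot_derivAt (h.contMDiffOn_fan hT hc) (uniqueDiffOn_rect hT) _)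

omit [T2Space N] [CompactSpace N] in
theorem length_ne_zero (h : m.IsLogMap x L) {y : N} (hy : y ≠ x) : m.nrm x (L y) ≠ 0 :=
  (Real.sqrt_pos.2 (m.ip_pos x fun h0 => hy (h.apply_eq_zero.1 h0))).ne'

theorem continuousOn_fanMomentum (h : m.IsLogMap x L) (hT : 0 < T)
    (hc : ContMDiffOn 𝓘(ℝ, ℝ) (𝓡∂ n) ∞ c (Icc 0 T)) (hx : ∀ τ ∈ Icc 0 T, c τ ≠ x) :
    ContinuousOn (h.fanMomentum c T) (Icc 0 T ×ˢ Icc (0 : ℝ) 1) :=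
  ((((h.continuousOn_length hc.continuousOn).inv₀ fun τ hτ => h.length_ne_zero (hx τ hτ)).comp
    continuousOn_fst fun _ hq => hq.1).mul
    (m.continuousOn_ip_derivAt (h.contMDiffOn_fan hT hc) (uniqueDiffOn_rect hT) _ _)).sub
    (m.continuousOn_pot_derivAt (h.contMDiffOn_fan hT hc) (uniqueDiffOn_rect hT) _)

theorem fderivWithin_fan_snd (h : m.IsLogMap x L) (hT : 0 < T)
    (hc : ContMDiffOn 𝓘(ℝ, ℝ) (𝓡∂ n) ∞ c (Icc 0 T)) {ℓ : ℝ} {γ : ℝ → N}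
    (hγ : m.IsMagneticGeodesic ℓ γ) (h0 : γ 0 = x) {τ s : ℝ} (hτ : τ ∈ Icc 0 T) (h1 : γ ℓ = c τ)
    (hs : s ∈ Icc (0 : ℝ) 1) {p : N} (hp : h.fan c (τ, s) ∈ (chartAt (EuclideanHalfSpace n) p).source) :
    fderivWithin ℝ (fun r => extChartAt (𝓡∂ n) p (h.fan c r)) (Icc 0 T ×ˢ Icc (0 : ℝ) 1) (τ, s) (0, 1)
      = ℓ • chartVelocity (𝓡∂ n) p γ ℓ (s * ℓ) := by
  have hq : (τ, s) ∈ Icc 0 T ×ˢ Icc (0 : ℝ) 1 := ⟨hτ, hs⟩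
  have hsl : s * ℓ ∈ Icc 0 ℓ :=
    ⟨mul_nonneg hs.1 hγ.pos.le, mul_le_of_le_one_left hγ.pos.le hs.2⟩
  have e : h.fan c (τ, s) = γ (s * ℓ) := by rw [fan, ← h1, h.divide_geodesic hγ h0 hs]
  rw [(hasFDerivWithinAt_extChartAt_comp ((h.contMDiffOn_fan hT hc _ hq).mdifferentiableWithinAt
    (by simp)) hp).fderivWithin (uniqueDiffOn_rect hT _ hq), ContinuousLinearMap.comp_apply,
    h.derivAt_fan_snd hT hc hγ h0 hτ h1 hs, map_smul, e,
    coframeAt_velocityAt hγ.pos hsl (hγ.mdiff hsl) (e ▸ hp)]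

/-- In a chart around the point, the hypotheses of `variation_identity` are the unit speed condition
and the momentum equation of the geodesics, rescaled by their length so that all of them are
parametrized by `[0, 1]`. -/
theorem variation_fan (h : m.IsLogMap x L) (hT : 0 < T)
    (hc : ContMDiffOn 𝓘(ℝ, ℝ) (𝓡∂ n) ∞ c (Icc 0 T)) (hx : ∀ τ ∈ Icc 0 T, c τ ≠ x) {q : ℝ × ℝ}
    (hq : q ∈ Ioo 0 T ×ˢ Ioo (0 : ℝ) 1) :
    ∃ P f : ℝ × ℝ →L[ℝ] ℝ, HasFDerivAt (h.fanMomentum c T) P q ∧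
      HasFDerivAt (h.fanDensity c T) f q ∧ P (0, 1) = f (1, 0) := by
  set R := Icc 0 T ×ˢ Icc (0 : ℝ) 1 with hR
  have hopen : IsOpen (Ioo 0 T ×ˢ Ioo (0 : ℝ) 1) := isOpen_Ioo.prod isOpen_Ioo
  have hRn : ∀ r ∈ Ioo 0 T ×ˢ Ioo (0 : ℝ) 1, R ∈ 𝓝 r := fun r hr =>
    mem_of_superset (hopen.mem_nhds hr) (prod_mono Ioo_subset_Icc_self Ioo_subset_Icc_self)
  have hRu := uniqueDiffOn_rect hT
  set p := h.fan c q with hp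
  have hsrc := mem_chart_source (EuclideanHalfSpace n) p
  have hC2 := (h.contMDiffOn_fan_interior hc hx).contMDiffAt (hopen.mem_nhds hq)
  have hev : ∀ᶠ r in 𝓝 q, r ∈ Ioo 0 T ×ˢ Ioo (0 : ℝ) 1 ∧
      h.fan c r ∈ (chartAt (EuclideanHalfSpace n) p).source :=
    (hopen.eventually_mem hq).and (hC2.continuousAt ((chartAt (EuclideanHalfSpace n) p).open_source.mem_nhds hsrc))
  have hmd : ∀ r ∈ R, MDifferentiableWithinAt 𝓘(ℝ, ℝ × ℝ) (𝓡∂ n) (h.fan c) R r := fun r hr =>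
    (h.contMDiffOn_fan hT hc r hr).mdifferentiableWithinAt (by simp)
  set U : ℝ × ℝ → Space n := fun r => extChartAt (𝓡∂ n) p (h.fan c r) with hU
  have hUd : ∀ r ∈ Ioo 0 T ×ˢ Ioo (0 : ℝ) 1, fderiv ℝ U r = fderivWithin ℝ U R r := fun r hr =>
    (fderivWithin_of_mem_nhds (hRn r hr)).symm
  obtain ⟨ℓ', hℓ'⟩ := h.hasDerivAt_length hc hx hq.1
  obtain ⟨γ, hγ, h0, h1⟩ := h.exists_geodesic_length (hx q.1 (Ioo_subset_Icc_self hq.1))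
  obtain ⟨P, f, hP, hf, heq⟩ := variation_identity (U := U) (q := q) (S := range (𝓡∂ n))
    (G := chartMetric (𝓡∂ n) m.h.inner p) (W := chartForm (𝓡∂ n) m.om p)
    (ℓ := fun τ => m.nrm x (L (c τ))) (ℓ' := ℓ')
    (contMDiffAt_iff_contDiffAt.1 ((contMDiffAt_extChartAt' (n := ∞) hsrc).of_le (by
      exact WithTop.coe_le_coe.2 le_top) |>.comp q hC2))
    (fun r => extChartAt_mem_range p _)
    (hasFDerivWithinAt_of_contDiffOn_target (V := Space n →L[ℝ] Space n →L[ℝ] ℝ)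
      (m.contDiffOn_gram p) hsrc)
    (hasFDerivWithinAt_of_contDiffOn_target (m.contDiffOn_cpot p) hsrc)
    (fun v w => by
      simp only [hU]
      rw [chartMetric_apply_of_mem _ hsrc, chartMetric_apply_of_mem _ hsrc, m.ip_symm])
    hℓ' (h.length_ne_zero (hx q.1 (Ioo_subset_Icc_self hq.1)))
    (by
      filter_upwards [hev] with r hr
      have hr1 := Ioo_subset_Icc_self hr.1.1
      have hr2 := Ioo_subset_Icc_self hr.1.2
      obtain ⟨γ, hγ, h0, h1⟩ := h.exists_geodesic_length (hx r.1 hr1)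
      rw [hUd r hr.1]
      have e : fderivWithin ℝ U R r (0, 1) = _ := h.fderivWithin_fan_snd hT hc hγ h0 hr1 h1 hr2 hr.2
      have e' : h.fan c r = γ (r.2 * m.nrm x (L (c r.1))) := by
        rw [fan]
        nth_rewrite 1 [← h1]
        rw [h.divide_geodesic hγ h0 hr2]
      have hsl : r.2 * m.nrm x (L (c r.1)) ∈ Icc 0 (m.nrm x (L (c r.1))) :=
        ⟨mul_nonneg hr2.1 hγ.pos.le, mul_le_of_le_one_left hγ.pos.le hr2.2⟩
      have e2 := chartMetric_chartVelocity m.h.inner hγ.pos hsl (hγ.mdiff hsl) (e' ▸ hr.2)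
      rw [hγ.ip_vel hsl, chartCurve, ← e'] at e2
      simp only [e, map_smul, smul_apply, smul_eq_mul]
      exact congrArg (fun a => m.nrm x (L (c r.1)) * (m.nrm x (L (c r.1)) * a)) e2 |>.trans (by
        rw [mul_one]))
    (by
      intro e
      have hq1 := Ioo_subset_Icc_self hq.1
      have hq2 := Ioo_subset_Icc_self hq.2
      set ℓ := m.nrm x (L (c q.1)) with hℓ
      have hmaps : ∀ s ∈ Icc (0 : ℝ) 1, s * ℓ ∈ Icc 0 ℓ := fun s hs =>
        ⟨mul_nonneg hs.1 hγ.pos.le, mul_le_of_le_one_left hγ.pos.le hs.2⟩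
      have efan : ∀ s ∈ Icc (0 : ℝ) 1, h.fan c (q.1, s) = γ (s * ℓ) := fun s hs => by
        simp only [fan]
        rw [← h1, h.divide_geodesic hγ h0 hs]
      have key := (hγ.hasDerivWithinAt_momentum (hmaps _ hq2) (c := p)
        (by rw [← efan _ hq2]; exact hsrc) e).scomp (h := fun s : ℝ => s * ℓ) (h' := ℓ)
        (t' := Icc 0 ℓ) q.2
        (by simpa using ((hasDerivAt_id q.2).mul_const ℓ).hasDerivWithinAt) hmaps
      have key2 := (key.hasDerivAt (Icc_mem_nhds hq.2.1 hq.2.2)).const_mul ℓ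
      have hline : Tendsto (fun s : ℝ => ((q.1, s) : ℝ × ℝ)) (𝓝 q.2) (𝓝 q) :=
        (Continuous.prodMk_right q.1).tendsto q.2
      have hd0 : fderiv ℝ U q (0, 1) = ℓ • chartVelocity (𝓡∂ n) p γ ℓ (q.2 * ℓ) := by
        rw [hUd q hq]
        exact h.fderivWithin_fan_snd hT hc hγ h0 hq1 h1 hq2 hsrc
      have hU0 : extChartAt (𝓡∂ n) p (h.fan c q) = chartCurve (𝓡∂ n) p γ (q.2 * ℓ) := by
        rw [chartCurve, ← efan _ hq2]
      refine (key2.congr_of_eventuallyEq ?_).congr_deriv ?_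
      · filter_upwards [hline.eventually hev] with s hs
        have hs2 := Ioo_subset_Icc_self hs.1.2
        rw [hUd _ hs.1]
        have := h.fderivWithin_fan_snd hT hc hγ h0 hq1 h1 hs2 hs.2
        simp only [hU, Function.comp_apply]
        rw [this, efan s hs2]
        simp only [map_smul, smul_apply, smul_eq_mul]
        rfl
      · rw [hd0, hU0]
        simp only [chartExtDeriv, map_smul, smul_apply, smul_eq_mul]
        ring)
  refine ⟨P, f, hP.congr_of_eventuallyEq ?_, hf.congr_of_eventuallyEq ?_, heq⟩
  · filter_upwards [hev] with r hr
    have hrR := mem_of_mem_nhds (hRn r hr.1)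
    rw [fanMomentum, hUd r hr.1]
    simp only [hU, ← hR]
    rw [chartMetric_fderivWithin _ (hmd r hrR) (hRu r hrR) hr.2,
      chartForm_fderivWithin _ (hmd r hrR) (hRu r hrR) hr.2]
  · filter_upwards [hev] with r hr
    have hrR := mem_of_mem_nhds (hRn r hr.1)
    rw [fanDensity, hUd r hr.1]
    simp only [hU, ← hR]
    rw [chartForm_fderivWithin _ (hmd r hrR) (hRu r hrR) hr.2]

end IsLogMap

theorem IsSimple.arrival_unique [T2Space N] (hm : m.IsSimple) {x y : N} {v w : Space n}
    (hv : m.IsArrival x y v) (hw : m.IsArrival x y w) : v = w := by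
  obtain ⟨ℓ, γ, hγ, h0, h1, rfl⟩ := hv
  obtain ⟨ℓ', γ', hγ', h0', h1', rfl⟩ := hw
  obtain rfl := hm.length_eq hγ hγ' (h0.trans h0'.symm) (h1.trans h1'.symm)
  exact hm.vel_eq hγ hγ' (h0.trans h0'.symm) (h1.trans h1'.symm) hγ.right_mem

theorem IsSimple.exists_arrival (hm : m.IsSimple) {x y : N} (h : x ≠ y) :
    ∃ v, m.IsArrival x y v := by
  obtain ⟨ℓ, γ, hγ, h0, h1⟩ := hm.exists_geodesic h
  exact ⟨_, ℓ, γ, hγ, h0, h1, rfl⟩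

/-- The first variation formula for the action from `x` along a curve avoiding `x`. -/
theorem IsSimple.first_variation [T2Space N] [CompactSpace N] (hm : m.IsSimple) {x : N} {T : ℝ}
    {c : ℝ → N} (hT : 0 < T) (hc : ContMDiffOn 𝓘(ℝ, ℝ) (𝓡∂ n) ∞ c (Icc 0 T))
    (hx : ∀ τ ∈ Icc 0 T, c τ ≠ x) {V : ℝ → Space n}
    (hV : ∀ τ ∈ Icc 0 T, m.IsArrival x (c τ) (V τ)) :
    ContinuousOn (fun τ => m.ip (c τ) (V τ) (vel c T τ) - m.pot (c τ) (vel c T τ)) (Icc 0 T) ∧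
    m.action x (c T) - m.action x (c 0)
      = ∫ τ in (0 : ℝ)..T, (m.ip (c τ) (V τ) (vel c T τ) - m.pot (c τ) (vel c T τ)) := by
  obtain ⟨L, h⟩ := hm.exists_isLogMap x
  have hone : ∀ τ ∈ Icc 0 T, h.fanMomentum c T (τ, 1)
      = m.ip (c τ) (V τ) (vel c T τ) - m.pot (c τ) (vel c T τ) := fun τ hτ => by
    obtain ⟨ℓ, γ, hγ, h0, h1, h2⟩ := hV τ hτ
    rw [h.fanMomentum_one hT hc hτ hγ h0 h1, h2]
  have hcm := h.continuousOn_fanMomentum hT hc hx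
  refine ⟨?_, ?_⟩
  · refine (ContinuousOn.congr (f := fun τ => h.fanMomentum c T (τ, 1)) ?_ fun τ hτ => (hone τ hτ).symm)
    exact hcm.comp (Continuous.prodMk_left (1 : ℝ)).continuousOn fun τ hτ => ⟨hτ, zero_le_one, le_rfl⟩
  · set Ro := Ioo 0 T ×ˢ Ioo (0 : ℝ) 1 with hRo
    choose! P f hP hf hPf using fun q (hq : q ∈ Ro) => h.variation_fan hT hc hx hq
    have hzero : ∀ q, Ro.indicator (fun q => -f q) q (1, 0) + Ro.indicator P q (0, 1) = 0 := by
      intro q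
      by_cases hq : q ∈ Ro
      · rw [indicator_of_mem hq, indicator_of_mem hq, hPf q hq]
        simp
      · rw [indicator_of_notMem hq, indicator_of_notMem hq]
        simp
    have hIcc : Icc ((0, 0) : ℝ × ℝ) (T, 1) = Icc 0 T ×ˢ Icc (0 : ℝ) 1 :=
      (Icc_prod_Icc (0 : ℝ) T (0 : ℝ) 1).symm
    -- The field `(-density, momentum)` is divergence free in the open rectangle and continuous up
    -- to the edges; the derivatives are extended by zero. The sides `τ = 0` and `τ = T` contribute
    -- the two actions, the side `s = 1` the integral in the claim.
    have key := MeasureTheory.integral_divergence_prod_Icc_of_hasFDerivAt_of_le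
      (fun q => -h.fanDensity c T q) (h.fanMomentum c T) (Ro.indicator fun q => -f q)
      (Ro.indicator P) (0, 0) (T, 1) ⟨hT.le, zero_le_one⟩
      (by rw [hIcc]; exact (h.continuousOn_fanDensity hT hc).neg)
      (by rw [hIcc]; exact hcm)
      (fun q hq => by rw [indicator_of_mem hq]; exact (hf q hq).neg)
      (fun q hq => by rw [indicator_of_mem hq]; exact hP q hq)
      (by simp only [hzero]; exact MeasureTheory.integrableOn_zero)
    simp only [hzero, MeasureTheory.integral_zero, intervalIntegral.integral_neg] at key
    rw [h.integral_fanDensity hm hT hc ⟨hT.le, le_rfl⟩ (hx T ⟨hT.le, le_rfl⟩),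
      h.integral_fanDensity hm hT hc ⟨le_rfl, hT.le⟩ (hx 0 ⟨le_rfl, hT.le⟩)] at key
    have e1 : ∫ τ in (0 : ℝ)..T, h.fanMomentum c T (τ, 1)
        = ∫ τ in (0 : ℝ)..T, (m.ip (c τ) (V τ) (vel c T τ) - m.pot (c τ) (vel c T τ)) :=
      intervalIntegral.integral_congr fun τ hτ => hone τ (by rwa [uIcc_of_le hT.le] at hτ)
    have e2 : ∫ τ in (0 : ℝ)..T, h.fanMomentum c T (τ, 0) = 0 := by
      rw [intervalIntegral.integral_congr (g := fun _ => (0 : ℝ)) fun τ hτ =>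
        h.fanMomentum_zero hT hc (by rwa [uIcc_of_le hT.le] at hτ)]
      simp
    rw [e1, e2] at key
    linarith

end MagneticSystem
end

/-! ### Uniform short-time estimates in half balls of a chart. -/

section

variable {n : ℕ} [NeZero n] {N : Type*} [TopologicalSpace N]
  [ChartedSpace (EuclideanHalfSpace n) N]

/-- A closed half ball in the range of the chart at `x`, around the image of `x`. -/
def halfBall (x : N) (R : ℝ) : Set (Space n) :=
  Metric.closedBall (extChartAt (𝓡∂ n) x x) R ∩ range (𝓡∂ n)

theorem isCompact_halfBall (x : N) (R : ℝ) : IsCompact (halfBall (n := n) x R) :=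
  (isCompact_closedBall _ _).inter_right (𝓡∂ n).isClosed_range

theorem convex_halfBall (x : N) (R : ℝ) : Convex ℝ (halfBall (n := n) x R) :=
  (convex_closedBall _ _).inter convex_range_halfSpace

theorem exists_halfBall_subset (x : N) :
    ∃ R > 0, halfBall x R ⊆ (extChartAt (𝓡∂ n) x).target := by
  obtain ⟨r, hr, h⟩ := Metric.mem_nhdsWithin_iff.1 (extChartAt_target_mem_nhdsWithin (I := 𝓡∂ n) x)
  exact ⟨r / 2, half_pos hr, fun u hu => h ⟨Metric.closedBall_subset_ball (half_lt_self hr) hu.1, hu.2⟩⟩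

theorem mem_halfBall {x y : N} {R : ℝ} :
    extChartAt (𝓡∂ n) x y ∈ halfBall x R ↔ ‖extChartAt (𝓡∂ n) x y - extChartAt (𝓡∂ n) x x‖ ≤ R := by
  rw [halfBall, mem_inter_iff, Metric.mem_closedBall, dist_eq_norm]
  exact and_iff_left (extChartAt_mem_range x y)

theorem continuousOn_fderivWithin_halfBall {V : Type*} [NormedAddCommGroup V] [NormedSpace ℝ V]
    {x : N} {f : Space n → V} (hf : ContDiffOn ℝ ∞ f (extChartAt (𝓡∂ n) x).target) {R : ℝ}
    (hR : halfBall x R ⊆ (extChartAt (𝓡∂ n) x).target) :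
    ContinuousOn (fderivWithin ℝ f (range (𝓡∂ n))) (halfBall x R) := fun u hu => by
  have h1 : ContDiffWithinAt ℝ ∞ f (range (𝓡∂ n)) u := (hf u (hR hu)).mono_of_mem_nhdsWithin
    (extChartAt_target_mem_nhdsWithin_of_mem (hR hu))
  exact ((h1.fderivWithin_right (𝓡∂ n).uniqueDiffOn (m := 0) (by simp) hu.2).continuousWithinAt).mono
    inter_subset_right

theorem hasFDerivWithinAt_halfBall {V : Type*} [NormedAddCommGroup V] [NormedSpace ℝ V]
    {x : N} {f : Space n → V} (hf : ContDiffOn ℝ ∞ f (extChartAt (𝓡∂ n) x).target) {R : ℝ}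
    (hR : halfBall x R ⊆ (extChartAt (𝓡∂ n) x).target) {u : Space n} (hu : u ∈ halfBall x R) :
    HasFDerivWithinAt f (fderivWithin ℝ f (range (𝓡∂ n)) u) (halfBall x R) u := by
  have h1 : ContDiffWithinAt ℝ ∞ f (range (𝓡∂ n)) u := (hf u (hR hu)).mono_of_mem_nhdsWithin
    (extChartAt_target_mem_nhdsWithin_of_mem (hR hu))
  exact (h1.differentiableWithinAt (by simp)).hasFDerivWithinAt.mono inter_subset_right

theorem norm_sub_le_of_fderivWithin_le {V : Type*} [NormedAddCommGroup V] [NormedSpace ℝ V]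
    {x : N} {f : Space n → V} (hf : ContDiffOn ℝ ∞ f (extChartAt (𝓡∂ n) x).target) {R C : ℝ}
    (hR : halfBall x R ⊆ (extChartAt (𝓡∂ n) x).target)
    (hC : ∀ u ∈ halfBall x R, ‖fderivWithin ℝ f (range (𝓡∂ n)) u‖ ≤ C) {u w : Space n}
    (hu : u ∈ halfBall x R) (hw : w ∈ halfBall x R) : ‖f u - f w‖ ≤ C * ‖u - w‖ :=
  (convex_halfBall x R).norm_image_sub_le_of_norm_hasFDerivWithin_le
    (fun _ h => hasFDerivWithinAt_halfBall hf hR h) hC hw hu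

theorem exists_bounds_halfBall {V : Type*} [NormedAddCommGroup V] [NormedSpace ℝ V]
    {x : N} {f : Space n → V} (hf : ContDiffOn ℝ ∞ f (extChartAt (𝓡∂ n) x).target) {R : ℝ}
    (hR : halfBall x R ⊆ (extChartAt (𝓡∂ n) x).target) :
    ∃ C, (∀ u ∈ halfBall x R, ‖f u‖ ≤ C) ∧
      (∀ u ∈ halfBall x R, ∀ e, ‖fderivWithin ℝ f (range (𝓡∂ n)) u e‖ ≤ C * ‖e‖) ∧
      ∀ u ∈ halfBall x R, ∀ w ∈ halfBall x R, ‖f u - f w‖ ≤ C * ‖u - w‖ := by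
  have hK := isCompact_halfBall (n := n) x R
  obtain ⟨C1, h1⟩ := hK.exists_bound_of_continuousOn (hf.continuousOn.mono hR)
  obtain ⟨C2, h2⟩ := hK.exists_bound_of_continuousOn (continuousOn_fderivWithin_halfBall hf hR)
  have h2' : ∀ u ∈ halfBall x R, ‖fderivWithin ℝ f (range (𝓡∂ n)) u‖ ≤ max C1 C2 :=
    fun u hu => (h2 u hu).trans (le_max_right _ _)
  exact ⟨max C1 C2, fun u hu => (h1 u hu).trans (le_max_left _ _),
    fun u hu e => ContinuousLinearMap.le_of_opNorm_le _ (h2' u hu) e,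
    fun u hu w hw => norm_sub_le_of_fderivWithin_le hf hR h2' hu hw⟩

variable [IsManifold (𝓡∂ n) ∞ N]

namespace MagneticSystem

variable (m : MagneticSystem n N)

/-- Bounds for the metric, the one-form and their first derivatives in a half ball. -/
structure HasChartBounds (x : N) (R C : ℝ) : Prop where
  pos : 0 < R
  one_le : 1 ≤ C
  subset : halfBall x R ⊆ (extChartAt (𝓡∂ n) x).target
  gram_le : ∀ u ∈ halfBall x R, ‖m.gram x u‖ ≤ C
  cpot_le : ∀ u ∈ halfBall x R, ‖m.cpot x u‖ ≤ C
  dgram_le : ∀ u ∈ halfBall x R, ∀ e,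
    ‖fderivWithin ℝ (chartMetric (𝓡∂ n) m.h.inner x) (range (𝓡∂ n)) u e‖ ≤ C * ‖e‖
  dcpot_le : ∀ u ∈ halfBall x R, ∀ e,
    ‖fderivWithin ℝ (chartForm (𝓡∂ n) m.om x) (range (𝓡∂ n)) u e‖ ≤ C * ‖e‖
  gram_sub_le : ∀ u ∈ halfBall x R, ∀ w ∈ halfBall x R, ‖m.gram x u - m.gram x w‖ ≤ C * ‖u - w‖
  cpot_sub_le : ∀ u ∈ halfBall x R, ∀ w ∈ halfBall x R, ‖m.cpot x u - m.cpot x w‖ ≤ C * ‖u - w‖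
  norm_sq_le : ∀ u ∈ halfBall x R, ∀ v : Space n, ‖v‖ ^ 2 ≤ C * m.gram x u v v

theorem gram_pos {x : N} {u : Space n} (hu : u ∈ (extChartAt (𝓡∂ n) x).target) {v : Space n}
    (hv : v ≠ 0) : 0 < m.gram x u v v := by
  rw [← (extChartAt (𝓡∂ n) x).right_inv hu, gram, chartMetric_apply_of_mem _ (by
    rw [← extChartAt_source (𝓡∂ n)]; exact (extChartAt (𝓡∂ n) x).map_target hu)]
  refine m.ip_pos _ fun h => hv (frameAt_injective (c := x)
    (p := (extChartAt (𝓡∂ n) x).symm u) ?_ (by rw [h, map_zero]))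
  rw [← extChartAt_source (𝓡∂ n)]
  exact (extChartAt (𝓡∂ n) x).map_target hu

theorem exists_hasChartBounds (x : N) : ∃ R C, m.HasChartBounds x R C := by
  obtain ⟨R, hR, hsub⟩ := exists_halfBall_subset (n := n) x
  have hK := isCompact_halfBall (n := n) x R
  have hG : ContinuousOn (chartMetric (𝓡∂ n) m.h.inner x) (halfBall x R) :=
    (m.contDiffOn_gram x).continuousOn.mono hsub
  obtain ⟨C1, h1, h2, h3⟩ := exists_bounds_halfBall (V := Space n →L[ℝ] Space n →L[ℝ] ℝ)
    (m.contDiffOn_gram x) hsub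
  obtain ⟨C2, i1, i2, i3⟩ := exists_bounds_halfBall (m.contDiffOn_cpot x) hsub
  -- The bound `norm_sq_le` comes from compactness of the half ball times the unit sphere, followed
  -- by scaling.
  have h5 : ContinuousOn (fun q : Space n × Space n => (m.gram x q.1 q.2 q.2)⁻¹)
      (halfBall x R ×ˢ Metric.sphere 0 1) := by
    refine ContinuousOn.inv₀ ?_ fun q hq => (m.gram_pos (hsub hq.1) ?_).ne'
    · exact ((hG.comp continuousOn_fst fun _ hq => hq.1).clm_apply continuousOn_snd).clm_apply
        continuousOn_snd
    · intro h0
      have := hq.2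
      rw [h0] at this
      simp at this
  obtain ⟨C5, h5⟩ := (hK.prod (isCompact_sphere (0 : Space n) 1)).exists_bound_of_continuousOn h5
  set C := max 1 (max C1 (max C2 C5)) with hC
  have c1 : C1 ≤ C := by simp [C]
  have c2 : C2 ≤ C := by simp [C]
  refine ⟨R, C, hR, le_max_left _ _, hsub, fun u hu => (h1 u hu).trans c1,
    fun u hu => (i1 u hu).trans c2, fun u hu e => (h2 u hu e).trans (by gcongr),
    fun u hu e => (i2 u hu e).trans (by gcongr), fun u hu w hw => (h3 u hu w hw).trans (by gcongr),
    fun u hu w hw => (i3 u hu w hw).trans (by gcongr), fun u hu v => ?_⟩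
  rcases eq_or_ne v 0 with rfl | hv
  · simp
  have hv' : 0 < ‖v‖ := norm_pos_iff.2 hv
  have h6 := h5 (u, ‖v‖⁻¹ • v) ⟨hu, by simp [norm_smul, hv'.ne']⟩
  have hpos := m.gram_pos (hsub hu) hv
  simp only [map_smul, smul_apply, smul_eq_mul, mul_inv_rev, inv_inv, norm_mul, norm_inv, norm_norm,
    Real.norm_of_nonneg hpos.le] at h6
  have h7 : (m.gram x u v v)⁻¹ * ‖v‖ ^ 2 ≤ C := by
    refine le_trans (le_of_eq ?_) (h6.trans (by simp [C]))
    ring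
  rwa [inv_mul_le_iff₀ hpos, mul_comm] at h7

variable {m}

namespace HasChartBounds

variable {x : N} {R C : ℝ}

theorem norm_le (hb : m.HasChartBounds x R C) {u : Space n} (hu : u ∈ halfBall x R) (v : Space n) :
    ‖v‖ ≤ C * √(m.gram x u v v) := by
  have h1 := hb.norm_sq_le u hu v
  have hC := hb.one_le
  have h0 : 0 ≤ m.gram x u v v := by
    by_contra! h
    nlinarith [sq_nonneg ‖v‖]
  refine (sq_le_sq₀ (norm_nonneg v) (by positivity)).1 ?_
  rw [mul_pow, Real.sq_sqrt h0]
  nlinarith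

theorem self_mem (hb : m.HasChartBounds x R C) : extChartAt (𝓡∂ n) x x ∈ halfBall x R :=
  mem_halfBall.2 (by simpa using hb.pos.le)

section Geodesic

variable {ℓ : ℝ} {γ : ℝ → N}

theorem norm_chartVelocity_le (hb : m.HasChartBounds x R C) (hγ : m.IsMagneticGeodesic ℓ γ) {s : ℝ}
    (hs : s ∈ Icc 0 ℓ) (h1 : γ s ∈ (chartAt (EuclideanHalfSpace n) x).source)
    (h2 : chartCurve (𝓡∂ n) x γ s ∈ halfBall x R) : ‖chartVelocity (𝓡∂ n) x γ ℓ s‖ ≤ C := by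
  have h3 := chartMetric_chartVelocity m.h.inner hγ.pos hs (hγ.mdiff hs) h1
  have h4 := hb.norm_le h2 (chartVelocity (𝓡∂ n) x γ ℓ s)
  rw [gram, h3, hγ.ip_vel hs] at h4
  simpa using h4

theorem norm_chartCurve_sub_le (hb : m.HasChartBounds x R C) (hγ : m.IsMagneticGeodesic ℓ γ) {s : ℝ}
    (hs : s ∈ Icc 0 ℓ) (h : ∀ r ∈ Icc 0 s, γ r ∈ (chartAt (EuclideanHalfSpace n) x).source ∧
      chartCurve (𝓡∂ n) x γ r ∈ halfBall x R) :
    ‖chartCurve (𝓡∂ n) x γ s - chartCurve (𝓡∂ n) x γ 0‖ ≤ C * s := by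
  have hsub : Icc 0 s ⊆ Icc 0 ℓ := Icc_subset_Icc_right hs.2
  have := (convex_Icc (0 : ℝ) s).norm_image_sub_le_of_norm_hasDerivWithin_le
    (f := chartCurve (𝓡∂ n) x γ) (f' := chartVelocity (𝓡∂ n) x γ ℓ) (C := C)
    (fun r hr => (hasDerivWithinAt_chartCurve (I := 𝓡∂ n) (hγ.mdiff (hsub hr)) (h r hr).1).mono hsub)
    (fun r hr => hb.norm_chartVelocity_le hγ (hsub hr) (h r hr).1 (h r hr).2)
    (left_mem_Icc.2 hs.1) (right_mem_Icc.2 hs.1)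
  simpa [Real.norm_of_nonneg hs.1] using this

/-- A continuity argument: as long as the curve stays in the closed half ball its chart speed is at
most `C`, so up to time `s` it remains strictly inside and cannot leave. Compactness of the half
ball makes the set of admissible times closed. -/
theorem mem_chart [T2Space N] (hb : m.HasChartBounds x R C) (hγ : m.IsMagneticGeodesic ℓ γ) {s : ℝ}
    (hs : s ∈ Icc 0 ℓ) (h1 : γ 0 ∈ (chartAt (EuclideanHalfSpace n) x).source)
    (h2 : ‖chartCurve (𝓡∂ n) x γ 0 - extChartAt (𝓡∂ n) x x‖ + C * s < R) :
    ∀ r ∈ Icc 0 s, γ r ∈ (chartAt (EuclideanHalfSpace n) x).source ∧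
      chartCurve (𝓡∂ n) x γ r ∈ halfBall x R := by
  have hC := hb.one_le
  set Q : Set N := (extChartAt (𝓡∂ n) x).symm '' halfBall x R with hQ
  have hQc : IsClosed Q := ((isCompact_halfBall x R).image_of_continuousOn
    ((continuousOn_extChartAt_symm x).mono hb.subset)).isClosed
  have hQ' : ∀ y ∈ Q, y ∈ (chartAt (EuclideanHalfSpace n) x).source ∧
      extChartAt (𝓡∂ n) x y ∈ halfBall x R := by
    rintro _ ⟨u, hu, rfl⟩
    refine ⟨?_, ?_⟩
    · rw [← extChartAt_source (𝓡∂ n)]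
      exact (extChartAt (𝓡∂ n) x).map_target (hb.subset hu)
    · rwa [(extChartAt (𝓡∂ n) x).right_inv (hb.subset hu)]
  have hQn : ∀ y ∈ (chartAt (EuclideanHalfSpace n) x).source,
      ‖extChartAt (𝓡∂ n) x y - extChartAt (𝓡∂ n) x x‖ < R → Q ∈ 𝓝 y := by
    intro y hy hyR
    rw [← extChartAt_source (𝓡∂ n)] at hy
    filter_upwards [extChartAt_source_mem_nhds' (I := 𝓡∂ n) hy,
      (continuousAt_extChartAt' (I := 𝓡∂ n) hy) (Metric.isOpen_ball.mem_nhds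
        (show _ ∈ Metric.ball (extChartAt (𝓡∂ n) x x) R by rwa [Metric.mem_ball, dist_eq_norm]))]
      with z hz hz'
    exact ⟨_, ⟨Metric.ball_subset_closedBall hz', extChartAt_mem_range x z⟩,
      (extChartAt (𝓡∂ n) x).left_inv hz⟩
  have hsub : Icc 0 s ⊆ Icc 0 ℓ := Icc_subset_Icc_right hs.2
  have hcont : ContinuousOn γ (Icc 0 s) := hγ.smooth.continuousOn.mono hsub
  have key : ∀ r ∈ Icc 0 s, γ r ∈ Q := by
    set A : Set ℝ := {r | ∀ t ∈ Icc 0 s, t ≤ r → γ t ∈ Q} with hA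
    have hA0 : (0 : ℝ) ∈ A := by
      intro t ht ht'
      obtain rfl : t = 0 := le_antisymm ht' ht.1
      exact mem_of_mem_nhds (hQn _ h1 (by
        refine lt_of_le_of_lt ?_ h2
        have := mul_nonneg (zero_le_one.trans hC) hs.1
        exact le_add_of_nonneg_right this))
    have hAc : IsClosed (A ∩ Icc 0 s) := by
      have hcl : IsClosed (Icc 0 s ∩ γ ⁻¹' Q) := hcont.preimage_isClosed_of_isClosed isClosed_Icc hQc
      refine isClosed_of_closure_subset fun r hr => ?_
      have hrI : r ∈ Icc 0 s := closure_minimal inter_subset_right isClosed_Icc hr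
      refine ⟨fun t ht htr => ?_, hrI⟩
      rcases htr.eq_or_lt with rfl | hlt
      · have hsubA : A ∩ Icc 0 s ⊆ Icc 0 s ∩ γ ⁻¹' Q := fun a ha => ⟨ha.2, ha.1 a ha.2 le_rfl⟩
        exact (closure_minimal hsubA hcl hr).2
      · obtain ⟨a, ha, ha'⟩ := mem_closure_iff_nhds.1 hr (Ioi t) (Ioi_mem_nhds hlt)
        exact ha'.1 t ht (le_of_lt ha)
    have hsubset := hAc.Icc_subset_of_forall_mem_nhdsWithin hA0 fun r hr => by
      have hrI : r ∈ Icc 0 s := ⟨hr.2.1, hr.2.2.le⟩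
      have hin : ∀ t ∈ Icc 0 r, γ t ∈ (chartAt (EuclideanHalfSpace n) x).source ∧
          chartCurve (𝓡∂ n) x γ t ∈ halfBall x R := fun t ht =>
        hQ' _ (hr.1 t ⟨ht.1, ht.2.trans hrI.2⟩ ht.2)
      have hle := hb.norm_chartCurve_sub_le hγ (hsub hrI) hin
      have hlt : ‖extChartAt (𝓡∂ n) x (γ r) - extChartAt (𝓡∂ n) x x‖ < R := by
        have e : extChartAt (𝓡∂ n) x (γ r) - extChartAt (𝓡∂ n) x x
            = (chartCurve (𝓡∂ n) x γ r - chartCurve (𝓡∂ n) x γ 0)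
              + (chartCurve (𝓡∂ n) x γ 0 - extChartAt (𝓡∂ n) x x) := by
          simp [chartCurve]
        have hCr : C * r ≤ C * s := by gcongr; exact hrI.2
        rw [e]
        exact (norm_add_le _ _).trans_lt (by linarith)
      have hn := hcont r hrI (hQn _ (hin r (right_mem_Icc.2 hrI.1)).1 hlt)
      obtain ⟨ε, hε, hε'⟩ := Metric.mem_nhdsWithin_iff.1 hn
      have : Iio (r + ε) ∈ 𝓝[>] r := mem_nhdsWithin_of_mem_nhds (Iio_mem_nhds (by linarith))
      filter_upwards [this] with a ha t ht hta
      rcases le_or_gt t r with htr | htr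
      · exact hr.1 t ht htr
      · refine hε' ⟨?_, ht⟩
        rw [Metric.mem_ball, Real.dist_eq, abs_of_pos (sub_pos.2 htr)]
        have : a < r + ε := ha
        linarith
    exact fun r hr => (hsubset hr) r hr le_rfl
  exact fun r hr => hQ' _ (key r hr)

/-- The momentum equation bounds the change of the covector `g(v, ·)`; coercivity converts this into
a bound on the velocity itself, with no need to solve for the acceleration. The factor `4` is `3`
from the momentum and `1` from the change of the metric along the curve. -/
theorem norm_chartVelocity_sub_le (hb : m.HasChartBounds x R C) (hγ : m.IsMagneticGeodesic ℓ γ)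
    {s : ℝ} (hs : s ∈ Icc 0 ℓ) (h : ∀ r ∈ Icc 0 s,
      γ r ∈ (chartAt (EuclideanHalfSpace n) x).source ∧ chartCurve (𝓡∂ n) x γ r ∈ halfBall x R) :
    ‖chartVelocity (𝓡∂ n) x γ ℓ s - chartVelocity (𝓡∂ n) x γ ℓ 0‖ ≤ 4 * C ^ 4 * s := by
  have hC := hb.one_le
  have hC0 : 0 ≤ C := zero_le_one.trans hC
  have hsub : Icc 0 s ⊆ Icc 0 ℓ := Icc_subset_Icc_right hs.2
  have h0s := left_mem_Icc.2 hs.1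
  have hss := right_mem_Icc.2 hs.1
  set u := chartCurve (𝓡∂ n) x γ with hu
  set v := chartVelocity (𝓡∂ n) x γ ℓ with hv
  have hvC : ∀ r ∈ Icc 0 s, ‖v r‖ ≤ C := fun r hr =>
    hb.norm_chartVelocity_le hγ (hsub hr) (h r hr).1 (h r hr).2
  have key : ∀ e : Space n, |m.gram x (u s) (v s) e - m.gram x (u 0) (v 0) e| ≤ 3 * C ^ 3 * ‖e‖ * s := by
    intro e
    have := (convex_Icc (0 : ℝ) s).norm_image_sub_le_of_norm_hasDerivWithin_le
      (f := fun r => m.gram x (u r) (v r) e) (C := 3 * C ^ 3 * ‖e‖)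
      (fun r hr => (hγ.hasDerivWithinAt_momentum (hsub hr) (h r hr).1 e).mono hsub)
      (fun r hr => by
        have b1 := (h r hr).2
        have b2 := hvC r hr
        have k1 := ContinuousLinearMap.le_of_opNorm_le _ (hb.dcpot_le _ b1 (v r)) e
        have k2 := ContinuousLinearMap.le_of_opNorm_le _ (hb.dcpot_le _ b1 e) (v r)
        have k3 := ContinuousLinearMap.le_of_opNorm₂_le_of_le _ (hb.dgram_le _ b1 e) b2 b2
        have j1 : C * ‖v r‖ * ‖e‖ ≤ C * C * ‖e‖ := by gcongr
        have j2 : C * ‖e‖ * ‖v r‖ ≤ C * ‖e‖ * C := by gcongr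
        have j4 : C * C * ‖e‖ ≤ C ^ 3 * ‖e‖ := by
          gcongr
          nlinarith [mul_nonneg hC0 hC0]
        have j5 : 0 ≤ C ^ 3 * ‖e‖ := by positivity
        refine (norm_add_le _ _).trans ?_
        rw [norm_mul, chartExtDeriv]
        have i1 := norm_sub_le (fderivWithin ℝ (chartForm (𝓡∂ n) m.om x) (range (𝓡∂ n)) (u r) (v r) e)
          (fderivWithin ℝ (chartForm (𝓡∂ n) m.om x) (range (𝓡∂ n)) (u r) e (v r))
        have i2 : ‖(1 / 2 : ℝ)‖ = 1 / 2 := by norm_num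
        rw [i2]
        linarith)
      h0s hss
    simpa [Real.norm_of_nonneg hs.1] using this
  -- The momentum estimate is tested with the velocity change itself, so that `norm_sq_le` applies
  -- to `g(e, e)`.
  set e := v s - v 0 with he
  have h1 := key e
  have h2 : |(m.gram x (u s) - m.gram x (u 0)) (v 0) e| ≤ C ^ 3 * ‖e‖ * s := by
    refine ((m.gram x (u s) - m.gram x (u 0)).le_opNorm₂ (v 0) e).trans ?_
    have i1 := hb.gram_sub_le _ (h s hss).2 _ (h 0 h0s).2
    have i2 := hb.norm_chartCurve_sub_le hγ hs h
    have i3 := hvC 0 h0s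
    calc ‖m.gram x (u s) - m.gram x (u 0)‖ * ‖v 0‖ * ‖e‖ ≤ (C * (C * s)) * C * ‖e‖ := by
          have i4 := i1.trans (mul_le_mul_of_nonneg_left i2 hC0)
          have i5 : 0 ≤ C * (C * s) := mul_nonneg hC0 (mul_nonneg hC0 hs.1)
          gcongr
      _ = C ^ 3 * ‖e‖ * s := by ring
  have h3 : m.gram x (u s) e e = (m.gram x (u s) (v s) e - m.gram x (u 0) (v 0) e)
      - (m.gram x (u s) - m.gram x (u 0)) (v 0) e := by
    have : m.gram x (u s) e e = m.gram x (u s) (v s) e - m.gram x (u s) (v 0) e := by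
      rw [← sub_apply, ← map_sub]
    rw [this, sub_apply, sub_apply]
    ring
  have h4 := hb.norm_sq_le _ (h s hss).2 e
  have h5 : m.gram x (u s) e e ≤ 4 * C ^ 3 * ‖e‖ * s := by
    rw [h3]
    have := (abs_le.1 h1).2
    have := (abs_le.1 h2).1
    linarith
  have h6 : ‖e‖ ^ 2 ≤ (4 * C ^ 4 * s) * ‖e‖ := by
    calc ‖e‖ ^ 2 ≤ C * (4 * C ^ 3 * ‖e‖ * s) := h4.trans (by gcongr)
      _ = _ := by ring
  rcases (norm_nonneg e).eq_or_lt with h0 | h0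
  · rw [← h0]
    have := hs.1
    positivity
  · rw [sq] at h6
    exact le_of_mul_le_mul_right h6 h0

theorem norm_chartCurve_sub_sub_le (hb : m.HasChartBounds x R C) (hγ : m.IsMagneticGeodesic ℓ γ)
    {s : ℝ} (hs : s ∈ Icc 0 ℓ) (h : ∀ r ∈ Icc 0 s,
      γ r ∈ (chartAt (EuclideanHalfSpace n) x).source ∧ chartCurve (𝓡∂ n) x γ r ∈ halfBall x R) :
    ‖chartCurve (𝓡∂ n) x γ s - chartCurve (𝓡∂ n) x γ 0 - s • chartVelocity (𝓡∂ n) x γ ℓ 0‖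
      ≤ 4 * C ^ 4 * s ^ 2 := by
  have hC := hb.one_le
  have hsub : Icc 0 s ⊆ Icc 0 ℓ := Icc_subset_Icc_right hs.2
  have := (convex_Icc (0 : ℝ) s).norm_image_sub_le_of_norm_hasDerivWithin_le
    (f := fun r => chartCurve (𝓡∂ n) x γ r - r • chartVelocity (𝓡∂ n) x γ ℓ 0)
    (f' := fun r => chartVelocity (𝓡∂ n) x γ ℓ r - (1 : ℝ) • chartVelocity (𝓡∂ n) x γ ℓ 0)
    (C := 4 * C ^ 4 * s)
    (fun r hr => ((hasDerivWithinAt_chartCurve (I := 𝓡∂ n) (hγ.mdiff (hsub hr)) (h r hr).1).mono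
      hsub).sub ((hasDerivAt_id r).smul_const _).hasDerivWithinAt)
    (fun r hr => by
      rw [one_smul]
      refine (hb.norm_chartVelocity_sub_le hγ (hsub hr)
        fun t ht => h t ⟨ht.1, ht.2.trans hr.2⟩).trans ?_
      gcongr
      exact hr.2)
    (left_mem_Icc.2 hs.1) (right_mem_Icc.2 hs.1)
  simp only [zero_smul, sub_zero, Real.norm_of_nonneg hs.1] at this
  rw [sub_right_comm]
  refine this.trans (le_of_eq ?_)
  ring

/-- The integrand `1 - ω(γ̇)` is frozen at the chart centre and the initial velocity; the position
and velocity estimates bound the error by a multiple of the time plus the initial distance to the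
centre. -/
theorem abs_action_sub_le [T2Space N] (hb : m.HasChartBounds x R C) (hm : m.IsSimple)
    (hγ : m.IsMagneticGeodesic ℓ γ) {s : ℝ} (hs : s ∈ Icc 0 ℓ) (h : ∀ r ∈ Icc 0 s,
      γ r ∈ (chartAt (EuclideanHalfSpace n) x).source ∧ chartCurve (𝓡∂ n) x γ r ∈ halfBall x R) :
    |m.action (γ 0) (γ s) - s * (1 - m.pot x (chartVelocity (𝓡∂ n) x γ ℓ 0))|
      ≤ 5 * C ^ 5 * s * (s + ‖chartCurve (𝓡∂ n) x γ 0 - extChartAt (𝓡∂ n) x x‖) := by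
  have hC := hb.one_le
  have hC0 : 0 ≤ C := zero_le_one.trans hC
  have hsub : Icc 0 s ⊆ Icc 0 ℓ := Icc_subset_Icc_right hs.2
  set u := chartCurve (𝓡∂ n) x γ with hu
  set v := chartVelocity (𝓡∂ n) x γ ℓ with hv
  set d := ‖u 0 - extChartAt (𝓡∂ n) x x‖ with hd
  have hd0 : 0 ≤ d := norm_nonneg _
  have h1 : s * (1 - m.pot x (v 0)) = ∫ _ in (0 : ℝ)..s, (1 - m.pot x (v 0)) := by
    rw [intervalIntegral.integral_const, sub_zero, smul_eq_mul]
  rw [hm.action_eq_integral hγ le_rfl hs.1 hs.2, h1, ← intervalIntegral.integral_sub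
    (hγ.intervalIntegrable hγ.zero_mem hs) intervalIntegrable_const]
  have key : ∀ r ∈ Icc 0 s, ‖(1 - m.pot (γ r) (vel γ ℓ r)) - (1 - m.pot x (v 0))‖
      ≤ 5 * C ^ 5 * (s + d) := by
    intro r hr
    obtain ⟨a1, a2⟩ := h r hr
    have hr' : ∀ t ∈ Icc 0 r, γ t ∈ (chartAt (EuclideanHalfSpace n) x).source ∧
      chartCurve (𝓡∂ n) x γ t ∈ halfBall x R := fun t ht => h t ⟨ht.1, ht.2.trans hr.2⟩
    have e1 : m.pot (γ r) (vel γ ℓ r) = m.cpot x (u r) (v r) :=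
      (chartForm_chartVelocity m.om hγ.pos (hsub hr) (hγ.mdiff (hsub hr)) a1).symm
    have e2 : m.pot x = m.cpot x (extChartAt (𝓡∂ n) x x) := (chartForm_self m.om x).symm
    rw [e1, e2]
    have e3 : (1 - m.cpot x (u r) (v r)) - (1 - m.cpot x (extChartAt (𝓡∂ n) x x) (v 0))
        = -((m.cpot x (u r) - m.cpot x (extChartAt (𝓡∂ n) x x)) (v r)
          + m.cpot x (extChartAt (𝓡∂ n) x x) (v r - v 0)) := by
      rw [sub_apply, map_sub]; ring
    rw [e3, norm_neg]
    have i1 := hb.norm_chartCurve_sub_le hγ (hsub hr) hr'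
    have i2 : ‖u r - extChartAt (𝓡∂ n) x x‖ ≤ C * r + d := by
      have : u r - extChartAt (𝓡∂ n) x x = (u r - u 0) + (u 0 - extChartAt (𝓡∂ n) x x) := by abel
      rw [this]
      exact (norm_add_le _ _).trans (by gcongr)
    have i3 := hb.cpot_sub_le _ a2 _ hb.self_mem
    have i4 := hb.norm_chartVelocity_le hγ (hsub hr) a1 a2
    have i5 := hb.norm_chartVelocity_sub_le hγ (hsub hr) hr'
    have i6 := hb.cpot_le _ hb.self_mem
    have j1 : ‖(m.cpot x (u r) - m.cpot x (extChartAt (𝓡∂ n) x x)) (v r)‖ ≤ (C * (C * s + d)) * C := by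
      refine ContinuousLinearMap.le_of_opNorm_le_of_le _ (i3.trans ?_) i4
      gcongr
      refine i2.trans ?_
      gcongr
      exact hr.2
    have j2 : ‖m.cpot x (extChartAt (𝓡∂ n) x x) (v r - v 0)‖ ≤ C * (4 * C ^ 4 * s) := by
      refine ContinuousLinearMap.le_of_opNorm_le_of_le _ i6 (i5.trans ?_)
      gcongr
      exact hr.2
    refine (norm_add_le _ _).trans ((add_le_add j1 j2).trans ?_)
    have k1 : C ^ 3 ≤ C ^ 5 := pow_le_pow_right₀ hC (by norm_num)
    have k2 : C ^ 2 ≤ C ^ 5 := pow_le_pow_right₀ hC (by norm_num)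
    have k3 := mul_le_mul_of_nonneg_right k1 hs.1
    have k4 := mul_le_mul_of_nonneg_right k2 hd0
    have k5 : 0 ≤ C ^ 5 * d := by positivity
    nlinarith
  have := intervalIntegral.norm_integral_le_of_norm_le_const (a := 0) (b := s)
    (f := fun r => (1 - m.pot (γ r) (vel γ ℓ r)) - (1 - m.pot x (v 0))) (C := 5 * C ^ 5 * (s + d))
    (fun r hr => key r (by
      rw [uIoc_of_le hs.1] at hr
      exact ⟨hr.1.le, hr.2⟩))
  rw [Real.norm_eq_abs, sub_zero, abs_of_nonneg hs.1] at this
  refine this.trans (le_of_eq ?_)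
  ring

end Geodesic

end HasChartBounds

end MagneticSystem
end

/-! ### Calibration and the triangle inequality for the action. -/

section

variable {n : ℕ} [NeZero n] {N : Type*} [TopologicalSpace N]
  [ChartedSpace (EuclideanHalfSpace n) N] [IsManifold (𝓡∂ n) ∞ N]

omit [IsManifold (𝓡∂ n) ∞ N] in
theorem contMDiffOn_segment {T : ℝ} {c : ℝ → N} (hc : ContMDiffOn 𝓘(ℝ, ℝ) (𝓡∂ n) ∞ c (Icc 0 T))
    {a b : ℝ} (ha : 0 ≤ a) (hb : b ≤ T) :
    ContMDiffOn 𝓘(ℝ, ℝ) (𝓡∂ n) ∞ (c ∘ fun s => a + s) (Icc 0 (b - a)) :=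
  hc.comp (contDiff_const.add contDiff_id).contMDiff.contMDiffOn fun s hs =>
    ⟨by linarith [hs.1], by linarith [hs.2]⟩

theorem vel_comp_add {T : ℝ} {c : ℝ → N} (hT : 0 < T)
    (hc : ContMDiffOn 𝓘(ℝ, ℝ) (𝓡∂ n) ∞ c (Icc 0 T)) {a b s : ℝ} (ha : 0 ≤ a) (hab : a < b)
    (hb : b ≤ T) (hs : s ∈ Icc 0 (b - a)) :
    vel (n := n) (c ∘ fun s => a + s) (b - a) s = vel c T (a + s) := by
  have hmaps : MapsTo (fun s => a + s) (Icc 0 (b - a)) (Icc 0 T) := fun s hs =>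
    ⟨by linarith [hs.1], by linarith [hs.2]⟩
  have hd : HasDerivWithinAt (fun s => a + s) 1 (Icc 0 (b - a)) s :=
    ((hasDerivAt_id s).const_add a).hasDerivWithinAt
  rw [vel, velocityAt_comp hT (sub_pos.2 hab) hs hd hmaps (mdiffAt_of_contMDiffOn hc (hmaps hs)),
    one_smul]

namespace MagneticSystem

variable (m : MagneticSystem n N)

theorem ip_nonneg (x : N) (v : Space n) : 0 ≤ m.ip x v v := by
  rcases eq_or_ne v 0 with rfl | hv
  · simp
  · exact (m.ip_pos x hv).le

theorem nrm_sq (x : N) (v : Space n) : m.nrm x v ^ 2 = m.ip x v v := Real.sq_sqrt (m.ip_nonneg x v)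

theorem ip_sq_le (x : N) (v w : Space n) : m.ip x v w ^ 2 ≤ m.ip x v v * m.ip x w w := by
  rcases eq_or_ne w 0 with rfl | hw
  · simp
  have hc := m.ip_pos x hw
  have h := m.ip_nonneg x (m.ip x w w • v - m.ip x v w • w)
  simp only [map_sub, map_smul, sub_apply, smul_apply, smul_eq_mul, m.ip_symm x w v] at h
  have h2 : 0 ≤ m.ip x w w * (m.ip x v v * m.ip x w w - m.ip x v w ^ 2) := by
    refine h.trans (le_of_eq ?_)
    ring
  have := nonneg_of_mul_nonneg_right h2 hc
  linarith

theorem ip_le (x : N) (v w : Space n) : m.ip x v w ≤ m.nrm x v * m.nrm x w := by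
  rw [nrm, nrm, ← Real.sqrt_mul (m.ip_nonneg x v)]
  exact Real.le_sqrt_of_sq_le (m.ip_sq_le x v w)

theorem eq_of_ip_eq {x : N} {v w : Space n} (hv : m.ip x v v = 1) (hw : m.ip x w w = 1)
    (h : m.ip x v w = 1) : v = w := by
  by_contra hne
  have := m.ip_pos x (sub_ne_zero.2 hne)
  simp only [map_sub, sub_apply, m.ip_symm x w v, hv, hw, h] at this
  norm_num at this

theorem continuousOn_curveAction_integrand {T : ℝ} {c : ℝ → N} (hT : 0 < T)
    (hc : ContMDiffOn 𝓘(ℝ, ℝ) (𝓡∂ n) ∞ c (Icc 0 T)) :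
    ContinuousOn (fun s => m.nrm (c s) (vel c T s) - m.pot (c s) (vel c T s)) (Icc 0 T) :=
  (m.continuousOn_nrm_vel hT hc).sub (m.continuousOn_pot_vel hT hc)

theorem curveAction_segment {T : ℝ} {c : ℝ → N} (hT : 0 < T)
    (hc : ContMDiffOn 𝓘(ℝ, ℝ) (𝓡∂ n) ∞ c (Icc 0 T)) {a b : ℝ} (ha : 0 ≤ a) (hab : a < b)
    (hb : b ≤ T) : m.curveAction (b - a) (c ∘ fun s => a + s)
      = ∫ s in a..b, (m.nrm (c s) (vel c T s) - m.pot (c s) (vel c T s)) := by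
  have h := intervalIntegral.integral_comp_add_left (a := 0) (b := b - a)
    (fun s => m.nrm (c s) (vel c T s) - m.pot (c s) (vel c T s)) a
  simp only [add_zero, add_sub_cancel] at h
  rw [← h]
  refine intervalIntegral.integral_congr fun s hs => ?_
  rw [uIcc_of_le (sub_pos.2 hab).le] at hs
  simp only [vel_comp_add hT hc ha hab hb hs, Function.comp_apply]

variable {m}

theorem IsArrival.ip_self {x y : N} {v : Space n} (h : m.IsArrival x y v) : m.ip y v v = 1 := by
  obtain ⟨ℓ, γ, hγ, -, rfl, rfl⟩ := h
  exact hγ.ip_vel hγ.right_mem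

theorem IsArrival.nrm_eq {x y : N} {v : Space n} (h : m.IsArrival x y v) : m.nrm y v = 1 := by
  rw [nrm, h.ip_self, Real.sqrt_one]

namespace IsSimple

variable [T2Space N] [CompactSpace N]

/-- The first variation formula, together with `(V, ċ) ≤ |ċ|` for the unit arrival velocity `V`. -/
theorem action_sub_le_of_ne (hm : m.IsSimple) {x : N} {T : ℝ} {c : ℝ → N} (hT : 0 < T)
    (hc : ContMDiffOn 𝓘(ℝ, ℝ) (𝓡∂ n) ∞ c (Icc 0 T)) (hx : ∀ τ ∈ Icc 0 T, c τ ≠ x) :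
    m.action x (c T) - m.action x (c 0) ≤ m.curveAction T c := by
  choose! V hV using fun τ (hτ : τ ∈ Icc 0 T) => hm.exists_arrival (hx τ hτ).symm
  obtain ⟨h1, h2⟩ := hm.first_variation hT hc hx hV
  rw [h2, curveAction]
  refine intervalIntegral.integral_mono_on hT.le ?_ ?_ fun τ hτ => ?_
  · exact ContinuousOn.intervalIntegrable (by rwa [uIcc_of_le hT.le])
  · apply ContinuousOn.intervalIntegrable
    rw [uIcc_of_le hT.le]
    exact m.continuousOn_curveAction_integrand hT hc
  · have := m.ip_le (c τ) (V τ) (vel c T τ)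
    rw [(hV τ hτ).nrm_eq, one_mul] at this
    exact sub_le_sub_right this _

-- The length of the geodesic is the norm of the logarithm and tends to zero, and the action is of
-- the order of the length. This covers curves that start or end at `x`, where the first variation
-- formula does not apply.
omit [CompactSpace N] in
theorem tendsto_action_self (hm : m.IsSimple) (x : N) : Tendsto (m.action x) (𝓝 x) (𝓝 0) := by
  obtain ⟨R, C, hb⟩ := m.exists_hasChartBounds x
  obtain ⟨L, hL⟩ := hm.exists_isLogMap x
  have hC := hb.one_le
  set ℓ : N → ℝ := fun y => m.nrm x (L y) with hℓ
  have hℓc : Tendsto ℓ (𝓝 x) (𝓝 0) := by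
    have : Continuous ℓ := (((m.ip x).continuous.comp hL.continuous).clm_apply hL.continuous).sqrt
    have h := this.tendsto x
    simpa [hℓ, hL.apply_self, nrm] using h
  have hbound : ∀ᶠ y in 𝓝 x, ‖m.action x y‖ ≤ ℓ y * (1 + C * C) + 5 * C ^ 5 * ℓ y * ℓ y := by
    filter_upwards [hℓc (Iio_mem_nhds (show 0 < R / C by have := hb.pos; positivity))] with y hy
    rcases eq_or_ne y x with rfl | hne
    · simp [hm.action_self, hℓ, hL.apply_self, nrm]
    obtain ⟨γ, hγ, h0, h1⟩ := hL.exists_geodesic_length hne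
    change m.IsMagneticGeodesic (ℓ y) γ at hγ
    change γ (ℓ y) = y at h1
    have hy' : C * ℓ y < R := by
      have : ℓ y < R / C := hy
      rw [lt_div_iff₀ (by linarith)] at this
      linarith
    have hsrc : γ 0 ∈ (chartAt (EuclideanHalfSpace n) x).source := by
      rw [h0]; exact mem_chart_source _ x
    have hu0 : ‖chartCurve (𝓡∂ n) x γ 0 - extChartAt (𝓡∂ n) x x‖ = 0 := by
      rw [chartCurve, h0, sub_self, norm_zero]
    have hin := hb.mem_chart hγ hγ.right_mem hsrc (by rw [hu0]; linarith)
    have h2 := hb.abs_action_sub_le hm hγ hγ.right_mem hin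
    have h3 := hb.norm_chartVelocity_le hγ hγ.zero_mem (hin 0 hγ.zero_mem).1 (hin 0 hγ.zero_mem).2
    have h4 : ‖m.pot x (chartVelocity (𝓡∂ n) x γ (ℓ y) 0)‖ ≤ C * C := by
      have : m.pot x = m.cpot x (extChartAt (𝓡∂ n) x x) := (chartForm_self m.om x).symm
      rw [this]
      exact ContinuousLinearMap.le_of_opNorm_le_of_le _ (hb.cpot_le _ hb.self_mem) h3
    rw [h0, h1, hu0, add_zero] at h2
    have h5 : |ℓ y * (1 - m.pot x (chartVelocity (𝓡∂ n) x γ (ℓ y) 0))| ≤ ℓ y * (1 + C * C) := by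
      rw [abs_mul, abs_of_pos hγ.pos]
      refine mul_le_mul_of_nonneg_left ?_ hγ.pos.le
      refine (abs_sub _ _).trans ?_
      rw [abs_one]
      exact add_le_add le_rfl h4
    rw [Real.norm_eq_abs]
    have := abs_sub_abs_le_abs_sub (m.action x y)
      (ℓ y * (1 - m.pot x (chartVelocity (𝓡∂ n) x γ (ℓ y) 0)))
    linarith
  refine squeeze_zero_norm' hbound ?_
  have := (hℓc.mul_const (1 + C * C)).add ((hℓc.const_mul (5 * C ^ 5)).mul hℓc)
  simpa using this

/-- The hypothesis `a ≠ 0 ∨ b ≠ T` ensures that the curve meets `x` at no more than one end of `[a,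
b]`; such an end is treated as a limit of smaller intervals, using continuity of the action at `x`.
-/
theorem action_sub_le_aux (hm : m.IsSimple) {x : N} {T : ℝ} {c : ℝ → N} (hT : 0 < T)
    (hc : ContMDiffOn 𝓘(ℝ, ℝ) (𝓡∂ n) ∞ c (Icc 0 T)) (hx : ∀ τ ∈ Ioo 0 T, c τ ≠ x) {a b : ℝ}
    (ha : 0 ≤ a) (hab : a < b) (hb : b ≤ T) (h : a ≠ 0 ∨ b ≠ T) :
    m.action x (c b) - m.action x (c a)
      ≤ ∫ s in a..b, (m.nrm (c s) (vel c T s) - m.pot (c s) (vel c T s)) := by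
  set f := fun s => m.nrm (c s) (vel c T s) - m.pot (c s) (vel c T s) with hf
  have hfc : ContinuousOn f (Icc 0 T) := m.continuousOn_curveAction_integrand hT hc
  have hint : ∀ a ∈ Icc 0 T, ∀ b ∈ Icc 0 T, IntervalIntegrable f MeasureTheory.volume a b :=
    fun a ha b hb => (hfc.mono (uIcc_subset_Icc ha hb)).intervalIntegrable
  have hprim : ContinuousOn (fun t => ∫ s in (0 : ℝ)..t, f s) (Icc 0 T) := by
    have := intervalIntegral.continuousOn_primitive_interval (μ := MeasureTheory.volume) (f := f)
      (a := 0) (b := T) (by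
        rw [uIcc_of_le hT.le]; exact hfc.integrableOn_Icc)
    rwa [uIcc_of_le hT.le] at this
  have hsub : ∀ a ∈ Icc 0 T, ∀ b ∈ Icc 0 T,
      ∫ s in a..b, f s = (∫ s in (0 : ℝ)..b, f s) - ∫ s in (0 : ℝ)..a, f s := fun a ha b hb =>
    (intervalIntegral.integral_interval_sub_left (hint 0 ⟨le_rfl, hT.le⟩ b hb)
      (hint 0 ⟨le_rfl, hT.le⟩ a ha)).symm
  have base : ∀ a b, 0 ≤ a → a < b → b ≤ T → (∀ τ ∈ Icc a b, c τ ≠ x) →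
      m.action x (c b) - m.action x (c a) ≤ ∫ s in a..b, f s := by
    intro a b ha hab hb hne
    have := hm.action_sub_le_of_ne (sub_pos.2 hab) (contMDiffOn_segment hc ha hb) (x := x)
      fun τ hτ => hne _ ⟨by linarith [hτ.1], by linarith [hτ.2]⟩
    rw [m.curveAction_segment hT hc ha hab hb] at this
    simpa using this
  have haI : a ∈ Icc 0 T := ⟨ha, hab.le.trans hb⟩
  have hbI : b ∈ Icc 0 T := ⟨ha.trans hab.le, hb⟩
  by_cases hca : a = 0 ∧ c a = x
  · have hbT : b < T := lt_of_le_of_ne hb (h.resolve_left (not_not.2 hca.1))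
    have h1 : Tendsto (fun t => m.action x (c b) - m.action x (c t)) (𝓝[>] a)
        (𝓝 (m.action x (c b) - 0)) := by
      refine tendsto_const_nhds.sub ((hm.tendsto_action_self x).comp ?_)
      have := (hc.continuousOn a haI).mono_left (nhdsWithin_le_of_mem (mem_of_superset
        (Ioo_mem_nhdsGT (hab.trans_le hb)) fun r hr => ⟨ha.trans hr.1.le, hr.2.le⟩) :
          𝓝[>] a ≤ 𝓝[Icc 0 T] a)
      rwa [hca.2] at this
    have h2 : Tendsto (fun t => ∫ s in t..b, f s) (𝓝[>] a) (𝓝 (∫ s in a..b, f s)) := by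
      rw [hsub a haI b hbI]
      have h3 := (hprim a haI).mono_left (nhdsWithin_le_of_mem (mem_of_superset
        (Ioo_mem_nhdsGT (hab.trans_le hb)) fun r hr => ⟨ha.trans hr.1.le, hr.2.le⟩) :
          𝓝[>] a ≤ 𝓝[Icc 0 T] a)
      refine (tendsto_const_nhds.sub h3).congr' ?_
      filter_upwards [Ioo_mem_nhdsGT (hab.trans_le hb)] with t ht
      exact (hsub t ⟨ha.trans ht.1.le, ht.2.le⟩ b hbI).symm
    have h4 := le_of_tendsto_of_tendsto h1 h2 (by
      filter_upwards [Ioo_mem_nhdsGT hab] with t ht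
      exact base t b (ha.trans ht.1.le) ht.2 hb fun τ hτ =>
        hx τ ⟨(ha.trans_lt ht.1).trans_le hτ.1, hτ.2.trans_lt hbT⟩)
    rw [hca.2, hm.action_self]
    exact h4
  by_cases hcb : b = T ∧ c b = x
  · have ha0 : 0 < a := lt_of_le_of_ne ha (Ne.symm (h.resolve_right (not_not.2 hcb.1)))
    have hle : 𝓝[<] b ≤ 𝓝[Icc 0 T] b := nhdsWithin_le_of_mem (mem_of_superset
        (Ioo_mem_nhdsLT hab) fun r hr => ⟨ha.trans hr.1.le, hr.2.le.trans hb⟩)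
    have h1 : Tendsto (fun t => m.action x (c t) - m.action x (c a)) (𝓝[<] b)
        (𝓝 (0 - m.action x (c a))) := by
      refine ((hm.tendsto_action_self x).comp ?_).sub tendsto_const_nhds
      have := (hc.continuousOn b hbI).mono_left hle
      rwa [hcb.2] at this
    have h2 : Tendsto (fun t => ∫ s in a..t, f s) (𝓝[<] b) (𝓝 (∫ s in a..b, f s)) := by
      rw [hsub a haI b hbI]
      refine (((hprim b hbI).mono_left hle).sub tendsto_const_nhds).congr' ?_
      filter_upwards [Ioo_mem_nhdsLT hab] with t ht
      exact (hsub a haI t ⟨ha.trans ht.1.le, ht.2.le.trans hb⟩).symm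
    have h4 := le_of_tendsto_of_tendsto h1 h2 (by
      filter_upwards [Ioo_mem_nhdsLT hab] with t ht
      exact base a t ha ht.1 (ht.2.le.trans hb) fun τ hτ =>
        hx τ ⟨ha0.trans_le hτ.1, hτ.2.trans_lt (ht.2.trans_le hb)⟩)
    rw [hcb.2, hm.action_self]
    exact h4
  refine base a b ha hab hb fun τ hτ => ?_
  rcases hτ.1.eq_or_lt with rfl | h1
  · rcases ha.eq_or_lt with h0 | h0
    · exact fun h' => hca ⟨h0.symm, h'⟩
    · exact hx _ ⟨h0, hab.trans_le hb⟩
  rcases hτ.2.eq_or_lt with rfl | h2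
  · rcases hb.eq_or_lt with h0 | h0
    · exact fun h' => hcb ⟨h0, h'⟩
    · exact hx _ ⟨ha.trans_lt hab, h0⟩
  exact hx τ ⟨ha.trans_lt h1, h2.trans_le hb⟩

/-- The action is calibrated by the action of curves. -/
theorem action_sub_le (hm : m.IsSimple) {x : N} {T : ℝ} {c : ℝ → N} (hT : 0 < T)
    (hc : ContMDiffOn 𝓘(ℝ, ℝ) (𝓡∂ n) ∞ c (Icc 0 T)) (hx : ∀ τ ∈ Ioo 0 T, c τ ≠ x) :
    m.action x (c T) - m.action x (c 0) ≤ m.curveAction T c := by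
  have hfc := m.continuousOn_curveAction_integrand hT hc
  -- The interval is halved, so that each half has at most one end at which the curve may meet `x`.
  have h1 := hm.action_sub_le_aux hT hc hx le_rfl (half_pos hT) (half_le_self hT.le)
    (Or.inr (half_lt_self hT).ne)
  have h2 := hm.action_sub_le_aux hT hc hx (half_pos hT).le (half_lt_self hT) le_rfl
    (Or.inl (half_pos hT).ne')
  have h3 := intervalIntegral.integral_add_adjacent_intervals
    ((hfc.mono (uIcc_subset_Icc ⟨le_rfl, hT.le⟩ ⟨(half_pos hT).le, half_le_self hT.le⟩)).intervalIntegrable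
      (μ := MeasureTheory.volume))
    ((hfc.mono (uIcc_subset_Icc ⟨(half_pos hT).le, half_le_self hT.le⟩ ⟨hT.le, le_rfl⟩)).intervalIntegrable
      (μ := MeasureTheory.volume))
  rw [curveAction, ← h3]
  linarith

/-- The action satisfies the triangle inequality. -/
theorem action_triangle (hm : m.IsSimple) (x w z : N) :
    m.action x z ≤ m.action x w + m.action w z := by
  by_cases hwz : w = z
  · rw [hwz, hm.action_self, add_zero]
  obtain ⟨ℓ, γ, hγ, rfl, rfl⟩ := hm.exists_geodesic hwz
  -- If the geodesic from `w` to `z` passes through `x`, the bound for its piece from `w` to `x`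
  -- reads `0 ≤ 𝔸(x, w) + 𝔸(w, x)`, and additivity along the geodesic finishes. Otherwise the whole
  -- geodesic is compared at once.
  by_cases hex : ∃ s ∈ Ioo 0 ℓ, γ s = x
  · obtain ⟨s, hs, rfl⟩ := hex
    have h1 := hm.action_add hγ le_rfl hs.1.le hs.2.le le_rfl
    have h2 := hm.action_sub_le (x := γ s) (sub_pos.2 hs.1)
      (hγ.segment le_rfl hs.1 hs.2.le).smooth fun τ hτ => by
        have : γ (0 + τ) ≠ γ s := hm.ne hγ (by linarith [hτ.1]) (by linarith [hτ.2]) hs.2.le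
        exact this
    rw [← hm.action_eq (hγ.segment le_rfl hs.1 hs.2.le)] at h2
    simp only [Function.comp_apply, sub_zero, zero_add, hm.action_self, zero_sub] at h2
    linarith
  · push Not at hex
    have := hm.action_sub_le hγ.pos hγ.smooth hex
    rw [hm.action_eq hγ]
    linarith

end IsSimple

end MagneticSystem
end

/-! ### Straight chart segments and continuity of the action. -/

section

variable {n : ℕ} [NeZero n] {N : Type*} [TopologicalSpace N]
  [ChartedSpace (EuclideanHalfSpace n) N] [IsManifold (𝓡∂ n) ∞ N]

/-- The straight segment from `u` to `u + T v`, in the chart at `x`. -/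
def chartLine (x : N) (u v : Space n) (τ : ℝ) : N := (extChartAt (𝓡∂ n) x).symm (u + τ • v)

section ChartLine

variable {x : N} {u v : Space n} {T : ℝ}

theorem contMDiffOn_chartLine (h : ∀ τ ∈ Icc 0 T, u + τ • v ∈ (extChartAt (𝓡∂ n) x).target) :
    ContMDiffOn 𝓘(ℝ, ℝ) (𝓡∂ n) ∞ (chartLine x u v) (Icc 0 T) :=
  (contMDiffOn_extChartAt_symm x).comp
    (contDiff_const.add (contDiff_id.smul contDiff_const)).contMDiff.contMDiffOn h

omit [IsManifold (𝓡∂ n) ∞ N] in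
theorem chartLine_mem_source {τ : ℝ} (h : u + τ • v ∈ (extChartAt (𝓡∂ n) x).target) :
    chartLine x u v τ ∈ (chartAt (EuclideanHalfSpace n) x).source := by
  rw [← extChartAt_source (𝓡∂ n)]
  exact (extChartAt (𝓡∂ n) x).map_target h

omit [IsManifold (𝓡∂ n) ∞ N] in
theorem extChartAt_chartLine {τ : ℝ} (h : u + τ • v ∈ (extChartAt (𝓡∂ n) x).target) :
    extChartAt (𝓡∂ n) x (chartLine x u v τ) = u + τ • v := (extChartAt (𝓡∂ n) x).right_inv h

omit [IsManifold (𝓡∂ n) ∞ N] in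
theorem chartVelocity_chartLine (hT : 0 < T)
    (h : ∀ τ ∈ Icc 0 T, u + τ • v ∈ (extChartAt (𝓡∂ n) x).target) {τ : ℝ} (hτ : τ ∈ Icc 0 T) :
    chartVelocity (𝓡∂ n) x (chartLine x u v) T τ = v := by
  have h1 : HasDerivWithinAt (fun τ : ℝ => u + τ • v) v (Icc 0 T) τ := by
    simpa using (((hasDerivAt_id τ).smul_const v).const_add u).hasDerivWithinAt
  exact (h1.congr (fun r hr => extChartAt_chartLine (h r hr)) (extChartAt_chartLine (h τ hτ))).derivWithin
    (uniqueDiffWithinAt_Icc hT hτ)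

end ChartLine

namespace MagneticSystem

variable {m : MagneticSystem n N}

namespace HasChartBounds

variable {x : N} {R C : ℝ}

/-- With `a` and `b` the two norms, `(a - b) a ≤ a² - b²`, and the Lipschitz bound for the metric is
divided by `a` using `‖v‖ ≤ C a`. This keeps the error linear in `‖v‖`. -/
theorem sqrt_gram_le (hb : m.HasChartBounds x R C) {u w : Space n} (hu : u ∈ halfBall x R)
    (hw : w ∈ halfBall x R) (v : Space n) :
    √(m.gram x u v v) ≤ √(m.gram x w v v) + C ^ 2 * ‖u - w‖ * ‖v‖ := by
  have hC := hb.one_le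
  have hnn : ∀ u ∈ halfBall x R, 0 ≤ m.gram x u v v := fun u hu => by
    rcases eq_or_ne v 0 with rfl | hv
    · simp
    · exact (m.gram_pos (hb.subset hu) hv).le
  set a := √(m.gram x u v v) with ha
  set b := √(m.gram x w v v) with hb'
  have h1 : a ^ 2 - b ^ 2 ≤ C * ‖u - w‖ * ‖v‖ * ‖v‖ := by
    rw [ha, hb', Real.sq_sqrt (hnn u hu), Real.sq_sqrt (hnn w hw)]
    have := ContinuousLinearMap.le_of_opNorm_le _ (ContinuousLinearMap.le_of_opNorm_le _
      (hb.gram_sub_le u hu w hw) v) v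
    exact (le_abs_self _).trans this
  have h2 : ‖v‖ ≤ C * a := hb.norm_le hu v
  have ha0 : 0 ≤ a := Real.sqrt_nonneg _
  have hb0 : 0 ≤ b := Real.sqrt_nonneg _
  by_contra! hlt
  have hD : 0 ≤ C ^ 2 * ‖u - w‖ * ‖v‖ := by positivity
  have hapos : 0 < a := by linarith
  have h3 : C * ‖u - w‖ * ‖v‖ * ‖v‖ ≤ C * ‖u - w‖ * ‖v‖ * (C * a) := by gcongr
  have h4 : (C ^ 2 * ‖u - w‖ * ‖v‖) * a < (a - b) * a := by
    apply mul_lt_mul_of_pos_right _ hapos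
    linarith
  have h5 : (a - b) * a ≤ a ^ 2 - b ^ 2 := by nlinarith
  have h6 : C * ‖u - w‖ * ‖v‖ * (C * a) = C ^ 2 * ‖u - w‖ * ‖v‖ * a := by ring
  linarith

/-- The action is at most that of the straight chart segment from `p` to `q`; the error term is the
cost of freezing the metric and the form at the chart centre. -/
theorem action_le [T2Space N] [CompactSpace N] (hb : m.HasChartBounds x R C) (hm : m.IsSimple)
    {p q : N} (hp : p ∈ (chartAt (EuclideanHalfSpace n) x).source)
    (hq : q ∈ (chartAt (EuclideanHalfSpace n) x).source)
    (hp' : extChartAt (𝓡∂ n) x p ∈ halfBall x R) (hq' : extChartAt (𝓡∂ n) x q ∈ halfBall x R) :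
    m.action p q ≤ m.nrm x (extChartAt (𝓡∂ n) x q - extChartAt (𝓡∂ n) x p)
      - m.pot x (extChartAt (𝓡∂ n) x q - extChartAt (𝓡∂ n) x p)
      + 2 * C ^ 2 * ‖extChartAt (𝓡∂ n) x q - extChartAt (𝓡∂ n) x p‖
        * (‖extChartAt (𝓡∂ n) x p - extChartAt (𝓡∂ n) x x‖
          + ‖extChartAt (𝓡∂ n) x q - extChartAt (𝓡∂ n) x x‖) := by
  have hC := hb.one_le
  set φ := extChartAt (𝓡∂ n) x with hφ
  have hpφ : φ.symm (φ p) = p := φ.left_inv (by rwa [hφ, extChartAt_source])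
  have hqφ : φ.symm (φ q) = q := φ.left_inv (by rwa [hφ, extChartAt_source])
  by_cases hpq : φ q = φ p
  · have : p = q := by rw [← hpφ, ← hqφ, hpq]
    rw [this, hm.action_self]
    simp [nrm]
  set d := φ q - φ p with hd
  have hd0 : d ≠ 0 := sub_ne_zero.2 hpq
  have hcomb : ∀ τ : ℝ, φ p + τ • d = (1 - τ) • φ p + τ • φ q := fun τ => by
    rw [hd, smul_sub, sub_smul, one_smul]; abel
  have hmem : ∀ τ ∈ Icc (0 : ℝ) 1, φ p + τ • d ∈ halfBall x R := fun τ hτ => by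
    rw [hcomb]
    exact convex_halfBall x R hp' hq' (sub_nonneg.2 hτ.2) hτ.1 (by ring)
  have htar : ∀ τ ∈ Icc (0 : ℝ) 1, φ p + τ • d ∈ φ.target := fun τ hτ => hb.subset (hmem τ hτ)
  have hc := contMDiffOn_chartLine (x := x) htar
  have h0 : chartLine x (φ p) d 0 = p := by
    rw [chartLine, zero_smul, add_zero, hpφ]
  have h1 : chartLine x (φ p) d 1 = q := by
    rw [chartLine, one_smul, hd, add_sub_cancel, hqφ]
  have key := hm.action_sub_le (x := p) zero_lt_one hc fun τ hτ h => by
    have hτ' := Ioo_subset_Icc_self hτ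
    have e := extChartAt_chartLine (htar τ hτ')
    rw [h] at e
    exact smul_ne_zero hτ.1.ne' hd0 (add_eq_left.1 e.symm)
  rw [h0, h1, hm.action_self, sub_zero, curveAction] at key
  set D := ‖φ p - φ x‖ + ‖φ q - φ x‖ with hD
  refine key.trans ((intervalIntegral.integral_mono_on zero_le_one ?_
    (intervalIntegrable_const (c := m.nrm x d - m.pot x d + 2 * C ^ 2 * ‖d‖ * D)) ?_).trans
    (le_of_eq (by simp)))
  · apply ContinuousOn.intervalIntegrable
    rw [uIcc_of_le zero_le_one]
    exact m.continuousOn_curveAction_integrand zero_lt_one hc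
  · intro τ hτ
    have hs := chartLine_mem_source (htar τ hτ)
    have hmd := mdiffAt_of_contMDiffOn hc hτ
    have e1 := chartMetric_chartVelocity m.h.inner zero_lt_one hτ hmd hs
    have e2 := chartForm_chartVelocity m.om zero_lt_one hτ hmd hs
    rw [chartVelocity_chartLine zero_lt_one htar hτ, chartCurve, extChartAt_chartLine (htar τ hτ)]
      at e1 e2
    have e3 : m.nrm (chartLine x (φ p) d τ) (vel (chartLine x (φ p) d) 1 τ)
        = √(m.gram x (φ p + τ • d) d d) := by
      rw [nrm, ← e1]
    have e4 : m.pot (chartLine x (φ p) d τ) (vel (chartLine x (φ p) d) 1 τ)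
        = m.cpot x (φ p + τ • d) d := e2.symm
    have e5 : m.nrm x d = √(m.gram x (φ x) d d) := by
      rw [nrm, gram, chartMetric_self]
    have e6 : m.pot x d = m.cpot x (φ x) d := by
      rw [cpot, chartForm_self]
    rw [e3, e4, e5, e6]
    have hdist : ‖φ p + τ • d - φ x‖ ≤ D := by
      have : φ p + τ • d - φ x = (1 - τ) • (φ p - φ x) + τ • (φ q - φ x) := by
        rw [hcomb, smul_sub, smul_sub, sub_smul, sub_smul, one_smul, one_smul]; abel
      rw [this]
      refine (norm_add_le _ _).trans ?_
      rw [norm_smul, norm_smul, Real.norm_of_nonneg (sub_nonneg.2 hτ.2), Real.norm_of_nonneg hτ.1]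
      have := norm_nonneg (φ p - φ x)
      have := norm_nonneg (φ q - φ x)
      have := hτ.1
      have := hτ.2
      nlinarith
    have i1 := hb.sqrt_gram_le (hmem τ hτ) hb.self_mem d
    have i2 := (abs_le.1 (ContinuousLinearMap.le_of_opNorm_le _
      (hb.cpot_sub_le _ (hmem τ hτ) _ hb.self_mem) d)).1
    rw [sub_apply] at i2
    have i3 : C ^ 2 * ‖φ p + τ • d - φ x‖ * ‖d‖ ≤ C ^ 2 * D * ‖d‖ := by gcongr
    have i4 : C * ‖φ p + τ • d - φ x‖ * ‖d‖ ≤ C ^ 2 * D * ‖d‖ := by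
      have : C ≤ C ^ 2 := by nlinarith
      gcongr
    simp only [← hφ] at i1 i2 ⊢
    have i5 : 2 * C ^ 2 * ‖d‖ * D = C ^ 2 * D * ‖d‖ + C ^ 2 * D * ‖d‖ := by ring
    linarith

end HasChartBounds

theorem continuous_nrm (x : N) : Continuous (m.nrm x) :=
  ((m.ip x).continuous.clm_apply continuous_id).sqrt

omit [IsManifold (𝓡∂ n) ∞ N] in
theorem eventually_mem_halfBall (x : N) {R : ℝ} (hR : 0 < R) :
    ∀ᶠ p in 𝓝 x, p ∈ (chartAt (EuclideanHalfSpace n) x).source ∧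
      extChartAt (𝓡∂ n) x p ∈ halfBall x R := by
  filter_upwards [chart_source_mem_nhds (EuclideanHalfSpace n) x,
    (continuousAt_extChartAt (I := 𝓡∂ n) x) (Metric.ball_mem_nhds _ hR)] with p h1 h2
  exact ⟨h1, Metric.ball_subset_closedBall h2, extChartAt_mem_range x p⟩

namespace IsSimple

variable [T2Space N] [CompactSpace N]

theorem eventually_action_lt (hm : m.IsSimple) (x : N) {ε : ℝ} (hε : 0 < ε) :
    ∀ᶠ p in 𝓝 x, m.action x p < ε ∧ m.action p x < ε := by
  obtain ⟨R, C, hb⟩ := m.exists_hasChartBounds x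
  set φ := extChartAt (𝓡∂ n) x with hφ
  have hc : Tendsto (fun p => φ p - φ x) (𝓝 x) (𝓝 0) := by
    rw [← sub_self (φ x)]
    exact (continuousAt_extChartAt (I := 𝓡∂ n) x).tendsto.sub_const (φ x)
  set f : Space n → ℝ := fun d => m.nrm x d - m.pot x d + 2 * C ^ 2 * ‖d‖ * ‖d‖ with hf
  have hfc : Continuous f := by
    have := continuous_nrm (m := m) x
    fun_prop
  have hf0 : f 0 = 0 := by simp [hf, nrm]
  have h1 : Tendsto (fun p => f (φ p - φ x)) (𝓝 x) (𝓝 0) := by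
    have := (hfc.tendsto 0).comp hc
    rwa [hf0] at this
  have h2 : Tendsto (fun p => f (φ x - φ p)) (𝓝 x) (𝓝 0) := by
    have := (hfc.tendsto 0).comp (f := fun p => φ x - φ p) (x := 𝓝 x) (by simpa using hc.neg)
    rwa [hf0] at this
  filter_upwards [eventually_mem_halfBall (n := n) x hb.pos, h1 (Iio_mem_nhds hε), h2 (Iio_mem_nhds hε)]
    with p hp hp1 hp2
  have hxs := mem_chart_source (EuclideanHalfSpace n) x
  refine ⟨(hb.action_le hm hxs hp.1 hb.self_mem hp.2).trans_lt ?_,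
    (hb.action_le hm hp.1 hxs hp.2 hb.self_mem).trans_lt ?_⟩
  · rw [sub_self, norm_zero, zero_add]
    exact hp1
  · have : f (φ x - φ p) < ε := hp2
    rw [sub_self, norm_zero, add_zero, norm_sub_rev (φ p) (φ x)]
    exact this

/-- The action behaves like an asymmetric distance. Four triangle inequalities reduce continuity to
upper bounds for the actions between nearby points, in both directions. -/
theorem continuous_action (hm : m.IsSimple) : Continuous fun q : N × N => m.action q.1 q.2 := by
  rw [continuous_iff_continuousAt]
  rintro ⟨x, y⟩
  rw [ContinuousAt, Metric.tendsto_nhds]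
  intro ε hε
  have h1 := (hm.eventually_action_lt x (half_pos hε)).prod_nhds
    (hm.eventually_action_lt y (half_pos hε))
  filter_upwards [h1] with q hq
  have t1 := hm.action_triangle q.1 x q.2
  have t2 := hm.action_triangle x y q.2
  have t3 := hm.action_triangle x q.1 y
  have t4 := hm.action_triangle q.1 q.2 y
  rw [Real.dist_eq, abs_lt]
  constructor <;> linarith [hq.1.1, hq.1.2, hq.2.1, hq.2.2]

end IsSimple

end MagneticSystem
end

/-! ### Equality in the triangle inequality. -/

section

variable {n : ℕ} [NeZero n] {N : Type*} [TopologicalSpace N]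
  [ChartedSpace (EuclideanHalfSpace n) N] [IsManifold (𝓡∂ n) ∞ N]

omit [IsManifold (𝓡∂ n) ∞ N] in
theorem hasDerivWithinAt_comp_curve {L : N → Space n} {T τ : ℝ} {c : ℝ → N}
    (hL : MDifferentiableAt (𝓡∂ n) 𝓘(ℝ, Space n) L (c τ))
    (hc : MDifferentiableWithinAt 𝓘(ℝ, ℝ) (𝓡∂ n) c (Icc 0 T) τ) :
    HasDerivWithinAt (fun s => L (c s)) (dmap L (c τ) (vel c T τ)) (Icc 0 T) τ := by
  have h : HasFDerivWithinAt (fun s => L (c s))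
      (dmap L (c τ) ∘L derivAt (𝓡∂ n) c (Icc 0 T) τ) (Icc 0 T) τ :=
    (hL.hasMFDerivAt.comp_hasMFDerivWithinAt τ hc.hasMFDerivWithinAt).hasFDerivWithinAt
  exact h.hasDerivWithinAt

omit [IsManifold (𝓡∂ n) ∞ N] in
theorem isClosed_chart_halfBall [T2Space N] {x : N} {R : ℝ}
    (h : halfBall x R ⊆ (extChartAt (𝓡∂ n) x).target) :
    IsClosed {y | y ∈ (chartAt (EuclideanHalfSpace n) x).source ∧
      extChartAt (𝓡∂ n) x y ∈ halfBall x R} := by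
  have : {y | y ∈ (chartAt (EuclideanHalfSpace n) x).source ∧
      extChartAt (𝓡∂ n) x y ∈ halfBall x R} = (extChartAt (𝓡∂ n) x).symm '' halfBall x R := by
    ext y
    constructor
    · rintro ⟨h1, h2⟩
      exact ⟨_, h2, (extChartAt (𝓡∂ n) x).left_inv (by rwa [extChartAt_source])⟩
    · rintro ⟨u, hu, rfl⟩
      refine ⟨?_, ?_⟩
      · rw [← extChartAt_source (𝓡∂ n)]
        exact (extChartAt (𝓡∂ n) x).map_target (h hu)
      · rwa [(extChartAt (𝓡∂ n) x).right_inv (h hu)]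
  rw [this]
  exact ((isCompact_halfBall x R).image_of_continuousOn
    ((continuousOn_extChartAt_symm x).mono h)).isClosed

namespace MagneticSystem

variable {m : MagneticSystem n N}

theorem nrm_nonneg (x : N) (v : Space n) : 0 ≤ m.nrm x v := Real.sqrt_nonneg _

theorem nrm_add_le (x : N) (v w : Space n) : m.nrm x (v + w) ≤ m.nrm x v + m.nrm x w := by
  have h := m.ip_le x v w
  have h1 := m.nrm_nonneg x v
  have h2 := m.nrm_nonneg x w
  refine Real.sqrt_le_iff.2 ⟨by positivity, ?_⟩
  simp only [map_add, add_apply, m.ip_symm x w v]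
  rw [← m.nrm_sq x v, ← m.nrm_sq x w]
  nlinarith

theorem nrm_neg (x : N) (v : Space n) : m.nrm x (-v) = m.nrm x v := by
  simp [nrm]

theorem HasChartBounds.nrm_le {x : N} {R C : ℝ} (hb : m.HasChartBounds x R C) (v : Space n) :
    m.nrm x v ≤ C * ‖v‖ := by
  have hC := hb.one_le
  refine Real.sqrt_le_iff.2 ⟨by positivity, ?_⟩
  have h1 := ContinuousLinearMap.le_of_opNorm_le _ (ContinuousLinearMap.le_of_opNorm_le _
    (hb.gram_le _ hb.self_mem) v) v
  rw [gram, chartMetric_self] at h1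
  have h2 := (le_abs_self _).trans h1
  have h3 : C * ‖v‖ * ‖v‖ ≤ (C * ‖v‖) ^ 2 := by
    have : C ≤ C ^ 2 := by nlinarith
    nlinarith [sq_nonneg ‖v‖]
  exact h2.trans h3

theorem HasChartBounds.norm_le_nrm {x : N} {R C : ℝ} (hb : m.HasChartBounds x R C) (v : Space n) :
    ‖v‖ ≤ C * m.nrm x v := by
  have := hb.norm_le hb.self_mem v
  rwa [gram, chartMetric_self] at this

/-- The logarithm maps geodesics from `x` to rays traversed at constant speed, so its differential
sends arrival velocities to normalized radial vectors. -/
theorem IsLogMap.dmap_arrival {x y : N} {L : N → Space n} (h : m.IsLogMap x L) {v : Space n}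
    (hv : m.IsArrival x y v) : dmap L y v = (m.nrm x (L y))⁻¹ • L y := by
  obtain ⟨ℓ, γ, hγ, h0, rfl, rfl⟩ := hv
  have h1 := hasDerivWithinAt_comp_curve ((h.contMDiff (γ ℓ)).mdifferentiableAt (by simp))
    (hγ.mdiff hγ.right_mem)
  have h2 : HasDerivWithinAt (fun s => L (γ s)) (vel γ ℓ 0) (Icc 0 ℓ) ℓ := by
    have h3 : HasDerivWithinAt (fun s : ℝ => s • vel (n := n) γ ℓ 0) (vel γ ℓ 0) (Icc 0 ℓ) ℓ := by
      simpa using ((hasDerivAt_id ℓ).smul_const (vel (n := n) γ ℓ 0)).hasDerivWithinAt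
    exact h3.congr (fun s hs => h.apply_geodesic hγ h0 hs) (h.apply_geodesic hγ h0 hγ.right_mem)
  have h3 := (uniqueDiffWithinAt_Icc hγ.pos hγ.right_mem).eq_deriv _ h1 h2
  rw [h3, h.length_eq hγ h0, h.apply_geodesic hγ h0 hγ.right_mem, smul_smul,
    inv_mul_cancel₀ hγ.pos.ne', one_smul]

namespace IsSimple

variable [T2Space N] [CompactSpace N]

/-- A unit speed curve along which the action from `x` grows at the maximal rate is radial. -/
theorem log_eq_of_calibrated (hm : m.IsSimple) {x : N} {L : N → Space n} (h : m.IsLogMap x L) {T : ℝ}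
    {c : ℝ → N} (hT : 0 < T) (hc : ContMDiffOn 𝓘(ℝ, ℝ) (𝓡∂ n) ∞ c (Icc 0 T))
    (hx : ∀ τ ∈ Icc 0 T, c τ ≠ x) (hunit : ∀ τ ∈ Icc 0 T, m.ip (c τ) (vel c T τ) (vel c T τ) = 1)
    (hcal : m.curveAction T c ≤ m.action x (c T) - m.action x (c 0)) :
    L (c T) = (m.nrm x (L (c 0)))⁻¹ • (m.nrm x (L (c 0)) + T) • L (c 0) := by
  choose! V hV using fun τ (hτ : τ ∈ Icc 0 T) => hm.exists_arrival (hx τ hτ).symm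
  obtain ⟨h1, h2⟩ := hm.first_variation hT hc hx hV
  have hle : ∀ τ ∈ Icc 0 T, m.ip (c τ) (V τ) (vel c T τ) - m.pot (c τ) (vel c T τ)
      ≤ m.nrm (c τ) (vel c T τ) - m.pot (c τ) (vel c T τ) := fun τ hτ => by
    have := m.ip_le (c τ) (V τ) (vel c T τ)
    rw [(hV τ hτ).nrm_eq, one_mul] at this
    exact sub_le_sub_right this _
  -- Where `V` and `ċ` differ, Cauchy–Schwarz is strict; by continuity of the integrands the
  -- integrated inequality is then strict as well, against `hcal`.
  have hVeq : ∀ τ ∈ Icc 0 T, V τ = vel c T τ := by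
    by_contra! hne
    obtain ⟨τ, hτ, hne⟩ := hne
    have := intervalIntegral.integral_lt_integral_of_continuousOn_of_le_of_exists_lt hT h1
      (m.continuousOn_curveAction_integrand hT hc) (fun τ hτ => hle τ ⟨hτ.1.le, hτ.2⟩)
      ⟨τ, hτ, lt_of_le_of_ne (hle τ hτ) fun heq => hne
        (m.eq_of_ip_eq (hV τ hτ).ip_self (hunit τ hτ) (by
          have e := sub_left_inj.1 heq
          rw [e, nrm, hunit τ hτ, Real.sqrt_one]))⟩
    rw [← h2] at this
    exact absurd hcal (not_le.2 this)
  -- Since `ċ` is the arrival velocity, `w` solves `w' = w / |w|`. Hence `|w| - τ` and `w / |w|` are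
  -- constant, which determines `w T`.
  set w := fun τ => L (c τ) with hw
  set ρ := fun τ => m.nrm x (w τ) with hρ
  have hw0 : ∀ τ ∈ Icc 0 T, w τ ≠ 0 := fun τ hτ h0 => hx τ hτ (h.apply_eq_zero.1 h0)
  have hρpos : ∀ τ ∈ Icc 0 T, 0 < ρ τ := fun τ hτ => Real.sqrt_pos.2 (m.ip_pos x (hw0 τ hτ))
  have hwd : ∀ τ ∈ Icc 0 T, HasDerivWithinAt w ((ρ τ)⁻¹ • w τ) (Icc 0 T) τ := fun τ hτ => by
    have h3 := hasDerivWithinAt_comp_curve ((h.contMDiff (c τ)).mdifferentiableAt (by simp))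
      (mdiffAt_of_contMDiffOn hc hτ)
    rwa [← hVeq τ hτ, h.dmap_arrival (hV τ hτ)] at h3
  have hρd : ∀ τ ∈ Icc 0 T, HasDerivWithinAt ρ 1 (Icc 0 T) τ := fun τ hτ => by
    have h3 := ((m.ip x).hasFDerivAt.comp_hasDerivWithinAt τ (hwd τ hτ)).clm_apply (hwd τ hτ)
    refine (h3.sqrt (m.ip_pos x (hw0 τ hτ)).ne').congr_deriv ?_
    have h5 := m.nrm_sq x (w τ)
    have h6 := hρpos τ hτ
    have h7 : m.ip x (w τ) (w τ) = ρ τ ^ 2 := h5.symm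
    simp only [Function.comp_apply, map_smul, smul_apply, smul_eq_mul, h7]
    rw [Real.sqrt_sq h6.le]
    field_simp
    norm_num
  have hconst : ∀ {V : Type} [NormedAddCommGroup V] [NormedSpace ℝ V] (f : ℝ → V),
      (∀ τ ∈ Icc 0 T, HasDerivWithinAt f 0 (Icc 0 T) τ) → f T = f 0 := by
    intro V _ _ f hf
    have := (convex_Icc (0 : ℝ) T).norm_image_sub_le_of_norm_hasDerivWithin_le (C := 0) hf
      (fun τ _ => by simp) (left_mem_Icc.2 hT.le) (right_mem_Icc.2 hT.le)
    rw [zero_mul] at this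
    exact sub_eq_zero.1 (norm_eq_zero.1 (le_antisymm this (norm_nonneg _)))
  have e1 := hconst (fun τ => ρ τ - τ) fun τ hτ => by
    simpa using (hρd τ hτ).fun_sub (hasDerivAt_id' τ).hasDerivWithinAt
  have e2 := hconst (fun τ => (ρ τ)⁻¹ • w τ) fun τ hτ => by
    refine (((hρd τ hτ).fun_inv (hρpos τ hτ).ne').smul (hwd τ hτ)).congr_deriv ?_
    rw [smul_smul, ← add_smul]
    have := (hρpos τ hτ).ne'
    rw [show (ρ τ)⁻¹ * (ρ τ)⁻¹ + -1 / ρ τ ^ 2 = 0 by field_simp; ring, zero_smul]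
  have h0 := hρpos 0 (left_mem_Icc.2 hT.le)
  have h1 := hρpos T (right_mem_Icc.2 hT.le)
  simp only [sub_zero] at e1 e2
  have e3 : ρ T = ρ 0 + T := by linarith
  have e4 : w T = ρ T • (ρ 0)⁻¹ • w 0 := by
    rw [← e2, smul_smul, mul_inv_cancel₀ h1.ne', one_smul]
  change w T = (ρ 0)⁻¹ • (ρ 0 + T) • w 0
  rw [e4, e3, smul_comm]

/-- Points of equality in the triangle inequality lie on the magnetic geodesic. -/
theorem exists_eq_of_action_add (hm : m.IsSimple) {ℓ : ℝ} {γ : ℝ → N}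
    (hγ : m.IsMagneticGeodesic ℓ γ) {z : N} (hz : z ≠ γ 0)
    (h : m.action (γ 0) z + m.action z (γ ℓ) = m.action (γ 0) (γ ℓ)) : ∃ r ∈ Icc 0 ℓ, γ r = z := by
  by_cases hzℓ : z = γ ℓ
  · exact ⟨ℓ, hγ.right_mem, hzℓ.symm⟩
  obtain ⟨L, hL⟩ := hm.exists_isLogMap (γ 0)
  -- Equality makes the geodesic `σ` from `z` to `γ ℓ` calibrated by the action from `γ 0`. Its
  -- logarithm then moves outward along the ray through `L z`, which puts `z` on the ray of `γ`.
  obtain ⟨b, σ, hσ, h0, h1⟩ := hm.exists_geodesic hzℓ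
  have hρ0 : 0 < m.nrm (γ 0) (L z) := Real.sqrt_pos.2 (m.ip_pos _ fun h0 => hz (hL.apply_eq_zero.1 h0))
  have hseg : ∀ s ∈ Ioc 0 b, (∀ τ ∈ Icc 0 s, σ τ ≠ γ 0) →
      m.action z (σ s) ≤ m.action (γ 0) (σ s) - m.action (γ 0) z →
      L (σ s) = (m.nrm (γ 0) (L z))⁻¹ • (m.nrm (γ 0) (L z) + s) • L z := by
    intro s hs hne hcal
    have hs' := hσ.segment le_rfl hs.1 hs.2
    have e := hm.action_eq hs'
    simp only [Function.comp_apply, zero_add, sub_zero, h0] at e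
    have := hm.log_eq_of_calibrated hL hs'.pos hs'.smooth
      (fun τ hτ => by
        simp only [Function.comp_apply, zero_add]
        exact hne τ (by simpa using hτ))
      (fun τ hτ => hs'.ip_vel hτ) (by
        simp only [Function.comp_apply, zero_add, sub_zero, h0]
        rw [← e]
        exact hcal)
    simpa [h0] using this
  -- The curve `σ` cannot run into `γ 0`: before that time the norm of its logarithm is at least
  -- that of `L z`, yet it would have to tend to zero.
  by_cases hhit : ∃ s ∈ Icc 0 b, σ s = γ 0
  · exfalso
    obtain ⟨s, hs, hsx⟩ := hhit
    have hs0 : 0 < s := lt_of_le_of_ne hs.1 fun h' => hz (by rw [← h0, ← hsx, h'])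
    have a1 := hm.action_add hσ le_rfl hs.1 hs.2 le_rfl
    rw [h0, h1, hsx] at a1
    have key : ∀ r ∈ Ioo 0 s, m.nrm (γ 0) (L z) ≤ m.nrm (γ 0) (L (σ r)) := by
      intro r hr
      have a2 := hm.action_add hσ le_rfl hr.1.le hr.2.le hs.2
      have a3 := hm.action_triangle (γ 0) (σ r) (γ 0)
      rw [hm.action_self] at a3
      rw [h0, hsx] at a2
      rw [hseg r ⟨hr.1, hr.2.le.trans hs.2⟩ (fun τ hτ => by
        rw [← hsx]
        exact hm.ne hσ hτ.1 (hτ.2.trans_lt hr.2) hs.2) (by linarith), smul_smul,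
        nrm_smul _ (by have := hr.1; positivity)]
      have : (1 : ℝ) ≤ (m.nrm (γ 0) (L z))⁻¹ * (m.nrm (γ 0) (L z) + r) := by
        rw [mul_add, inv_mul_cancel₀ hρ0.ne']
        have := hr.1
        have : 0 ≤ (m.nrm (γ 0) (L z))⁻¹ * r := by positivity
        linarith
      exact le_mul_of_one_le_left hρ0.le this
    have hcont : Tendsto (fun r => m.nrm (γ 0) (L (σ r))) (𝓝[<] s) (𝓝 0) := by
      have h2 := (hL.continuousOn_length hσ.smooth.continuousOn) s hs
      rw [ContinuousWithinAt, hsx, hL.apply_self] at h2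
      have h3 : m.nrm (γ 0) (0 : Space n) = 0 := by simp [nrm]
      rw [h3] at h2
      exact h2.mono_left (nhdsWithin_le_of_mem (mem_of_superset (Ioo_mem_nhdsLT hs0)
        fun r hr => ⟨hr.1.le, hr.2.le.trans hs.2⟩))
    have := ge_of_tendsto hcont (by
      filter_upwards [Ioo_mem_nhdsLT hs0] with r hr
      exact key r hr)
    exact absurd hρ0 (not_lt.2 this)
  · push Not at hhit
    have e := hseg b ⟨hσ.pos, le_rfl⟩ hhit (by rw [h1]; linarith)
    rw [h1, hL.apply_geodesic hγ rfl hγ.right_mem] at e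
    set ρ := m.nrm (γ 0) (L z) with hρ
    have hb := hσ.pos
    have hℓ := hγ.pos
    -- The equation `e` says `L (γ ℓ) = ((ρ + b) / ρ) • L z`, while `L (γ r) = (r / ℓ) • L (γ ℓ)`;
    -- this dictates the time `r`.
    have hr : ℓ * (ρ / (ρ + b)) ∈ Icc 0 ℓ := by
      refine ⟨by positivity, mul_le_of_le_one_right hℓ.le ?_⟩
      rw [div_le_one (by positivity)]
      linarith
    refine ⟨_, hr, hL.injective ?_⟩
    rw [hL.apply_geodesic hγ rfl hr, mul_comm, mul_smul, e, smul_smul, smul_smul]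
    rw [show ρ / (ρ + b) * ρ⁻¹ * (ρ + b) = 1 by field_simp, one_smul]

end IsSimple

end MagneticSystem
end

/-! ### Continuous dependence of the initial velocity on the initial point. -/

section

variable {n : ℕ} [NeZero n] {N : Type*} [TopologicalSpace N]
  [ChartedSpace (EuclideanHalfSpace n) N] [IsManifold (𝓡∂ n) ∞ N]

namespace MagneticSystem

variable {m : MagneticSystem n N}

theorem IsMagneticGeodesic.nrm_chartVelocity {x : N} {ℓ : ℝ} {γ : ℝ → N} (hγ : m.IsMagneticGeodesic ℓ γ) (h0 : γ 0 = x) :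
    m.nrm x (chartVelocity (𝓡∂ n) x γ ℓ 0) = 1 := by
  have hsrc : γ 0 ∈ (chartAt (EuclideanHalfSpace n) x).source := by
    rw [h0]; exact mem_chart_source _ x
  have h1 := chartMetric_chartVelocity m.h.inner hγ.pos hγ.zero_mem (hγ.mdiff hγ.zero_mem) hsrc
  rw [hγ.ip_vel hγ.zero_mem, chartCurve, h0, chartMetric_self] at h1
  rw [nrm, h1, Real.sqrt_one]

/-- Two vectors of norm one with small difference of multiples are close. -/
theorem HasChartBounds.norm_sub_le_of_smul {x : N} {R C : ℝ} (hb : m.HasChartBounds x R C)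
    {v w : Space n} (hv : m.nrm x v = 1) (hw : m.nrm x w = 1) {r δ K : ℝ} (hr : 0 ≤ r) (hδ : 0 < δ)
    (hK : 1 ≤ K) (hrs : 4 * C * K * r ≤ 1) (hδs : 4 * C * K * δ ≤ 1)
    (h : ‖r • v - δ • w‖ ≤ K * (r ^ 2 + δ ^ 2)) : ‖v - w‖ ≤ 10 * C ^ 2 * K * δ := by
  have hC := hb.one_le
  have h1 : r - δ ≤ C * (K * (r ^ 2 + δ ^ 2)) := by
    have e : r • v = (r • v - δ • w) + δ • w := by abel
    have e1 := m.nrm_add_le x (r • v - δ • w) (δ • w)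
    rw [← e, nrm_smul _ hr, nrm_smul _ hδ.le, hv, hw] at e1
    have e2 := (hb.nrm_le (r • v - δ • w)).trans (mul_le_mul_of_nonneg_left h (by linarith))
    linarith
  have h2 : δ - r ≤ C * (K * (r ^ 2 + δ ^ 2)) := by
    have e : δ • w = -(r • v - δ • w) + r • v := by abel
    have e1 := m.nrm_add_le x (-(r • v - δ • w)) (r • v)
    rw [← e, nrm_smul _ hr, nrm_smul _ hδ.le, hv, hw, nrm_neg] at e1
    have e2 := (hb.nrm_le (r • v - δ • w)).trans (mul_le_mul_of_nonneg_left h (by linarith))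
    linarith
  -- The smallness assumptions make the quadratic error at most `(r + δ) / 4`, so the two multiples
  -- are comparable and every error can be measured by `δ`.
  have h3 : r ≤ 2 * δ := by
    have a1 : C * K * r * r ≤ 1 / 4 * r := mul_le_mul_of_nonneg_right (by linarith) hr
    have a2 : C * K * δ * δ ≤ 1 / 4 * δ := mul_le_mul_of_nonneg_right (by linarith) hδ.le
    nlinarith
  have h4 : r ^ 2 + δ ^ 2 ≤ 5 * δ ^ 2 := by nlinarith
  have h5 : |δ - r| ≤ C * (K * (5 * δ ^ 2)) := by
    have : C * (K * (r ^ 2 + δ ^ 2)) ≤ C * (K * (5 * δ ^ 2)) := by gcongr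
    rw [abs_le]
    constructor <;> linarith
  have h6 : ‖v‖ ≤ C := by simpa [hv] using hb.norm_le_nrm v
  have h7 : δ * ‖v - w‖ ≤ K * (5 * δ ^ 2) + C * (K * (5 * δ ^ 2)) * C := by
    rw [← Real.norm_of_nonneg hδ.le, ← norm_smul, Real.norm_of_nonneg hδ.le]
    have e : δ • (v - w) = (r • v - δ • w) + (δ - r) • v := by
      rw [smul_sub, sub_smul]; abel
    rw [e]
    refine (norm_add_le _ _).trans (add_le_add (h.trans (by gcongr)) ?_)
    rw [norm_smul, Real.norm_eq_abs]
    gcongr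
  have h8 : K * (5 * δ ^ 2) + C * (K * (5 * δ ^ 2)) * C ≤ δ * (10 * C ^ 2 * K * δ) := by
    have : 0 ≤ (C ^ 2 - 1) * (K * δ ^ 2) :=
      mul_nonneg (by nlinarith) (by positivity)
    linarith
  exact le_of_mul_le_mul_left (h7.trans h8) hδ

theorem tendsto_apply_apply {α V : Type*} [NormedAddCommGroup V] [NormedSpace ℝ V] {F : Filter α}
    {G : α → V →L[ℝ] V →L[ℝ] ℝ} {B : V →L[ℝ] V →L[ℝ] ℝ} (hG : Tendsto G F (𝓝 B)) {v : α → V} {w : V}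
    (hv : Tendsto v F (𝓝 w)) : Tendsto (fun y => G y (v y) (v y)) F (𝓝 (B w w)) :=
  (((continuous_fst.clm_apply continuous_snd).clm_apply continuous_snd :
    Continuous fun q : (V →L[ℝ] V →L[ℝ] ℝ) × V => q.1 q.2 q.2).tendsto (B, w)).comp
    (hG.prodMk_nhds hv)

theorem tendsto_gram {x : N} {F : Filter N} (hF : F ≤ 𝓝 x) {v : N → Space n} {w : Space n}
    (hv : Tendsto v F (𝓝 w)) :
    Tendsto (fun y => m.gram x (extChartAt (𝓡∂ n) x y) (v y) (v y)) F (𝓝 (m.ip x w w)) := by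
  have h1 : Tendsto (fun y => chartMetric (𝓡∂ n) m.h.inner x (extChartAt (𝓡∂ n) x y)) F
      (𝓝 (m.ip x)) := by
    have := continuousWithinAt_comp_extChartAt (Γ := fun y : N => y) (R := univ) (q := x) (c := x)
      (m.contDiffOn_gram x).continuousOn continuousWithinAt_id (mem_chart_source _ x)
    rw [continuousWithinAt_univ, ContinuousAt, chartMetric_self] at this
    exact this.mono_left hF
  exact tendsto_apply_apply h1 hv

theorem IsLogMap.exists_radius {x : N} {L : N → Space n} (hL : m.IsLogMap x L) {η : ℝ} (hη : 0 < η) :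
    ∃ r > 0, ∀ z ∈ (chartAt (EuclideanHalfSpace n) x).source,
      ‖extChartAt (𝓡∂ n) x z - extChartAt (𝓡∂ n) x x‖ < r → m.nrm x (L z) < η := by
  set φ := extChartAt (𝓡∂ n) x with hφ
  have h1 : ContinuousAt (fun u => m.nrm x (L (φ.symm u))) (φ x) :=
    ((continuous_nrm (m := m) x).comp hL.continuous).continuousAt.comp
      (continuousAt_extChartAt_symm (I := 𝓡∂ n) x)
  have h3 : m.nrm x (L (φ.symm (φ x))) = 0 := by
    rw [hφ, extChartAt_to_inv, hL.apply_self]; simp [nrm]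
  have h4 := h1.tendsto
  rw [h3] at h4
  obtain ⟨r, hr, h5⟩ := Metric.eventually_nhds_iff.1 (h4.eventually_lt_const hη)
  refine ⟨r, hr, fun z hz hzr => ?_⟩
  have h6 := h5 (show dist (φ z) (φ x) < r by rwa [dist_eq_norm])
  rwa [φ.left_inv (by rwa [hφ, extChartAt_source])] at h6

theorem exists_pos_mul_lt_mul_lt (a b : ℝ) {c d : ℝ} (hc : 0 < c) (hd : 0 < d) :
    ∃ δ > 0, a * δ < c ∧ b * δ < d := by
  have h1 : ∀ a b : ℝ, 0 < b → ∀ᶠ δ in 𝓝[>] (0 : ℝ), a * δ < b := fun a b hb => by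
    have := (by fun_prop : Continuous fun δ : ℝ => a * δ).tendsto 0
    rw [mul_zero] at this
    exact (this.mono_left nhdsWithin_le_nhds).eventually_lt_const hb
  obtain ⟨δ, h2⟩ := ((h1 a c hc).and ((h1 b d hd).and self_mem_nhdsWithin)).exists
  exact ⟨δ, h2.2.2, h2.1, h2.2.1⟩

namespace IsSimple

variable [T2Space N] [CompactSpace N]

set_option maxHeartbeats 400000 in
/-- The initial velocity of the magnetic geodesic to a fixed point depends continuously on the
initial point. -/
theorem eventually_norm_chartVelocity_sub_le (hm : m.IsSimple) {ℓ : ℝ} {γ : ℝ → N}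
    (hγ : m.IsMagneticGeodesic ℓ γ) {η : ℝ} (hη : 0 < η) :
    ∀ᶠ y in 𝓝 (γ 0), ∀ ℓ' γ', m.IsMagneticGeodesic ℓ' γ' → γ' 0 = y → γ' ℓ' = γ ℓ →
      ‖chartVelocity (𝓡∂ n) (γ 0) γ' ℓ' 0 - chartVelocity (𝓡∂ n) (γ 0) γ ℓ 0‖ ≤ η := by
  obtain ⟨R, C, hb⟩ := m.exists_hasChartBounds (γ 0)
  obtain ⟨L, hL⟩ := hm.exists_isLogMap (γ 0)
  have hC := hb.one_le
  have hR := hb.pos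
  set x := γ 0 with hx
  set y0 := γ ℓ with hy0
  set φ := extChartAt (𝓡∂ n) x with hφ
  set ξ := chartVelocity (𝓡∂ n) x γ ℓ 0 with hξ
  have hxs := mem_chart_source (EuclideanHalfSpace n) x
  have hxy : x ≠ y0 := hm.ne hγ le_rfl hγ.pos le_rfl
  by_contra hbad
  rw [not_eventually] at hbad
  -- An ultrafilter of bad initial points converging to `x`: along it, the initial velocities and
  -- the points at time `δ` converge by compactness.
  obtain ⟨𝒰, h𝒰⟩ := exists_ultrafilter_iff.2 (frequently_iff_neBot.1 hbad)
  have h𝒰x : (𝒰 : Filter N) ≤ 𝓝 x := h𝒰.trans inf_le_left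
  have hbad' := h𝒰.trans inf_le_right (mem_principal_self _)
  choose! lx gx hg using fun y (hy : ¬∀ ℓ' γ', m.IsMagneticGeodesic ℓ' γ' → γ' 0 = y → γ' ℓ' = y0 →
      ‖chartVelocity (𝓡∂ n) x γ' ℓ' 0 - ξ‖ ≤ η) => by
    push Not at hy; exact hy
  have hgev : ∀ᶠ y in (𝒰 : Filter N), m.IsMagneticGeodesic (lx y) (gx y) ∧ gx y 0 = y ∧
      gx y (lx y) = y0 ∧ η < ‖chartVelocity (𝓡∂ n) x (gx y) (lx y) 0 - ξ‖ :=
    mem_of_superset hbad' fun y hy => hg y hy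
  set v : N → Space n := fun y => chartVelocity (𝓡∂ n) x (gx y) (lx y) 0 with hv
  have hφt : Tendsto φ (𝒰 : Filter N) (𝓝 (φ x)) :=
    ((continuousAt_extChartAt (I := 𝓡∂ n) x).tendsto).mono_left h𝒰x
  have hvC : ∀ᶠ y in (𝒰 : Filter N), v y ∈ Metric.closedBall (0 : Space n) C := by
    filter_upwards [hgev, h𝒰x (eventually_mem_halfBall (n := n) x hR)] with y hy hy'
    rw [mem_closedBall_zero_iff]
    exact hb.norm_chartVelocity_le hy.1 hy.1.zero_mem (by rw [hy.2.1]; exact hy'.1)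
      (by rw [chartCurve, hy.2.1]; exact hy'.2)
  obtain ⟨ξ', -, hξ'⟩ := (isCompact_closedBall (0 : Space n) C).ultrafilter_le_nhds' (𝒰.map v) hvC
  have hvt : Tendsto v (𝒰 : Filter N) (𝓝 ξ') := hξ'
  have hξ1 : m.nrm x ξ = 1 := hγ.nrm_chartVelocity rfl
  have hξ'1 : m.nrm x ξ' = 1 := by
    have h1 := tendsto_gram (m := m) h𝒰x hvt
    have h3 : ∀ᶠ y in (𝒰 : Filter N), m.gram x (φ y) (v y) (v y) = 1 := by
      filter_upwards [hgev, h𝒰x (chart_source_mem_nhds (EuclideanHalfSpace n) x)] with y hy hy'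
      have := chartMetric_chartVelocity m.h.inner (c := x) hy.1.pos hy.1.zero_mem
        (hy.1.mdiff hy.1.zero_mem) (by rw [hy.2.1]; exact hy')
      rw [hy.1.ip_vel hy.1.zero_mem, chartCurve, hy.2.1] at this
      exact this
    have h4 := tendsto_nhds_unique (h1.congr' h3) tendsto_const_nhds
    rw [nrm, h4, Real.sqrt_one]
  have hne : η ≤ ‖ξ' - ξ‖ := by
    refine ge_of_tendsto ((hvt.sub_const ξ).norm) ?_
    filter_upwards [hgev] with y hy using hy.2.2.2.le
  -- The end `y0` is at a definite chart distance from `x`, or outside the chart, so geodesics from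
  -- nearby points to `y0` last at least until time `δ`.
  obtain ⟨r0, hr0, hr0'⟩ : ∃ r0 > 0, ¬(y0 ∈ (chartAt (EuclideanHalfSpace n) x).source ∧
      ‖φ y0 - φ x‖ ≤ r0) := by
    by_cases hy : y0 ∈ (chartAt (EuclideanHalfSpace n) x).source
    · have : 0 < ‖φ y0 - φ x‖ := norm_pos_iff.2 (sub_ne_zero.2 fun h => hxy ((φ.injOn
        (by rwa [hφ, extChartAt_source]) (by rwa [hφ, extChartAt_source]) h).symm))
      exact ⟨‖φ y0 - φ x‖ / 2, by positivity, fun h => by linarith [h.2]⟩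
    · exact ⟨1, one_pos, fun h => hy h.1⟩
  set K := 4 * C ^ 4 with hK
  have hK1 : 1 ≤ K := by
    have : 1 ≤ C ^ 4 := one_le_pow₀ hC
    linarith
  -- Points at chart distance less than `r1` from `x` have a short logarithm. This will bound the
  -- time at which `γ` passes through the limit point `z`.
  obtain ⟨r1, hr1, hr1'⟩ := hL.exists_radius (show 0 < min (R / (2 * C)) (1 / (4 * C * K)) by
    positivity)
  obtain ⟨δ, hδ, hδR, hδ0, hδ1, hδK, hδη⟩ : ∃ δ > 0, C * δ < R / 2 ∧ C * δ < r0 ∧ C * δ < r1 ∧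
      4 * C * K * δ ≤ 1 ∧ 10 * C ^ 2 * K * δ < η := by
    obtain ⟨δ, h0, h1, h2⟩ := exists_pos_mul_lt_mul_lt C (10 * C ^ 2 * K)
      (show 0 < min (R / 2) (min r0 r1) by positivity) (show 0 < min 1 η by positivity)
    simp only [lt_min_iff] at h1 h2
    refine ⟨δ, h0, h1.1, h1.2.1, h1.2.2, ?_, h2.2⟩
    have h3 : 4 * C * K * δ ≤ 10 * C ^ 2 * K * δ := by
      gcongr <;> nlinarith
    linarith
  have hd : ∀ᶠ y in (𝒰 : Filter N), ‖φ y - φ x‖ < R / 2 ∧ ‖φ y - φ x‖ < r0 - C * δ := by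
    have h1 : Tendsto (fun y => ‖φ y - φ x‖) (𝒰 : Filter N) (𝓝 0) := by
      have := (hφt.sub_const (φ x)).norm
      rwa [sub_self, norm_zero] at this
    exact (h1.eventually_lt_const (half_pos hR)).and (h1.eventually_lt_const (by linarith))
  have hloc : ∀ᶠ y in (𝒰 : Filter N), δ ≤ lx y ∧ ∀ r ∈ Icc 0 δ,
      gx y r ∈ (chartAt (EuclideanHalfSpace n) x).source ∧
        chartCurve (𝓡∂ n) x (gx y) r ∈ halfBall x R := by
    filter_upwards [hgev, hd, h𝒰x (chart_source_mem_nhds (EuclideanHalfSpace n) x)] with y hy hy' hys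
    have hsrc : gx y 0 ∈ (chartAt (EuclideanHalfSpace n) x).source := by rw [hy.2.1]; exact hys
    have hu0 : chartCurve (𝓡∂ n) x (gx y) 0 = φ y := by rw [chartCurve, hy.2.1]
    have hle : δ ≤ lx y := by
      by_contra! hlt
      have h2 : C * lx y ≤ C * δ := by gcongr
      have h1 := hb.mem_chart hy.1 hy.1.right_mem hsrc (by rw [hu0]; linarith [hy'.1])
      refine hr0' ⟨?_, ?_⟩
      · have := (h1 _ hy.1.right_mem).1
        rwa [hy.2.2.1] at this
      · have h3 := hb.norm_chartCurve_sub_le hy.1 hy.1.right_mem h1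
        rw [hu0, chartCurve, hy.2.2.1] at h3
        have : φ y0 - φ x = (φ y0 - φ y) + (φ y - φ x) := by abel
        rw [this]
        exact (norm_add_le _ _).trans (by linarith [hy'.2])
    exact ⟨hle, hb.mem_chart hy.1 ⟨hδ.le, hle⟩ hsrc (by rw [hu0]; linarith [hy'.1])⟩
  obtain ⟨z, -, hz⟩ := isCompact_univ.ultrafilter_le_nhds' (𝒰.map fun y => gx y δ) univ_mem
  have hzt : Tendsto (fun y => gx y δ) (𝒰 : Filter N) (𝓝 z) := hz
  have hzmem : z ∈ (chartAt (EuclideanHalfSpace n) x).source ∧ φ z ∈ halfBall x R :=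
    (isClosed_chart_halfBall hb.subset).mem_of_tendsto hzt (by
      filter_upwards [hloc] with y hy
      exact hy.2 δ (right_mem_Icc.2 hδ.le))
  have hφz : Tendsto (fun y => φ (gx y δ)) (𝒰 : Filter N) (𝓝 (φ z)) :=
    ((continuousAt_extChartAt' (I := 𝓡∂ n) (by rw [extChartAt_source]; exact hzmem.1)).tendsto).comp hzt
  have e1 : ‖φ z - φ x - δ • ξ'‖ ≤ K * δ ^ 2 := by
    refine le_of_tendsto ((hφz.sub hφt).sub (hvt.const_smul δ)).norm ?_
    filter_upwards [hgev, hloc] with y hy hy'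
    have := hb.norm_chartCurve_sub_sub_le hy.1 ⟨hδ.le, hy'.1⟩ hy'.2
    rw [chartCurve, chartCurve, hy.2.1] at this
    exact this
  have e2 : ‖φ z - φ x‖ ≤ C * δ := by
    refine le_of_tendsto (hφz.sub hφt).norm ?_
    filter_upwards [hgev, hloc] with y hy hy'
    have := hb.norm_chartCurve_sub_le hy.1 ⟨hδ.le, hy'.1⟩ hy'.2
    rw [chartCurve, chartCurve, hy.2.1] at this
    exact this
  -- Additivity along the perturbed geodesics passes to the limit by continuity of the action. The
  -- equality case of the triangle inequality then places `z` on `γ`.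
  have e3 : m.action x z + m.action z y0 = m.action x y0 := by
    have hca := hm.continuous_action
    have ht : Tendsto (fun y : N => y) (𝒰 : Filter N) (𝓝 x) := h𝒰x
    have t1 : Tendsto (fun y => m.action y (gx y δ)) (𝒰 : Filter N) (𝓝 (m.action x z)) :=
      (hca.tendsto (x, z)).comp (ht.prodMk_nhds hzt)
    have t2 : Tendsto (fun y => m.action (gx y δ) y0) (𝒰 : Filter N) (𝓝 (m.action z y0)) :=
      (hca.tendsto (z, y0)).comp (hzt.prodMk_nhds tendsto_const_nhds)
    have t3 : Tendsto (fun y => m.action y y0) (𝒰 : Filter N) (𝓝 (m.action x y0)) :=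
      (hca.tendsto (x, y0)).comp (ht.prodMk_nhds tendsto_const_nhds)
    refine tendsto_nhds_unique (t1.add t2) (t3.congr' ?_)
    filter_upwards [hgev, hloc] with y hy hy'
    have := hm.action_add hy.1 le_rfl hδ.le hy'.1 le_rfl
    rw [hy.2.1, hy.2.2.1] at this
    exact this.symm
  have hCK : 0 < 4 * C * K := by positivity
  have e4 : ∃ r, 0 ≤ r ∧ 4 * C * K * r ≤ 1 ∧ ‖φ z - φ x - r • ξ‖ ≤ K * r ^ 2 := by
    by_cases hzx : z = x
    · exact ⟨0, le_rfl, by simp, by simp [hzx]⟩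
    obtain ⟨r, hr, hrz⟩ := hm.exists_eq_of_action_add hγ hzx e3
    have h1 := hr1' z hzmem.1 (by linarith)
    rw [lt_min_iff, ← hrz, hL.nrm_geodesic hγ rfl hr] at h1
    have h2 : C * r < R := by
      have := h1.1
      rw [lt_div_iff₀ (by positivity)] at this
      nlinarith [hr.1]
    have h3 := hb.mem_chart hγ hr hxs (by
      rw [chartCurve, ← hx, sub_self, norm_zero, zero_add]
      exact h2)
    refine ⟨r, hr.1, ?_, ?_⟩
    · have := h1.2
      rw [lt_div_iff₀ hCK] at this
      linarith
    · have := hb.norm_chartCurve_sub_sub_le hγ hr h3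
      rw [chartCurve, chartCurve, hrz] at this
      exact this
  obtain ⟨r, hr, hrK, hrz⟩ := e4
  -- The point `z` has two expansions, along the limit velocity `ξ'` at time `δ` and along `ξ` at
  -- time `r`. For the chosen `δ` their comparison contradicts `η ≤ ‖ξ' - ξ‖`.
  have e5 : ‖r • ξ - δ • ξ'‖ ≤ K * (r ^ 2 + δ ^ 2) := by
    have : r • ξ - δ • ξ' = (φ z - φ x - δ • ξ') - (φ z - φ x - r • ξ) := by abel
    rw [this]
    refine (norm_sub_le _ _).trans ?_
    linarith
  have := hb.norm_sub_le_of_smul hξ1 hξ'1 hr hδ hK1 hrK hδK e5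
  rw [norm_sub_rev] at this
  linarith

end IsSimple

end MagneticSystem
end

/-! ### The derivative of the action in the initial point. -/

section

variable {n : ℕ} [NeZero n] {N : Type*} [TopologicalSpace N]
  [ChartedSpace (EuclideanHalfSpace n) N] [IsManifold (𝓡∂ n) ∞ N]

/-- The straight segment with initial velocity `u`, in the chart at its initial point. -/
abbrev ownLine (x : N) (u : Space n) (τ : ℝ) : N := chartLine x (extChartAt (𝓡∂ n) x x) u τ

omit [IsManifold (𝓡∂ n) ∞ N] in
theorem exists_ownLine_mem {x : N} {u : Space n}
    (hu : ∀ ε : ℝ, 0 ≤ ε → extChartAt (𝓡∂ n) x x + ε • u ∈ range (𝓡∂ n)) {R : ℝ} (hR : 0 < R) :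
    ∃ T : ℝ, 0 < T ∧ ∀ τ ∈ Icc (0 : ℝ) T, extChartAt (𝓡∂ n) x x + τ • u ∈ halfBall x R := by
  refine ⟨R / (‖u‖ + 1), by positivity, fun τ hτ => ⟨?_, hu τ hτ.1⟩⟩
  rw [Metric.mem_closedBall, dist_eq_norm, add_sub_cancel_left, norm_smul,
    Real.norm_of_nonneg hτ.1]
  have h1 : τ * ‖u‖ ≤ R / (‖u‖ + 1) * ‖u‖ := by gcongr; exact hτ.2
  refine h1.trans ?_
  rw [div_mul_eq_mul_div, div_le_iff₀ (by positivity)]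
  nlinarith [norm_nonneg u]

omit [IsManifold (𝓡∂ n) ∞ N] in
theorem ownLine_zero (x : N) (u : Space n) : ownLine x u 0 = x := by
  rw [ownLine, chartLine, zero_smul, add_zero, extChartAt_to_inv]

omit [IsManifold (𝓡∂ n) ∞ N] in
theorem tendsto_ownLine (x : N) (u : Space n) :
    Tendsto (ownLine x u) (𝓝[>] 0) (𝓝 x) := by
  have h1 : Tendsto (fun τ : ℝ => extChartAt (𝓡∂ n) x x + τ • u) (𝓝[>] 0)
      (𝓝 (extChartAt (𝓡∂ n) x x)) := by
    have := (by fun_prop : Continuous fun τ : ℝ => extChartAt (𝓡∂ n) x x + τ • u).tendsto 0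
    rw [zero_smul, add_zero] at this
    exact this.mono_left nhdsWithin_le_nhds
  have h2 := (continuousAt_extChartAt_symm (I := 𝓡∂ n) x).tendsto.comp h1
  rwa [extChartAt_to_inv] at h2

namespace MagneticSystem

variable {m : MagneticSystem n N}

/-- The inequality `2δ|w| ≤ |w|² + δ²` replaces the norm by its square, which expands exactly. This
linearizes the norm from above near `δ v`. -/
theorem nrm_add_smul_le {x : N} {v d : Space n} {δ a : ℝ} (hδ : 0 < δ)
    (ha : m.ip x v v ≤ 1 + a) :
    m.nrm x (d + δ • v) ≤ δ + m.ip x v d + δ * a / 2 + m.ip x d d / (2 * δ) := by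
  have h1 : m.ip x (d + δ • v) (d + δ • v)
      = m.ip x d d + 2 * δ * m.ip x v d + δ ^ 2 * m.ip x v v := by
    simp only [map_add, map_smul, add_apply, smul_apply, smul_eq_mul, m.ip_symm x d v]
    ring
  have h2 := m.nrm_sq x (d + δ • v)
  rw [h1] at h2
  have h3 : 2 * δ * m.nrm x (d + δ • v) ≤ m.nrm x (d + δ • v) ^ 2 + δ ^ 2 := by
    nlinarith [sq_nonneg (m.nrm x (d + δ • v) - δ)]
  have h4 : δ ^ 2 * m.ip x v v ≤ δ ^ 2 * (1 + a) := by gcongr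
  have h5 : 2 * δ * m.nrm x (d + δ • v)
      ≤ 2 * δ * (δ + m.ip x v d + δ * a / 2 + m.ip x d d / (2 * δ)) := by
    have e : 2 * δ * (δ + m.ip x v d + δ * a / 2 + m.ip x d d / (2 * δ))
        = 2 * δ ^ 2 + 2 * δ * m.ip x v d + δ ^ 2 * a + m.ip x d d := by field_simp
    rw [e]
    linarith
  exact le_of_mul_le_mul_left h5 (by positivity)

/-- Moving the initial point of a short magnetic geodesic. -/
theorem HasChartBounds.action_sub_le [T2Space N] [CompactSpace N] {x : N} {R C : ℝ}
    (hb : m.HasChartBounds x R C) (hm : m.IsSimple) {ℓ : ℝ} {γ : ℝ → N}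
    (hγ : m.IsMagneticGeodesic ℓ γ) {δ : ℝ} (hδ : δ ∈ Ioc 0 ℓ) (h : ∀ r ∈ Icc 0 δ,
      γ r ∈ (chartAt (EuclideanHalfSpace n) x).source ∧ chartCurve (𝓡∂ n) x γ r ∈ halfBall x R)
    {q : N} (hq : q ∈ (chartAt (EuclideanHalfSpace n) x).source)
    (hq' : extChartAt (𝓡∂ n) x q ∈ halfBall x R) {A : ℝ} (hA : A ≤ δ)
    (hA1 : ‖extChartAt (𝓡∂ n) x (γ 0) - extChartAt (𝓡∂ n) x x‖ ≤ A)
    (hA2 : ‖extChartAt (𝓡∂ n) x q - extChartAt (𝓡∂ n) x x‖ ≤ A)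
    (hA3 : ‖extChartAt (𝓡∂ n) x (γ 0) - extChartAt (𝓡∂ n) x q‖ ≤ A) :
    m.action q (γ δ) - m.action (γ 0) (γ δ)
      ≤ m.ip x (chartVelocity (𝓡∂ n) x γ ℓ 0)
          (extChartAt (𝓡∂ n) x (γ 0) - extChartAt (𝓡∂ n) x q)
        - m.pot x (extChartAt (𝓡∂ n) x (γ 0) - extChartAt (𝓡∂ n) x q)
        + 103 * C ^ 10 * δ ^ 2 + C * A ^ 2 / δ := by
  have hC := hb.one_le
  have hδI : δ ∈ Icc 0 ℓ := ⟨hδ.1.le, hδ.2⟩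
  have hδ0 := hδ.1
  have h0δ := left_mem_Icc.2 hδ0.le
  have hδδ := right_mem_Icc.2 hδ0.le
  set φ := extChartAt (𝓡∂ n) x with hφ
  set ξ := chartVelocity (𝓡∂ n) x γ ℓ 0 with hξ
  set d := φ (γ 0) - φ q with hd
  have hA0 : 0 ≤ A := (norm_nonneg _).trans hA1
  have p45 : ∀ k ≤ 10, C ^ k ≤ C ^ 10 := fun k hk => pow_le_pow_right₀ hC hk
  have hCp : ∀ k, 1 ≤ C ^ k := fun k => one_le_pow₀ hC
  set e := φ (γ δ) - φ (γ 0) - δ • ξ with he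
  have he1 : ‖e‖ ≤ 4 * C ^ 4 * δ ^ 2 := hb.norm_chartCurve_sub_sub_le hγ hδI h
  have hz1 : ‖φ (γ δ) - φ (γ 0)‖ ≤ C * δ := hb.norm_chartCurve_sub_le hγ hδI h
  have hξC : ‖ξ‖ ≤ C := hb.norm_chartVelocity_le hγ hγ.zero_mem (h 0 h0δ).1 (h 0 h0δ).2
  have hlow : δ * (1 - m.pot x ξ) - 10 * C ^ 5 * δ ^ 2 ≤ m.action (γ 0) (γ δ) := by
    have h1 := (abs_le.1 (hb.abs_action_sub_le hm hγ hδI h)).1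
    have h2 : 5 * C ^ 5 * δ * (δ + ‖chartCurve (𝓡∂ n) x γ 0 - φ x‖) ≤ 5 * C ^ 5 * δ * (δ + δ) := by
      gcongr
      exact hA1.trans hA
    linarith
  have hup := hb.action_le hm hq (h δ hδδ).1 hq' (h δ hδδ).2
  -- The chord from `q` to `γ δ` is the displacement `d` plus `δ ξ`, up to an error `e` of order
  -- `δ²`.
  have hD : φ (γ δ) - φ q = (d + δ • ξ) + e := by rw [hd, he]; abel
  have hDn : ‖φ (γ δ) - φ q‖ ≤ 2 * C * δ := by
    have : φ (γ δ) - φ q = (φ (γ δ) - φ (γ 0)) + d := by rw [hd]; abel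
    rw [this]
    refine (norm_add_le _ _).trans ?_
    nlinarith
  have hzn : ‖φ (γ δ) - φ x‖ ≤ 2 * C * δ := by
    have : φ (γ δ) - φ x = (φ (γ δ) - φ (γ 0)) + (φ (γ 0) - φ x) := by abel
    rw [this]
    refine (norm_add_le _ _).trans ?_
    nlinarith
  simp only [← hφ] at hup
  have h3 : 2 * C ^ 2 * ‖φ (γ δ) - φ q‖ * (‖φ q - φ x‖ + ‖φ (γ δ) - φ x‖)
      ≤ 2 * C ^ 2 * (2 * C * δ) * (C * δ + 2 * C * δ) := by
    gcongr
    nlinarith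
  have hn1 : m.nrm x (φ (γ δ) - φ q) ≤ m.nrm x (d + δ • ξ) + C * (4 * C ^ 4 * δ ^ 2) := by
    rw [hD]
    refine (m.nrm_add_le x _ _).trans (add_le_add le_rfl ((hb.nrm_le e).trans ?_))
    gcongr
  -- The vector `ξ` has unit length for the metric at `γ 0`, whereas the norm is taken at the chart
  -- centre `x`.
  have hipξ : m.ip x ξ ξ ≤ 1 + C ^ 3 * δ := by
    have h1 := chartMetric_chartVelocity m.h.inner hγ.pos hγ.zero_mem (hγ.mdiff hγ.zero_mem) (h 0 h0δ).1
    rw [hγ.ip_vel hγ.zero_mem] at h1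
    have h2 := (abs_le.1 (ContinuousLinearMap.le_of_opNorm_le _ (ContinuousLinearMap.le_of_opNorm_le _
      (hb.gram_sub_le _ hb.self_mem _ (h 0 h0δ).2) ξ) ξ)).2
    rw [sub_apply, sub_apply, gram, gram, h1, chartMetric_self, norm_sub_rev] at h2
    have h4 : C * ‖chartCurve (𝓡∂ n) x γ 0 - φ x‖ * ‖ξ‖ * ‖ξ‖ ≤ C * δ * C * C := by
      gcongr
      exact hA1.trans hA
    have h5 : C * δ * C * C = C ^ 3 * δ := by ring
    have h6 : m.ip x ξ ξ - 1 ≤ C * ‖chartCurve (𝓡∂ n) x γ 0 - φ x‖ * ‖ξ‖ * ‖ξ‖ := h2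
    linarith
  have hn2 := nrm_add_smul_le (d := d) hδ0 hipξ
  have hdd : m.ip x d d / (2 * δ) ≤ C * A ^ 2 / δ := by
    have h1 := ContinuousLinearMap.le_of_opNorm_le _ (ContinuousLinearMap.le_of_opNorm_le _
      (hb.gram_le _ hb.self_mem) d) d
    rw [gram, chartMetric_self] at h1
    have h2 : m.ip x d d ≤ C * A ^ 2 := by
      refine ((le_abs_self _).trans h1).trans ?_
      rw [mul_assoc, ← sq]
      gcongr
    have h5 : 0 ≤ C * A ^ 2 := by positivity
    rw [div_le_div_iff₀ (by positivity) hδ0]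
    nlinarith
  have hp : -m.pot x (φ (γ δ) - φ q) ≤ -m.pot x d - δ * m.pot x ξ + C * (4 * C ^ 4 * δ ^ 2) := by
    have h1 := (abs_le.1 (ContinuousLinearMap.le_of_opNorm_le_of_le _
      (hb.cpot_le _ hb.self_mem) he1)).1
    rw [cpot, chartForm_self] at h1
    have h2 : -(C * (4 * C ^ 4 * δ ^ 2)) ≤ m.pot x e := h1
    rw [hD, map_add, map_add, map_smul, smul_eq_mul]
    linarith
  have q1 : C ^ 5 * δ ^ 2 ≤ C ^ 10 * δ ^ 2 := mul_le_mul_of_nonneg_right (p45 5 (by norm_num)) (sq_nonneg δ)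
  have q2 : C ^ 4 * δ ^ 2 ≤ C ^ 10 * δ ^ 2 := mul_le_mul_of_nonneg_right (p45 4 (by norm_num)) (sq_nonneg δ)
  have q3 : C ^ 3 * δ ^ 2 ≤ C ^ 10 * δ ^ 2 := mul_le_mul_of_nonneg_right (p45 3 (by norm_num)) (sq_nonneg δ)
  have q4 : 0 ≤ C ^ 10 * δ ^ 2 := by positivity
  have r1 : 2 * C ^ 2 * (2 * C * δ) * (C * δ + 2 * C * δ) = 12 * (C ^ 4 * δ ^ 2) := by ring
  have r2 : C * (4 * C ^ 4 * δ ^ 2) = 4 * (C ^ 5 * δ ^ 2) := by ring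
  have r3 : δ * (C ^ 3 * δ) / 2 = C ^ 3 * δ ^ 2 / 2 := by ring
  rw [r1] at h3
  rw [r2] at hn1 hp
  rw [r3] at hn2
  linarith

theorem tendsto_cube_nhdsGT : Tendsto (fun κ : ℝ => κ ^ 3) (𝓝[>] 0) (𝓝[>] 0) := by
  refine tendsto_nhdsWithin_iff.2 ⟨?_, ?_⟩
  · have := (continuous_pow 3 : Continuous fun κ : ℝ => κ ^ 3).tendsto 0
    rw [zero_pow (by norm_num)] at this
    exact this.mono_left nhdsWithin_le_nhds
  · filter_upwards [self_mem_nhdsWithin] with κ hκ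
    exact pow_pos (mem_Ioi.1 hκ) 3

theorem eventually_small {a b c : ℝ} (hb : 0 < b) (hc : 0 < c) :
    ∀ᶠ κ in 𝓝[>] (0 : ℝ), a * κ < b ∧ κ < c ∧ 0 < κ := by
  have h1 : Tendsto (fun κ : ℝ => a * κ) (𝓝[>] 0) (𝓝 0) := by
    have := (by fun_prop : Continuous fun δ : ℝ => a * δ).tendsto 0
    rw [mul_zero] at this
    exact this.mono_left nhdsWithin_le_nhds
  filter_upwards [h1.eventually_lt_const hb, Ioo_mem_nhdsGT hc] with κ h2 h3
  exact ⟨h2, h3.2, h3.1⟩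

namespace IsSimple

variable [T2Space N] [CompactSpace N]

/-- The derivative of the action in the initial point. -/
theorem tendsto_start (hm : m.IsSimple) {ℓ : ℝ} {γ : ℝ → N} (hγ : m.IsMagneticGeodesic ℓ γ)
    {u : Space n}
    (hu : ∀ ε : ℝ, 0 ≤ ε → extChartAt (𝓡∂ n) (γ 0) (γ 0) + ε • u ∈ range (𝓡∂ n)) :
    Tendsto (fun κ : ℝ => (m.action (ownLine (γ 0) u (κ ^ 3)) (γ ℓ) - m.action (γ 0) (γ ℓ)) / κ ^ 3)
      (𝓝[>] 0) (𝓝 (-(m.ip (γ 0) (vel γ ℓ 0) u - m.pot (γ 0) u))) := by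
  obtain ⟨R, C, hb⟩ := m.exists_hasChartBounds (γ 0)
  have hC := hb.one_le
  have hR := hb.pos
  have hxy : γ 0 ≠ γ ℓ := hm.ne hγ le_rfl hγ.pos le_rfl
  have hξ : vel (n := n) γ ℓ 0 = chartVelocity (𝓡∂ n) (γ 0) γ ℓ 0 :=
    (chartVelocity_self hγ.pos hγ.zero_mem (hγ.mdiff hγ.zero_mem)).symm
  rw [hξ]
  set x := γ 0 with hx
  set y0 := γ ℓ with hy0
  set φ := extChartAt (𝓡∂ n) x with hφ
  set ξ := chartVelocity (𝓡∂ n) x γ ℓ 0 with hξ'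
  have hxs := mem_chart_source (EuclideanHalfSpace n) x
  obtain ⟨T, hT, hTmem⟩ := exists_ownLine_mem hu (half_pos hR)
  have hhalf : halfBall x (R / 2) ⊆ halfBall (n := n) x R := fun w hw =>
    ⟨Metric.closedBall_subset_closedBall (half_le_self hR.le) hw.1, hw.2⟩
  have hline : Tendsto (fun κ : ℝ => ownLine x u (κ ^ 3)) (𝓝[>] 0) (𝓝 x) :=
    (tendsto_ownLine x u).comp tendsto_cube_nhdsGT
  have hpt : ∀ κ : ℝ, 0 < κ → κ < min 1 T → ownLine x u (κ ^ 3) ∈ (chartAt (EuclideanHalfSpace n) x).source ∧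
      φ (ownLine x u (κ ^ 3)) = φ x + κ ^ 3 • u ∧ φ x + κ ^ 3 • u ∈ halfBall x (R / 2) := by
    intro κ h0 h1
    rw [lt_min_iff] at h1
    have h2 : κ ^ 3 ≤ T := by
      have : κ ^ 3 ≤ κ := pow_le_of_le_one h0.le h1.1.le (by norm_num)
      linarith [h1.2]
    have h3 := hTmem (κ ^ 3) ⟨by positivity, h2⟩
    exact ⟨chartLine_mem_source (hb.subset (hhalf h3)), extChartAt_chartLine (hb.subset (hhalf h3)), h3⟩
  -- The initial point moves by a multiple of `κ³` and the first leg lasts for time `δ = κ²`. Both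
  -- errors, `δ²` and `(κ³)² / δ`, are then of order `κ⁴`, negligible against `κ³`.
  set K := 103 * C ^ 10 + C * ‖u‖ ^ 2 with hK
  have herr : ∀ κ : ℝ, 0 < κ → 103 * C ^ 10 * (κ ^ 2) ^ 2 + C * (κ ^ 3 * ‖u‖) ^ 2 / κ ^ 2 = K * κ ^ 4 := by
    intro κ h0
    rw [hK]
    field_simp
  -- Upper bound: from the moved point to `γ (κ²)`, and from there along `γ`.
  have hup : ∀ᶠ κ in 𝓝[>] (0 : ℝ),
      (m.action (ownLine x u (κ ^ 3)) y0 - m.action x y0) / κ ^ 3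
        ≤ -(m.ip x ξ u - m.pot x u) + K * κ := by
    filter_upwards [eventually_small (a := ‖u‖) one_pos (show 0 < min (min 1 T) (min ℓ (R / C)) by
      have := hγ.pos
      positivity)] with κ hκ
    obtain ⟨k1, k2, k0⟩ := hκ
    rw [lt_min_iff, lt_min_iff (b := ℓ)] at k2
    obtain ⟨k2, k3, k4⟩ := k2
    have k5 : κ < 1 := k2.trans_le (min_le_left _ _)
    obtain ⟨h1, h2, h3⟩ := hpt κ k0 k2
    have hsq : κ ^ 2 ≤ κ := pow_le_of_le_one k0.le k5.le (by norm_num)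
    have hδ : κ ^ 2 ∈ Ioc 0 ℓ := ⟨by positivity, by linarith⟩
    have hmem := hb.mem_chart hγ ⟨hδ.1.le, hδ.2⟩ hxs (by
      rw [chartCurve, ← hx, sub_self, norm_zero, zero_add]
      rw [lt_div_iff₀ (by linarith)] at k4
      nlinarith)
    have hA : κ ^ 3 * ‖u‖ ≤ κ ^ 2 := by
      have : κ ^ 3 * ‖u‖ = κ ^ 2 * (‖u‖ * κ) := by ring
      rw [this]
      exact mul_le_of_le_one_right (by positivity) k1.le
    have hn : ‖κ ^ 3 • u‖ = κ ^ 3 * ‖u‖ := by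
      rw [norm_smul, Real.norm_of_nonneg (by positivity)]
    have key := hb.action_sub_le hm hγ hδ hmem h1 (by rw [← hφ, h2]; exact hhalf h3) hA
      (by rw [← hx, sub_self, norm_zero]; positivity)
      (by rw [← hφ, h2, add_sub_cancel_left, hn])
      (by rw [← hx, ← hφ, h2, sub_add_cancel_left, norm_neg, hn])
    have t1 := hm.action_triangle (ownLine x u (κ ^ 3)) (γ (κ ^ 2)) y0
    have t2 := hm.action_add hγ le_rfl hδ.1.le hδ.2 le_rfl
    rw [← hx, ← hφ, h2, sub_add_cancel_left, map_neg, map_neg, map_smul, map_smul, smul_eq_mul,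
      smul_eq_mul, add_assoc, herr κ k0] at key
    rw [div_le_iff₀ (by positivity)]
    have e : (-(m.ip x ξ u - m.pot x u) + K * κ) * κ ^ 3
        = -(κ ^ 3 * m.ip x ξ u) - -(κ ^ 3 * m.pot x u) + K * κ ^ 4 := by ring
    rw [e]
    linarith
  -- Lower bound: the roles are exchanged, from `x` to a point of the geodesic starting at the moved
  -- point and then along that geodesic. Its initial velocity is within `η` of that of `γ`.
  have hlow : ∀ η > 0, ∀ᶠ κ in 𝓝[>] (0 : ℝ),
      -(m.ip x ξ u - m.pot x u) - (K * κ + C * η * ‖u‖)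
        ≤ (m.action (ownLine x u (κ ^ 3)) y0 - m.action x y0) / κ ^ 3 := by
    intro η hη
    have hlen : ∀ᶠ y in 𝓝 x, y ≠ y0 := by
      exact isOpen_ne.mem_nhds hxy
    obtain ⟨r0, hr0, hr0'⟩ : ∃ r0 > 0, ¬(y0 ∈ (chartAt (EuclideanHalfSpace n) x).source ∧
        ‖φ y0 - φ x‖ ≤ r0) := by
      by_cases hy : y0 ∈ (chartAt (EuclideanHalfSpace n) x).source
      · have : 0 < ‖φ y0 - φ x‖ := norm_pos_iff.2 (sub_ne_zero.2 fun h => hxy ((φ.injOn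
          (by rwa [hφ, extChartAt_source]) (by rwa [hφ, extChartAt_source]) h).symm))
        exact ⟨‖φ y0 - φ x‖ / 2, by positivity, fun h => by linarith [h.2]⟩
      · exact ⟨1, one_pos, fun h => hy h.1⟩
    filter_upwards [eventually_small (a := ‖u‖) one_pos (show 0 < min (min 1 T)
        (min (r0 / (C + 1)) (R / (2 * C))) by positivity), hline.eventually hlen,
      hline.eventually (hm.eventually_norm_chartVelocity_sub_le hγ hη)] with κ hκ hne hvel
    obtain ⟨k1, k2, k0⟩ := hκ
    rw [lt_min_iff, lt_min_iff (b := r0 / (C + 1))] at k2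
    obtain ⟨k2, k3, k4⟩ := k2
    rw [lt_div_iff₀ (by positivity)] at k3 k4
    have k5 : κ < 1 := k2.trans_le (min_le_left _ _)
    obtain ⟨h1, h2, h3⟩ := hpt κ k0 k2
    have hsq : κ ^ 2 ≤ κ := pow_le_of_le_one k0.le k5.le (by norm_num)
    have hn : ‖κ ^ 3 • u‖ = κ ^ 3 * ‖u‖ := by
      rw [norm_smul, Real.norm_of_nonneg (by positivity)]
    have hA : κ ^ 3 * ‖u‖ ≤ κ ^ 2 := by
      have : κ ^ 3 * ‖u‖ = κ ^ 2 * (‖u‖ * κ) := by ring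
      rw [this]
      exact mul_le_of_le_one_right (by positivity) k1.le
    obtain ⟨ℓ', γ', hγ', g0, g1⟩ := hm.exists_geodesic hne
    have hv := hvel ℓ' γ' hγ' g0 g1
    change ‖chartVelocity (𝓡∂ n) x γ' ℓ' 0 - ξ‖ ≤ η at hv
    set ξ' := chartVelocity (𝓡∂ n) x γ' ℓ' 0 with hξ''
    have hsrc : γ' 0 ∈ (chartAt (EuclideanHalfSpace n) x).source := by rw [g0]; exact h1
    have hu0 : chartCurve (𝓡∂ n) x γ' 0 - φ x = κ ^ 3 • u := by
      rw [chartCurve, g0, ← hφ, h2, add_sub_cancel_left]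
    have hRhalf : ‖chartCurve (𝓡∂ n) x γ' 0 - φ x‖ ≤ R / 2 := by
      have := h3.1
      rwa [Metric.mem_closedBall, dist_eq_norm, add_sub_cancel_left, ← hu0] at this
    have hδℓ : κ ^ 2 ≤ ℓ' := by
      by_contra! hlt
      have hCl : C * ℓ' ≤ C * κ := by
        have : ℓ' ≤ κ := by linarith
        gcongr
      have hin := hb.mem_chart hγ' hγ'.right_mem hsrc (by
        refine lt_of_le_of_lt (add_le_add hRhalf hCl) ?_
        nlinarith)
      refine hr0' ⟨?_, ?_⟩
      · have := (hin _ hγ'.right_mem).1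
        rwa [g1] at this
      · have h5 := hb.norm_chartCurve_sub_le hγ' hγ'.right_mem hin
        have h6 : φ y0 - φ x = (chartCurve (𝓡∂ n) x γ' ℓ' - chartCurve (𝓡∂ n) x γ' 0)
            + (chartCurve (𝓡∂ n) x γ' 0 - φ x) := by
          rw [sub_add_sub_cancel, chartCurve, g1]
        rw [h6]
        refine (norm_add_le _ _).trans ((add_le_add h5 (le_of_eq (by rw [hu0, hn]))).trans ?_)
        nlinarith
    have hδ : κ ^ 2 ∈ Ioc 0 ℓ' := ⟨by positivity, hδℓ⟩
    have hmem := hb.mem_chart hγ' ⟨hδ.1.le, hδ.2⟩ hsrc (by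
      have h5 : C * κ ^ 2 ≤ C * κ := by gcongr
      refine lt_of_le_of_lt (add_le_add hRhalf h5) ?_
      nlinarith)
    have key := hb.action_sub_le hm hγ' hδ hmem hxs hb.self_mem hA
      (by rw [← hn, ← hu0]; exact le_rfl)
      (by rw [sub_self, norm_zero]; positivity)
      (by rw [← hn, ← hu0]; exact le_rfl)
    have t1 := hm.action_triangle x (γ' (κ ^ 2)) y0
    have t2 := hm.action_add hγ' le_rfl hδ.1.le hδ.2 le_rfl
    rw [g0, g1] at t2
    rw [g0, ← hφ, h2, add_sub_cancel_left, map_smul, map_smul, smul_eq_mul, smul_eq_mul, add_assoc,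
      herr κ k0, ← hξ''] at key
    have hip : m.ip x ξ' u ≤ m.ip x ξ u + C * η * ‖u‖ := by
      have h5 := ContinuousLinearMap.le_of_opNorm_le _ (ContinuousLinearMap.le_of_opNorm_le_of_le _
        (hb.gram_le _ hb.self_mem) hv) u
      rw [gram, chartMetric_self, map_sub, sub_apply] at h5
      have := (le_abs_self _).trans h5
      linarith
    rw [le_div_iff₀ (by positivity)]
    have h7 : κ ^ 3 * m.ip x ξ' u ≤ κ ^ 3 * (m.ip x ξ u + C * η * ‖u‖) := by gcongr
    have e : (-(m.ip x ξ u - m.pot x u) - (K * κ + C * η * ‖u‖)) * κ ^ 3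
        = -(κ ^ 3 * (m.ip x ξ u + C * η * ‖u‖)) + κ ^ 3 * m.pot x u - K * κ ^ 4 := by ring
    rw [e]
    linarith
  rw [Metric.tendsto_nhds]
  intro ε hε
  have hη : 0 < ε / (2 * (C * ‖u‖ + 1)) := by positivity
  have hK0 : 0 ≤ K := by positivity
  filter_upwards [hup, hlow _ hη, eventually_small (a := K) (half_pos hε) one_pos] with κ h1 h2 h3
  have h4 : C * (ε / (2 * (C * ‖u‖ + 1))) * ‖u‖ ≤ ε / 2 := by
    rw [show C * (ε / (2 * (C * ‖u‖ + 1))) * ‖u‖ = (ε * (C * ‖u‖)) / (2 * (C * ‖u‖ + 1)) by ring,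
      div_le_div_iff₀ (by positivity) two_pos]
    nlinarith
  rw [Real.dist_eq, abs_lt]
  constructor <;> linarith [h3.1]

end IsSimple

end MagneticSystem
end

/-! ### Boundary directions; derivatives on the diagonal and in the final point. -/

section

variable {n : ℕ} [NeZero n] {N : Type*} [TopologicalSpace N]
  [ChartedSpace (EuclideanHalfSpace n) N]

theorem extChartAt_zero_nonneg (c p : N) : 0 ≤ extChartAt (𝓡∂ n) c p 0 := by
  have := extChartAt_mem_range (I := 𝓡∂ n) c p
  rwa [range_modelWithCornersEuclideanHalfSpace] at this

variable [IsManifold (𝓡∂ n) ∞ N]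

theorem mem_interior_iff_of_mem_source {c p : N}
    (hp : p ∈ (chartAt (EuclideanHalfSpace n) c).source) :
    p ∈ (𝓡∂ n).interior N ↔ 0 < extChartAt (𝓡∂ n) c p 0 := by
  have h1 := (𝓡∂ n).isInteriorPoint_iff_of_mem_atlas (n := ∞) (by simp)
    (chart_mem_atlas (EuclideanHalfSpace n) c) hp
  have h2 := interior_range_modelWithCornersEuclideanHalfSpace n
  refine Iff.trans h1 ⟨fun h => ?_, fun h => ?_⟩
  · have h3 := interior_mono (OpenPartialHomeomorph.extend_target_subset_range
      (I := 𝓡∂ n) (chartAt (EuclideanHalfSpace n) c)) h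
    rwa [h2] at h3
  · refine (chartAt (EuclideanHalfSpace n) c).mem_interior_extend_target
      ((chartAt (EuclideanHalfSpace n) c).map_source hp) ?_
    rw [h2]
    exact h

theorem mem_boundary_iff_of_mem_source {c p : N}
    (hp : p ∈ (chartAt (EuclideanHalfSpace n) c).source) :
    p ∈ (𝓡∂ n).boundary N ↔ extChartAt (𝓡∂ n) c p 0 = 0 := by
  rw [← ModelWithCorners.compl_interior, mem_compl_iff, mem_interior_iff_of_mem_source hp, not_lt]
  exact ⟨fun h => le_antisymm h (extChartAt_zero_nonneg c p), fun h => h.le⟩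

theorem mem_boundary_iff {x : N} : x ∈ (𝓡∂ n).boundary N ↔ extChartAt (𝓡∂ n) x x 0 = 0 :=
  mem_boundary_iff_of_mem_source (mem_chart_source _ x)

theorem add_smul_mem_range_of_mem_boundary {x : N} (hx : x ∈ (𝓡∂ n).boundary N) {u : Space n}
    (hu : u 0 = 0) (ε : ℝ) : extChartAt (𝓡∂ n) x x + ε • u ∈ range (𝓡∂ n) := by
  rw [range_modelWithCornersEuclideanHalfSpace]
  change 0 ≤ (extChartAt (𝓡∂ n) x x + ε • u) 0
  rw [PiLp.add_apply, PiLp.smul_apply, hu, mem_boundary_iff.1 hx, smul_zero, add_zero]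

theorem eventually_ownLine_mem_boundary {x : N} (hx : x ∈ (𝓡∂ n).boundary N) {u : Space n}
    (hu : u 0 = 0) : ∀ᶠ ε in 𝓝[>] (0 : ℝ), ownLine x u ε ∈ (𝓡∂ n).boundary N := by
  obtain ⟨R, hR, hsub⟩ := exists_halfBall_subset (n := n) x
  obtain ⟨T, hT, hTm⟩ := exists_ownLine_mem
    (fun ε _ => add_smul_mem_range_of_mem_boundary hx hu ε) hR
  filter_upwards [Ioo_mem_nhdsGT hT] with ε hε
  have h := hsub (hTm ε ⟨hε.1.le, hε.2.le⟩)
  rw [mem_boundary_iff_of_mem_source (chartLine_mem_source h), extChartAt_chartLine h,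
    PiLp.add_apply, PiLp.smul_apply, hu, mem_boundary_iff.1 hx, smul_zero, add_zero]

namespace MagneticSystem

variable {m : MagneticSystem n N} [T2Space N] [CompactSpace N]

omit [CompactSpace N] in
/-- The action to nearby points, from below. -/
theorem HasChartBounds.le_action {x : N} {R C : ℝ}
    (hb : m.HasChartBounds x R C) (hm : m.IsSimple) {s : ℝ} {γ : ℝ → N}
    (hγ : m.IsMagneticGeodesic s γ) (h0 : γ 0 = x) (hs : C * s < R) (hs' : 8 * C ^ 5 * s ≤ 1)
    {d : Space n} (hd : extChartAt (𝓡∂ n) x (γ s) - extChartAt (𝓡∂ n) x x = d) :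
    m.nrm x d - m.pot x d - 52 * C ^ 7 * ‖d‖ ^ 2 ≤ m.action x (γ s) := by
  have hC := hb.one_le
  have hs0 := hγ.pos
  have hmem := hb.mem_chart hγ hγ.right_mem (by rw [h0]; exact mem_chart_source _ x)
    (by rwa [chartCurve, h0, sub_self, norm_zero, zero_add])
  have h1 := hb.norm_chartCurve_sub_sub_le hγ hγ.right_mem hmem
  have h2 := (abs_le.1 (hb.abs_action_sub_le hm hγ hγ.right_mem hmem)).1
  have hξ1 := hγ.nrm_chartVelocity h0
  simp only [chartCurve, h0, sub_self, norm_zero, add_zero, hd] at h1 h2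
  set ξ := chartVelocity (𝓡∂ n) x γ s 0
  set e := d - s • ξ with he
  have hde : d = s • ξ + e := by rw [he]; abel
  have hse : s • ξ = d + -e := by rw [he]; abel
  have hsn : m.nrm x (s • ξ) = s := by rw [m.nrm_smul x hs0.le, hξ1, mul_one]
  have hen : m.nrm x e ≤ 4 * C ^ 5 * s ^ 2 := by
    refine (hb.nrm_le e).trans ?_
    calc C * ‖e‖ ≤ C * (4 * C ^ 4 * s ^ 2) := by gcongr
      _ = 4 * C ^ 5 * s ^ 2 := by ring
  have hep : m.pot x e ≥ -(4 * C ^ 5 * s ^ 2) := by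
    have h3 := (abs_le.1 (ContinuousLinearMap.le_of_opNorm_le_of_le _
      (hb.cpot_le _ hb.self_mem) h1)).1
    rw [cpot, chartForm_self] at h3
    have h4 : -(C * (4 * C ^ 4 * s ^ 2)) ≤ m.pot x e := h3
    linarith
  -- The quadratic error is absorbed into `s`, so that errors in the length `s` become errors in the
  -- chart distance `‖d‖`.
  have hsle : s ≤ 2 * (C * ‖d‖) := by
    have h3 : s ≤ m.nrm x d + m.nrm x e := by
      have := m.nrm_add_le x d (-e)
      rwa [← hse, hsn, m.nrm_neg] at this
    have h4 := hb.nrm_le d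
    have h5 : 8 * C ^ 5 * s * s ≤ 1 * s := by gcongr
    linarith
  have hnd : m.nrm x d ≤ s + 4 * C ^ 5 * s ^ 2 := by
    have := m.nrm_add_le x (s • ξ) e
    rw [← hde, hsn] at this
    linarith
  have hpd : m.pot x d = s * m.pot x ξ + m.pot x e := by
    rw [hde, map_add, map_smul, smul_eq_mul]
  -- The constant is `13 = 5 + 4 + 4`, from the expansion of the action and from the norm and the
  -- potential of the remainder `e`.
  have hs2 : 13 * C ^ 5 * s ^ 2 ≤ 13 * C ^ 5 * (2 * (C * ‖d‖)) ^ 2 := by gcongr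
  have e1 : 13 * C ^ 5 * (2 * (C * ‖d‖)) ^ 2 = 52 * C ^ 7 * ‖d‖ ^ 2 := by ring
  rw [e1] at hs2
  linarith

namespace IsSimple

/-- The action on the diagonal, to first order. -/
theorem tendsto_diag (hm : m.IsSimple) {x : N} {u : Space n}
    (hu : ∀ ε : ℝ, 0 ≤ ε → extChartAt (𝓡∂ n) x x + ε • u ∈ range (𝓡∂ n)) :
    Tendsto (fun ε : ℝ => m.action x (ownLine x u ε) / ε) (𝓝[>] 0)
      (𝓝 (m.nrm x u - m.pot x u)) := by
  obtain ⟨R, C, hb⟩ := m.exists_hasChartBounds x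
  obtain ⟨L, hL⟩ := hm.exists_isLogMap x
  have hC := hb.one_le
  have hR := hb.pos
  obtain ⟨T, hT, hTm⟩ := exists_ownLine_mem hu hR
  set φ := extChartAt (𝓡∂ n) x with hφ
  have hxs := mem_chart_source (EuclideanHalfSpace n) x
  have hpt : ∀ ε ∈ Ioo 0 T, ownLine x u ε ∈ (chartAt (EuclideanHalfSpace n) x).source ∧
      φ (ownLine x u ε) - φ x = ε • u ∧ φ (ownLine x u ε) ∈ halfBall x R := by
    intro ε hε
    have h3 := hTm ε ⟨hε.1.le, hε.2.le⟩
    have h4 := extChartAt_chartLine (hb.subset h3)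
    exact ⟨chartLine_mem_source (hb.subset h3), by rw [hφ, h4, add_sub_cancel_left],
      by rw [hφ, h4]; exact h3⟩
  have hlen : Tendsto (fun ε => m.nrm x (L (ownLine x u ε))) (𝓝[>] 0) (𝓝 0) := by
    have h1 := ((m.continuous_nrm x).comp hL.continuous).tendsto x
    simp only [Function.comp_apply, hL.apply_self] at h1
    have h0 : m.nrm x 0 = 0 := by simp [nrm]
    rw [h0] at h1
    exact h1.comp (tendsto_ownLine x u)
  have hup : ∀ᶠ ε in 𝓝[>] (0 : ℝ), m.action x (ownLine x u ε) / ε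
      ≤ (m.nrm x u - m.pot x u) + 52 * C ^ 7 * ‖u‖ ^ 2 * ε := by
    filter_upwards [Ioo_mem_nhdsGT hT] with ε hε
    obtain ⟨h1, h2, h3⟩ := hpt ε hε
    have hε0 := hε.1
    have h4 := hb.action_le hm hxs h1 hb.self_mem h3
    rw [← hφ, h2, sub_self, norm_zero, zero_add, m.nrm_smul x hε0.le, map_smul, norm_smul,
      Real.norm_of_nonneg hε0.le, smul_eq_mul] at h4
    rw [div_le_iff₀ hε0]
    have h5 : 2 * C ^ 2 * ‖u‖ ^ 2 * ε ^ 2 ≤ 52 * C ^ 7 * ‖u‖ ^ 2 * ε ^ 2 := by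
      gcongr <;> norm_num
    have e : (m.nrm x u - m.pot x u + 52 * C ^ 7 * ‖u‖ ^ 2 * ε) * ε
        = ε * m.nrm x u - ε * m.pot x u + 52 * C ^ 7 * ‖u‖ ^ 2 * ε ^ 2 := by ring
    rw [e]
    linarith
  have hlow : ∀ᶠ ε in 𝓝[>] (0 : ℝ), (m.nrm x u - m.pot x u) - 52 * C ^ 7 * ‖u‖ ^ 2 * ε
      ≤ m.action x (ownLine x u ε) / ε := by
    filter_upwards [Ioo_mem_nhdsGT hT, hlen.eventually_lt_const (show 0 < R / C by positivity),
      hlen.eventually_lt_const (show 0 < 1 / (8 * C ^ 5) by positivity)] with ε hε hs1 hs2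
    obtain ⟨h1, h2, h3⟩ := hpt ε hε
    have hε0 := hε.1
    rw [le_div_iff₀ hε0]
    by_cases hne : ownLine x u ε = x
    · have h5 : u = 0 := by
        rw [hne, sub_self] at h2
        exact (smul_eq_zero.1 h2.symm).resolve_left hε0.ne'
      rw [hne, hm.action_self, h5]
      simp [nrm]
    · obtain ⟨γ, hγ, g0, g1⟩ := hL.exists_geodesic_length hne
      rw [lt_div_iff₀ (by positivity)] at hs1 hs2
      have h4 := hb.le_action hm hγ g0 (by linarith) (by linarith) (d := ε • u) (by rw [g1]; exact h2)
      rw [g1, m.nrm_smul x hε0.le, map_smul, norm_smul, Real.norm_of_nonneg hε0.le,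
        smul_eq_mul] at h4
      refine le_trans (le_of_eq ?_) h4
      ring
  have hlim : ∀ K : ℝ, Tendsto (fun ε : ℝ => (m.nrm x u - m.pot x u) + K * ε) (𝓝[>] 0)
      (𝓝 (m.nrm x u - m.pot x u)) := by
    intro K
    have := (by fun_prop : Continuous fun ε : ℝ => (m.nrm x u - m.pot x u) + K * ε).tendsto 0
    rw [mul_zero, add_zero] at this
    exact this.mono_left nhdsWithin_le_nhds
  have hlim' := hlim (-(52 * C ^ 7 * ‖u‖ ^ 2))
  simp only [neg_mul, ← sub_eq_add_neg] at hlim'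
  exact tendsto_of_tendsto_of_tendsto_of_le_of_le' hlim' (hlim _) hlow hup

/-- The derivative of the action in the final point. -/
theorem tendsto_end (hm : m.IsSimple) {x y : N} (hxy : y ≠ x) {V : Space n}
    (hV : m.IsArrival x y V) {u : Space n}
    (hu : ∀ ε : ℝ, 0 ≤ ε → extChartAt (𝓡∂ n) y y + ε • u ∈ range (𝓡∂ n)) :
    Tendsto (fun ε : ℝ => (m.action x (ownLine y u ε) - m.action x y) / ε) (𝓝[>] 0)
      (𝓝 (m.ip y V u - m.pot y u)) := by
  obtain ⟨R, hR, hsub⟩ := exists_halfBall_subset (n := n) y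
  obtain ⟨T₁, hT₁, hTm⟩ := exists_ownLine_mem hu hR
  obtain ⟨T₂, hT₂, hne⟩ := mem_nhdsGT_iff_exists_Ioo_subset.1
    ((tendsto_ownLine y u).eventually (isOpen_ne.mem_nhds hxy))
  set T := min T₁ (T₂ / 2) with hT'
  have hT₂0 : 0 < T₂ := hT₂
  have hT : 0 < T := lt_min hT₁ (half_pos hT₂0)
  have hc0 := ownLine_zero y u
  set c := ownLine y u with hc
  have hx : ∀ τ ∈ Icc 0 T, c τ ≠ x := by
    intro τ hτ
    rcases hτ.1.eq_or_lt with h | h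
    · rw [← h, hc0]; exact hxy
    · exact hne ⟨h, by linarith [hτ.2.trans (min_le_right _ _)]⟩
  have htar : ∀ t ≤ T, ∀ τ ∈ Icc 0 t, extChartAt (𝓡∂ n) y y + τ • u ∈ (extChartAt (𝓡∂ n) y).target :=
    fun t ht τ hτ => hsub (hTm τ ⟨hτ.1, (hτ.2.trans ht).trans (min_le_left _ _)⟩)
  choose! W hW using fun τ (hτ : τ ∈ Icc 0 T) => hm.exists_arrival (hx τ hτ).symm
  have hW0 : W 0 = V := by
    have := hW 0 ⟨le_rfl, hT.le⟩
    rw [hc0] at this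
    exact hm.arrival_unique this hV
  have hvel : ∀ t, 0 < t → t ≤ T → ∀ τ ∈ Icc 0 t, vel (n := n) c t τ
      = frameAt (𝓡∂ n) y (extChartAt (𝓡∂ n) y y + τ • u) u := by
    intro t ht htT τ hτ
    have h1 := htar t htT
    have h2 := frameAt_chartVelocity (c := y) ht hτ
      (mdiffAt_of_contMDiffOn (contMDiffOn_chartLine h1) hτ) (chartLine_mem_source (h1 τ hτ))
    rw [chartVelocity_chartLine ht h1 hτ, chartCurve, extChartAt_chartLine (h1 τ hτ)] at h2
    exact h2.symm
  -- The velocity of the segment is written through the frame because `vel c t` formally depends on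
  -- the interval `[0, t]`; one integrand then serves for all `t`, and the derivative at zero is `f
  -- 0`.
  set f : ℝ → ℝ := fun τ => m.ip (c τ) (W τ) (frameAt (𝓡∂ n) y (extChartAt (𝓡∂ n) y y + τ • u) u)
    - m.pot (c τ) (frameAt (𝓡∂ n) y (extChartAt (𝓡∂ n) y y + τ • u) u) with hf
  have key : ∀ t, 0 < t → t ≤ T → ContinuousOn f (Icc 0 t) ∧
      m.action x (c t) - m.action x y = ∫ τ in (0 : ℝ)..t, f τ := by
    intro t ht htT
    obtain ⟨h1, h2⟩ := hm.first_variation ht (contMDiffOn_chartLine (htar t htT))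
      (fun τ hτ => hx τ ⟨hτ.1, hτ.2.trans htT⟩) (V := W) (fun τ hτ => hW τ ⟨hτ.1, hτ.2.trans htT⟩)
    refine ⟨h1.congr fun τ hτ => ?_, ?_⟩
    · have := hvel t ht htT τ hτ
      simp only [hf, ← this]
      rfl
    · have e0 : chartLine y (extChartAt (𝓡∂ n) y y) u 0 = y := hc0
      rw [e0] at h2
      refine h2.trans (intervalIntegral.integral_congr fun τ hτ => ?_)
      rw [uIcc_of_le ht.le] at hτ
      have := hvel t ht htT τ hτ
      simp only [hf, ← this]
      rfl
  have hfc := (key T hT le_rfl).1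
  have h0T : (0 : ℝ) ∈ Icc 0 T := ⟨le_rfl, hT.le⟩
  have hle : 𝓝[>] (0 : ℝ) ≤ 𝓝[Icc 0 T] 0 := by
    rw [nhdsWithin_Icc_eq_nhdsGE hT]
    exact nhdsWithin_mono _ Ioi_subset_Ici_self
  have hderiv : HasDerivWithinAt (fun t => ∫ τ in (0 : ℝ)..t, f τ) (f 0) (Ici 0) 0 :=
    intervalIntegral.integral_hasDerivWithinAt_right (t := Ioi 0) (by simp)
      ((hfc.stronglyMeasurableAtFilter_nhdsWithin measurableSet_Icc 0).filter_mono hle)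
      ((hfc 0 h0T).mono_left hle)
  have hslope := (hasDerivWithinAt_iff_tendsto_slope' (by simp)).1
    (hderiv.mono Ioi_subset_Ici_self)
  have hf0 : f 0 = m.ip y V u - m.pot y u := by
    simp only [hf, hW0, hc0, zero_smul, add_zero, frameAt_self]
    rfl
  rw [hf0] at hslope
  refine hslope.congr' ?_
  filter_upwards [Ioo_mem_nhdsGT hT] with t ht
  rw [(key t ht.1 ht.2.le).2, slope_def_field, intervalIntegral.integral_same, sub_zero, sub_zero]

end IsSimple

end MagneticSystem
end

/-! ### Normal vectors and strict convexity of the boundary. -/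

section

variable {n : ℕ} [NeZero n] {N : Type*} [TopologicalSpace N]
  [ChartedSpace (EuclideanHalfSpace n) N] [IsManifold (𝓡∂ n) ∞ N]

namespace MagneticSystem

variable (m : MagneticSystem n N)

theorem exists_ip_eq (x : N) (f : Space n →L[ℝ] ℝ) : ∃ w, ∀ v, m.ip x w v = f v := by
  let B : Space n →ₗ[ℝ] Module.Dual ℝ (Space n) :=
    { toFun := fun w => (m.ip x w : Space n →ₗ[ℝ] ℝ)
      map_add' := fun a b => by ext v; simp [ip]
      map_smul' := fun a b => by ext v; simp [ip] }
  have hB : Function.Injective B := by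
    refine (injective_iff_map_eq_zero B).2 fun w hw => ?_
    by_contra h0
    have h1 := m.ip_pos x h0
    have h2 : B w w = 0 := by rw [hw]; rfl
    exact h1.ne' h2
  obtain ⟨w, hw⟩ := (LinearMap.injective_iff_surjective_of_finrank_eq_finrank
    (Subspace.dual_finrank_eq (K := ℝ) (V := Space n)).symm).1 hB (f : Space n →ₗ[ℝ] ℝ)
  exact ⟨w, fun v => LinearMap.congr_fun hw v⟩

/-- A normal vector of the boundary. -/
theorem exists_normal (x : N) : ∃ w : Space n, 0 < w 0 ∧ ∀ v, m.ip x w v = v 0 := by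
  obtain ⟨w, hw⟩ := m.exists_ip_eq x (EuclideanSpace.proj 0)
  have hw' : ∀ v, m.ip x w v = v 0 := hw
  refine ⟨w, ?_, hw'⟩
  rw [← hw' w]
  refine m.ip_pos x fun h => ?_
  have h1 := hw' (EuclideanSpace.single 0 1)
  rw [h] at h1
  simp at h1

/-- The orthogonal projection to the tangent space of the boundary. -/
theorem exists_tangent_projection (x : N) (v : Space n) :
    ∃ v' : Space n, v' 0 = 0 ∧ ∀ u : Space n, u 0 = 0 → m.ip x v' u = m.ip x v u := by
  obtain ⟨w, hw0, hw⟩ := m.exists_normal x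
  refine ⟨v - (v 0 / w 0) • w, ?_, fun u hu => ?_⟩
  · rw [PiLp.sub_apply, PiLp.smul_apply, smul_eq_mul, div_mul_cancel₀ _ hw0.ne', sub_self]
  · rw [map_sub, map_smul, sub_apply, smul_apply, hw, hu, smul_zero, sub_zero]

variable {m}

/-- Both sides are linear in the normal vector. As `w` represents the coordinate `v ↦ v 0`, its
squared length is `w 0`, which gives the normalizing factor. -/
theorem IsStrictlyConvex.lt_of_normal (hm : m.IsStrictlyConvex) {x : N}
    (hx : x ∈ (𝓡∂ n).boundary N) {ξ w : Space n} (hξ : ξ 0 = 0) (hξ1 : m.ip x ξ ξ = 1)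
    (hw0 : 0 < w 0) (hw : ∀ v, m.ip x w v = v 0) :
    chartExtDeriv (𝓡∂ n) m.om x (extChartAt (𝓡∂ n) x x) ξ w
      < christoffel (𝓡∂ n) m.h.inner x (extChartAt (𝓡∂ n) x x) ξ ξ w := by
  set a := (√(w 0))⁻¹ with ha
  have ha0 : 0 < a := by positivity
  have haw : ∀ v : Space n, m.ip x (a • w) v = a * v 0 := fun v => by
    rw [map_smul, smul_apply, hw, smul_eq_mul]
  have h1 := hm x hx ξ (a • w) hξ hξ1
    (by
      change 0 < (a • w) 0
      rw [PiLp.smul_apply, smul_eq_mul]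
      positivity)
    (by
      change m.ip x (a • w) (a • w) = 1
      rw [haw, PiLp.smul_apply, smul_eq_mul, ← mul_assoc, ha, ← mul_inv,
        Real.mul_self_sqrt hw0.le, inv_mul_cancel₀ hw0.ne'])
    (fun η hη => (haw η).trans (mul_eq_zero_of_right a hη))
  have h2 : chartExtDeriv (𝓡∂ n) m.om x (extChartAt (𝓡∂ n) x x) ξ (a • w)
      = a * chartExtDeriv (𝓡∂ n) m.om x (extChartAt (𝓡∂ n) x x) ξ w := by
    simp only [chartExtDeriv, map_smul, smul_apply, smul_eq_mul]
    ring
  have h3 : christoffel (𝓡∂ n) m.h.inner x (extChartAt (𝓡∂ n) x x) ξ ξ (a • w)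
      = a * christoffel (𝓡∂ n) m.h.inner x (extChartAt (𝓡∂ n) x x) ξ ξ w := by
    simp only [christoffel, map_smul, smul_apply, smul_eq_mul]
    ring
  have h4 : a * chartExtDeriv (𝓡∂ n) m.om x (extChartAt (𝓡∂ n) x x) ξ w
      < a * christoffel (𝓡∂ n) m.h.inner x (extChartAt (𝓡∂ n) x x) ξ ξ w := by
    rw [← h2, ← h3]
    exact h1
  exact lt_of_mul_lt_mul_left h4 ha0.le

/-- A function with nonnegative values has nonnegative second derivative at a zero. -/
theorem second_deriv_nonneg {f f' : ℝ → ℝ} {a s : ℝ} (hf : ∀ᶠ r in 𝓝 s, 0 ≤ f r) (hs : f s = 0)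
    (h1 : ∀ᶠ r in 𝓝 s, HasDerivAt f (f' r) r) (h2 : HasDerivAt f' a s) : f' s = 0 ∧ 0 ≤ a := by
  have hmin : IsLocalMin f s := by filter_upwards [hf] with r hr; rwa [hs]
  have hd : deriv f =ᶠ[𝓝 s] f' := by filter_upwards [h1] with r hr using hr.deriv
  have h0 : f' s = 0 := by rw [← hd.eq_of_nhds]; exact hmin.deriv_eq_zero
  refine ⟨h0, ?_⟩
  by_contra! ha
  have hdd : deriv (deriv f) s = a := hd.deriv_eq.trans h2.deriv
  -- A negative second derivative would make `s` a local maximum as well, so `f` would vanish near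
  -- `s` and its second derivative would be zero.
  have hmax := isLocalMax_of_deriv_deriv_neg (by rw [hdd]; exact ha)
    (by rw [hd.eq_of_nhds]; exact h0) h1.self_of_nhds.continuousAt
  have hz : f =ᶠ[𝓝 s] fun _ => 0 := by
    filter_upwards [hf, hmax] with r h3 h4
    rw [hs] at h4
    exact le_antisymm h4 h3
  have := hz.deriv.deriv_eq
  rw [hdd] at this
  simp at this
  exact ha.ne this

/-- Magnetic geodesics touch a strictly convex boundary at their end points only. -/
theorem IsStrictlyConvex.mem_interior (hm : m.IsStrictlyConvex) {ℓ : ℝ} {γ : ℝ → N}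
    (hγ : m.IsMagneticGeodesic ℓ γ) {s : ℝ} (hs : s ∈ Ioo 0 ℓ) : γ s ∈ (𝓡∂ n).interior N := by
  by_contra hint
  have hx : γ s ∈ (𝓡∂ n).boundary N := by
    rw [← ModelWithCorners.compl_interior]; exact hint
  have hsI := Ioo_subset_Icc_self hs
  have hxs := mem_chart_source (EuclideanHalfSpace n) (γ s)
  have hnh : Icc 0 ℓ ∈ 𝓝 s := Icc_mem_nhds hs.1 hs.2
  have hcont : ContinuousAt γ s := (hγ.smooth.continuousOn s hsI).continuousAt hnh
  have hsrc : ∀ᶠ r in 𝓝 s, γ r ∈ (chartAt (EuclideanHalfSpace n) (γ s)).source :=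
    hcont.eventually ((chartAt _ (γ s)).open_source.mem_nhds hxs)
  set p : Space n →L[ℝ] ℝ := EuclideanSpace.proj 0 with hp
  have hd1 : ∀ᶠ r in 𝓝 s, HasDerivAt (fun r => p (chartCurve (𝓡∂ n) (γ s) γ r))
      (p (chartVelocity (𝓡∂ n) (γ s) γ ℓ r)) r := by
    filter_upwards [hsrc, isOpen_Ioo.mem_nhds hs] with r hr hr'
    exact p.hasFDerivAt.comp_hasDerivAt r ((hasDerivWithinAt_chartCurve
      (hγ.mdiff (Ioo_subset_Icc_self hr')) hr).hasDerivAt (Icc_mem_nhds hr'.1 hr'.2))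
  have hd2 : HasDerivAt (fun r => p (chartVelocity (𝓡∂ n) (γ s) γ ℓ r))
      (p (derivWithin (chartVelocity (𝓡∂ n) (γ s) γ ℓ) (Icc 0 ℓ) s)) s := by
    refine p.hasFDerivAt.comp_hasDerivAt s (HasDerivWithinAt.hasDerivAt ?_ hnh)
    exact ((contDiffWithinAt_chartVelocity hγ.pos hsI (hγ.smooth s hsI) hxs).differentiableWithinAt
      (by simp)).hasDerivWithinAt
  -- The coordinate defining the boundary is nonnegative along `γ` and vanishes at time `s`, so the
  -- velocity there is tangent to the boundary and the second derivative of the coordinate is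
  -- nonnegative.
  obtain ⟨h1, h2⟩ := second_deriv_nonneg
    (Eventually.of_forall fun r => extChartAt_zero_nonneg (γ s) (γ r)) (mem_boundary_iff.1 hx) hd1 hd2
  obtain ⟨w, hw0, hw⟩ := m.exists_normal (γ s)
  have hunit := chartMetric_chartVelocity m.h.inner hγ.pos hsI (hγ.mdiff hsI) hxs
  rw [hγ.ip_vel hsI, chartCurve, chartMetric_self] at hunit
  have h3 := hm.lt_of_normal hx h1 hunit hw0 hw
  -- Paired with the normal `w`, the magnetic equation expresses that second derivative as the
  -- magnetic term minus the Christoffel term, which strict convexity makes negative.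
  have h4 := hγ.newton (γ s) s hsI hxs w
  rw [covariantAcceleration, chartCurve, chartMetric_self] at h4
  have h5 := m.ip_symm (γ s) (derivWithin (chartVelocity (𝓡∂ n) (γ s) γ ℓ) (Icc 0 ℓ) s) w
  rw [hw] at h5
  change m.ip (γ s) _ w + _ = _ at h4
  rw [h5] at h4
  have h6 : 0 ≤ (derivWithin (chartVelocity (𝓡∂ n) (γ s) γ ℓ) (Icc 0 ℓ) s) 0 := h2
  linarith

/-! ### Boundary determination -/

section Determination

variable [T2Space N] [CompactSpace N] {m' : MagneticSystem n N}

/-- The derivative on the diagonal is `|u| - ω(u)`. Replacing `u` by `-u` separates the even part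
`|u|` from the odd part `ω(u)`. -/
theorem pot_eq_and_nrm_eq_of_action_eq (hm : m.IsSimple) (hm' : m'.IsSimple)
    (hA : ∀ x ∈ (𝓡∂ n).boundary N, ∀ y ∈ (𝓡∂ n).boundary N, m.action x y = m'.action x y)
    {x : N} (hx : x ∈ (𝓡∂ n).boundary N) {u : Space n} (hu : u 0 = 0) :
    m.pot x u = m'.pot x u ∧ m.nrm x u = m'.nrm x u := by
  have key : ∀ u : Space n, u 0 = 0 → m.nrm x u - m.pot x u = m'.nrm x u - m'.pot x u := by
    intro u hu
    have h1 := hm.tendsto_diag (x := x) (fun ε _ => add_smul_mem_range_of_mem_boundary hx hu ε)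
    have h2 := hm'.tendsto_diag (x := x) (fun ε _ => add_smul_mem_range_of_mem_boundary hx hu ε)
    refine tendsto_nhds_unique_of_eventuallyEq h1 h2 ?_
    filter_upwards [eventually_ownLine_mem_boundary hx hu] with ε hε
    rw [hA x hx _ hε]
  have h1 := key u hu
  have h2 := key (-u) (by rw [PiLp.neg_apply, hu, neg_zero])
  rw [nrm_neg, nrm_neg, map_neg, map_neg] at h2
  constructor <;> linarith

theorem ip_eq_of_action_eq (hm : m.IsSimple) (hm' : m'.IsSimple)
    (hA : ∀ x ∈ (𝓡∂ n).boundary N, ∀ y ∈ (𝓡∂ n).boundary N, m.action x y = m'.action x y)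
    {x : N} (hx : x ∈ (𝓡∂ n).boundary N) {u v : Space n} (hu : u 0 = 0) (hv : v 0 = 0) :
    m.ip x u v = m'.ip x u v := by
  have key : ∀ u : Space n, u 0 = 0 → m.ip x u u = m'.ip x u u := fun u hu => by
    rw [← nrm_sq, ← nrm_sq, (pot_eq_and_nrm_eq_of_action_eq hm hm' hA hx hu).2]
  have h1 := key (u + v) (by rw [PiLp.add_apply, hu, hv, add_zero])
  simp only [map_add, add_apply, key u hu, key v hv, m.ip_symm x v u, m'.ip_symm x v u] at h1
  linarith

/-- The derivative of the action in the initial point is `-(ξ, u) + ω(u)`, and `ω(u)` is already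
determined by the diagonal. -/
theorem ip_vel_zero_eq_of_action_eq (hm : m.IsSimple) (hm' : m'.IsSimple)
    (hA : ∀ x ∈ (𝓡∂ n).boundary N, ∀ y ∈ (𝓡∂ n).boundary N, m.action x y = m'.action x y)
    {ℓ ℓ' : ℝ} {γ γ' : ℝ → N} (hγ : m.IsMagneticGeodesic ℓ γ) (hγ' : m'.IsMagneticGeodesic ℓ' γ')
    (h0 : γ' 0 = γ 0) (h1 : γ' ℓ' = γ ℓ) (hx : γ 0 ∈ (𝓡∂ n).boundary N)
    (hy : γ ℓ ∈ (𝓡∂ n).boundary N) {u : Space n} (hu : u 0 = 0) :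
    m.ip (γ 0) (vel γ ℓ 0) u = m'.ip (γ 0) (vel γ' ℓ' 0) u := by
  have t1 := hm.tendsto_start hγ (fun ε _ => add_smul_mem_range_of_mem_boundary hx hu ε)
  have t2 := hm'.tendsto_start hγ' (u := u) (by
    rw [h0]
    exact fun ε _ => add_smul_mem_range_of_mem_boundary hx hu ε)
  rw [h0, h1] at t2
  have h2 := tendsto_nhds_unique_of_eventuallyEq t1 t2 (by
    filter_upwards [tendsto_cube_nhdsGT.eventually (eventually_ownLine_mem_boundary hx hu)] with ε hε
    rw [hA _ hε _ hy, hA _ hx _ hy])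
  have h3 := (pot_eq_and_nrm_eq_of_action_eq hm hm' hA hx hu).1
  linarith

theorem ip_arrival_eq_of_action_eq (hm : m.IsSimple) (hm' : m'.IsSimple)
    (hA : ∀ x ∈ (𝓡∂ n).boundary N, ∀ y ∈ (𝓡∂ n).boundary N, m.action x y = m'.action x y)
    {x y : N} (hxy : y ≠ x) {V V' : Space n} (hV : m.IsArrival x y V) (hV' : m'.IsArrival x y V')
    (hx : x ∈ (𝓡∂ n).boundary N) (hy : y ∈ (𝓡∂ n).boundary N) {u : Space n} (hu : u 0 = 0) :
    m.ip y V u = m'.ip y V' u := by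
  have hr : ∀ ε : ℝ, 0 ≤ ε → extChartAt (𝓡∂ n) y y + ε • u ∈ range (𝓡∂ n) :=
    fun ε _ => add_smul_mem_range_of_mem_boundary hy hu ε
  have h2 := tendsto_nhds_unique_of_eventuallyEq (hm.tendsto_end hxy hV hr)
    (hm'.tendsto_end hxy hV' hr) (by
      filter_upwards [eventually_ownLine_mem_boundary hy hu] with ε hε
      rw [hA _ hx _ hε, hA _ hx _ hy])
  have h3 := (pot_eq_and_nrm_eq_of_action_eq hm hm' hA hy hu).1
  linarith

end Determination

end MagneticSystem
end

/-! ### Reparametrization of intervals. -/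

section

/-- `G` is the inverse of the primitive of `f`. The positive minimum of `f` makes this inverse
Lipschitz, and `contDiffOn_of_comp_left` then makes it smooth up to the ends. It is used for passing
between light ray parameters and arclength. -/
theorem exists_reparametrization {f : ℝ → ℝ} {T : ℝ} (hT : 0 < T)
    (hf : ContDiffOn ℝ ∞ f (Icc 0 T)) (hpos : ∀ s ∈ Icc 0 T, 0 < f s) :
    ∃ (ℓ : ℝ) (G : ℝ → ℝ), 0 < ℓ ∧ ContDiffOn ℝ ∞ G (Icc 0 ℓ) ∧ MapsTo G (Icc 0 ℓ) (Icc 0 T) ∧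
      G 0 = 0 ∧ G ℓ = T ∧ MapsTo G (Ioo 0 ℓ) (Ioo 0 T) ∧
      ∀ σ ∈ Icc 0 ℓ, HasDerivWithinAt G (f (G σ))⁻¹ (Icc 0 ℓ) σ := by
  have h0 : (0 : ℝ) ∈ Icc 0 T := left_mem_Icc.2 hT.le
  have h1 : T ∈ Icc 0 T := right_mem_Icc.2 hT.le
  have hS : UniqueDiffOn ℝ (Icc 0 T) := uniqueDiffOn_Icc hT
  set F : ℝ → ℝ := fun s => ∫ r in (0 : ℝ)..s, f r with hF
  have hFd : ∀ s ∈ Icc 0 T, HasDerivWithinAt F (f s) (Icc 0 T) s := by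
    intro s hs
    have : Fact (s ∈ Icc 0 T) := ⟨hs⟩
    refine intervalIntegral.integral_hasDerivWithinAt_right (t := Icc 0 T)
      (hf.continuousOn.mono ?_).intervalIntegrable
      (hf.continuousOn.stronglyMeasurableAtFilter_nhdsWithin measurableSet_Icc s)
      (hf.continuousOn s hs)
    rw [uIcc_of_le hs.1]
    exact Icc_subset_Icc_right hs.2
  have hFdw : ∀ s ∈ Icc 0 T, derivWithin F (Icc 0 T) s = f s :=
    fun s hs => (hFd s hs).derivWithin (hS s hs)
  have hFs : ContDiffOn ℝ ∞ F (Icc 0 T) := (contDiffOn_infty_iff_derivWithin hS).2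
    ⟨fun s hs => (hFd s hs).differentiableWithinAt, hf.congr hFdw⟩
  have hF0 : F 0 = 0 := by simp [hF]
  obtain ⟨s₀, hs₀, hmin⟩ := isCompact_Icc.exists_isMinOn ⟨0, h0⟩ hf.continuousOn
  set c := f s₀ with hc
  have hc0 : 0 < c := hpos s₀ hs₀
  have hlow : ∀ a ∈ Icc 0 T, ∀ b ∈ Icc 0 T, a ≤ b → c * (b - a) ≤ F b - F a := by
    refine (convex_Icc 0 T).mul_sub_le_image_sub_of_le_deriv hFs.continuousOn
      (fun s hs => ?_) (fun s hs => ?_)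
    · exact (hFd s (interior_subset hs)).differentiableWithinAt.mono interior_subset
    · have hs' := interior_subset hs
      rw [((hFd s hs').hasDerivAt (mem_interior_iff_mem_nhds.1 hs)).deriv]
      exact hmin hs'
  have hanti : ∀ a ∈ Icc 0 T, ∀ b ∈ Icc 0 T, |b - a| ≤ c⁻¹ * |F b - F a| := by
    intro a ha b hb
    rw [← div_eq_inv_mul, le_div_iff₀ hc0, mul_comm]
    rcases le_total a b with h | h
    · rw [abs_of_nonneg (sub_nonneg.2 h)]
      exact (hlow a ha b hb h).trans (le_abs_self _)
    · rw [abs_sub_comm, abs_of_nonneg (sub_nonneg.2 h), abs_sub_comm (F b)]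
      exact (hlow b hb a ha h).trans (le_abs_self _)
  have hinj : InjOn F (Icc 0 T) := fun a ha b hb hab => by
    have := hanti a ha b hb
    rw [hab, sub_self, abs_zero, mul_zero] at this
    exact (sub_eq_zero.1 (abs_nonpos_iff.1 this)).symm
  have hsurj : ∀ σ ∈ Icc 0 (F T), ∃ s ∈ Icc 0 T, F s = σ := by
    have := intermediate_value_Icc hT.le hFs.continuousOn
    rw [hF0] at this
    exact this
  choose! G hG1 hG2 using hsurj
  have hℓ : 0 < F T := by
    have := hlow 0 h0 T h1 hT.le
    rw [hF0, sub_zero, sub_zero] at this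
    exact lt_of_lt_of_le (by positivity) this
  have g0 : G 0 = 0 := hinj (hG1 0 ⟨le_rfl, hℓ.le⟩) h0 ((hG2 0 ⟨le_rfl, hℓ.le⟩).trans hF0.symm)
  have gT : G (F T) = T := hinj (hG1 _ ⟨hℓ.le, le_rfl⟩) h1 (hG2 _ ⟨hℓ.le, le_rfl⟩)
  have hGc : ContinuousOn G (Icc 0 (F T)) := by
    refine (LipschitzOnWith.of_dist_le_mul (K := Real.toNNReal c⁻¹) fun a ha b hb => ?_).continuousOn
    have := hanti _ (hG1 b hb) _ (hG1 a ha)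
    rw [hG2 b hb, hG2 a ha] at this
    rwa [Real.dist_eq, Real.dist_eq, Real.coe_toNNReal _ (by positivity)]
  have hR : UniqueDiffOn ℝ (Icc 0 (F T)) := uniqueDiffOn_Icc hℓ
  have hGs : ContDiffOn ℝ ∞ G (Icc 0 (F T)) := by
    rw [contDiffOn_infty]
    intro k
    refine contDiffOn_of_comp_left (f := F) hS (fun a ha => ?_) hR hGc hG1 k
      (contDiffOn_infty.1 hFs k) (contDiffOn_id.congr hG2)
    have e : ∀ v, fderivWithin ℝ F (Icc 0 T) a v = v * f a := fun v => by
      rw [(hFd a ha).hasFDerivWithinAt.fderivWithin (hS a ha)]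
      simp
    have hfa := (hpos a ha).ne'
    refine ⟨fun v w h => ?_, fun w => ⟨w / f a, ?_⟩⟩
    · rw [e, e] at h
      exact mul_right_cancel₀ hfa h
    · rw [e, div_mul_cancel₀ _ hfa]
  refine ⟨F T, G, hℓ, hGs, hG1, g0, gT, fun σ hσ => ?_, fun σ hσ => ?_⟩
  · have hσ' := Ioo_subset_Icc_self hσ
    have h3 := hG1 σ hσ'
    have h4 := hG2 σ hσ'
    refine ⟨h3.1.lt_of_ne fun h => ?_, h3.2.lt_of_ne fun h => ?_⟩
    · rw [← h, hF0] at h4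
      exact hσ.1.ne h4
    · rw [h] at h4
      exact hσ.2.ne' h4
  · have hd := ((hGs σ hσ).differentiableWithinAt (by simp)).hasDerivWithinAt
    have hcomp := (hFd _ (hG1 σ hσ)).scomp σ hd hG1
    have hid : HasDerivWithinAt (F ∘ G) 1 (Icc 0 (F T)) σ :=
      (hasDerivWithinAt_id σ _).congr hG2 (hG2 σ hσ)
    have heq := (hR σ hσ).eq_deriv _ hcomp hid
    rw [smul_eq_mul] at heq
    rwa [← eq_inv_of_mul_eq_one_left heq]

end

/-! ### Product charts on the cylinder. -/

section

variable {n : ℕ} [NeZero n] {N : Type*} [TopologicalSpace N]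
  [ChartedSpace (EuclideanHalfSpace n) N]

open StationaryMetric

theorem mem_cylinder_chart_source {c p : ℝ × N} :
    p ∈ (chartAt (ModelProd ℝ (EuclideanHalfSpace n)) c).source
      ↔ p.2 ∈ (chartAt (EuclideanHalfSpace n) c.2).source := by
  rw [prodChartedSpace_chartAt]
  simp [chartAt_self_eq]

theorem extChartAt_cylinder (c p : ℝ × N) :
    extChartAt (cylinderModel n) c p = (p.1, extChartAt (𝓡∂ n) c.2 p.2) := by
  rw [cylinderModel, extChartAt_prod]
  rfl

theorem extChartAt_cylinder_symm (c : ℝ × N) (u : ℝ × Space n) :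
    (extChartAt (cylinderModel n) c).symm u = (u.1, (extChartAt (𝓡∂ n) c.2).symm u.2) := by
  rw [cylinderModel, extChartAt_prod]
  rfl

theorem extChartAt_cylinder_target (c : ℝ × N) :
    (extChartAt (cylinderModel n) c).target = univ ×ˢ (extChartAt (𝓡∂ n) c.2).target := by
  rw [cylinderModel, extChartAt_prod, PartialEquiv.prod_target, extChartAt_model_space_eq_id]
  rfl

theorem range_cylinderModel : range (cylinderModel n) = univ ×ˢ range (𝓡∂ n) := by
  rw [cylinderModel, ModelWithCorners.range_prod]
  simp

theorem frameAt_cylinder [IsManifold (𝓡∂ n) ∞ N] {c : ℝ × N} {u : ℝ × Space n}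
    (hu : u.2 ∈ (extChartAt (𝓡∂ n) c.2).target) (v : ℝ × Space n) :
    frameAt (cylinderModel n) c u v = (v.1, frameAt (𝓡∂ n) c.2 u.2 v.2) := by
  have h1 : MDifferentiableWithinAt 𝓘(ℝ, Space n) (𝓡∂ n) (extChartAt (𝓡∂ n) c.2).symm
      (range (𝓡∂ n)) u.2 := mdifferentiableWithinAt_extChartAt_symm hu
  have h2 : HasMFDerivWithinAt 𝓘(ℝ, ℝ × Space n) 𝓘(ℝ, Space n) (Prod.snd : ℝ × Space n → Space n)
      (univ ×ˢ range (𝓡∂ n)) u (ContinuousLinearMap.snd ℝ ℝ (Space n)) :=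
    (hasFDerivAt_snd (𝕜 := ℝ) (p := u)).hasMFDerivAt.hasMFDerivWithinAt
  have h3 : HasMFDerivWithinAt 𝓘(ℝ, ℝ × Space n) 𝓘(ℝ, ℝ) (Prod.fst : ℝ × Space n → ℝ)
      (univ ×ˢ range (𝓡∂ n)) u (ContinuousLinearMap.fst ℝ ℝ (Space n)) :=
    (hasFDerivAt_fst (𝕜 := ℝ) (p := u)).hasMFDerivAt.hasMFDerivWithinAt
  have h4 := h3.prodMk (h1.hasMFDerivWithinAt.comp u h2 (fun w hw => hw.2))
  have h5 : ⇑(extChartAt (cylinderModel n) c).symm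
      = fun w => (Prod.fst w, ((extChartAt (𝓡∂ n) c.2).symm ∘ Prod.snd) w) := by
    ext1 w
    exact extChartAt_cylinder_symm c w
  have hru : u ∈ range (cylinderModel n) := by
    rw [range_cylinderModel]
    exact ⟨mem_univ _, extChartAt_target_subset_range c.2 hu⟩
  rw [← h5, ← range_cylinderModel] at h4
  have h6 := h4.mfderivWithin ((cylinderModel n).uniqueDiffOn u hru).uniqueMDiffWithinAt
  exact DFunLike.congr_fun h6 v

end

/-! ### The stationary metric in charts. -/

section

theorem hasFDerivWithinAt_apply {E V W : Type*} [NormedAddCommGroup E] [NormedSpace ℝ E]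
    [NormedAddCommGroup V] [NormedSpace ℝ V] [NormedAddCommGroup W] [NormedSpace ℝ W]
    {f : E → V →L[ℝ] W} {f' : E →L[ℝ] V →L[ℝ] W} {S : Set E} {x : E}
    (h : HasFDerivWithinAt f f' S x) (v : V) :
    HasFDerivWithinAt (fun y => f y v) ((ContinuousLinearMap.apply ℝ W v).comp f') S x :=
  (ContinuousLinearMap.apply ℝ W v).hasFDerivAt.comp_hasFDerivWithinAt x h

variable {n : ℕ} [NeZero n] {N : Type*} [TopologicalSpace N]
  [ChartedSpace (EuclideanHalfSpace n) N] [IsManifold (𝓡∂ n) ∞ N]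

namespace StationaryMetric

variable (g : StationaryMetric n N)

/-- The conformal factor in the chart at `c`. -/
def clam (c : N) (u : Space n) : ℝ := g.lam ((extChartAt (𝓡∂ n) c).symm u)

theorem contDiffOn_clam (c : N) : ContDiffOn ℝ ∞ (g.clam c) (extChartAt (𝓡∂ n) c).target :=
  contDiffOn_of_frame fun p _ => g.smooth_lam p

theorem chartMetric_metric {c : ℝ × N} {u : ℝ × Space n}
    (hu : u.2 ∈ (extChartAt (𝓡∂ n) c.2).target) (a b : ℝ × Space n) :
    chartMetric (cylinderModel n) g.metric c u a b
      = g.clam c.2 u.2 * (g.gram c.2 u.2 a.2 b.2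
        - (a.1 + g.cpot c.2 u.2 a.2) * (b.1 + g.cpot c.2 u.2 b.2)) := by
  rw [chartMetric_eq, extChartAt_cylinder_symm, frameAt_cylinder hu, frameAt_cylinder hu,
    MagneticSystem.gram, chartMetric_eq, MagneticSystem.cpot, chartForm_eq, chartForm_eq]
  rfl

theorem contDiffOn_chartMetric_metric (c : ℝ × N) :
    ContDiffOn ℝ ∞ (chartMetric (cylinderModel n) g.metric c)
      (extChartAt (cylinderModel n) c).target := by
  rw [contDiffOn_clm_apply]
  intro a
  rw [contDiffOn_clm_apply]
  intro b
  have hsnd : MapsTo (Prod.snd : ℝ × Space n → Space n) (extChartAt (cylinderModel n) c).target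
      (extChartAt (𝓡∂ n) c.2).target := fun u hu => by
    rw [extChartAt_cylinder_target] at hu
    exact hu.2
  have h1 := (g.contDiffOn_clam c.2).comp contDiff_snd.contDiffOn hsnd
  have h2 := (((g.contDiffOn_gram c.2).clm_apply (contDiffOn_const (c := a.2))).clm_apply
    (contDiffOn_const (c := b.2))).comp contDiff_snd.contDiffOn hsnd
  have h3 : ∀ e : Space n, ContDiffOn ℝ ∞ _ _ := fun e =>
    ((g.contDiffOn_cpot c.2).clm_apply (contDiffOn_const (c := e))).comp contDiff_snd.contDiffOn hsnd
  refine (h1.mul (h2.sub (((contDiffOn_const (c := a.1)).add (h3 a.2)).mul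
    ((contDiffOn_const (c := b.1)).add (h3 b.2))))).congr fun u hu => ?_
  exact g.chartMetric_metric (hsnd hu) a b

/-- The derivative of the metric in a null direction. -/
theorem fderivWithin_chartMetric_metric {c p : ℝ × N}
    (hp : p.2 ∈ (chartAt (EuclideanHalfSpace n) c.2).source) {v : ℝ × Space n} {q : ℝ}
    (hq : v.1 + g.cpot c.2 (extChartAt (𝓡∂ n) c.2 p.2) v.2 = q)
    (hv : g.gram c.2 (extChartAt (𝓡∂ n) c.2 p.2) v.2 v.2 = q * q) (e : ℝ × Space n) :
    fderivWithin ℝ (chartMetric (cylinderModel n) g.metric c) (range (cylinderModel n))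
        (extChartAt (cylinderModel n) c p) e v v
      = g.lam p.2 * (fderivWithin ℝ (chartMetric (𝓡∂ n) g.h.inner c.2) (range (𝓡∂ n))
          (extChartAt (𝓡∂ n) c.2 p.2) e.2 v.2 v.2
        - 2 * q * fderivWithin ℝ (chartForm (𝓡∂ n) g.om c.2) (range (𝓡∂ n))
          (extChartAt (𝓡∂ n) c.2 p.2) e.2 v.2) := by
  set u := extChartAt (𝓡∂ n) c.2 p.2 with hu
  have hp' : p ∈ (chartAt (ModelProd ℝ (EuclideanHalfSpace n)) c).source :=
    mem_cylinder_chart_source.2 hp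
  have hru : extChartAt (cylinderModel n) c p ∈ range (cylinderModel n) := extChartAt_mem_range c p
  have hut : extChartAt (cylinderModel n) c p ∈ (extChartAt (cylinderModel n) c).target :=
    (extChartAt (cylinderModel n) c).map_source (by rwa [extChartAt_source])
  have hsnd : HasFDerivWithinAt (Prod.snd : ℝ × Space n → Space n)
      (ContinuousLinearMap.snd ℝ ℝ (Space n)) (range (cylinderModel n))
      (extChartAt (cylinderModel n) c p) := hasFDerivAt_snd.hasFDerivWithinAt
  have hmaps : MapsTo (Prod.snd : ℝ × Space n → Space n) (range (cylinderModel n))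
      (range (𝓡∂ n)) := fun w hw => by
    rw [range_cylinderModel] at hw
    exact hw.2
  have e0 : (extChartAt (cylinderModel n) c p).2 = u := by rw [extChartAt_cylinder]
  have hG := hasFDerivWithinAt_apply (hasFDerivWithinAt_apply (hasFDerivWithinAt_of_contDiffOn_target
    (V := (ℝ × Space n) →L[ℝ] (ℝ × Space n) →L[ℝ] ℝ) (g.contDiffOn_chartMetric_metric c) hp') v) v
  have hl := hasFDerivWithinAt_of_contDiffOn_target (g.contDiffOn_clam c.2) hp
  have hh := hasFDerivWithinAt_apply (hasFDerivWithinAt_apply (hasFDerivWithinAt_of_contDiffOn_target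
    (V := Space n →L[ℝ] Space n →L[ℝ] ℝ) (g.contDiffOn_gram c.2) hp) v.2) v.2
  have hw := hasFDerivWithinAt_apply (hasFDerivWithinAt_of_contDiffOn_target
    (V := Space n →L[ℝ] ℝ) (g.contDiffOn_cpot c.2) hp) v.2
  rw [← hu, ← e0] at hl hh hw
  have hl' := hl.comp _ hsnd hmaps
  have hh' := hh.comp _ hsnd hmaps
  have hw' := (hw.comp _ hsnd hmaps).const_add v.1
  have hF := hl'.mul (hh'.sub (hw'.mul hw'))
  have heq := (hF.congr_of_eventuallyEq (f₁ := fun w => chartMetric (cylinderModel n) g.metric c w v v)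
    (by
      filter_upwards [extChartAt_target_mem_nhdsWithin_of_mem hut] with w hw
      rw [extChartAt_cylinder_target] at hw
      exact g.chartMetric_metric hw.2 v v)
    (g.chartMetric_metric (by
      rw [extChartAt_cylinder_target] at hut
      exact hut.2) v v))
  have key := DFunLike.congr_fun (((cylinderModel n).uniqueDiffOn _ hru).eq hG heq) e
  refine key.trans ?_
  have hlam : g.clam c.2 u = g.lam p.2 := by
    rw [clam, hu, (extChartAt (𝓡∂ n) c.2).left_inv (by rwa [extChartAt_source])]
  simp only [Function.comp_apply, e0, Pi.mul_apply, Pi.sub_apply, add_apply, smul_apply, sub_apply, ContinuousLinearMap.comp_apply, ContinuousLinearMap.apply_apply, ContinuousLinearMap.coe_snd', smul_eq_mul]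
  have hq' : v.1 + chartForm (𝓡∂ n) g.om c.2 u v.2 = q := hq
  have hv' : chartMetric (𝓡∂ n) g.h.inner c.2 u v.2 v.2 = q * q := hv
  -- The null condition kills the term containing the derivative of `λ`, which is why null geodesics
  -- are conformally invariant up to parametrization.
  rw [hlam, hq', hv']
  ring

end StationaryMetric

end

/-! ### Light rays as null curves with conserved energy. -/

section

variable {n : ℕ} [NeZero n] {N : Type*} [TopologicalSpace N]
  [ChartedSpace (EuclideanHalfSpace n) N]

open StationaryMetric

section Curves

variable {t : ℝ → ℝ} {x : ℝ → N} {T s : ℝ}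

theorem contMDiffOn_cylinder_iff {S : Set ℝ} :
    ContMDiffOn 𝓘(ℝ, ℝ) (cylinderModel n) ∞ (fun r => (t r, x r)) S
      ↔ ContDiffOn ℝ ∞ t S ∧ ContMDiffOn 𝓘(ℝ, ℝ) (𝓡∂ n) ∞ x S := by
  rw [contMDiffOn_prod_iff, ← contMDiffOn_iff_contDiffOn]
  rfl

variable [IsManifold (𝓡∂ n) ∞ N]

theorem chartVelocity_cylinder (hT : 0 < T) (ht : ContDiffOn ℝ ∞ t (Icc 0 T))
    (hx : ContMDiffOn 𝓘(ℝ, ℝ) (𝓡∂ n) ∞ x (Icc 0 T)) (hs : s ∈ Icc 0 T) {c : ℝ × N}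
    (hc : x s ∈ (chartAt (EuclideanHalfSpace n) c.2).source) :
    chartVelocity (cylinderModel n) c (fun r => (t r, x r)) T s
      = (derivWithin t (Icc 0 T) s, chartVelocity (𝓡∂ n) c.2 x T s) := by
  have h1 := ((ht s hs).differentiableWithinAt (by simp)).hasDerivWithinAt
  have h2 := hasDerivWithinAt_chartCurve (c := c.2) (mdiffAt_of_contMDiffOn hx hs) hc
  have h3 : chartCurve (cylinderModel n) c (fun r => (t r, x r))
      = fun r => (t r, chartCurve (𝓡∂ n) c.2 x r) := by
    ext1 r
    exact extChartAt_cylinder c (t r, x r)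
  rw [chartVelocity, h3]
  exact (h1.prodMk h2).derivWithin (uniqueDiffWithinAt_Icc hT hs)

theorem velocityAt_cylinder (hT : 0 < T) (ht : ContDiffOn ℝ ∞ t (Icc 0 T))
    (hx : ContMDiffOn 𝓘(ℝ, ℝ) (𝓡∂ n) ∞ x (Icc 0 T)) (hs : s ∈ Icc 0 T) :
    velocityAt (cylinderModel n) (fun r => (t r, x r)) T s
      = (derivWithin t (Icc 0 T) s, vel x T s) := by
  have h1 := chartVelocity_cylinder hT ht hx hs (c := (t s, x s)) (mem_chart_source _ (x s))
  rw [chartVelocity_self hT hs (mdiffAt_of_contMDiffOn hx hs)] at h1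
  rw [← h1]
  exact (chartVelocity_self hT hs (mdiffAt_of_contMDiffOn (contMDiffOn_cylinder_iff.2 ⟨ht, hx⟩) hs)).symm

end Curves

variable [IsManifold (𝓡∂ n) ∞ N]

namespace StationaryMetric

variable (g : StationaryMetric n N)

/-- The value of `dt + ω` on the velocity of `(t, x)`. -/
def timeRate (t : ℝ → ℝ) (x : ℝ → N) (T s : ℝ) : ℝ :=
  derivWithin t (Icc 0 T) s + g.pot (x s) (vel x T s)

/-- The curve `(t, x)` is null and solves the geodesic equation in first order form, with conserved
energy `k`. -/
structure IsNullCurve (k T : ℝ) (t : ℝ → ℝ) (x : ℝ → N) : Prop where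
  smooth_time : ContDiffOn ℝ ∞ t (Icc 0 T)
  smooth_space : ContMDiffOn 𝓘(ℝ, ℝ) (𝓡∂ n) ∞ x (Icc 0 T)
  energy : ∀ s ∈ Icc 0 T, g.lam (x s) * g.timeRate t x T s = k
  null : ∀ s ∈ Icc 0 T, g.ip (x s) (vel x T s) (vel x T s) = g.timeRate t x T s * g.timeRate t x T s
  momentum : ∀ c : N, ∀ s ∈ Icc 0 T, x s ∈ (chartAt (EuclideanHalfSpace n) c).source →
    ∀ e : Space n, HasDerivWithinAt (fun r => g.lam (x r) *
        g.gram c (chartCurve (𝓡∂ n) c x r) (chartVelocity (𝓡∂ n) c x T r) e)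
      (1 / 2 * (g.lam (x s) * fderivWithin ℝ (chartMetric (𝓡∂ n) g.h.inner c) (range (𝓡∂ n))
          (chartCurve (𝓡∂ n) c x s) e (chartVelocity (𝓡∂ n) c x T s) (chartVelocity (𝓡∂ n) c x T s))
        + k * chartExtDeriv (𝓡∂ n) g.om c (chartCurve (𝓡∂ n) c x s)
          (chartVelocity (𝓡∂ n) c x T s) e) (Icc 0 T) s

variable {g} {t : ℝ → ℝ} {x : ℝ → N} {T s k : ℝ}

theorem momentum_eq (hT : 0 < T) (ht : ContDiffOn ℝ ∞ t (Icc 0 T))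
    (hx : ContMDiffOn 𝓘(ℝ, ℝ) (𝓡∂ n) ∞ x (Icc 0 T)) (hs : s ∈ Icc 0 T) {c : ℝ × N}
    (hc : x s ∈ (chartAt (EuclideanHalfSpace n) c.2).source) (e : ℝ × Space n) :
    chartMetric (cylinderModel n) g.metric c
        (chartCurve (cylinderModel n) c (fun r => (t r, x r)) s)
        (chartVelocity (cylinderModel n) c (fun r => (t r, x r)) T s) e
      = g.lam (x s) * (g.gram c.2 (chartCurve (𝓡∂ n) c.2 x s) (chartVelocity (𝓡∂ n) c.2 x T s) e.2
        - g.timeRate t x T s * (e.1 + g.cpot c.2 (chartCurve (𝓡∂ n) c.2 x s) e.2)) := by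
  have h1 : chartCurve (cylinderModel n) c (fun r => (t r, x r)) s
      = (t s, chartCurve (𝓡∂ n) c.2 x s) := extChartAt_cylinder c (t s, x s)
  have h2 : chartCurve (𝓡∂ n) c.2 x s ∈ (extChartAt (𝓡∂ n) c.2).target :=
    (extChartAt (𝓡∂ n) c.2).map_source (by rwa [extChartAt_source])
  have h3 := chartForm_chartVelocity g.om hT hs (mdiffAt_of_contMDiffOn hx hs) hc
  have h4 : g.clam c.2 (chartCurve (𝓡∂ n) c.2 x s) = g.lam (x s) := by
    rw [clam, chartCurve, (extChartAt (𝓡∂ n) c.2).left_inv (by rwa [extChartAt_source])]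
  rw [h1, chartVelocity_cylinder hT ht hx hs hc, g.chartMetric_metric h2, h4, MagneticSystem.cpot, h3]
  rfl

/-- The momentum of the curve is `λ (h(v, ·) - q (dt + ω))` with `λ q = k`. Adding `k (dt + ω)`
leaves `λ h(v, ·)`, and the derivative of `ω` along the curve combines with the derivative of the
metric into `k dω`. -/
theorem covariantAcceleration_eq_zero_iff (hT : 0 < T) (ht : ContDiffOn ℝ ∞ t (Icc 0 T))
    (hx : ContMDiffOn 𝓘(ℝ, ℝ) (𝓡∂ n) ∞ x (Icc 0 T)) (hs : s ∈ Icc 0 T)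
    (henergy : ∀ s ∈ Icc 0 T, g.lam (x s) * g.timeRate t x T s = k)
    (hnull : g.ip (x s) (vel x T s) (vel x T s) = g.timeRate t x T s * g.timeRate t x T s)
    {c : ℝ × N} (hc : x s ∈ (chartAt (EuclideanHalfSpace n) c.2).source) (e : ℝ × Space n) :
    covariantAcceleration (cylinderModel n) g.metric c (fun r => (t r, x r)) T s e = 0 ↔
    HasDerivWithinAt (fun r => g.lam (x r) *
        g.gram c.2 (chartCurve (𝓡∂ n) c.2 x r) (chartVelocity (𝓡∂ n) c.2 x T r) e.2)
      (1 / 2 * (g.lam (x s) * fderivWithin ℝ (chartMetric (𝓡∂ n) g.h.inner c.2) (range (𝓡∂ n))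
          (chartCurve (𝓡∂ n) c.2 x s) e.2 (chartVelocity (𝓡∂ n) c.2 x T s)
          (chartVelocity (𝓡∂ n) c.2 x T s))
        + k * chartExtDeriv (𝓡∂ n) g.om c.2 (chartCurve (𝓡∂ n) c.2 x s)
          (chartVelocity (𝓡∂ n) c.2 x T s) e.2) (Icc 0 T) s := by
  have hsm := contMDiffOn_cylinder_iff.2 ⟨ht, hx⟩
  have hmd := mdiffAt_of_contMDiffOn hx hs
  have hA := hasDerivWithinAt_momentum (g.contDiffOn_chartMetric_metric c) hT hs hsm
    (mem_cylinder_chart_source.2 hc) e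
  have hB := hasDerivWithinAt_chartForm (g.contDiffOn_cpot c.2) hs hx hc e.2
  have hform := chartForm_chartVelocity g.om hT hs hmd hc
  have hD := g.fderivWithin_chartMetric_metric (c := c) (p := (t s, x s)) hc
    (v := (derivWithin t (Icc 0 T) s, chartVelocity (𝓡∂ n) c.2 x T s)) (q := g.timeRate t x T s)
    (by rw [timeRate]; exact congrArg _ hform)
    ((chartMetric_chartVelocity g.h.inner hT hs hmd hc).trans hnull) e
  have hC := hA.add ((hB.const_add e.1).const_mul k)
  have hQ := hC.congr_of_eventuallyEq (f₁ := fun r => g.lam (x r) *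
      g.gram c.2 (chartCurve (𝓡∂ n) c.2 x r) (chartVelocity (𝓡∂ n) c.2 x T r) e.2) (by
    have hsrc := (hx.continuousOn s hs).eventually
      ((chartAt (EuclideanHalfSpace n) c.2).open_source.mem_nhds hc)
    filter_upwards [hsrc, self_mem_nhdsWithin] with r hr hr'
    rw [Pi.add_apply, momentum_eq hT ht hx hr' hr, ← henergy r hr', MagneticSystem.cpot]
    ring) (by
    rw [Pi.add_apply, momentum_eq hT ht hx hs hc, ← henergy s hs, MagneticSystem.cpot]
    ring)
  have hR : covariantAcceleration (cylinderModel n) g.metric c (fun r => (t r, x r)) T s e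
      + 1 / 2 * fderivWithin ℝ (chartMetric (cylinderModel n) g.metric c) (range (cylinderModel n))
        (chartCurve (cylinderModel n) c (fun r => (t r, x r)) s) e
        (chartVelocity (cylinderModel n) c (fun r => (t r, x r)) T s)
        (chartVelocity (cylinderModel n) c (fun r => (t r, x r)) T s)
      + k * fderivWithin ℝ (chartForm (𝓡∂ n) g.om c.2) (range (𝓡∂ n)) (chartCurve (𝓡∂ n) c.2 x s)
        (chartVelocity (𝓡∂ n) c.2 x T s) e.2
      = covariantAcceleration (cylinderModel n) g.metric c (fun r => (t r, x r)) T s e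
        + (1 / 2 * (g.lam (x s) * fderivWithin ℝ (chartMetric (𝓡∂ n) g.h.inner c.2) (range (𝓡∂ n))
          (chartCurve (𝓡∂ n) c.2 x s) e.2 (chartVelocity (𝓡∂ n) c.2 x T s)
          (chartVelocity (𝓡∂ n) c.2 x T s))
        + k * chartExtDeriv (𝓡∂ n) g.om c.2 (chartCurve (𝓡∂ n) c.2 x s)
          (chartVelocity (𝓡∂ n) c.2 x T s) e.2) := by
    have hcc : chartCurve (cylinderModel n) c (fun r => (t r, x r)) s
        = extChartAt (cylinderModel n) c (t s, x s) := rfl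
    rw [hcc, chartVelocity_cylinder hT ht hx hs hc, hD, ← henergy s hs, chartExtDeriv]
    simp only [chartCurve]
    ring
  rw [hR] at hQ
  constructor
  · intro h
    rwa [h, zero_add] at hQ
  · intro h
    have := (uniqueDiffWithinAt_Icc hT hs).eq_deriv _ hQ h
    linarith

/-- The metric does not depend on `t`, so the momentum paired with `∂/∂t` is conserved; this is the
energy `k` up to sign, and future pointing means `k > 0`. The spatial components are
`covariantAcceleration_eq_zero_iff`. -/
theorem isLightRay_iff : g.IsLightRay T (fun r => (t r, x r)) ↔
    0 < T ∧ ∃ k, 0 < k ∧ g.IsNullCurve k T t x := by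
  have hmetric : 0 < T → ContDiffOn ℝ ∞ t (Icc 0 T) → ContMDiffOn 𝓘(ℝ, ℝ) (𝓡∂ n) ∞ x (Icc 0 T) →
      ∀ s ∈ Icc 0 T, g.metric (t s, x s) (velocity (cylinderModel n) (fun r => (t r, x r)) T s)
          (velocity (cylinderModel n) (fun r => (t r, x r)) T s)
        = g.lam (x s) * (-(g.timeRate t x T s * g.timeRate t x T s)
          + g.ip (x s) (vel x T s) (vel x T s)) ∧
        g.metric (t s, x s) (velocity (cylinderModel n) (fun r => (t r, x r)) T s)
          (timeVector (t s, x s)) = -(g.lam (x s) * g.timeRate t x T s) := by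
    intro hT ht hx s hs
    have hv : velocity (cylinderModel n) (fun r => (t r, x r)) T s
      = (derivWithin t (Icc 0 T) s, vel x T s) := velocityAt_cylinder hT ht hx hs
    rw [hv]
    refine ⟨g.metric_apply _ _ _, (g.metric_apply _ _ _).trans ?_⟩
    change g.lam (x s) * (-(g.timeRate t x T s * (1 + g.pot (x s) 0)) + g.ip (x s) (vel x T s) 0) = _
    rw [map_zero, map_zero]
    ring
  constructor
  · rintro ⟨hT, ⟨hsm, hgeo⟩, hnull, hfut⟩
    obtain ⟨ht, hx⟩ := contMDiffOn_cylinder_iff.1 hsm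
    have hm := hmetric hT ht hx
    have h0 : (0 : ℝ) ∈ Icc 0 T := ⟨le_rfl, hT.le⟩
    have hnull' : ∀ s ∈ Icc 0 T,
        g.ip (x s) (vel x T s) (vel x T s) = g.timeRate t x T s * g.timeRate t x T s := by
      intro s hs
      have h1 := hnull s hs
      rw [(hm s hs).1] at h1
      have := (mul_eq_zero.1 h1).resolve_left (g.lam_pos _).ne'
      linarith
    have hder : ∀ s ∈ Icc 0 T, HasDerivWithinAt (fun r => g.lam (x r) * g.timeRate t x T r) 0
        (Icc 0 T) s := by
      intro s hs
      have hc : x s ∈ (chartAt (EuclideanHalfSpace n) ((t s, x s) : ℝ × N).2).source :=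
        mem_chart_source _ (x s)
      have hA := hasDerivWithinAt_momentum (g.contDiffOn_chartMetric_metric (t s, x s)) hT hs hsm
        -- The direction `∂/∂t`, in which the metric has zero derivative.
        (mem_cylinder_chart_source.2 hc) ((1, 0) : ℝ × Space n)
      have hD := g.fderivWithin_chartMetric_metric (c := (t s, x s)) (p := (t s, x s)) hc
        (v := (derivWithin t (Icc 0 T) s, chartVelocity (𝓡∂ n) (x s) x T s))
        (q := g.timeRate t x T s)
        (by
          rw [timeRate]
          exact congrArg _ (chartForm_chartVelocity g.om hT hs (mdiffAt_of_contMDiffOn hx hs) hc))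
        ((chartMetric_chartVelocity g.h.inner hT hs (mdiffAt_of_contMDiffOn hx hs) hc).trans
          (hnull' s hs)) ((1, 0) : ℝ × Space n)
      simp only [map_zero, zero_apply, mul_zero, sub_zero] at hD
      have hz := hgeo (t s, x s) s hs (mem_cylinder_chart_source.2 hc) ((1, 0) : ℝ × Space n)
      rw [hz, zero_add] at hA
      have hcc : chartCurve (cylinderModel n) (t s, x s) (fun r => (t r, x r)) s
          = extChartAt (cylinderModel n) (t s, x s) (t s, x s) := rfl
      rw [hcc, chartVelocity_cylinder hT ht hx hs hc, hD, mul_zero] at hA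
      have hB := hA.neg
      rw [neg_zero] at hB
      refine hB.congr_of_eventuallyEq ?_ ?_
      · filter_upwards [(hx.continuousOn s hs).eventually
          ((chartAt (EuclideanHalfSpace n) (x s)).open_source.mem_nhds hc), self_mem_nhdsWithin]
          with r hr hr'
        rw [Pi.neg_apply, momentum_eq (c := (t s, x s)) hT ht hx hr' hr, map_zero, map_zero]
        ring
      · rw [Pi.neg_apply, momentum_eq (c := (t s, x s)) hT ht hx hs hc, map_zero, map_zero]
        ring
    have hconst : ∀ s ∈ Icc 0 T, g.lam (x s) * g.timeRate t x T s
        = g.lam (x 0) * g.timeRate t x T 0 := by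
      refine constant_of_derivWithin_zero (fun s hs => (hder s hs).differentiableWithinAt)
        fun s hs => (hder s (Ico_subset_Icc_self hs)).derivWithin
          (uniqueDiffWithinAt_Icc hT (Ico_subset_Icc_self hs))
    refine ⟨hT, g.lam (x 0) * g.timeRate t x T 0, ?_, ht, hx, hconst, hnull', ?_⟩
    · have := hfut 0 h0
      rw [(hm 0 h0).2] at this
      linarith
    · intro c s hs hc e
      exact (covariantAcceleration_eq_zero_iff hT ht hx hs hconst (hnull' s hs) (c := (0, c)) hc
        ((0, e) : ℝ × Space n)).1 (hgeo (0, c) s hs (mem_cylinder_chart_source.2 hc) (0, e))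
  · rintro ⟨hT, k, hk, h⟩
    have hm := hmetric hT h.smooth_time h.smooth_space
    refine ⟨hT, ⟨contMDiffOn_cylinder_iff.2 ⟨h.smooth_time, h.smooth_space⟩, ?_⟩, ?_, ?_⟩
    · intro c s hs hc e
      have hc' := mem_cylinder_chart_source.1 hc
      exact (covariantAcceleration_eq_zero_iff hT h.smooth_time h.smooth_space hs h.energy
        (h.null s hs) hc' e).2 (h.momentum c.2 s hs hc' e.2)
    · intro s hs
      rw [(hm s hs).1, h.null s hs, neg_add_cancel, mul_zero]
    · intro s hs
      rw [(hm s hs).2, h.energy s hs]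
      linarith

end StationaryMetric

end

/-! ### Correspondence between null curves and magnetic geodesics. -/

section

variable {n : ℕ} [NeZero n] {N : Type*} [TopologicalSpace N]
  [ChartedSpace (EuclideanHalfSpace n) N]

theorem eventually_mem_source_comp {x : ℝ → N} {G : ℝ → ℝ} {ℓ T σ : ℝ} {c : N}
    (hx : ContinuousOn x (Icc 0 T)) (hG : ContinuousOn G (Icc 0 ℓ))
    (hmaps : MapsTo G (Icc 0 ℓ) (Icc 0 T)) (hσ : σ ∈ Icc 0 ℓ)
    (hc : x (G σ) ∈ (chartAt (EuclideanHalfSpace n) c).source) :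
    ∀ᶠ r in 𝓝[Icc 0 ℓ] σ, r ∈ Icc 0 ℓ ∧ x (G r) ∈ (chartAt (EuclideanHalfSpace n) c).source :=
  eventually_mem_nhdsWithin.and (((hx.comp hG hmaps) σ hσ).eventually
    ((chartAt (EuclideanHalfSpace n) c).open_source.mem_nhds hc))

variable [IsManifold (𝓡∂ n) ∞ N]

open StationaryMetric

theorem StationaryMetric.contDiffOn_lam_comp (g : StationaryMetric n N) {x : ℝ → N} {T : ℝ}
    (hx : ContMDiffOn 𝓘(ℝ, ℝ) (𝓡∂ n) ∞ x (Icc 0 T)) :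
    ContDiffOn ℝ ∞ (fun s => g.lam (x s)) (Icc 0 T) :=
  contMDiffOn_iff_contDiffOn.1 (g.smooth_lam.comp_contMDiffOn hx)

theorem MagneticSystem.contDiffOn_pot_vel (m : MagneticSystem n N) {x : ℝ → N} {T : ℝ} (hT : 0 < T)
    (hx : ContMDiffOn 𝓘(ℝ, ℝ) (𝓡∂ n) ∞ x (Icc 0 T)) :
    ContDiffOn ℝ ∞ (fun s => m.pot (x s) (vel x T s)) (Icc 0 T) := by
  intro s hs
  have hc := mem_chart_source (EuclideanHalfSpace n) (x s)
  have hu : extChartAt (𝓡∂ n) (x s) (x s) ∈ (extChartAt (𝓡∂ n) (x s)).target :=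
    mem_extChartAt_target (x s)
  have hev := eventually_mem_source_comp (G := id) (ℓ := T) hx.continuousOn continuousOn_id
    (mapsTo_id _) hs hc
  have h1 := contDiffWithinAt_chartCurve (c := x s) (hx s hs) hc
  have h2 := contDiffWithinAt_chartVelocity (c := x s) hT hs (hx s hs) hc
  have h3 : ContDiffWithinAt ℝ ∞ (fun r => m.cpot (x s) (chartCurve (𝓡∂ n) (x s) x r)) (Icc 0 T) s := by
    refine ((m.contDiffOn_cpot (x s)) _ hu).comp_of_preimage_mem_nhdsWithin s h1 ?_
    filter_upwards [hev] with r hr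
    exact (extChartAt (𝓡∂ n) (x s)).map_source (by rw [extChartAt_source]; exact hr.2)
  refine (h3.clm_apply h2).congr_of_eventuallyEq ?_ ?_
  · filter_upwards [hev] with r hr
    exact (chartForm_chartVelocity m.om hT hr.1 (mdiffAt_of_contMDiffOn hx hr.1) hr.2).symm
  · exact (chartForm_chartVelocity m.om hT hs (mdiffAt_of_contMDiffOn hx hs) hc).symm

variable {g : StationaryMetric n N}

/-- Null curves project to magnetic geodesics. -/
theorem StationaryMetric.IsNullCurve.exists_geodesic {t : ℝ → ℝ} {x : ℝ → N} {T k : ℝ}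
    (hT : 0 < T) (hk : 0 < k) (h : g.IsNullCurve k T t x) :
    ∃ (ℓ : ℝ) (y : ℝ → N), g.IsMagneticGeodesic ℓ y ∧ y 0 = x 0 ∧ y ℓ = x T ∧
      t T - t 0 = g.curveAction ℓ y ∧ 0 < g.timeRate t x T 0 ∧ 0 < g.timeRate t x T T ∧
      vel (n := n) x T 0 = g.timeRate t x T 0 • vel y ℓ 0 ∧
      vel (n := n) x T T = g.timeRate t x T T • vel y ℓ ℓ := by
  have hx := h.smooth_space
  have h0 : (0 : ℝ) ∈ Icc 0 T := left_mem_Icc.2 hT.le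
  have h1 : T ∈ Icc 0 T := right_mem_Icc.2 hT.le
  -- By the energy identity and the null condition, `k / λ` is the `h`-speed of the projection; the
  -- reparametrization below gives it unit speed.
  set f : ℝ → ℝ := fun s => k * (g.lam (x s))⁻¹ with hf
  have hfq : ∀ s ∈ Icc 0 T, g.timeRate t x T s = f s := fun s hs => by
    rw [hf, ← h.energy s hs]
    field_simp [(g.lam_pos (x s)).ne']
  have hfpos : ∀ s, 0 < f s := fun s => mul_pos hk (inv_pos.2 (g.lam_pos _))
  obtain ⟨ℓ, G, hℓ, hGs, hmaps, g0, gℓ, -, hGd⟩ := exists_reparametrization (f := f) hT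
    (contDiffOn_const.mul ((g.contDiffOn_lam_comp hx).inv fun s _ => (g.lam_pos _).ne'))
    (fun s _ => hfpos s)
  have hl0 : (0 : ℝ) ∈ Icc 0 ℓ := left_mem_Icc.2 hℓ.le
  have hl1 : ℓ ∈ Icc 0 ℓ := right_mem_Icc.2 hℓ.le
  have hvel : ∀ σ ∈ Icc 0 ℓ, vel (n := n) (x ∘ G) ℓ σ = (f (G σ))⁻¹ • vel x T (G σ) := fun σ hσ =>
    velocityAt_comp hT hℓ hσ (hGd σ hσ) hmaps (mdiffAt_of_contMDiffOn hx (hmaps hσ))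
  have hcvel : ∀ (c : N), ∀ σ ∈ Icc 0 ℓ, x (G σ) ∈ (chartAt (EuclideanHalfSpace n) c).source →
      chartVelocity (𝓡∂ n) c (x ∘ G) ℓ σ = (f (G σ))⁻¹ • chartVelocity (𝓡∂ n) c x T (G σ) :=
    fun c σ hσ hc => chartVelocity_comp hℓ hσ (hGd σ hσ) hmaps
      (mdiffAt_of_contMDiffOn hx (hmaps hσ)) hc
  have hfinv : ∀ s, (f s)⁻¹ = k⁻¹ * g.lam (x s) := fun s => by rw [hf]; simp [mul_comm]
  have hy : g.IsMagneticGeodesic ℓ (x ∘ G) := by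
    refine MagneticSystem.IsMagneticGeodesic.of_hasDerivWithinAt hℓ
      (hx.comp hGs.contMDiffOn hmaps) (fun σ hσ => ?_) (fun c σ hσ hc e => ?_)
    · have hn := h.null (G σ) (hmaps hσ)
      rw [hfq _ (hmaps hσ)] at hn
      have := (hfpos (G σ)).ne'
      rw [hvel σ hσ, map_smul, map_smul, smul_apply, Function.comp_apply, hn, smul_eq_mul,
        smul_eq_mul]
      field_simp
    · have hD := ((h.momentum c (G σ) (hmaps hσ) hc e).scomp σ (hGd σ hσ) hmaps).const_mul k⁻¹
      refine (hD.congr_of_eventuallyEq ?_ ?_).congr_deriv ?_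
      · filter_upwards [eventually_mem_source_comp hx.continuousOn hGs.continuousOn hmaps hσ hc]
          with r hr
        rw [hcvel c r hr.1 hr.2, map_smul, smul_apply, hfinv, smul_eq_mul, mul_assoc]
        rfl
      · rw [hcvel c σ hσ hc, map_smul, smul_apply, hfinv, smul_eq_mul, mul_assoc]
        rfl
      · rw [hcvel c σ hσ hc]
        have e1 : chartCurve (𝓡∂ n) c (x ∘ G) σ = chartCurve (𝓡∂ n) c x (G σ) := rfl
        rw [e1]
        simp only [chartExtDeriv, map_smul, smul_apply, smul_eq_mul, hfinv]
        field_simp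
        ring
  refine ⟨ℓ, x ∘ G, hy, congrArg x g0, congrArg x gℓ, ?_, ?_, ?_, ?_, ?_⟩
  · have hderiv : ∀ σ ∈ Icc 0 ℓ, HasDerivWithinAt (t ∘ G)
        (1 - g.pot ((x ∘ G) σ) (vel (x ∘ G) ℓ σ)) (Icc 0 ℓ) σ := by
      intro σ hσ
      have hd := ((h.smooth_time _ (hmaps hσ)).differentiableWithinAt (by simp)).hasDerivWithinAt
      refine (hd.scomp σ (hGd σ hσ) hmaps).congr_deriv ?_
      have hq := hfq _ (hmaps hσ)
      rw [timeRate] at hq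
      have := (hfpos (G σ)).ne'
      rw [hvel σ hσ, map_smul, smul_eq_mul, smul_eq_mul, Function.comp_apply,
        eq_sub_of_add_eq hq]
      field_simp
    have hint := intervalIntegral.integral_eq_sub_of_hasDerivAt_of_le hℓ.le
      (fun σ hσ => (hderiv σ hσ).continuousWithinAt)
      (fun σ hσ => (hderiv σ (Ioo_subset_Icc_self hσ)).hasDerivAt (Icc_mem_nhds hσ.1 hσ.2))
      (hy.intervalIntegrable hl0 hl1)
    rw [hy.curveAction_eq, hint, Function.comp_apply, Function.comp_apply, g0, gℓ]
  · rw [hfq 0 h0]; exact hfpos 0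
  · rw [hfq T h1]; exact hfpos T
  · rw [hvel 0 hl0, g0, hfq 0 h0, smul_inv_smul₀ (hfpos 0).ne']
  · rw [hvel ℓ hl1, gℓ, hfq T h1, smul_inv_smul₀ (hfpos T).ne']

/-- Magnetic geodesics lift to null curves. -/
theorem MagneticSystem.IsMagneticGeodesic.exists_nullCurve {ℓ : ℝ} {y : ℝ → N}
    (hy : g.IsMagneticGeodesic ℓ y) (t₀ : ℝ) :
    ∃ (T : ℝ) (t : ℝ → ℝ) (x : ℝ → N), 0 < T ∧ g.IsNullCurve 1 T t x ∧ x 0 = y 0 ∧ x T = y ℓ ∧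
      t 0 = t₀ ∧ t T = t₀ + g.curveAction ℓ y ∧ (∀ s ∈ Ioo 0 T, ∃ σ ∈ Ioo 0 ℓ, x s = y σ) ∧
      0 < g.timeRate t x T 0 ∧ 0 < g.timeRate t x T T ∧
      vel (n := n) x T 0 = g.timeRate t x T 0 • vel y ℓ 0 ∧
      vel (n := n) x T T = g.timeRate t x T T • vel y ℓ ℓ := by
  have hℓ := hy.pos
  -- The parameter is chosen so that the lift has `h`-speed `λ⁻¹`, which amounts to energy one.
  obtain ⟨T, G, hT, hGs, hmaps, g0, gT, hIoo, hGd⟩ := exists_reparametrization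
    (f := fun σ => g.lam (y σ)) hℓ (g.contDiffOn_lam_comp hy.smooth) (fun s _ => g.lam_pos _)
  have h0 : (0 : ℝ) ∈ Icc 0 T := left_mem_Icc.2 hT.le
  have h1 : T ∈ Icc 0 T := right_mem_Icc.2 hT.le
  -- The null condition prescribes the time coordinate as the action accumulated along `y`.
  set P : ℝ → ℝ := fun σ => ∫ r in (0 : ℝ)..σ, (1 - g.pot (y r) (vel y ℓ r)) with hP
  have hps : ContDiffOn ℝ ∞ (fun r => 1 - g.pot (y r) (vel y ℓ r)) (Icc 0 ℓ) :=
    contDiffOn_const.sub (g.contDiffOn_pot_vel hℓ hy.smooth)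
  have hPd : ∀ σ ∈ Icc 0 ℓ, HasDerivWithinAt P (1 - g.pot (y σ) (vel y ℓ σ)) (Icc 0 ℓ) σ := by
    intro σ hσ
    have : Fact (σ ∈ Icc 0 ℓ) := ⟨hσ⟩
    exact intervalIntegral.integral_hasDerivWithinAt_right (t := Icc 0 ℓ)
      (hy.intervalIntegrable hy.zero_mem hσ)
      (hps.continuousOn.stronglyMeasurableAtFilter_nhdsWithin measurableSet_Icc σ)
      (hps.continuousOn σ hσ)
  have hPs : ContDiffOn ℝ ∞ P (Icc 0 ℓ) :=
    (contDiffOn_infty_iff_derivWithin (uniqueDiffOn_Icc hℓ)).2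
      ⟨fun σ hσ => (hPd σ hσ).differentiableWithinAt,
        hps.congr fun σ hσ => (hPd σ hσ).derivWithin (uniqueDiffWithinAt_Icc hℓ hσ)⟩
  have hvel : ∀ s ∈ Icc 0 T, vel (n := n) (y ∘ G) T s = (g.lam (y (G s)))⁻¹ • vel y ℓ (G s) :=
    fun s hs => velocityAt_comp hℓ hT hs (hGd s hs) hmaps (hy.mdiff (hmaps hs))
  have hcvel : ∀ (c : N), ∀ s ∈ Icc 0 T, y (G s) ∈ (chartAt (EuclideanHalfSpace n) c).source →
      chartVelocity (𝓡∂ n) c (y ∘ G) T s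
        = (g.lam (y (G s)))⁻¹ • chartVelocity (𝓡∂ n) c y ℓ (G s) :=
    fun c s hs hc => chartVelocity_comp hT hs (hGd s hs) hmaps (hy.mdiff (hmaps hs)) hc
  set t : ℝ → ℝ := fun s => t₀ + P (G s) with ht
  have hlam : ∀ p, g.lam p ≠ 0 := fun p => (g.lam_pos p).ne'
  have hrate : ∀ s ∈ Icc 0 T, g.timeRate t (y ∘ G) T s = (g.lam (y (G s)))⁻¹ := by
    intro s hs
    have hd := ((hPd _ (hmaps hs)).scomp s (hGd s hs) hmaps).const_add t₀
    have hd' : derivWithin t (Icc 0 T) s = _ := hd.derivWithin (uniqueDiffWithinAt_Icc hT hs)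
    rw [timeRate, hd', hvel s hs, map_smul, smul_eq_mul, smul_eq_mul, Function.comp_apply]
    ring
  have hnull : g.IsNullCurve 1 T t (y ∘ G) := by
    refine ⟨contDiffOn_const.add (hPs.comp hGs hmaps), hy.smooth.comp hGs.contMDiffOn hmaps,
      fun s hs => ?_, fun s hs => ?_, fun c s hs hc e => ?_⟩
    · rw [hrate s hs]
      exact mul_inv_cancel₀ (hlam _)
    · rw [hrate s hs, hvel s hs, map_smul, map_smul, smul_apply, Function.comp_apply,
        hy.ip_vel (hmaps hs), smul_eq_mul, smul_eq_mul, mul_one]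
    · have hD := (hy.hasDerivWithinAt_momentum (hmaps hs) hc e).scomp s (hGd s hs) hmaps
      refine (hD.congr_of_eventuallyEq ?_ ?_).congr_deriv ?_
      · filter_upwards [eventually_mem_source_comp hy.smooth.continuousOn hGs.continuousOn hmaps hs hc]
          with r hr
        rw [hcvel c r hr.1 hr.2, map_smul, smul_apply, smul_eq_mul]
        exact mul_inv_cancel_left₀ (hlam _) _
      · rw [hcvel c s hs hc, map_smul, smul_apply, smul_eq_mul]
        exact mul_inv_cancel_left₀ (hlam _) _
      · rw [hcvel c s hs hc]
        have e1 : chartCurve (𝓡∂ n) c (y ∘ G) s = chartCurve (𝓡∂ n) c y (G s) := rfl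
        have e2 : g.lam ((y ∘ G) s) = g.lam (y (G s)) := rfl
        have e3 := hlam (y (G s))
        rw [e1, e2]
        simp only [chartExtDeriv, map_smul, smul_apply, smul_eq_mul]
        field_simp
        ring
  have hpos : ∀ s ∈ Icc 0 T, 0 < g.timeRate t (y ∘ G) T s := fun s hs => by
    rw [hrate s hs]
    exact inv_pos.2 (g.lam_pos _)
  refine ⟨T, t, y ∘ G, hT, hnull, congrArg y g0, congrArg y gT, ?_, ?_,
    fun s hs => ⟨G s, hIoo hs, rfl⟩, hpos 0 h0, hpos T h1, ?_, ?_⟩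
  · simp [ht, hP, g0]
  · rw [hy.curveAction_eq, ht]
    simp only [gT, hP]
  · rw [hvel 0 h0, hrate 0 h0, g0]
  · rw [hvel T h1, hrate T h1, gT]

end

/-! ### The scattering relation in terms of the action. -/

section

variable {n : ℕ} [NeZero n] {N : Type*} [TopologicalSpace N]
  [ChartedSpace (EuclideanHalfSpace n) N] [IsManifold (𝓡∂ n) ∞ N]

/-- `v` is, up to a positive factor, the orthogonal projection to `T∂M` of the direction over the
unit vector `ξ`. -/
def MagneticSystem.IsEndDirection (m : MagneticSystem n N) (x : N) (ξ : Space n)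
    (v : ℝ × Space n) : Prop :=
  v.2 0 = 0 ∧ 0 < v.1 + m.pot x v.2 ∧
    ∀ u : Space n, u 0 = 0 → m.ip x v.2 u = (v.1 + m.pot x v.2) * m.ip x ξ u

theorem MagneticSystem.exists_isEndDirection (m : MagneticSystem n N) (x : N) (ξ : Space n) :
    ∃ v, m.IsEndDirection x ξ v := by
  obtain ⟨v, hv0, hv⟩ := m.exists_tangent_projection x ξ
  -- The time component makes `dt + ω` equal to one, the normalization that belongs to a unit vector
  -- `ξ`.
  refine ⟨(1 - m.pot x v, v), hv0, ?_, fun u hu => ?_⟩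
  · rw [sub_add_cancel]; exact one_pos
  · rw [sub_add_cancel, one_mul]; exact hv u hu

/-- An end direction involves only the tangential parts of the metric, of the form and of `ξ`, which
are the data that the boundary action determines. -/
theorem MagneticSystem.IsEndDirection.of_eq {m m' : MagneticSystem n N} {x : N} {ξ ξ' : Space n}
    {v : ℝ × Space n} (hv : m.IsEndDirection x ξ v)
    (hpot : ∀ u : Space n, u 0 = 0 → m.pot x u = m'.pot x u)
    (hip : ∀ u : Space n, u 0 = 0 → ∀ w : Space n, w 0 = 0 → m.ip x u w = m'.ip x u w)
    (hξ : ∀ u : Space n, u 0 = 0 → m.ip x ξ u = m'.ip x ξ' u) : m'.IsEndDirection x ξ' v := by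
  refine ⟨hv.1, ?_, fun u hu => ?_⟩
  · rw [← hpot _ hv.1]; exact hv.2.1
  · rw [← hpot _ hv.1, ← hip _ hv.1 u hu, ← hξ u hu]
    exact hv.2.2 u hu

namespace StationaryMetric

variable {g : StationaryMetric n N}

/-- The vector `∂/∂t` is tangent to `∂M`; testing with it gives the equality of the values of `dt +
ω`, and the remaining tests compare tangential parts. The factor `λ` drops out. -/
theorem isBoundaryProjection_iff {p : ℝ × N} {v v' : ℝ × Space n} :
    g.IsBoundaryProjection (p := p) v v' ↔ v'.2 0 = 0 ∧
      v'.1 + g.pot p.2 v'.2 = v.1 + g.pot p.2 v.2 ∧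
      ∀ u : Space n, u 0 = 0 → g.ip p.2 v'.2 u = g.ip p.2 v.2 u := by
  have key : ∀ u : ℝ × Space n, g.metric p (v - v' : ℝ × Space n) u = g.lam p.2 *
      (-(((v.1 - v'.1) + (g.pot p.2 v.2 - g.pot p.2 v'.2)) * (u.1 + g.pot p.2 u.2))
        + (g.ip p.2 v.2 u.2 - g.ip p.2 v'.2 u.2)) := by
    intro u
    rw [← map_sub, ← sub_apply, ← map_sub]
    exact g.metric_apply p _ _
  have hl := (g.lam_pos p.2).ne'
  constructor
  · rintro ⟨h0, h⟩
    have h1 : v'.1 + g.pot p.2 v'.2 = v.1 + g.pot p.2 v.2 := by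
      have h2 : g.metric p (v - v' : ℝ × Space n) ((1, 0) : ℝ × Space n) = 0 := h _ rfl
      rw [key] at h2
      have h3 := (mul_eq_zero.1 h2).resolve_left hl
      simp only [map_zero] at h3
      linarith
    refine ⟨h0, h1, fun u hu => ?_⟩
    have h2 : g.metric p (v - v' : ℝ × Space n) ((0, u) : ℝ × Space n) = 0 := h _ hu
    rw [key] at h2
    have h3 := (mul_eq_zero.1 h2).resolve_left hl
    have h4 : (v.1 - v'.1) + (g.pot p.2 v.2 - g.pot p.2 v'.2) = 0 := by linarith
    rw [h4] at h3
    linarith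
  · rintro ⟨h0, h1, h2⟩
    refine ⟨h0, fun u hu => ?_⟩
    have h3 := h2 u.2 hu
    have h4 : (v.1 - v'.1) + (g.pot p.2 v.2 - g.pot p.2 v'.2) = 0 := by linarith
    refine (key u).trans ?_
    rw [h4, h3]
    ring

theorem isBoundaryProjection_smul_iff {p : ℝ × N} {v v' : ℝ × Space n} {a b : ℝ} {ξ : Space n}
    (ha : v.1 + g.pot p.2 v.2 = a) (hξ : v.2 = a • ξ) :
    g.IsBoundaryProjection (p := p) (b • v : ℝ × Space n) v' ↔ v'.2 0 = 0 ∧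
      v'.1 + g.pot p.2 v'.2 = b * a ∧
      ∀ u : Space n, u 0 = 0 → g.ip p.2 v'.2 u = b * a * g.ip p.2 ξ u := by
  rw [isBoundaryProjection_iff]
  have e1 : (b • v).1 + g.pot p.2 (b • v).2 = b * a := by
    rw [Prod.smul_fst, Prod.smul_snd, map_smul, smul_eq_mul, smul_eq_mul, ← mul_add, ha]
  have e2 : ∀ u, g.ip p.2 (b • v).2 u = b * a * g.ip p.2 ξ u := fun u => by
    rw [Prod.smul_snd, hξ, map_smul, map_smul, smul_apply, smul_apply, smul_eq_mul, smul_eq_mul,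
      mul_assoc]
  simp only [e1, e2]

omit [IsManifold (𝓡∂ n) ∞ N] in
theorem tangentBundle_mk_eq {p q : ℝ × N} (h : p = q) (v : ℝ × Space n) :
    (⟨p, v⟩ : TangentBundle (cylinderModel n) (ℝ × N)) = ⟨q, v⟩ := by
  rw [h]

/-- Null curves and magnetic geodesics correspond, with the action as time delay. Strict convexity
supplies the requirement that the ray stay in the interior between its ends. The conformal factor no
longer appears. -/
theorem mem_scatteringRelation_iff (hg : g.toMagneticSystem.IsStrictlyConvex) {p q : ℝ × N}
    {v w : ℝ × Space n} :
    ((⟨p, v⟩, ⟨q, w⟩) : TangentBundle (cylinderModel n) (ℝ × N) ×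
      TangentBundle (cylinderModel n) (ℝ × N)) ∈ g.scatteringRelation ↔
    p.2 ∈ (𝓡∂ n).boundary N ∧ q.2 ∈ (𝓡∂ n).boundary N ∧
    ∃ (ℓ : ℝ) (y : ℝ → N), g.IsMagneticGeodesic ℓ y ∧ y 0 = p.2 ∧ y ℓ = q.2 ∧
      q.1 = p.1 + g.curveAction ℓ y ∧ g.IsEndDirection p.2 (vel y ℓ 0) v ∧
      g.IsEndDirection q.2 (vel y ℓ ℓ) w := by
  constructor
  · rintro ⟨T, γ, hγ, h0, hT, -, a, b, v', w', ha, hb, hv, hw, heq⟩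
    have hp1 : p = γ 0 := congrArg (fun P => P.1.1) heq
    have hq1 : q = γ T := congrArg (fun P => P.2.1) heq
    have hv1 : v = v' := congrArg (fun P : TangentBundle (cylinderModel n) (ℝ × N) ×
      TangentBundle (cylinderModel n) (ℝ × N) => (P.1.2 : ℝ × Space n)) heq
    have hw1 : w = w' := congrArg (fun P : TangentBundle (cylinderModel n) (ℝ × N) ×
      TangentBundle (cylinderModel n) (ℝ × N) => (P.2.2 : ℝ × Space n)) heq
    obtain ⟨hTpos, k, hk, hnull⟩ := isLightRay_iff.1
      (show g.IsLightRay T (fun r => ((γ r).1, (γ r).2)) from hγ)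
    obtain ⟨ℓ, y, hy, y0, yℓ, hact, r0, rT, e0, eT⟩ := hnull.exists_geodesic hTpos hk
    have m0 : (0 : ℝ) ∈ Icc 0 T := left_mem_Icc.2 hTpos.le
    have mT : T ∈ Icc 0 T := right_mem_Icc.2 hTpos.le
    have w0 : velocity (cylinderModel n) γ T 0 = _ :=
      velocityAt_cylinder hTpos hnull.smooth_time hnull.smooth_space m0
    have wT : velocity (cylinderModel n) γ T T = _ :=
      velocityAt_cylinder hTpos hnull.smooth_time hnull.smooth_space mT
    rw [w0] at hv
    rw [wT] at hw
    have c0 := (isBoundaryProjection_smul_iff (v' := v') rfl e0).1 hv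
    have cT := (isBoundaryProjection_smul_iff (v' := w') rfl eT).1 hw
    rw [hp1, hq1]
    refine ⟨h0, hT, ℓ, y, hy, y0, yℓ, by linarith, ?_, ?_⟩
    · rw [hv1]
      refine ⟨c0.1, ?_, fun u hu => ?_⟩
      · rw [c0.2.1]; exact mul_pos ha r0
      · rw [c0.2.1]; exact c0.2.2 u hu
    · rw [hw1]
      refine ⟨cT.1, ?_, fun u hu => ?_⟩
      · rw [cT.2.1]; exact mul_pos hb rT
      · rw [cT.2.1]; exact cT.2.2 u hu
  · rintro ⟨hp, hq, ℓ, y, hy, y0, yℓ, hact, hv, hw⟩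
    obtain ⟨T, t, x, hTpos, hnull, x0, xT, t0, tT, hint, r0, rT, e0, eT⟩ := hy.exists_nullCurve p.1
    have m0 : (0 : ℝ) ∈ Icc 0 T := left_mem_Icc.2 hTpos.le
    have mT : T ∈ Icc 0 T := right_mem_Icc.2 hTpos.le
    have hp1 : p = (t 0, x 0) := by rw [t0, x0, y0]
    have hq1 : q = (t T, x T) := by rw [tT, xT, yℓ, ← hact]
    have w0 : velocity (cylinderModel n) (fun r => (t r, x r)) T 0 = _ :=
      velocityAt_cylinder hTpos hnull.smooth_time hnull.smooth_space m0
    have wT : velocity (cylinderModel n) (fun r => (t r, x r)) T T = _ :=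
      velocityAt_cylinder hTpos hnull.smooth_time hnull.smooth_space mT
    have p2 : p.2 = x 0 := by rw [hp1]
    have q2 : q.2 = x T := by rw [hq1]
    rw [p2] at hv hp
    rw [q2] at hw hq
    -- The positive factors are the value of `dt + ω` on the given end direction divided by its
    -- value on the velocity of the lift.
    refine ⟨T, fun r => (t r, x r), isLightRay_iff.2 ⟨hTpos, 1, one_pos, hnull⟩, hp, hq,
      fun s hs => ?_, (v.1 + g.pot (x 0) v.2) / g.timeRate t x T 0,
      (w.1 + g.pot (x T) w.2) / g.timeRate t x T T, v, w, div_pos hv.2.1 r0, div_pos hw.2.1 rT,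
      ?_, ?_, Prod.ext (tangentBundle_mk_eq hp1 v) (tangentBundle_mk_eq hq1 w)⟩
    · obtain ⟨σ, hσ, hs'⟩ := hint s hs
      change x s ∈ _
      rw [hs']
      exact hg.mem_interior hy hσ
    · rw [w0]
      refine (isBoundaryProjection_smul_iff (v' := v) rfl e0).2 ⟨hv.1, ?_, fun u hu => ?_⟩
      · exact (div_mul_cancel₀ _ r0.ne').symm
      · exact (hv.2.2 u hu).trans (congrArg (· * _) (div_mul_cancel₀ _ r0.ne').symm)
    · rw [wT]
      refine (isBoundaryProjection_smul_iff (v' := w) rfl eT).2 ⟨hw.1, ?_, fun u hu => ?_⟩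
      · exact (div_mul_cancel₀ _ rT.ne').symm
      · exact (hw.2.2 u hu).trans (congrArg (· * _) (div_mul_cancel₀ _ rT.ne').symm)

variable [T2Space N] [CompactSpace N] {g' : StationaryMetric n N}

-- A light ray leaving `x` at time zero above the geodesic to `y` arrives at time `𝔸(x, y)`. The
-- second metric has a ray with the same end points in spacetime, so its action is the same.
omit [CompactSpace N] in
theorem action_eq_of_scatteringRelation_subset (hg : g.IsSimple) (hg' : g'.IsSimple)
    (hS : g.scatteringRelation ⊆ g'.scatteringRelation) {x y : N} (hx : x ∈ (𝓡∂ n).boundary N)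
    (hy : y ∈ (𝓡∂ n).boundary N) :
    g.toMagneticSystem.action x y = g'.toMagneticSystem.action x y := by
  by_cases hxy : x = y
  · rw [hxy, MagneticSystem.IsSimple.action_self hg, MagneticSystem.IsSimple.action_self hg']
  obtain ⟨ℓ, γ, hγ, h0, h1⟩ := MagneticSystem.IsSimple.exists_geodesic hg hxy
  obtain ⟨v, hv⟩ := g.exists_isEndDirection x (vel γ ℓ 0)
  obtain ⟨w, hw⟩ := g.exists_isEndDirection y (vel γ ℓ ℓ)
  have hmem := hS ((mem_scatteringRelation_iff hg.1 (p := (0, x)) (q := (g.curveAction ℓ γ, y))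
    (v := v) (w := w)).2 ⟨hx, hy, ℓ, γ, hγ, h0, h1, (zero_add _).symm, hv, hw⟩)
  obtain ⟨-, -, ℓ', γ', hγ', h0', h1', hact, -⟩ := (mem_scatteringRelation_iff hg'.1).1 hmem
  have e1 := MagneticSystem.IsSimple.action_eq hg hγ
  have e2 := MagneticSystem.IsSimple.action_eq hg' hγ'
  rw [h0, h1] at e1
  rw [h0', h1'] at e2
  exact e1.trans ((hact.trans (zero_add _)).trans e2.symm)

/-- The geodesic of `g'` between the same boundary points has the same time delay. By boundary
determination the tangential metrics, forms and end velocities agree, so it carries the same end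
directions. -/
theorem scatteringRelation_subset_of_action_eq (hg : g.IsSimple) (hg' : g'.IsSimple)
    (hA : ∀ x ∈ (𝓡∂ n).boundary N, ∀ y ∈ (𝓡∂ n).boundary N,
      g.toMagneticSystem.action x y = g'.toMagneticSystem.action x y) :
    g.scatteringRelation ⊆ g'.scatteringRelation := by
  rintro ⟨⟨p, v⟩, ⟨q, w⟩⟩ h
  obtain ⟨hp, hq, ℓ, y, hy, h0, h1, hact, hv, hw⟩ := (mem_scatteringRelation_iff hg.1).1 h
  have hne : q.2 ≠ p.2 := by
    rw [← h0, ← h1]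
    exact (MagneticSystem.IsSimple.ne hg hy le_rfl hy.pos le_rfl).symm
  obtain ⟨ℓ', y', hy', h0', h1'⟩ := MagneticSystem.IsSimple.exists_geodesic hg' hne.symm
  have hpot : ∀ x ∈ (𝓡∂ n).boundary N, ∀ u : Space n, u 0 = 0 → g.pot x u = g'.pot x u :=
    fun x hx u hu => (MagneticSystem.pot_eq_and_nrm_eq_of_action_eq hg hg' hA hx hu).1
  have hip : ∀ x ∈ (𝓡∂ n).boundary N, ∀ u : Space n, u 0 = 0 → ∀ w : Space n, w 0 = 0 →
      g.ip x u w = g'.ip x u w :=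
    fun x hx u hu w hw => MagneticSystem.ip_eq_of_action_eq hg hg' hA hx hu hw
  refine (mem_scatteringRelation_iff hg'.1).2 ⟨hp, hq, ℓ', y', hy', h0', h1', ?_, ?_, ?_⟩
  · have e1 := MagneticSystem.IsSimple.action_eq hg hy
    have e2 := MagneticSystem.IsSimple.action_eq hg' hy'
    rw [h0, h1] at e1
    rw [h0', h1'] at e2
    rw [hact, ← e1, ← e2, hA _ hp _ hq]
  · refine MagneticSystem.IsEndDirection.of_eq hv (hpot _ hp) (hip _ hp) fun u hu => ?_
    have h := MagneticSystem.ip_vel_zero_eq_of_action_eq hg hg' hA hy hy' (h0'.trans h0.symm)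
      (h1'.trans h1.symm) (h0.symm ▸ hp) (h1.symm ▸ hq) hu
    rwa [h0] at h
  · exact MagneticSystem.IsEndDirection.of_eq hw (hpot _ hq) (hip _ hq) fun u hu =>
      MagneticSystem.ip_arrival_eq_of_action_eq hg hg' hA hne ⟨ℓ, y, hy, h0, h1, rfl⟩
        ⟨ℓ', y', hy', h0', h1', rfl⟩ hp hq hu

theorem scatteringRelation_eq_iff (hg : g.IsSimple) (hg' : g'.IsSimple) :
    g.scatteringRelation = g'.scatteringRelation ↔
      g.toMagneticSystem.boundaryAction = g'.toMagneticSystem.boundaryAction := by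
  constructor
  · intro h
    ext x y
    exact action_eq_of_scatteringRelation_subset hg hg' h.subset x.2 y.2
  · intro h
    have hA : ∀ x ∈ (𝓡∂ n).boundary N, ∀ y ∈ (𝓡∂ n).boundary N,
        g.toMagneticSystem.action x y = g'.toMagneticSystem.action x y :=
      fun x hx y hy => congrFun (congrFun h ⟨x, hx⟩) ⟨y, hy⟩
    exact (scatteringRelation_subset_of_action_eq hg hg' hA).antisymm
      (scatteringRelation_subset_of_action_eq hg' hg fun x hx y hy => (hA x hx y hy).symm)

end StationaryMetric

end

/-! ### Gauge equivalence. -/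

section Gauge

variable {n : ℕ} [NeZero n] {N : Type*} [TopologicalSpace N]
  [ChartedSpace (EuclideanHalfSpace n) N] [IsManifold (𝓡∂ n) ∞ N]

omit [IsManifold (𝓡∂ n) ∞ N] in
theorem differential_comp (ψ : N ≃ₘ^∞⟮𝓡∂ n, 𝓡∂ n⟯ N) {φ : N → ℝ}
    (hφ : ContMDiff (𝓡∂ n) 𝓘(ℝ, ℝ) ∞ φ) (x : N) (u : TangentSpace (𝓡∂ n) x) :
    differential (φ ∘ ψ) x u = differential φ (ψ x) (mfderiv (𝓡∂ n) (𝓡∂ n) ψ x u) :=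
  DFunLike.congr_fun (mfderiv_comp x (hφ.mdifferentiable (by simp) _)
    (ψ.contMDiff.mdifferentiable (by simp) _)) u

/-- The two notions differ in whether `dφ` is pulled back by `ψ`, so `φ` is replaced by `φ ∘ ψ` or
`φ ∘ ψ⁻¹`; it still vanishes on the boundary because `ψ` fixes the boundary pointwise. -/
theorem StationaryMetric.gaugeEquivalent_iff {g g' : StationaryMetric n N} :
    g.GaugeEquivalent g' ↔
      g.toMagneticSystem.IsMagneticallyGaugeEquivalent g'.toMagneticSystem := by
  constructor
  · rintro ⟨ψ, φ, hφ, hψ, hφ0, hom, hh⟩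
    refine ⟨ψ, φ ∘ ψ, hφ.comp ψ.contMDiff, hψ, fun x hx => ?_, hh, fun x u => ?_⟩
    · rw [Function.comp_apply, hψ x hx, hφ0 x hx]
    · rw [hom, differential_comp ψ hφ]
  · rintro ⟨ψ, φ, hφ, hψ, hφ0, hh, hom⟩
    have hφ' : ContMDiff (𝓡∂ n) 𝓘(ℝ, ℝ) ∞ (φ ∘ ψ.symm) := hφ.comp ψ.symm.contMDiff
    refine ⟨ψ, φ ∘ ψ.symm, hφ', hψ, fun x hx => ?_, fun x u => ?_, hh⟩
    · have h1 : ψ.symm x = x := by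
        rw [← hψ x hx]
        exact (ψ.symm_apply_apply x).trans (hψ x hx).symm
      rw [Function.comp_apply, h1, hφ0 x hx]
    · rw [hom, ← differential_comp ψ hφ']
      have h2 : (φ ∘ ψ.symm) ∘ ψ = φ := by
        ext y
        exact congrArg φ (ψ.symm_apply_apply y)
      rw [h2]

/-- The stationary metric of a magnetic system with conformal factor `1`. -/
def MagneticSystem.toStationaryMetric (m : MagneticSystem n N) : StationaryMetric n N where
  toMagneticSystem := m
  lam := fun _ => 1
  lam_pos := fun _ => one_pos
  smooth_lam := contMDiff_const

end Gauge

end StationaryRigidity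

end

/-! ### The main theorem. -/

theorem mainTheorem4 (n : ℕ) [NeZero n] (N : Type*) [TopologicalSpace N] [T2Space N]
    [CompactSpace N] [ChartedSpace (EuclideanHalfSpace n) N] [IsManifold (𝓡∂ n) ∞ N] :
    (∀ g g' : StationaryRigidity.StationaryMetric n N, g.IsSimple → g'.IsSimple →
      ((g.scatteringRelation = g'.scatteringRelation → g.GaugeEquivalent g') ↔
        (g.toMagneticSystem.boundaryAction = g'.toMagneticSystem.boundaryAction →
          g.toMagneticSystem.IsMagneticallyGaugeEquivalent g'.toMagneticSystem))) ∧
    (∀ g : StationaryRigidity.StationaryMetric n N, g.IsSimple →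
      (g.toMagneticSystem.IsMagneticallyBoundaryRigid ↔ g.IsBoundaryRigid)) := by
  refine ⟨fun g g' hg hg' => ?_, fun g hg => ⟨fun h g' hg' hS => ?_, fun h m' hm' hA => ?_⟩⟩
  · rw [StationaryRigidity.StationaryMetric.scatteringRelation_eq_iff hg hg',
      StationaryRigidity.StationaryMetric.gaugeEquivalent_iff]
  · rw [StationaryRigidity.StationaryMetric.gaugeEquivalent_iff]
    exact h g'.toMagneticSystem hg'
      ((StationaryRigidity.StationaryMetric.scatteringRelation_eq_iff hg hg').1 hS)
  -- The competing magnetic system is realized by a stationary metric with `λ = 1`; any conformal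
  -- factor would do, since gauge equivalence ignores it.
  · have hm : m'.toStationaryMetric.IsSimple := hm'
    exact StationaryRigidity.StationaryMetric.gaugeEquivalent_iff.1 (h m'.toStationaryMetric hm
      ((StationaryRigidity.StationaryMetric.scatteringRelation_eq_iff hg hm).2 hA))
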